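/- **Conventions.** Let $\phi_0=e^{123}+e^{145}+e^{167}+e^{246}-e^{257}-e^{347}-e^{356}$ on $\mathbb{R}^7$. A $\mathrm{G}_2$-structure on a smooth 7-manifold $M$ is a smooth 3-form $\varphi$ such that at each $x$ there is a linear isomorphism (a $\mathrm{G}_2$-coframe) $T_xM\to\mathbb{R}^7$ carrying $\phi_0$ to $\varphi_x$; it induces a metric, an orientation and a Hodge star $*_\varphi$. If $d\varphi=0$, its torsion form is the 2-form $\tau$ with $d{*_\varphi}\varphi=\tau\wedge\varphi$, and $\varphi$ is *extremally Ricci-pinched* (ERP) if $d\tau=\tfrac16|\tau|^2\varphi+\tfrac16{*_\varphi}(\tau\wedge\tau)$. For a constant $k>0$, say that an ERP closed $\mathrm{G}_2$-structure defines a $\mathrm{U}(2)^+$-structure with constant $k$ if at each point there is a $\mathrm{G}_2$-coframe $(\omega_1,\dots,\omega_7)$ with $\tau=6k(\omega_4\wedge\omega_5-\omega_6\wedge\omega_7)$; these adapted coframes form the $\mathrm{U}(2)^+$-structure $\mathcal{Q}\to M$. For a local section of $\mathcal Q$ put $\eta_1=\omega_4+i\omega_5$, $\eta_2=-\omega_6+i\omega_7$,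 $\nu_{1\bar1}=-\nu_{2\bar2}=-i\omega_1$, $\nu_{1\bar2}=-\overline{\nu_{2\bar1}}=-\omega_2+i\omega_3$, and let $\varepsilon_{ab}$ be skew-symmetric with $\varepsilon_{12}=\tfrac12$. The torsion tensors $A_{abcde}$, $S_{abcd}$, $N_a$ (complex-valued, fully symmetric) and the natural connection $\kappa_{a\bar b}=-\overline{\kappa_{b\bar a}}$ are determined by (sum over repeated indices $b,c,\dots\in\{1,2\}$) $$\begin{aligned} d\eta_a&=-\kappa_{a\bar b}\wedge\eta_b+ik\,\nu_{a\bar b}\wedge\eta_b+\varepsilon_{ab}N_c\,\overline{\eta_c\wedge\eta_b}-2\,\varepsilon_{be}S_{abcd}\,\overline{\eta_d}\wedge\nu_{e\bar c},\\ d\nu_{a\bar b}&=-\kappa_{a\bar c}\wedge\nu_{c\bar b}+\kappa_{c\bar b}\wedge\nu_{a\bar c}+4\,\varepsilon_{cb}\varepsilon_{eg}A_{acdef}\,\nu_{g\bar f}\wedge\overline{\eta_d}+4\,\varepsilon_{ca}\varepsilon_{eg}\overline{A_{bcdef}}\,\nu_{f\bar g}\wedge\eta_d .\end{aligned}$$ The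 structure is *of type $S$* if $A=0$ and $N=0$ everywhere. Let $\mathbb{R}^{3,3}=\Lambda^2(\mathbb{R}^4)^*$ with $\langle\alpha,\beta\rangle\,dx^{1234}=\tfrac12\,\alpha\wedge\beta$, oriented on its space-like 3-planes by the triple $dx^{12}+dx^{34},\ dx^{13}-dx^{24},\ -(dx^{14}+dx^{23})$, and let $Q=\{\alpha:\langle\alpha,\alpha\rangle=-1\}\cong\mathrm{SO}(3,3)/\mathrm{SO}(3,2)$. A smooth space-like immersion $u:B^3\to Q$ is *maximal* if its mean curvature vector in $Q$ vanishes. Let $h$ be the pullback metric and $\mathrm{vol}_h$ its volume form for the orientation of $B$ induced through $u$, and regard $u$ as a 2-form on $B\times\mathbb{R}^4$. **Theorem.** Let $k,c>0$ be constants with $8k^3c=1$ (in particular $c=1$ at the scale $k=\tfrac12$). 1. Let $\varphi$, with torsion form $\tau$, be an ERP closed $\mathrm{G}_2$-structure on a 7-manifold $M$ that defines a $\mathrm{U}(2)^+$-structure of type $S$ with constant $k$. Then each point of $M$ has an open neighbourhood $W$ for which there are a 3-manifold $B$, a maximal space-like immersion $u:B\to Q$, and a diffeomorphism $\Phi$ from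 $W$ onto an open subset of $B\times\mathbb{R}^4$ such that on $W$ $$\varphi=\Phi^*\big(c\,\mathrm{vol}_h+du\big),\qquad \tau=12k^2\,\Phi^*u .$$ 2. Conversely, for every 3-manifold $B$ and every maximal space-like immersion $u:B\to Q$, the 3-form $\varphi=c\,\mathrm{vol}_h+du$ on $B\times\mathbb{R}^4$ is an ERP closed $\mathrm{G}_2$-structure with torsion form $\tau=12k^2u$, and it defines a $\mathrm{U}(2)^+$-structure of type $S$ with constant $k$. -/

import Mathlib

open scoped Manifold ContDiff

namespace G2ERP

noncomputable section

/-! ### Differential forms on a manifold without boundary -/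

section Forms

variable {E : Type*} [NormedAddCommGroup E] [NormedSpace ℝ E]
  {H : Type*} [TopologicalSpace H] (I : ModelWithCorners ℝ E H)
  {E' : Type*} [NormedAddCommGroup E'] [NormedSpace ℝ E']
  {H' : Type*} [TopologicalSpace H'] (J : ModelWithCorners ℝ E' H')
  {M : Type*} [TopologicalSpace M] [ChartedSpace H M]
  {M' : Type*} [TopologicalSpace M'] [ChartedSpace H' M']
  {F : Type*} [NormedAddCommGroup F] [NormedSpace ℝ F] {n : ℕ}

/-- (Not necessarily smooth) `F`-valued `n`-forms on `M`. -/
abbrev MForm (M : Type*) [TopologicalSpace M] [ChartedSpace H M] (n : ℕ)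
    (F : Type*) [NormedAddCommGroup F] [NormedSpace ℝ F] :=
  ∀ x : M, TangentSpace I x [⋀^Fin n]→L[ℝ] F

/-- The expression of a form in the preferred chart at `x₀`. -/
def MForm.chartRep (α : MForm I M n F) (x₀ : M) : E → E [⋀^Fin n]→L[ℝ] F := fun y =>
  (α ((extChartAt I x₀).symm y)).compContinuousLinearMap
    (mfderiv 𝓘(ℝ, E) I (extChartAt I x₀).symm y)

/-- The form is smooth at every point of `U`. -/
def MForm.SmoothOn (α : MForm I M n F) (U : Set M) : Prop :=
  ∀ x ∈ U, ContDiffAt ℝ ∞ (α.chartRep I x) (extChartAt I x x)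

/-- The exterior derivative, computed at `x` in the preferred chart at `x`. -/
def MForm.d (α : MForm I M n F) : MForm I M (n + 1) F := fun x =>
  (extDeriv (α.chartRep I x) (extChartAt I x x)).compContinuousLinearMap
    (mfderiv I 𝓘(ℝ, E) (extChartAt I x) x)

/-- The pullback of a form by a map. -/
def MForm.pullback (f : M → M') (α : MForm J M' n F) : MForm I M n F := fun x =>
  (α (f x)).compContinuousLinearMap (mfderiv I J f x)

end Forms

/-! ### Multilinear algebra -/

/-- `e^{s 0} ∧ ⋯ ∧ e^{s (k-1)}` on `ℝⁿ`, for the dual of the standard basis. -/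
def dx {k n : ℕ} (s : Fin k → Fin n) : (Fin n → ℝ) [⋀^Fin k]→L[ℝ] ℝ :=
  { (Matrix.detRowAlternating (n := Fin k) (R := ℝ)).compLinearMap (LinearMap.funLeft ℝ ℝ s) with
    cont := by
      change Continuous fun v : Fin k → Fin n → ℝ => Matrix.det (fun a b => v a (s b))
      exact Continuous.matrix_det (by fun_prop) }

/-- The standard basis of `ℝⁿ`. -/
abbrev stdVec {n : ℕ} (i : Fin n) : Fin n → ℝ := Pi.single i 1

/-- The wedge product of a `2`-form `α` with an `n`-form `β`: the sum over `(2,n)`-shuffles of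
`± α(v_p, v_q) β(remaining v)`, written as half of the sum over ordered pairs. -/
def wedge2 {V : Type*} {n : ℕ} (α : (Fin 2 → V) → ℝ) (β : (Fin n → V) → ℝ)
    (v : Fin (n + 2) → V) : ℝ :=
  (1 / 2) * ∑ p : Fin (n + 2), ∑ q : Fin (n + 1), (-1) ^ ((p : ℕ) + (q : ℕ)) *
    (α ![v p, v (p.succAbove q)] * β (fun i => v (p.succAbove (q.succAbove i))))

/-- The Hodge star of an `m`-form on Euclidean `ℝ^{m+n}` with its standard orientation. -/
def hodgeStar {m n : ℕ} (α : (Fin m → Fin (m + n) → ℝ) → ℝ) (v : Fin n → Fin (m + n) → ℝ) : ℝ :=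
  (1 / (m.factorial : ℝ)) * ∑ s : Fin m → Fin (m + n),
    α (fun a => stdVec (s a)) * Matrix.det (Matrix.of (Fin.append (fun a => stdVec (s a)) v))

/-- The square norm of a `2`-form on Euclidean `ℝⁿ`, for which `|e^{ij}| = 1` if `i < j`. -/
def normSq2 {n : ℕ} (α : (Fin 2 → Fin n → ℝ) → ℝ) : ℝ :=
  (1 / 2) * ∑ i : Fin n, ∑ j : Fin n, α ![stdVec i, stdVec j] ^ 2

/-- The standard `3`-form on `ℝ⁷` (indices start at `0`). -/
def phi0 : (Fin 7 → ℝ) [⋀^Fin 3]→L[ℝ] ℝ :=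
  dx ![0, 1, 2] + dx ![0, 3, 4] + dx ![0, 5, 6] + dx ![1, 3, 5] - dx ![1, 4, 6]
    - dx ![2, 3, 6] - dx ![2, 4, 5]

/-- Its Hodge dual `4`-form. -/
def psi0 : (Fin 7 → ℝ) [⋀^Fin 4]→L[ℝ] ℝ :=
  dx ![3, 4, 5, 6] + dx ![1, 2, 5, 6] + dx ![1, 2, 3, 4] + dx ![0, 2, 4, 6]
    - dx ![0, 2, 3, 5] - dx ![0, 1, 4, 5] - dx ![0, 1, 3, 6]

/-- `e⁴ ∧ e⁵ - e⁶ ∧ e⁷`, the element of `Λ²₁₄` whose stabiliser in `G₂` is `U(2)⁺`. -/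
def tau0 : (Fin 7 → ℝ) [⋀^Fin 2]→L[ℝ] ℝ := dx ![3, 4] - dx ![5, 6]

/-! ### Closed `G₂`-structures

Notions that depend on a `G₂`-coframe `L` at a point do not depend on its choice, because `G₂`
preserves the standard metric, orientation and `4`-form of `ℝ⁷`. -/

section G2

variable {E : Type*} [NormedAddCommGroup E] [NormedSpace ℝ E]
  {H : Type*} [TopologicalSpace H] (I : ModelWithCorners ℝ E H)
  {M : Type*} [TopologicalSpace M] [ChartedSpace H M]

/-- `L` is a `G₂`-coframe of `φ` at `x`: it carries the standard `3`-form to `φ`. -/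
def IsG2Coframe (φ : MForm I M 3 ℝ) (x : M) (L : TangentSpace I x ≃L[ℝ] (Fin 7 → ℝ)) : Prop :=
  φ x = phi0.compContinuousLinearMap (L : TangentSpace I x →L[ℝ] (Fin 7 → ℝ))

/-- A (smooth) `G₂`-structure, as a `3`-form. -/
def IsG2Structure (φ : MForm I M 3 ℝ) : Prop :=
  φ.SmoothOn I Set.univ ∧ ∀ x, ∃ L, IsG2Coframe I φ x L

/-- `ψ` is the Hodge dual `*_φ φ` of the `G₂`-structure `φ`. -/
def IsHodgeDual (φ : MForm I M 3 ℝ) (ψ : MForm I M 4 ℝ) : Prop :=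
  ∀ x, ∃ L, IsG2Coframe I φ x L ∧
    ψ x = psi0.compContinuousLinearMap (L : TangentSpace I x →L[ℝ] (Fin 7 → ℝ))

/-- `φ` is a closed `G₂`-structure and `τ` is its torsion `2`-form: `d *_φ φ = τ ∧ φ`. -/
def IsClosedWithTorsion (φ : MForm I M 3 ℝ) (τ : MForm I M 2 ℝ) : Prop :=
  IsG2Structure I φ ∧ φ.d I = 0 ∧ τ.SmoothOn I Set.univ ∧
    ∃ ψ : MForm I M 4 ℝ, IsHodgeDual I φ ψ ∧
      ∀ x (v : Fin 5 → TangentSpace I x), ψ.d I x v = wedge2 (τ x) (φ x) v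

/-- `dτ = (1/7)|τ|² φ + l ((1/7)|τ|² φ + *_φ (τ ∧ τ))`. -/
def IsQuadratic (l : ℝ) (φ : MForm I M 3 ℝ) (τ : MForm I M 2 ℝ) : Prop :=
  ∀ x, ∃ L, IsG2Coframe I φ x L ∧ ∀ v : Fin 3 → TangentSpace I x,
    τ.d I x v =
      (1 / 7) * normSq2 (fun w => τ x (fun i => L.symm (w i))) * φ x v
      + l * ((1 / 7) * normSq2 (fun w => τ x (fun i => L.symm (w i))) * φ x v
        + hodgeStar (m := 4) (n := 3)
            (fun w => wedge2 (τ x) (τ x) (fun i => L.symm (w i))) (fun i => L (v i)))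

/-- `φ` is an extremally Ricci-pinched closed `G₂`-structure with torsion form `τ`. -/
def IsERP (φ : MForm I M 3 ℝ) (τ : MForm I M 2 ℝ) : Prop :=
  IsClosedWithTorsion I φ τ ∧ IsQuadratic I (1 / 6) φ τ

/-! ### The induced `U(2)⁺`-structure -/

/-- Fibre at `x` of the `U(2)⁺`-structure: the `G₂`-coframes with `τ = 6k (e⁴⁵ - e⁶⁷)`. -/
def IsAdaptedCoframe (k : ℝ) (φ : MForm I M 3 ℝ) (τ : MForm I M 2 ℝ) (x : M)
    (L : TangentSpace I x ≃L[ℝ] (Fin 7 → ℝ)) : Prop :=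
  IsG2Coframe I φ x L ∧
    τ x = (6 * k) • tau0.compContinuousLinearMap (L : TangentSpace I x →L[ℝ] (Fin 7 → ℝ))

/-- `om₁, …, om₇` is a smooth section over `U` of the `U(2)⁺`-structure. -/
def IsAdaptedSection (k : ℝ) (φ : MForm I M 3 ℝ) (τ : MForm I M 2 ℝ) (U : Set M)
    (om : Fin 7 → MForm I M 1 ℝ) : Prop :=
  (∀ i, (om i).SmoothOn I U) ∧
    ∀ x ∈ U, ∃ L, IsAdaptedCoframe I k φ τ x L ∧ ∀ i v, L v i = om i x (fun _ => v)

/-- The complex components `η₁ = z₄ + i z₅`, `η₂ = - z₆ + i z₇` (indices start at `0`). -/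
def etaC (z : Fin 7 → ℝ) : Fin 2 → ℂ :=
  ![z 3 + Complex.I * z 4, -z 5 + Complex.I * z 6]

/-- The complex components `ν_{a b̄}`, a trace-free skew-Hermitian matrix. -/
def nuC (z : Fin 7 → ℝ) : Matrix (Fin 2) (Fin 2) ℂ :=
  !![-Complex.I * z 0, -z 1 + Complex.I * z 2; z 1 + Complex.I * z 2, Complex.I * z 0]

/-- The skew-symmetric symbol with `ε₁₂ = 1/2`. -/
def eps : Matrix (Fin 2) (Fin 2) ℂ := !![0, 1 / 2; -(1 / 2), 0]

/-- `(α ∧ β)(v, w)` for complex-valued `1`-forms. -/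
def wedge11 {V : Type*} (α β : V → ℂ) (v w : V) : ℂ := α v * β w - α w * β v

/-- Cartan's first structure equations at `x` for a local section `om` of the `U(2)⁺`-structure,
with the natural connection `κ` (a `u(2)`-valued `1`-form) and the torsion tensors
`A ∈ Sym⁵ ℂ²`, `S ∈ Sym⁴ ℂ²`, `N ∈ ℂ²`:
`dη_a = - κ_{ab̄} ∧ η_b + i k ν_{ab̄} ∧ η_b + ε_{ab} N_c conj(η_c ∧ η_b)
          - 2 ε_{be} S_{abcd} conj(η_d) ∧ ν_{ec̄}`,
`dν_{ab̄} = - κ_{ac̄} ∧ ν_{cb̄} + κ_{cb̄} ∧ ν_{ac̄} + 4 ε_{cb} ε_{eg} A_{acdef} ν_{gf̄} ∧ conj(η_d)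
          + 4 ε_{ca} ε_{eg} conj(A_{bcdef}) ν_{fḡ} ∧ η_d`.
They determine `κ`, `A`, `S`, `N` uniquely. -/
def StructureEquations (k : ℝ) (om : Fin 7 → MForm I M 1 ℝ)
    (κ : Fin 2 → Fin 2 → MForm I M 1 ℂ)
    (A : (Fin 5 → Fin 2) → M → ℂ) (S : (Fin 4 → Fin 2) → M → ℂ) (N : Fin 2 → M → ℂ)
    (x : M) : Prop :=
  let η : Fin 2 → TangentSpace I x → ℂ := fun a v => etaC (fun i => om i x (fun _ => v)) a
  let η' : Fin 2 → TangentSpace I x → ℂ := fun a v => star (η a v)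
  let ν : Fin 2 → Fin 2 → TangentSpace I x → ℂ :=
    fun a b v => nuC (fun i => om i x (fun _ => v)) a b
  let K : Fin 2 → Fin 2 → TangentSpace I x → ℂ := fun a b v => κ a b x (fun _ => v)
  (∀ a b v, K a b v = -star (K b a v)) ∧
  (∀ (s : Fin 5 → Fin 2) (σ : Equiv.Perm (Fin 5)), A (s ∘ σ) x = A s x) ∧
  (∀ (s : Fin 4 → Fin 2) (σ : Equiv.Perm (Fin 4)), S (s ∘ σ) x = S s x) ∧
  (∀ a v w, etaC (fun i => (om i).d I x ![v, w]) a =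
    -(∑ b, wedge11 (K a b) (η b) v w)
    + Complex.I * k * (∑ b, wedge11 (ν a b) (η b) v w)
    + (∑ b, ∑ c, eps a b * N c x * wedge11 (η' c) (η' b) v w)
    - 2 * (∑ b, ∑ c, ∑ d, ∑ e, eps b e * S ![a, b, c, d] x * wedge11 (η' d) (ν e c) v w)) ∧
  (∀ a b v w, nuC (fun i => (om i).d I x ![v, w]) a b =
    -(∑ c, wedge11 (K a c) (ν c b) v w) + (∑ c, wedge11 (K c b) (ν a c) v w)
    + 4 * (∑ c, ∑ d, ∑ e, ∑ f, ∑ g,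
        eps c b * eps e g * A ![a, c, d, e, f] x * wedge11 (ν g f) (η' d) v w)
    + 4 * (∑ c, ∑ d, ∑ e, ∑ f, ∑ g,
        eps c a * eps e g * star (A ![b, c, d, e, f] x) * wedge11 (ν f g) (η d) v w))

/-- `φ`, with torsion form `τ`, is an ERP closed `G₂`-structure whose torsion is special of
positive type, normalised by the positive constant `k`, and the associated `U(2)⁺`-structure is of
type `S`: the torsion tensors `A` and `N` vanish. -/
structure IsTypeS (k : ℝ) (φ : MForm I M 3 ℝ) (τ : MForm I M 2 ℝ) : Prop where
  pos : 0 < k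
  erp : IsERP I φ τ
  special : ∀ x, ∃ L, IsAdaptedCoframe I k φ τ x L
  typeS : ∀ p : M, ∃ U : Set M, IsOpen U ∧ p ∈ U ∧
    ∃ (om : Fin 7 → MForm I M 1 ℝ) (κ : Fin 2 → Fin 2 → MForm I M 1 ℂ)
      (A : (Fin 5 → Fin 2) → M → ℂ) (S : (Fin 4 → Fin 2) → M → ℂ) (N : Fin 2 → M → ℂ),
      IsAdaptedSection I k φ τ U om ∧
      (∀ a b, (κ a b).SmoothOn I U) ∧
      (∀ s, ContMDiffOn I 𝓘(ℝ, ℂ) ∞ (A s) U) ∧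
      (∀ s, ContMDiffOn I 𝓘(ℝ, ℂ) ∞ (S s) U) ∧
      (∀ a, ContMDiffOn I 𝓘(ℝ, ℂ) ∞ (N a) U) ∧
      (∀ x ∈ U, StructureEquations I k om κ A S N x) ∧
      (∀ x ∈ U, (∀ s, A s x = 0) ∧ (∀ a, N a x = 0))

end G2

/-! ### Space-like submanifolds of the quadric in `Λ²(ℝ⁴)* = ℝ^{3,3}` -/

/-- Constant-coefficient `2`-forms on `ℝ⁴`. -/
abbrev Lam2 := (Fin 4 → ℝ) [⋀^Fin 2]→L[ℝ] ℝ

/-- The inner product of signature `(3,3)` given by `⟪α, β⟫ e⁰¹²³ = (1/2) α ∧ β`. -/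
def pair (α β : Lam2) : ℝ := (1 / 2) * wedge2 α β (fun i : Fin 4 => stdVec i)

/-- An oriented orthonormal basis of a maximal space-like subspace of `ℝ^{3,3}`. -/
def posBasis : Fin 3 → Lam2 :=
  ![dx ![0, 1] + dx ![2, 3], dx ![0, 2] - dx ![1, 3], -(dx ![0, 3] + dx ![1, 2])]

/-- The number whose sign tells whether a basis of a space-like `3`-plane is positively oriented;
the orthogonal projection from a space-like `3`-plane to the span of `posBasis` is bijective. -/
def orient (α : Fin 3 → Lam2) : ℝ := Matrix.det (Matrix.of fun i j => pair (α i) (posBasis j))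

section Immersions

variable {B : Type*} [TopologicalSpace B] [ChartedSpace (EuclideanSpace ℝ (Fin 3)) B]

/-- The differential of `u` at `b`. -/
def du (u : B → Lam2) (b : B) (v : TangentSpace (𝓡 3) b) : Lam2 :=
  mfderiv (𝓡 3) 𝓘(ℝ, Lam2) u b v

/-- The pullback metric. -/
def pullMetric (u : B → Lam2) (b : B) (v w : TangentSpace (𝓡 3) b) : ℝ :=
  pair (du u b v) (du u b w)

/-- The second derivative of `u` at `b` in the preferred chart at `b`. Its component orthogonal to
the tangent space and to the position vector is the second fundamental form in the quadric. -/
def hess (u : B → Lam2) (b : B) (v w : TangentSpace (𝓡 3) b) : Lam2 :=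
  let U : EuclideanSpace ℝ (Fin 3) → Lam2 := fun y => u ((extChartAt (𝓡 3) b).symm y)
  fderiv ℝ (fderiv ℝ U) (extChartAt (𝓡 3) b b) v w

/-- `u` is a smooth space-like immersion into the quadric of vectors of norm `-1` whose mean
curvature vector in the quadric vanishes: the trace (over an orthonormal frame `f`) of the second
fundamental form is orthogonal to each vector `w` that is tangent to the quadric and normal
to `u`. -/
structure IsMaximalInQuadric (u : B → Lam2) : Prop where
  smooth : ContMDiff (𝓡 3) 𝓘(ℝ, Lam2) ∞ u
  quadric : ∀ b, pair (u b) (u b) = -1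
  spacelike : ∀ b (v : TangentSpace (𝓡 3) b), v ≠ 0 → 0 < pullMetric u b v v
  maximal : ∀ b (f : Fin 3 → TangentSpace (𝓡 3) b),
    (∀ i j, pullMetric u b (f i) (f j) = if i = j then 1 else 0) →
    ∀ w : Lam2, pair (u b) w = 0 → (∀ v, pair (du u b v) w = 0) →
      ∑ i, pair (hess u b (f i) (f i)) w = 0

/-- The coordinate frame at `b` of the preferred chart at `b`. -/
def coordVec (b : B) (i : Fin 3) : TangentSpace (𝓡 3) b :=
  (EuclideanSpace.single i 1 : EuclideanSpace ℝ (Fin 3))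

/-- The volume form `± √(det h) dx¹ ∧ dx² ∧ dx³` of the pullback metric `h`, where `B` is given
the orientation that `u` pulls back from the orientation of space-like `3`-planes. -/
def volForm (u : B → Lam2) : MForm (𝓡 3) B 3 ℝ := fun b =>
  ((SignType.sign (orient fun i => du u b (coordVec b i)) : ℝ) *
    √(Matrix.det (Matrix.of fun i j => pullMetric u b (coordVec b i) (coordVec b j)))) •
  (dx ![0, 1, 2]).compContinuousLinearMap
    (EuclideanSpace.equiv (Fin 3) ℝ : EuclideanSpace ℝ (Fin 3) →L[ℝ] (Fin 3 → ℝ))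

/-- The model with corners of `B × ℝ⁴`. -/
abbrev modelBR4 := (𝓡 3).prod 𝓘(ℝ, Fin 4 → ℝ)

/-- `u`, considered as a `2`-form on `B × ℝ⁴`. -/
def tautForm (u : B → Lam2) : MForm modelBR4 (B × (Fin 4 → ℝ)) 2 ℝ := fun p =>
  (u p.1).compContinuousLinearMap (mfderiv modelBR4 𝓘(ℝ, Fin 4 → ℝ) Prod.snd p)

/-- Baraglia's `3`-form `c vol_h + du` on `B × ℝ⁴`. -/
def baragliaForm (c : ℝ) (u : B → Lam2) : MForm modelBR4 (B × (Fin 4 → ℝ)) 3 ℝ := fun p =>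
  c • (volForm u).pullback modelBR4 (𝓡 3) Prod.fst p + (tautForm u).d modelBR4 p

end Immersions

end

end G2ERP

/-! The isomorphism `sl(4, ℝ) = so(3, 3)` governs both directions. Split an adapted coframe into
three base forms ω_a and four fibre forms. For type `S` the structure equations say that the base
forms are torsion-free for an `so(3)`-connection `G`, and that the fibre forms satisfy dω = -Γ ∧ ω.
Here Γ is an `sl(4, ℝ)`-valued form built from `G`, a `u(1)`-part ρ, the forms k ω_a, and H = P + iQ
applied to the base forms. H is the tensor `S`, read through Sym⁴ℂ² as a complex symmetric
trace-free 3 × 3 matrix. On two-forms of ℝ⁴, Γ looks like the connection of a moving frame (u, f₁,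
f₂, f₃, n, n') in ℝ^{3,3}: k ω is the differential of u, P and Q are the second fundamental form.
Symmetry of H reflects symmetry of second derivatives and its vanishing trace is maximality.

From type `S` to an immersion, the crux is that Γ is flat (`RealFrame.curv_eq_zero`). The first
Bianchi identity kills its curvature on two base vectors; the `so(3)`-part of this is the Gauss
equation. With one base and two fibre vectors it gives Cauchy-Riemann relations for the covariant
derivative DH along the fibres. Differentiating the Gauss equation along a fibre shows that |H|² is
constant there, so Re⟨H, DH⟩ = 0, and the Cauchy-Riemann relations then give Im⟨H, DH⟩ = 0 on
fibres. The fibre distribution is integrable, so d Im⟨H, DH⟩ also vanishes on fibres; by the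
Cauchy-Riemann relations its value is, up to sign, a sum of squares of the components of DH. Hence
DH = 0 along the fibres, and no curvature is left.

A flat Γ has a parallel frame g near a point, with dg = gΓ (`exists_gauge_of_flat`). Then g applied
to the fibre forms is closed and integrates to fibre coordinates Y, and the constant form e⁰¹ - e²³
transported by g⁻¹ is the position vector U, with dU = 2k Σ ω_a f_a. Thus U has rank three and is
constant on the fibres; it descends to a maximal immersion (`RealFrame.exists_flatChart`,
`FlatChart.exists_chart`). The scale is fixed by c (2k)³ = 1.

Conversely, an oriented orthonormal tangent frame of a maximal immersion, together with u, has to be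
carried to standard position by a smooth frame of ℝ⁴. This lift from `SO(3,3)` to `SL(4, ℝ)` is made
explicit by the Clifford relations between two-forms and their dual bivectors: the tangent frame
gives quaternionic structures and a metric on ℝ⁴, and u gives an involution (`exists_frame`). The
derivative of the resulting coframe of ℝ⁴ has exactly the shape of Γ, which yields the structure
equations with A = N = 0 (`SpaceFrame.prodOm_eqs`). The equation for dτ is arithmetic with the
normalisation. The equation d*φ = τ ∧ φ is the Laplace equation Δu = 3u of a maximal immersion into
the quadric, combined with u ∧ du = 0, which is ⟨u, du⟩ = 0 (`SpaceFrame.extDeriv_psiForm`). -/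

namespace G2ERP

set_option linter.unusedSectionVars false

/-! ### Forms in charts: pullbacks and naturality of the exterior derivative. -/

section ChartCalculus

variable {E : Type*} [NormedAddCommGroup E] [NormedSpace ℝ E]
  {H : Type*} [TopologicalSpace H] {I : ModelWithCorners ℝ E H} [I.Boundaryless]
  {M : Type*} [TopologicalSpace M] [ChartedSpace H M] [IsManifold I ∞ M]
  {E' : Type*} [NormedAddCommGroup E'] [NormedSpace ℝ E']
  {F : Type*} [NormedAddCommGroup F] [NormedSpace ℝ F] {n : ℕ}

theorem two_le_infty : (2 : WithTop ℕ∞) ≤ ∞ := by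
  exact WithTop.coe_le_coe.2 (le_top : (2 : ℕ∞) ≤ ⊤)

theorem contMDiffAt_extChartAt_symm {x₀ : M} {z : E} (hz : z ∈ (extChartAt I x₀).target) :
    ContMDiffAt 𝓘(ℝ, E) I ∞ (extChartAt I x₀).symm z :=
  (contMDiffOn_extChartAt_symm (n := ∞) x₀).contMDiffAt
    ((isOpen_extChartAt_target x₀).mem_nhds hz)

theorem contMDiffAt_extChartAt_of_mem {x₀ x : M} (hx : x ∈ (extChartAt I x₀).source) :
    ContMDiffAt I 𝓘(ℝ, E) ∞ (extChartAt I x₀) x :=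
  contMDiffAt_extChartAt' (by simpa [extChartAt_source] using hx)

theorem mfderiv_symm_comp_mfderiv_extChartAt {x₀ x : M} (hx : x ∈ (extChartAt I x₀).source) :
    (mfderiv 𝓘(ℝ, E) I (extChartAt I x₀).symm (extChartAt I x₀ x)).comp
      (mfderiv I 𝓘(ℝ, E) (extChartAt I x₀) x) = ContinuousLinearMap.id ℝ (TangentSpace I x) := by
  have h := mfderivWithin_extChartAt_symm_comp_mfderiv_extChartAt' (I := I) hx
  rwa [I.range_eq_univ, mfderivWithin_univ] at h

theorem mfderiv_comp_mfderiv_symm_extChartAt {x₀ : M} {z : E}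
    (hz : z ∈ (extChartAt I x₀).target) :
    (mfderiv I 𝓘(ℝ, E) (extChartAt I x₀) ((extChartAt I x₀).symm z)).comp
      (mfderiv 𝓘(ℝ, E) I (extChartAt I x₀).symm z) = ContinuousLinearMap.id ℝ E := by
  have h := mfderiv_extChartAt_comp_mfderivWithin_extChartAt_symm (I := I) hz
  rwa [I.range_eq_univ, mfderivWithin_univ] at h

theorem contDiffAt_comp_chart_symm {f : M → E'} {x₀ x : M}
    (hx : x ∈ (extChartAt I x₀).source) (hf : ContMDiffAt I 𝓘(ℝ, E') ∞ f x) :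
    ContDiffAt ℝ ∞ (f ∘ (extChartAt I x₀).symm) (extChartAt I x₀ x) := by
  have hs : ContMDiffAt 𝓘(ℝ, E) I ∞ (extChartAt I x₀).symm (extChartAt I x₀ x) :=
    contMDiffAt_extChartAt_symm ((extChartAt I x₀).map_source hx)
  have hf' : ContMDiffAt I 𝓘(ℝ, E') ∞ f ((extChartAt I x₀).symm (extChartAt I x₀ x)) := by
    rwa [(extChartAt I x₀).left_inv hx]
  exact (hf'.comp _ hs).contDiffAt

theorem fderiv_comp_chart_symm {f : M → E'} {x₀ x : M}
    (hx : x ∈ (extChartAt I x₀).source) (hf : MDifferentiableAt I 𝓘(ℝ, E') f x) :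
    fderiv ℝ (f ∘ (extChartAt I x₀).symm) (extChartAt I x₀ x) =
      (mfderiv I 𝓘(ℝ, E') f x).comp
        (mfderiv 𝓘(ℝ, E) I (extChartAt I x₀).symm (extChartAt I x₀ x)) := by
  have hs : ContMDiffAt 𝓘(ℝ, E) I ∞ (extChartAt I x₀).symm (extChartAt I x₀ x) :=
    contMDiffAt_extChartAt_symm ((extChartAt I x₀).map_source hx)
  have hsx := (extChartAt I x₀).left_inv hx
  have hf' : MDifferentiableAt I 𝓘(ℝ, E') f ((extChartAt I x₀).symm (extChartAt I x₀ x)) := by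
    rwa [hsx]
  rw [← mfderiv_eq_fderiv, mfderiv_comp _ hf' (hs.mdifferentiableAt (by simp))]
  congr 1
  rw [hsx]

theorem mfderiv_eq_fderiv_comp_chart {f : M → E'} {x₀ x : M}
    (hx : x ∈ (extChartAt I x₀).source) (hf : MDifferentiableAt I 𝓘(ℝ, E') f x) :
    mfderiv I 𝓘(ℝ, E') f x =
      (fderiv ℝ (f ∘ (extChartAt I x₀).symm) (extChartAt I x₀ x)).comp
        (mfderiv I 𝓘(ℝ, E) (extChartAt I x₀) x) := by
  rw [fderiv_comp_chart_symm hx hf]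
  ext v
  have := DFunLike.congr_fun (mfderiv_symm_comp_mfderiv_extChartAt (I := I) hx) v
  simp only [ContinuousLinearMap.comp_apply] at this ⊢
  exact congrArg _ this.symm

theorem eventually_mdifferentiableAt {f : M → E'} {x : M}
    (hf : ContMDiffAt I 𝓘(ℝ, E') ∞ f x) :
    ∀ᶠ y in nhds x, MDifferentiableAt I 𝓘(ℝ, E') f y := by
  have : IsManifold I 1 M := IsManifold.of_le (n := ∞) (by simp)
  have h1 : ContMDiffAt I 𝓘(ℝ, E') 1 f x := hf.of_le (by simp)
  exact ((contMDiffAt_iff_contMDiffAt_nhds (n := 1) (by simp)).1 h1).mono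
    fun y hy => hy.mdifferentiableAt (by simp)

theorem eventually_symm_extChartAt {x₀ x : M} (hx : x ∈ (extChartAt I x₀).source)
    {p : M → Prop} (hp : ∀ᶠ y in nhds x, p y) :
    ∀ᶠ z in nhds (extChartAt I x₀ x), p ((extChartAt I x₀).symm z) := by
  have hz := (extChartAt I x₀).map_source hx
  have hs : ContMDiffAt 𝓘(ℝ, E) I ∞ (extChartAt I x₀).symm (extChartAt I x₀ x) :=
    contMDiffAt_extChartAt_symm hz
  have := hs.continuousAt.tendsto
  rw [(extChartAt I x₀).left_inv hx] at this
  exact this.eventually hp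

/-- The chart expression of a form that is a pullback from a vector space near `x`. -/
theorem chartRep_eventuallyEq_of_pullback {α : MForm I M n F} {f : M → E'}
    {β : E' → E' [⋀^Fin n]→L[ℝ] F} {x₀ x : M} (hx : x ∈ (extChartAt I x₀).source)
    (hf : ContMDiffAt I 𝓘(ℝ, E') ∞ f x)
    (h : ∀ᶠ y in nhds x, α y = (β (f y)).compContinuousLinearMap (mfderiv I 𝓘(ℝ, E') f y)) :
    α.chartRep I x₀ =ᶠ[nhds (extChartAt I x₀ x)] fun z =>
      (β ((f ∘ (extChartAt I x₀).symm) z)).compContinuousLinearMap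
        (fderiv ℝ (f ∘ (extChartAt I x₀).symm) z) := by
  have hz := (extChartAt I x₀).map_source hx
  have hf' := eventually_mdifferentiableAt hf
  filter_upwards [eventually_symm_extChartAt hx h, eventually_symm_extChartAt hx hf',
    (isOpen_extChartAt_target x₀).mem_nhds hz] with z h1 h2 h3
  rw [MForm.chartRep, h1]
  have h4 := fderiv_comp_chart_symm (I := I) ((extChartAt I x₀).map_target h3) h2
  rw [(extChartAt I x₀).right_inv h3] at h4
  rw [h4]
  rfl

/-- Evaluation on tuples of basis vectors embeds the alternating forms linearly into a product of
copies of `F`. A linear left inverse recovers the form from these values, so smoothness can be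
tested on fixed arguments. -/
theorem contDiffAt_alternating_of_apply [FiniteDimensional ℝ E] [FiniteDimensional ℝ F]
    {X : Type*} [NormedAddCommGroup X] [NormedSpace ℝ X] {α : X → E [⋀^Fin n]→L[ℝ] F} {x : X}
    (h : ∀ v : Fin n → E, ContDiffAt ℝ ∞ (fun z => α z v) x) :
    ContDiffAt ℝ ∞ α x := by
  let b := Module.finBasis ℝ E
  let ev : (E [⋀^Fin n]→L[ℝ] F) →ₗ[ℝ] ((Fin n → Fin (Module.finrank ℝ E)) → F) :=
    { toFun := fun w s => w (fun i => b (s i))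
      map_add' := fun _ _ => rfl
      map_smul' := fun _ _ => rfl }
  have hev : LinearMap.ker ev = ⊥ := by
    refine LinearMap.ker_eq_bot'.2 fun w hw => ?_
    apply ContinuousAlternatingMap.toAlternatingMap_injective
    refine Module.Basis.ext_alternating b fun s _ => ?_
    exact congrFun hw s
  obtain ⟨L, hL⟩ := LinearMap.exists_leftInverse_of_injective ev hev
  have h1 : ContDiffAt ℝ ∞ (fun z => ev (α z)) x := contDiffAt_pi.2 fun s => h _
  have h2 : α = fun z => LinearMap.toContinuousLinearMap L (ev (α z)) := by
    funext z
    exact (DFunLike.congr_fun hL (α z)).symm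
  rw [h2]
  exact (ContinuousLinearMap.contDiff _).contDiffAt.comp x h1

/-- The value on v is the pullback of the form by the lines t ↦ t vᵢ, evaluated at (1, …, 1). This
pullback is continuous and multilinear in the lines and linear in the form, so it is smooth in all
of them. -/
theorem contDiffAt_alternating_apply {X : Type*} [NormedAddCommGroup X] [NormedSpace ℝ X]
    {α : X → E [⋀^Fin n]→L[ℝ] F} {v : X → Fin n → E} {x : X}
    (h : ContDiffAt ℝ ∞ α x) (hv : ∀ i, ContDiffAt ℝ ∞ (fun z => v z i) x) :
    ContDiffAt ℝ ∞ (fun z => α z (v z)) x := by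
  let C := ContinuousMultilinearMap.compContinuousLinearMapContinuousMultilinear ℝ
    (fun _ : Fin n => ℝ) (fun _ : Fin n => E) F
  let T : E →L[ℝ] (ℝ →L[ℝ] E) := ContinuousLinearMap.flip
    (ContinuousLinearMap.lsmul ℝ ℝ : ℝ →L[ℝ] E →L[ℝ] E)
  have h1 : ContDiffAt ℝ ∞ (fun z => C (fun i => T (v z i))) x :=
    C.contDiff.contDiffAt.comp x (contDiffAt_pi.2 fun i => T.contDiff.contDiffAt.comp x (hv i))
  have h2 : ContDiffAt ℝ ∞ (fun z => (α z).toContinuousMultilinearMap) x :=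
    (ContinuousAlternatingMap.toContinuousMultilinearMapLI
      (𝕜 := ℝ) (E := E) (F := F) (ι := Fin n)).contDiff.contDiffAt.comp x h
  have h3 := (h1.clm_apply h2)
  have h4 := (ContinuousMultilinearMap.apply ℝ (fun _ : Fin n => ℝ) F
    (fun _ => 1)).contDiff.contDiffAt.comp x h3
  convert h4 using 2 with z
  simp [C, T]

theorem contDiffAt_pullback_vectorSpace [FiniteDimensional ℝ E] [FiniteDimensional ℝ F]
    {f : E → E'} {β : E' → E' [⋀^Fin n]→L[ℝ] F} {z : E}
    (hβ : ContDiffAt ℝ ∞ β (f z)) (hf : ContDiffAt ℝ ∞ f z) :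
    ContDiffAt ℝ ∞ (fun z => (β (f z)).compContinuousLinearMap (fderiv ℝ f z)) z := by
  have h1 : ContDiffAt ℝ ∞ (fun z => β (f z)) z := hβ.comp z hf
  have h2 : ContDiffAt ℝ ∞ (fderiv ℝ f) z := hf.fderiv_right (by simp)
  exact contDiffAt_alternating_of_apply fun v =>
    contDiffAt_alternating_apply (v := fun z i => fderiv ℝ f z (v i)) h1
      fun i => h2.clm_apply contDiffAt_const

/-- Smoothness at a point of a form that is a pullback from a vector space. -/
theorem contDiffAt_chartRep_of_pullback [FiniteDimensional ℝ E] [FiniteDimensional ℝ F]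
    {α : MForm I M n F} {f : M → E'} {β : E' → E' [⋀^Fin n]→L[ℝ] F} {x₀ x : M}
    (hx : x ∈ (extChartAt I x₀).source) (hf : ContMDiffAt I 𝓘(ℝ, E') ∞ f x)
    (hβ : ContDiffAt ℝ ∞ β (f x))
    (h : ∀ᶠ y in nhds x, α y = (β (f y)).compContinuousLinearMap (mfderiv I 𝓘(ℝ, E') f y)) :
    ContDiffAt ℝ ∞ (α.chartRep I x₀) (extChartAt I x₀ x) := by
  refine ContDiffAt.congr_of_eventuallyEq ?_ (chartRep_eventuallyEq_of_pullback hx hf h)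
  refine contDiffAt_pullback_vectorSpace ?_ (contDiffAt_comp_chart_symm hx hf)
  rwa [Function.comp_apply, (extChartAt I x₀).left_inv hx]

/-- Naturality of the exterior derivative for maps to a vector space. -/
theorem d_eq_of_pullback {α : MForm I M n F} {f : M → E'}
    {β : E' → E' [⋀^Fin n]→L[ℝ] F} {x : M} (hf : ContMDiffAt I 𝓘(ℝ, E') ∞ f x)
    (hβ : DifferentiableAt ℝ β (f x))
    (h : ∀ᶠ y in nhds x, α y = (β (f y)).compContinuousLinearMap (mfderiv I 𝓘(ℝ, E') f y)) :
    α.d I x = (extDeriv β (f x)).compContinuousLinearMap (mfderiv I 𝓘(ℝ, E') f x) := by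
  have hx := mem_extChartAt_source (I := I) x
  have hl := (extChartAt I x).left_inv hx
  have h1 := contDiffAt_comp_chart_symm hx hf
  have h3 := mfderiv_eq_fderiv_comp_chart (I := I) hx (hf.mdifferentiableAt (by simp))
  rw [MForm.d, (chartRep_eventuallyEq_of_pullback hx hf h).extDeriv_eq,
    extDeriv_pullback (r := ∞) (by rwa [Function.comp_apply, hl]) h1 (by simpa using
        two_le_infty), h3,
    Function.comp_apply, hl]
  rfl

/-- Every form is locally the pullback, by a chart, of its own chart expression. The results on
pullbacks from a vector space therefore also handle changes of chart. -/
theorem eq_chartRep_pullback (α : MForm I M n F) {x₀ x : M}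
    (hx : x ∈ (extChartAt I x₀).source) :
    α x = (α.chartRep I x₀ (extChartAt I x₀ x)).compContinuousLinearMap
      (mfderiv I 𝓘(ℝ, E) (extChartAt I x₀) x) := by
  ext v
  -- The tangent spaces at χ⁻¹(χ x) and at x are different types; with a variable base point the
  -- equality can be substituted.
  have key : ∀ y, y = x → α x v = α y (fun i =>
      (mfderiv 𝓘(ℝ, E) I (extChartAt I x₀).symm (extChartAt I x₀ x))
        (mfderiv I 𝓘(ℝ, E) (extChartAt I x₀) x (v i))) := by
    rintro y rfl
    congr 1
    funext i
    exact (DFunLike.congr_fun (mfderiv_symm_comp_mfderiv_extChartAt (I := I) hx) (v i)).symm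
  exact key _ ((extChartAt I x₀).left_inv hx)

theorem eventually_mem_extChartAt_source {x₀ x : M} (hx : x ∈ (extChartAt I x₀).source) :
    ∀ᶠ y in nhds x, y ∈ (extChartAt I x₀).source :=
  (isOpen_extChartAt_source x₀).mem_nhds hx

theorem contDiffAt_chartRep_of_smooth [FiniteDimensional ℝ E] [FiniteDimensional ℝ F]
    {α : MForm I M n F} {x₀ x : M} (hx : x ∈ (extChartAt I x₀).source)
    (h : ContDiffAt ℝ ∞ (α.chartRep I x) (extChartAt I x x)) :
    ContDiffAt ℝ ∞ (α.chartRep I x₀) (extChartAt I x₀ x) :=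
  contDiffAt_chartRep_of_pullback hx
    (contMDiffAt_extChartAt_of_mem (mem_extChartAt_source x)) h
    ((eventually_mem_extChartAt_source (mem_extChartAt_source x)).mono
      fun _ hy => eq_chartRep_pullback α hy)

/-- The exterior derivative of a smooth form, computed in an arbitrary preferred chart. -/
theorem d_eq_chartRep [FiniteDimensional ℝ E] [FiniteDimensional ℝ F]
    {α : MForm I M n F} {x₀ x : M} (hx : x ∈ (extChartAt I x₀).source)
    (h : ContDiffAt ℝ ∞ (α.chartRep I x) (extChartAt I x x)) :
    α.d I x = (extDeriv (α.chartRep I x₀) (extChartAt I x₀ x)).compContinuousLinearMap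
      (mfderiv I 𝓘(ℝ, E) (extChartAt I x₀) x) :=
  d_eq_of_pullback (contMDiffAt_extChartAt_of_mem hx)
    ((contDiffAt_chartRep_of_smooth hx h).differentiableAt (by simp))
    ((eventually_mem_extChartAt_source hx).mono fun _ hy => eq_chartRep_pullback α hy)

end ChartCalculus
end G2ERP

namespace G2ERP

/-! ### Exterior derivatives of one-forms on a vector space. -/

section OneForms

variable {E : Type*} [NormedAddCommGroup E] [NormedSpace ℝ E]
  {F : Type*} [NormedAddCommGroup F] [NormedSpace ℝ F]

/-- The exterior derivative of a `1`-form on a vector space. -/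
noncomputable def dOne (α : E → E →L[ℝ] F) (x v w : E) : F := fderiv ℝ α x v w - fderiv ℝ α x w v

theorem hasFDerivAt_clm_apply_const {X : Type*} [NormedAddCommGroup X] [NormedSpace ℝ X]
    {δ : X → E →L[ℝ] F} {δ' : X →L[ℝ] E →L[ℝ] F} {x : X} (h : HasFDerivAt δ δ' x) (s : E) :
    HasFDerivAt (fun y => δ y s) (δ'.flip s) x :=
  (ContinuousLinearMap.apply ℝ F s).hasFDerivAt.comp x h

theorem dOne_add {α β : E → E →L[ℝ] F} {x : E} (hα : DifferentiableAt ℝ α x)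
    (hβ : DifferentiableAt ℝ β x) (v w : E) :
    dOne (fun y => α y + β y) x v w = dOne α x v w + dOne β x v w := by
  simp only [dOne, fderiv_fun_add hα hβ, add_apply]
  abel

theorem dOne_sub {α β : E → E →L[ℝ] F} {x : E} (hα : DifferentiableAt ℝ α x)
    (hβ : DifferentiableAt ℝ β x) (v w : E) :
    dOne (fun y => α y - β y) x v w = dOne α x v w - dOne β x v w := by
  simp only [dOne, fderiv_fun_sub hα hβ, sub_apply]
  abel

theorem dOne_const_smul (c : ℝ) {α : E → E →L[ℝ] F} {x : E} (hα : DifferentiableAt ℝ α x)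
    (v w : E) : dOne (fun y => c • α y) x v w = c • dOne α x v w := by
  simp only [dOne, fderiv_fun_const_smul hα, smul_apply, smul_sub]

theorem dOne_sum {ι : Type*} (s : Finset ι) {α : ι → E → E →L[ℝ] F} {x : E}
    (hα : ∀ i ∈ s, DifferentiableAt ℝ (α i) x) (v w : E) :
    dOne (fun y => ∑ i ∈ s, α i y) x v w = ∑ i ∈ s, dOne (α i) x v w := by
  simp only [dOne, fderiv_fun_sum hα, sum_apply, Finset.sum_sub_distrib]

theorem dOne_smul {f : E → ℝ} {α : E → E →L[ℝ] F} {x : E} (hf : DifferentiableAt ℝ f x)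
    (hα : DifferentiableAt ℝ α x) (v w : E) :
    dOne (fun y => f y • α y) x v w =
      f x • dOne α x v w + (fderiv ℝ f x v • α x w - fderiv ℝ f x w • α x v) := by
  simp only [dOne, fderiv_fun_smul hf hα, add_apply,
    smul_apply, ContinuousLinearMap.smulRight_apply, smul_sub]
  abel

theorem dOne_swap (α : E → E →L[ℝ] F) (x v w : E) : dOne α x w v = -dOne α x v w := by
  simp [dOne]

theorem dOne_fderiv {f : E → F} {x : E} (hf : ContDiffAt ℝ ∞ f x) (v w : E) :
    dOne (fderiv ℝ f) x v w = 0 := by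
  have := (hf.isSymmSndFDerivAt (by simpa using two_le_infty)) v w
  rw [dOne, this, sub_self]

theorem extDeriv_oneForm_apply {α : E → E [⋀^Fin 1]→L[ℝ] F} {α' : E → E →L[ℝ] F} {x : E}
    (h : ∀ y v, α' y v = α y (fun _ => v)) (hα : DifferentiableAt ℝ α x)
    (hα' : DifferentiableAt ℝ α' x) (v w : E) :
    extDeriv α x ![v, w] = dOne α' x v w := by
  rw [extDeriv_apply hα, Fin.sum_univ_two, dOne]
  have e : ∀ u t : E, fderiv ℝ α' x t u = fderiv ℝ (fun y => α y (fun _ => u)) x t := by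
    intro u t
    have : (fun y => α y (fun _ => u)) = fun y => α' y u := by
      funext y
      rw [h]
    rw [this, fderiv_clm_apply hα' (differentiableAt_const u)]
    simp
  rw [e, e]
  have r0 : (0 : Fin 2).removeNth ![v, w] = fun _ => w := by
    funext i; fin_cases i; rfl
  have r1 : (1 : Fin 2).removeNth ![v, w] = fun _ => v := by
    funext i; fin_cases i; rfl
  rw [r0, r1]
  simp [sub_eq_add_neg]

/-- The identity obtained by taking the exterior derivative of `dα = ∑ βᵢ ∧ γᵢ`. -/
theorem cyclic_sum_of_dOne_eq {ι : Type*} [Fintype ι] {α : E → E →L[ℝ] ℝ}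
    {β γ : ι → E → E →L[ℝ] ℝ} {x : E} (hα : ContDiffAt ℝ ∞ α x)
    (hβ : ∀ i, DifferentiableAt ℝ (β i) x) (hγ : ∀ i, DifferentiableAt ℝ (γ i) x)
    (h : ∀ᶠ y in nhds x, ∀ v w, dOne α y v w = ∑ i, (β i y v * γ i y w - β i y w * γ i y v))
    (u v w : E) :
    ∑ i, (dOne (β i) x u v * γ i x w + dOne (β i) x v w * γ i x u + dOne (β i) x w u * γ i x v
      - β i x u * dOne (γ i) x v w - β i x v * dOne (γ i) x w u
      - β i x w * dOne (γ i) x u v) = 0 := by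
  have hD : ContDiffAt ℝ ∞ (fderiv ℝ α) x := hα.fderiv_right (by simp)
  have hDd : DifferentiableAt ℝ (fderiv ℝ α) x := hD.differentiableAt (by simp)
  have hsymm : ∀ a b, fderiv ℝ (fderiv ℝ α) x a b = fderiv ℝ (fderiv ℝ α) x b a := fun a b =>
    (hα.isSymmSndFDerivAt (by simpa using two_le_infty)) a b
  -- Differentiate the equation for dα in the direction a. In the cyclic sum over (u, v, w) the left
  -- sides cancel by symmetry of the second derivative of α as a function of its base point.
  have key : ∀ a b c : E, fderiv ℝ (fderiv ℝ α) x a b c - fderiv ℝ (fderiv ℝ α) x a c b =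
      ∑ i, (fderiv ℝ (β i) x a b * γ i x c + β i x b * fderiv ℝ (γ i) x a c
        - (fderiv ℝ (β i) x a c * γ i x b + β i x c * fderiv ℝ (γ i) x a b)) := by
    intro a b c
    have h1 : HasFDerivAt (fun y => dOne α y b c)
        ((((fderiv ℝ (fderiv ℝ α) x).flip b).flip c) -
          (((fderiv ℝ (fderiv ℝ α) x).flip c).flip b)) x := by
      have hb : ∀ s t : E, HasFDerivAt (fun y => fderiv ℝ α y s t)
          (((fderiv ℝ (fderiv ℝ α) x).flip s).flip t) x := by
        intro s t
        exact hasFDerivAt_clm_apply_const (hasFDerivAt_clm_apply_const hDd.hasFDerivAt s) t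
      exact (hb b c).sub (hb c b)
    have h2 : HasFDerivAt (fun y => ∑ i, (β i y b * γ i y c - β i y c * γ i y b))
        (∑ i, ((β i x b • (fderiv ℝ (γ i) x).flip c + γ i x c • (fderiv ℝ (β i) x).flip b)
          - (β i x c • (fderiv ℝ (γ i) x).flip b + γ i x b • (fderiv ℝ (β i) x).flip c))) x := by
      have hb : ∀ (δ : E → E →L[ℝ] ℝ), DifferentiableAt ℝ δ x → ∀ s : E,
          HasFDerivAt (fun y => δ y s) ((fderiv ℝ δ x).flip s) x := by
        intro δ hδ s
        exact hasFDerivAt_clm_apply_const hδ.hasFDerivAt s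
      refine HasFDerivAt.fun_sum fun i _ => ?_
      exact ((hb _ (hβ i) b).mul (hb _ (hγ i) c)).sub ((hb _ (hβ i) c).mul (hb _ (hγ i) b))
    have h3 := (h1.congr_of_eventuallyEq (h.mono fun y hy => (hy b c).symm)).unique h2
    have h4 := DFunLike.congr_fun h3 a
    simp only [sub_apply, ContinuousLinearMap.flip_apply,
      sum_apply, add_apply,
      smul_apply, smul_eq_mul] at h4
    rw [h4]
    refine Finset.sum_congr rfl fun i _ => ?_
    ring
  have hs : (fderiv ℝ (fderiv ℝ α) x u v w - fderiv ℝ (fderiv ℝ α) x u w v)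
      + (fderiv ℝ (fderiv ℝ α) x v w u - fderiv ℝ (fderiv ℝ α) x v u w)
      + (fderiv ℝ (fderiv ℝ α) x w u v - fderiv ℝ (fderiv ℝ α) x w v u) = 0 := by
    rw [hsymm v u, hsymm w u, hsymm w v]
    ring
  rw [key u v w, key v w u, key w u v, ← Finset.sum_add_distrib, ← Finset.sum_add_distrib] at hs
  rw [← hs]
  refine Finset.sum_congr rfl fun i _ => ?_
  simp only [dOne]
  ring

end OneForms
end G2ERP

namespace G2ERP

set_option linter.unusedSectionVars false

/-! ### Parallel frames of flat connections, by transport along rays. -/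

section Gauge

open Set Metric

variable {E : Type*} [NormedAddCommGroup E] [NormedSpace ℝ E]
  {𝔸 : Type*} [NormedRing 𝔸] [NormedAlgebra ℝ 𝔸] [CompleteSpace 𝔸] [NormOneClass 𝔸]

theorem add_smul_mem_ball {p h : E} {r t : ℝ} (hh : ‖h‖ < r) (ht : t ∈ Icc (0 : ℝ) 1) :
    p + t • h ∈ ball p r := by
  rw [mem_ball, dist_eq_norm, add_sub_cancel_left, norm_smul, Real.norm_of_nonneg ht.1]
  exact (mul_le_of_le_one_left (norm_nonneg h) ht.2).trans_lt hh

/-- Parallel transport along a short ray. -/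
theorem exists_parallel_transport_ray {γ : E → E →L[ℝ] 𝔸} {p h : E} {r C : ℝ}
    (hγ : ContinuousOn γ (ball p r)) (hC : ∀ y ∈ ball p r, ‖γ y‖ ≤ C) (hrC : r * C ≤ 1 / 4)
    (hh : ‖h‖ < r) :
    ∃ G : ℝ → 𝔸, G 0 = 1 ∧ ∀ t ∈ Icc (0 : ℝ) 1,
      HasDerivWithinAt G (G t * γ (p + t • h) h) (Icc 0 1) t := by
  have hb : ∀ t ∈ Icc (0 : ℝ) 1, ‖γ (p + t • h) h‖ ≤ 1 / 4 := by
    intro t ht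
    have h1 := hC _ (add_smul_mem_ball (p := p) hh ht)
    have h0 : 0 ≤ C := (norm_nonneg _).trans h1
    calc ‖γ (p + t • h) h‖ ≤ ‖γ (p + t • h)‖ * ‖h‖ := (γ _).le_opNorm h
      _ ≤ C * r := mul_le_mul h1 hh.le (norm_nonneg _) h0
      _ ≤ 1 / 4 := by rwa [mul_comm]
  -- In the unit ball around 1 one has ‖A‖ ≤ 2, so the field has norm at most 1/2 and Lipschitz
  -- constant at most 1/4. Hence the constants 1 suffice for a solution on the whole interval [0,
  -- 1].
  have hpl : IsPicardLindelof (fun t A => A * γ (p + t • h) h) (tmin := 0) (tmax := 1)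
      ⟨0, by simp⟩ (1 : 𝔸) 1 0 1 1 := by
    refine ⟨fun t ht => ?_, fun A _ => ?_, fun t ht A hA => ?_, by simp⟩
    · refine LipschitzWith.lipschitzOnWith (LipschitzWith.of_dist_le_mul fun A A' => ?_)
      rw [dist_eq_norm, dist_eq_norm, ← sub_mul, NNReal.coe_one, one_mul]
      refine (norm_mul_le _ _).trans (mul_le_of_le_one_right (norm_nonneg _) ?_)
      exact (hb t ht).trans (by norm_num)
    · refine continuousOn_const.mul (ContinuousOn.clm_apply (hγ.comp ?_ ?_) continuousOn_const)
      · fun_prop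
      · exact fun t ht => add_smul_mem_ball hh ht
    · have hA' : ‖A‖ ≤ 2 := by
        have : ‖A - 1‖ ≤ 1 := by simpa [dist_eq_norm] using hA
        calc ‖A‖ = ‖(A - 1) + 1‖ := by simp
          _ ≤ ‖A - 1‖ + ‖(1 : 𝔸)‖ := norm_add_le _ _
          _ ≤ 2 := by rw [norm_one]; linarith
      refine (norm_mul_le _ _).trans ?_
      have := mul_le_mul hA' (hb t ht) (norm_nonneg _) (by norm_num)
      rw [NNReal.coe_one]
      linarith
  obtain ⟨G, h0, hG⟩ := hpl.exists_eq_forall_mem_Icc_hasDerivWithinAt₀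
  exact ⟨G, h0, hG⟩

/-- Comparison of parallel transport along neighbouring rays for a flat connection. -/
theorem norm_parallel_transport_sub_le {γ : E → E →L[ℝ] 𝔸} {p h v : E} {r C K : ℝ}
    (hr : r ≤ 1)
    (hd : ∀ y ∈ ball p r, DifferentiableAt ℝ γ y)
    (hC : ∀ y ∈ ball p r, ‖γ y‖ ≤ C)
    (hL : ∀ y ∈ ball p r, ∀ z ∈ ball p r, ‖γ y - γ z‖ ≤ C * ‖y - z‖)
    (hL2 : ∀ y ∈ ball p r, ∀ z ∈ ball p r, ‖fderiv ℝ γ y - fderiv ℝ γ z‖ ≤ C * ‖y - z‖)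
    (hrC : r * C ≤ 1 / 4)
    (hflat : ∀ y ∈ ball p r, ∀ v w, dOne γ y v w + (γ y v * γ y w - γ y w * γ y v) = 0)
    (hh : ‖h‖ < r) (hv : ‖h + v‖ < r) {G A : ℝ → 𝔸} (hG0 : G 0 = 1) (hA0 : A 0 = 1)
    (hG : ∀ t ∈ Icc (0 : ℝ) 1, HasDerivWithinAt G (G t * γ (p + t • h) h) (Icc 0 1) t)
    (hA : ∀ t ∈ Icc (0 : ℝ) 1,
      HasDerivWithinAt A (A t * γ (p + t • (h + v)) (h + v)) (Icc 0 1) t)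
    (hK : ∀ t ∈ Icc (0 : ℝ) 1, ‖G t‖ ≤ K) :
    ‖A 1 - G 1 - G 1 * γ (p + h) v‖ ≤ 2 * (K * (2 * C + 2 * C * C) * ‖v‖ ^ 2) := by
  have hC0 : 0 ≤ C := (norm_nonneg _).trans (hC p (mem_ball_self ((norm_nonneg h).trans_lt hh)))
  have hK0 : 0 ≤ K := (norm_nonneg _).trans (hK 0 (by simp))
  -- The error of the first-order prediction G + t G γ(v) for transport along the neighbouring ray.
  -- It vanishes at t = 0, and flatness makes its derivative linear in Δ up to O(‖v‖²), so that
  -- Grönwall's inequality applies.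
  set Δ : ℝ → 𝔸 := fun t => A t - G t - t • (G t * γ (p + t • h) v) with hΔ
  set Δ' : ℝ → 𝔸 := fun t => A t * γ (p + t • (h + v)) (h + v) - G t * γ (p + t • h) h
    - (t • (G t * fderiv ℝ γ (p + t • h) h v + G t * γ (p + t • h) h * γ (p + t • h) v)
      + (1 : ℝ) • (G t * γ (p + t • h) v)) with hΔ'
  have hder : ∀ t ∈ Icc (0 : ℝ) 1, HasDerivWithinAt Δ (Δ' t) (Icc 0 1) t := by
    intro t ht
    have h1 : HasDerivWithinAt (fun s : ℝ => γ (p + s • h) v)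
        (fderiv ℝ γ (p + t • h) h v) (Icc 0 1) t := by
      have e1 : HasDerivAt (fun s : ℝ => p + s • h) h t := by
        simpa using ((hasDerivAt_id t).smul_const h).const_add p
      have e2 := (hd _ (add_smul_mem_ball hh ht)).hasFDerivAt.comp_hasDerivAt t e1
      have e3 := (hasFDerivAt_clm_apply_const (hasFDerivAt_id _) v).comp_hasDerivAt t e2
      exact e3.hasDerivWithinAt
    have h2 := ((hasDerivWithinAt_id t (Icc (0 : ℝ) 1)).smul ((hG t ht).mul h1))
    have h3 := ((hA t ht).sub (hG t ht)).sub h2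
    refine h3.congr_deriv ?_
    rw [hΔ']
    simp only [id, smul_add, one_smul]
    abel
  have hbound : ∀ t ∈ Icc (0 : ℝ) 1, ‖Δ' t‖ ≤ 1 * ‖Δ t‖ + K * (2 * C + 2 * C * C) * ‖v‖ ^ 2 := by
    intro t ht
    have hz := add_smul_mem_ball (p := p) hh ht
    have hz' := add_smul_mem_ball (p := p) hv ht
    set z := p + t • h with hzdef
    set z' := p + t • (h + v) with hzdef'
    have hzz : z' - z = t • v := by
      rw [hzdef, hzdef', smul_add]; abel
    have hnt : ‖t • v‖ ≤ ‖v‖ := by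
      rw [norm_smul, Real.norm_of_nonneg ht.1]
      exact mul_le_of_le_one_left (norm_nonneg v) ht.2
    have hf := hflat z hz h v
    -- Flatness exchanges ∂ₕγ(v) for ∂ᵥγ(h) and a commutator. Apart from the term in Δ, each summand
    -- is then quadratic in v.
    have e1 : Δ' t = Δ t * γ z' (h + v)
        + G t * ((γ z' - γ z) v + (γ z' - γ z - fderiv ℝ γ z (t • v)) h)
        + t • (G t * γ z v * ((γ z' - γ z) (h + v) + γ z v)) := by
      have hf' : fderiv ℝ γ z h v = fderiv ℝ γ z v h - (γ z h * γ z v - γ z v * γ z h) := by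
        rw [dOne] at hf
        have := eq_neg_of_add_eq_zero_left hf
        rw [sub_eq_iff_eq_add] at this
        rw [this]
        abel
      have e2 : Δ t = A t - G t - t • (G t * γ z v) := rfl
      have e3 : Δ' t = A t * γ z' (h + v) - G t * γ z h
        - (t • (G t * fderiv ℝ γ z h v + G t * γ z h * γ z v) + (1 : ℝ) • (G t * γ z v)) := rfl
      rw [e2, e3, hf']
      simp only [sub_apply, map_add, map_smul, smul_apply, one_smul]
      simp only [mul_add, mul_sub, sub_mul, smul_add, smul_sub, smul_mul_assoc,
        mul_smul_comm, mul_assoc]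
      abel
    have b0 : ‖γ z' (h + v)‖ ≤ 1 := by
      calc ‖γ z' (h + v)‖ ≤ ‖γ z'‖ * ‖h + v‖ := (γ z').le_opNorm _
        _ ≤ C * r := mul_le_mul (hC _ hz') hv.le (norm_nonneg _) hC0
        _ ≤ 1 := by linarith
    have b1 : ‖γ z' - γ z‖ ≤ C * ‖v‖ :=
      (hL _ hz' _ hz).trans (by rw [hzz]; exact mul_le_mul_of_nonneg_left hnt hC0)
    have b2 : ‖γ z' - γ z - fderiv ℝ γ z (t • v)‖ ≤ C * ‖v‖ * ‖v‖ := by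
      have := (convex_segment z z').norm_image_sub_le_of_norm_fderiv_le' (𝕜 := ℝ) (f := γ)
        (C := C * ‖v‖) (φ := fderiv ℝ γ z)
        (fun y hy => hd y ((convex_ball p r).segment_subset hz hz' hy))
        (fun y hy => ?_) (left_mem_segment ℝ z z') (right_mem_segment ℝ z z')
      · rw [hzz] at this
        exact this.trans (mul_le_mul_of_nonneg_left hnt (by positivity))
      · refine (hL2 _ ((convex_ball p r).segment_subset hz hz' hy) _ hz).trans ?_
        refine mul_le_mul_of_nonneg_left ?_ hC0
        obtain ⟨s, hs, rfl⟩ := (segment_eq_image' ℝ z z' ▸ hy : y ∈ _)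
        rw [add_sub_cancel_left, hzz, norm_smul, Real.norm_of_nonneg hs.1]
        exact (mul_le_of_le_one_left (norm_nonneg _) hs.2).trans hnt
    have hh1 : ‖h‖ ≤ 1 := hh.le.trans hr
    have hv1 : ‖h + v‖ ≤ 1 := hv.le.trans hr
    have c1 : ‖(γ z' - γ z) v + (γ z' - γ z - fderiv ℝ γ z (t • v)) h‖ ≤ 2 * C * ‖v‖ ^ 2 := by
      refine (norm_add_le _ _).trans ?_
      have d1 := ((γ z' - γ z).le_opNorm v).trans
        (mul_le_mul_of_nonneg_right b1 (norm_nonneg v))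
      have d2 := ((γ z' - γ z - fderiv ℝ γ z (t • v)).le_opNorm h).trans
        (mul_le_mul b2 hh1 (norm_nonneg h) (by positivity))
      nlinarith
    have c0 : ‖γ z v‖ ≤ C * ‖v‖ :=
      ((γ z).le_opNorm v).trans (mul_le_mul_of_nonneg_right (hC _ hz) (norm_nonneg v))
    have c2 : ‖(γ z' - γ z) (h + v) + γ z v‖ ≤ 2 * C * ‖v‖ := by
      refine (norm_add_le _ _).trans ?_
      have d1 := ((γ z' - γ z).le_opNorm (h + v)).trans
        (mul_le_mul b1 hv1 (norm_nonneg _) (by positivity))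
      linarith
    rw [e1]
    have f1 : ‖Δ t * γ z' (h + v)‖ ≤ 1 * ‖Δ t‖ := by
      refine (norm_mul_le _ _).trans ?_
      rw [one_mul]
      exact mul_le_of_le_one_right (norm_nonneg _) b0
    have f2 : ‖G t * ((γ z' - γ z) v + (γ z' - γ z - fderiv ℝ γ z (t • v)) h)‖
        ≤ K * (2 * C * ‖v‖ ^ 2) :=
      (norm_mul_le _ _).trans (mul_le_mul (hK t ht) c1 (norm_nonneg _) hK0)
    have f3 : ‖t • (G t * γ z v * ((γ z' - γ z) (h + v) + γ z v))‖
        ≤ K * (C * ‖v‖) * (2 * C * ‖v‖) := by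
      rw [norm_smul, Real.norm_of_nonneg ht.1]
      refine (mul_le_of_le_one_left (norm_nonneg _) ht.2).trans ?_
      refine (norm_mul_le _ _).trans (mul_le_mul ?_ c2 (norm_nonneg _) (by positivity))
      exact (norm_mul_le _ _).trans (mul_le_mul (hK t ht) c0 (norm_nonneg _) hK0)
    refine (norm_add_le _ _).trans ((add_le_add ((norm_add_le _ _).trans
      (add_le_add f1 f2)) f3).trans (le_of_eq ?_))
    ring
  have hg := norm_le_gronwallBound_of_norm_deriv_right_le (f := Δ) (f' := Δ') (δ := 0) (K := 1)
    (ε := K * (2 * C + 2 * C * C) * ‖v‖ ^ 2) (a := 0) (b := 1)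
    (fun t ht => (hder t ht).continuousWithinAt)
    (fun t ht => (hder t ⟨ht.1, ht.2.le⟩).mono_of_mem_nhdsWithin (Icc_mem_nhdsGE_of_mem ht))
    (by simp [hΔ, hG0, hA0]) (fun t ht => hbound t ⟨ht.1, ht.2.le⟩) 1 (by simp)
  rw [gronwallBound_of_K_ne_0 (one_ne_zero : (1 : ℝ) ≠ 0)] at hg
  simp only [hΔ, one_smul, sub_zero, zero_mul, zero_add, div_one, mul_one] at hg
  refine hg.trans ?_
  have h1 : Real.exp 1 - 1 ≤ 2 := by
    have := Real.exp_one_lt_d9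
    linarith
  have h2 : 0 ≤ K * (2 * C + 2 * C * C) * ‖v‖ ^ 2 := by positivity
  nlinarith

/-- A flat connection on a vector bundle has a parallel frame near each point. -/
theorem exists_gauge_of_flat {γ : E → E →L[ℝ] 𝔸} {p : E} (hγ : ContDiffAt ℝ ∞ γ p)
    (hflat : ∀ᶠ y in nhds p, ∀ v w, dOne γ y v w + (γ y v * γ y w - γ y w * γ y v) = 0) :
    ∃ (g : E → 𝔸) (r : ℝ), 0 < r ∧ g p = 1 ∧ ∀ y ∈ ball p r,
      HasFDerivAt g ((ContinuousLinearMap.mul ℝ 𝔸 (g y)).comp (γ y)) y := by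
  have hD : ContDiffAt ℝ ∞ (fderiv ℝ γ) p := hγ.fderiv_right (by simp)
  obtain ⟨K1, s1, hs1, hK1⟩ := (hγ.of_le (by simp : (1 : WithTop ℕ∞) ≤ ∞)).exists_lipschitzOnWith
  obtain ⟨K2, s2, hs2, hK2⟩ := (hD.of_le (by simp : (1 : WithTop ℕ∞) ≤ ∞)).exists_lipschitzOnWith
  have hdiff : ∀ᶠ y in nhds p, DifferentiableAt ℝ γ y :=
    ((hγ.of_le (by simp : (1 : WithTop ℕ∞) ≤ ∞)).eventually (by simp)).mono
      fun y hy => hy.differentiableAt (by simp)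
  have hbd : ∀ᶠ y in nhds p, ‖γ y‖ < ‖γ p‖ + 1 :=
    (hγ.continuousAt.norm).eventually_lt continuousAt_const (by simp)
  obtain ⟨r0, hr0, hball⟩ := Metric.eventually_nhds_iff_ball.1
    ((((hflat.and hdiff).and hbd).and hs1).and hs2)
  set C : ℝ := ‖γ p‖ + 1 + K1 + K2 with hCdef
  have hC0 : 0 < C := by positivity
  set r := min r0 (min 1 (1 / (4 * C))) with hrdef
  have hr : 0 < r := by positivity
  have hrr0 : ball p r ⊆ ball p r0 := ball_subset_ball (min_le_left _ _)
  have hr1 : r ≤ 1 := (min_le_right _ _).trans (min_le_left _ _)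
  have hrC : r * C ≤ 1 / 4 := by
    have : r ≤ 1 / (4 * C) := (min_le_right _ _).trans (min_le_right _ _)
    calc r * C ≤ 1 / (4 * C) * C := mul_le_mul_of_nonneg_right this hC0.le
      _ = 1 / 4 := by field_simp
  have hd : ∀ y ∈ ball p r, DifferentiableAt ℝ γ y := fun y hy => (hball y (hrr0 hy)).1.1.1.2
  have hC : ∀ y ∈ ball p r, ‖γ y‖ ≤ C := fun y hy => by
    have h1 := (hball y (hrr0 hy)).1.1.2
    have h2 : (0 : ℝ) ≤ K1 := K1.2
    have h3 : (0 : ℝ) ≤ K2 := K2.2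
    simp only [hCdef]
    linarith
  have hL : ∀ y ∈ ball p r, ∀ z ∈ ball p r, ‖γ y - γ z‖ ≤ C * ‖y - z‖ := fun y hy z hz => by
    have := hK1.dist_le_mul y (hball y (hrr0 hy)).1.2 z (hball z (hrr0 hz)).1.2
    rw [dist_eq_norm, dist_eq_norm] at this
    refine this.trans (mul_le_mul_of_nonneg_right ?_ (norm_nonneg _))
    have h3 : (0 : ℝ) ≤ K2 := K2.2
    have := norm_nonneg (γ p)
    simp only [hCdef]
    linarith
  have hL2 : ∀ y ∈ ball p r, ∀ z ∈ ball p r,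
      ‖fderiv ℝ γ y - fderiv ℝ γ z‖ ≤ C * ‖y - z‖ := fun y hy z hz => by
    have := hK2.dist_le_mul y (hball y (hrr0 hy)).2 z (hball z (hrr0 hz)).2
    rw [dist_eq_norm, dist_eq_norm] at this
    refine this.trans (mul_le_mul_of_nonneg_right ?_ (norm_nonneg _))
    have h3 : (0 : ℝ) ≤ K1 := K1.2
    have := norm_nonneg (γ p)
    simp only [hCdef]
    linarith
  have hcont : ContinuousOn γ (ball p r) :=
    fun y hy => (hd y hy).continuousAt.continuousWithinAt
  have hex : ∀ h : E, ∃ G : ℝ → 𝔸, ‖h‖ < r → G 0 = 1 ∧ ∀ t ∈ Icc (0 : ℝ) 1,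
      HasDerivWithinAt G (G t * γ (p + t • h) h) (Icc 0 1) t := by
    intro h
    by_cases hh : ‖h‖ < r
    · obtain ⟨G, hG⟩ := exists_parallel_transport_ray hcont hC hrC hh
      exact ⟨G, fun _ => hG⟩
    · exact ⟨0, fun h' => absurd h' hh⟩
  choose T hT using hex
  have hT0 : T 0 1 = 1 := by
    obtain ⟨h0, h1⟩ := hT 0 (by simpa using hr)
    have := (convex_Icc (0 : ℝ) 1).is_const_of_fderivWithin_eq_zero (𝕜 := ℝ) (f := T 0)
      (fun t ht => (h1 t ht).differentiableWithinAt) (fun t ht => ?_)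
      (x := 1) (y := 0) (by simp) (by simp)
    · rw [this, h0]
    · have h2 := h1 t ht
      rw [map_zero, mul_zero] at h2
      have := h2.hasFDerivWithinAt.fderivWithin (uniqueDiffOn_Icc zero_lt_one t ht)
      rw [this]
      ext
      simp
  refine ⟨fun y => T (y - p) 1, r, hr, by simpa using hT0, fun y hy => ?_⟩
  have hh : ‖y - p‖ < r := by rwa [mem_ball, dist_eq_norm] at hy
  obtain ⟨hG0, hG⟩ := hT _ hh
  have hGc : ContinuousOn (T (y - p)) (Icc 0 1) := fun t ht => (hG t ht).continuousWithinAt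
  obtain ⟨K, hK⟩ := isCompact_Icc.exists_bound_of_continuousOn hGc
  set C' := 2 * (K * (2 * C + 2 * C * C)) with hC'
  rw [hasFDerivAt_iff_isLittleO_nhds_zero]
  -- Transport to y + v agrees with its linearisation at y up to O(‖v‖²); this gives the derivative
  -- at every y in the ball and not only at the centre.
  have hO : (fun v : E => T (y + v - p) 1 - T (y - p) 1 -
      ((ContinuousLinearMap.mul ℝ 𝔸 (T (y - p) 1)).comp (γ y)) v) =O[nhds 0]
      fun v => ‖v‖ ^ 2 := by
    refine Asymptotics.IsBigO.of_bound C' ?_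
    have hnear : ∀ᶠ v : E in nhds 0, ‖(y - p) + v‖ < r :=
      ContinuousAt.eventually_lt (by fun_prop) continuousAt_const (by simpa using hh)
    filter_upwards [hnear] with v hv
    obtain ⟨hA0, hA⟩ := hT _ hv
    have := norm_parallel_transport_sub_le hr1 hd hC hL hL2 hrC
      (fun y hy => (hball y (hrr0 hy)).1.1.1.1) hh hv hG0 hA0 hG hA hK
    rw [add_sub_cancel] at this
    rw [show y + v - p = y - p + v by abel]
    simp only [ContinuousLinearMap.comp_apply, ContinuousLinearMap.mul_apply', norm_pow, norm_norm]
    refine this.trans (le_of_eq ?_)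
    rw [hC']
    ring
  exact hO.trans_isLittleO (Asymptotics.isLittleO_norm_pow_id one_lt_two)

/-- Bootstrapping: the equation Dg = gγ makes Dg as smooth as g. -/
theorem contDiffOn_of_hasFDerivAt_mul {γ : E → E →L[ℝ] 𝔸} {g : E → 𝔸} {s : Set E}
    (hs : IsOpen s) (hγ : ContDiffOn ℝ ∞ γ s)
    (hg : ∀ y ∈ s, HasFDerivAt g ((ContinuousLinearMap.mul ℝ 𝔸 (g y)).comp (γ y)) y) :
    ContDiffOn ℝ ∞ g s := by
  rw [contDiffOn_infty]
  intro n
  induction n with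
  | zero =>
    exact contDiffOn_zero.2 fun y hy => (hg y hy).continuousAt.continuousWithinAt
  | succ n ih =>
    push_cast
    rw [contDiffOn_succ_iff_fderiv_of_isOpen hs]
    refine ⟨fun y hy => (hg y hy).differentiableAt.differentiableWithinAt, by simp, ?_⟩
    have h1 : ContDiffOn ℝ n (fun y => (ContinuousLinearMap.mul ℝ 𝔸 (g y)).comp (γ y)) s :=
      ((ContinuousLinearMap.mul ℝ 𝔸).contDiff.comp_contDiffOn ih).clm_comp
        (hγ.of_le (by exact_mod_cast le_top))
    exact h1.congr fun y hy => (hg y hy).fderiv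

end Gauge
end G2ERP

namespace G2ERP

noncomputable section

/-! ### The structure equations in real form -/

/-- A general element of `sl(4, ℝ) = so(3, 3)` without component in the plane of the two
rotations that move `e⁰¹ - e²³` inside its negative definite complement: `G` and `ρ` are the
coordinates in `su(2) ⊕ u(1)`, while `w`, `p`, `q` are those in the symmetric matrices. -/
def gam (G : Fin 3 → ℝ) (ρ : ℝ) (w p q : Fin 3 → ℝ) : Matrix (Fin 4) (Fin 4) ℝ :=
  !![-w 0 + p 2 - q 1, -(ρ - G 0) / 2 + q 2 + p 1, G 1 / 2 - w 2 - p 0, -G 2 / 2 - w 1 + q 0;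
     (ρ - G 0) / 2 + q 2 + p 1, -w 0 - p 2 + q 1, -G 2 / 2 - w 1 - q 0, -G 1 / 2 + w 2 - p 0;
     -G 1 / 2 - w 2 - p 0, G 2 / 2 - w 1 - q 0, w 0 - p 2 - q 1, (ρ + G 0) / 2 - p 1 + q 2;
     G 2 / 2 - w 1 + q 0, G 1 / 2 + w 2 - p 0, -(ρ + G 0) / 2 - p 1 + q 2, w 0 + p 2 + q 1]

/-- The connection matrix on the span of the last four coframe elements; `z` are the values of the
coframe on a vector. -/
def conn (k : ℝ) (P Q : Fin 3 → Fin 3 → ℝ) (G : Fin 3 → ℝ) (ρ : ℝ) (z : Fin 7 → ℝ) :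
    Matrix (Fin 4) (Fin 4) ℝ :=
  gam G ρ ![k * z 0, k * z 1, k * z 2]
    (fun a => P a 0 * z 0 + P a 1 * z 1 + P a 2 * z 2)
    (fun a => Q a 0 * z 0 + Q a 1 * z 1 + Q a 2 * z 2)

/-- The last four coframe components. -/
def fib (z : Fin 7 → ℝ) : Fin 4 → ℝ := ![z 3, z 4, z 5, z 6]

/-- The right hand sides of the real structure equations. -/
def realRHS (k : ℝ) (P Q : Fin 3 → Fin 3 → ℝ) (Gv : Fin 3 → ℝ) (ρv : ℝ) (zv : Fin 7 → ℝ)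
    (Gw : Fin 3 → ℝ) (ρw : ℝ) (zw : Fin 7 → ℝ) : Fin 7 → ℝ :=
  let A := conn k P Q Gw ρw zw
  let B := conn k P Q Gv ρv zv
  ![(Gv 2 * zw 1 - Gw 2 * zv 1) - (Gv 1 * zw 2 - Gw 1 * zv 2),
    (Gv 0 * zw 2 - Gw 0 * zv 2) - (Gv 2 * zw 0 - Gw 2 * zv 0),
    (Gv 1 * zw 0 - Gw 1 * zv 0) - (Gv 0 * zw 1 - Gw 0 * zv 1),
    ∑ j, (A 0 j * fib zv j - B 0 j * fib zw j),
    ∑ j, (A 1 j * fib zv j - B 1 j * fib zw j),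
    ∑ j, (A 2 j * fib zv j - B 2 j * fib zw j),
    ∑ j, (A 3 j * fib zv j - B 3 j * fib zw j)]

/-- The skew-Hermitian matrix with coordinates `G`, `ρ`. -/
def kapC (G : Fin 3 → ℝ) (ρ : ℝ) : Matrix (Fin 2) (Fin 2) ℂ :=
  !![Complex.I * ((ρ - G 0) / 2 : ℝ), (-G 1 / 2 : ℝ) + Complex.I * (G 2 / 2 : ℝ);
     (G 1 / 2 : ℝ) + Complex.I * (G 2 / 2 : ℝ), Complex.I * ((ρ + G 0) / 2 : ℝ)]

/-- The complex symmetric trace-free matrix of a binary quartic with coefficients `s`. -/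
def quarticMat (s : ℕ → ℂ) : Fin 3 → Fin 3 → ℂ :=
  ![![-2 * Complex.I * s 2, -(s 1 + s 3), Complex.I * (s 3 - s 1)],
    ![-(s 1 + s 3), Complex.I / 2 * (s 0 + 2 * s 2 + s 4), (s 4 - s 0) / 2],
    ![Complex.I * (s 3 - s 1), (s 4 - s 0) / 2, -(Complex.I / 2) * (s 0 - 2 * s 2 + s 4)]]

variable {V : Type*}

/-- Separation into real and imaginary parts. A fully symmetric `S` depends only on the number of
its indices equal to 2, which is the argument of `s`; `quarticMat` realises Sym⁴ℂ² as symmetric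
trace-free 3 × 3 matrices, and their real and imaginary parts enter the real connection as P and Q.
The term in k gives the part of `gam` with coordinates k ω. -/
theorem eta_rhs_eq (k : ℝ) (s : ℕ → ℂ) (z : V → Fin 7 → ℝ) (G : V → Fin 3 → ℝ) (ρ : V → ℝ)
    (v w : V) (a : Fin 2) :
    -(∑ b, wedge11 (fun u => kapC (G u) (ρ u) a b) (fun u => etaC (z u) b) v w)
      + Complex.I * k * (∑ b, wedge11 (fun u => nuC (z u) a b) (fun u => etaC (z u) b) v w)
      - 2 * (∑ b : Fin 2, ∑ c : Fin 2, ∑ d : Fin 2, ∑ e : Fin 2,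
          eps b e * s ((a : ℕ) + b + c + d) *
          wedge11 (fun u => star (etaC (z u) d)) (fun u => nuC (z u) e c) v w) =
    etaC (realRHS k (fun a b => (quarticMat s a b).re) (fun a b => (quarticMat s a b).im)
      (G v) (ρ v) (z v) (G w) (ρ w) (z w)) a := by
  fin_cases a <;> apply Complex.ext <;>
  simp [wedge11, Fin.sum_univ_four, Fin.sum_univ_two, kapC, etaC, nuC, eps, realRHS, conn, gam,
      fib, quarticMat,
    Fin.isValue] <;> ring

/-- Without `A`, only the adjoint action of κ on `su(2) = so(3)` remains. The trace of κ acts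
trivially, so ρ does not occur in the first three real equations. -/
theorem nu_rhs_eq (k : ℝ) (s : ℕ → ℂ) (z : V → Fin 7 → ℝ) (G : V → Fin 3 → ℝ) (ρ : V → ℝ)
    (v w : V) (a b : Fin 2) :
    -(∑ c, wedge11 (fun u => kapC (G u) (ρ u) a c) (fun u => nuC (z u) c b) v w)
      + (∑ c, wedge11 (fun u => kapC (G u) (ρ u) c b) (fun u => nuC (z u) a c) v w) =
    nuC (realRHS k (fun a b => (quarticMat s a b).re) (fun a b => (quarticMat s a b).im)
      (G v) (ρ v) (z v) (G w) (ρ w) (z w)) a b := by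
  fin_cases a <;> fin_cases b <;> apply Complex.ext <;>
  simp [wedge11, Fin.sum_univ_two, kapC, nuC, realRHS] <;> ring

theorem eq_of_etaC_nuC {z z' : Fin 7 → ℝ} (h1 : ∀ a, etaC z a = etaC z' a)
    (h2 : ∀ a b, nuC z a b = nuC z' a b) : z = z' := by
  have a0 := h1 0
  have a1 := h1 1
  have b0 := h2 0 0
  have b1 := h2 0 1
  simp only [etaC, nuC, Complex.ext_iff] at a0 a1 b0 b1
  simp at a0 a1 b0 b1
  funext i
  fin_cases i
  exacts [b0, b1.1, b1.2, a0.1, a0.2, a1.1, a1.2]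

/-- The multi-index in increasing order with `m` entries `1`. -/
def quarticIdx (m : ℕ) : Fin 4 → Fin 2 :=
  ![![0, 0, 0, 0], ![0, 0, 0, 1], ![0, 0, 1, 1], ![0, 1, 1, 1], ![1, 1, 1, 1]] (Fin.ofNat 5 m)

/-- Adjacent transpositions sort the multi-index. -/
theorem quartic_eq_of_symmetric {T : (Fin 4 → Fin 2) → ℂ}
    (hT : ∀ (t : Fin 4 → Fin 2) (σ : Equiv.Perm (Fin 4)), T (t ∘ σ) = T t) (a b c d : Fin 2) :
    T ![a, b, c, d] = T (quarticIdx ((a : ℕ) + b + c + d)) := by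
  have h01 : ∀ a b c d : Fin 2, T ![b, a, c, d] = T ![a, b, c, d] := fun a b c d => by
    rw [← hT ![a, b, c, d] (Equiv.swap 0 1)]
    congr 1
    funext i
    fin_cases i <;> rfl
  have h12 : ∀ a b c d : Fin 2, T ![a, c, b, d] = T ![a, b, c, d] := fun a b c d => by
    rw [← hT ![a, b, c, d] (Equiv.swap 1 2)]
    congr 1
    funext i
    fin_cases i <;> rfl
  have h23 : ∀ a b c d : Fin 2, T ![a, b, d, c] = T ![a, b, c, d] := fun a b c d => by
    rw [← hT ![a, b, c, d] (Equiv.swap 2 3)]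
    congr 1
    funext i
    fin_cases i <;> rfl
  have e1 := h01 0 1
  have e2 := fun a => h12 a 0 1
  have e3 := fun a b => h23 a b 0 1
  fin_cases a <;> fin_cases b <;> fin_cases c <;> fin_cases d <;>
    simp [e1, e2, e3, Fin.ofNat, quarticIdx]

end

end G2ERP

namespace G2ERP

noncomputable section

/-! ### The curvature of the `sl(4, ℝ)`-connection -/

/-- `gam` in terms of the list of its thirteen coordinates. -/
def gamL (b : Fin 13 → ℝ) : Matrix (Fin 4) (Fin 4) ℝ :=
  gam ![b 0, b 1, b 2] (b 3) ![b 4, b 5, b 6] ![b 7, b 8, b 9] ![b 10, b 11, b 12]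

/-- The generator of `sl(4, ℝ)` that belongs to the `m`-th coordinate of `gamL`. -/
def gen (m : Fin 13) : Matrix (Fin 4) (Fin 4) ℝ := gamL (fun j => if m = j then 1 else 0)

theorem gamL_eq_sum (b : Fin 13 → ℝ) (i j : Fin 4) : gamL b i j = ∑ m, gen m i j * b m := by
  have hadd : ∀ b c : Fin 13 → ℝ, gamL (b + c) i j = gamL b i j + gamL c i j := by
    intro b c
    fin_cases i <;> fin_cases j <;> simp [gamL, gam] <;> ring
  have hsmul : ∀ (c : ℝ) (b : Fin 13 → ℝ), gamL (c • b) i j = c * gamL b i j := by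
    intro c b
    fin_cases i <;> fin_cases j <;> simp [gamL, gam] <;> ring
  let L : (Fin 13 → ℝ) →ₗ[ℝ] ℝ := ⟨⟨fun b => gamL b i j, hadd⟩, hsmul⟩
  calc gamL b i j = L b := rfl
    _ = ∑ m, b m • L (fun j => if m = j then 1 else 0) := LinearMap.pi_apply_eq_sum_univ L b
    _ = _ := Finset.sum_congr rfl fun m _ => by
      change b m * gen m i j = _
      rw [mul_comm]

variable {E : Type*} [NormedAddCommGroup E] [NormedSpace ℝ E]

/-- The index in the coframe of the `j`-th fibre form. -/
def fibIdx : Fin 4 → Fin 7 := ![3, 4, 5, 6]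

/-- The `1`-forms `∑ P_{ab} ω_b`. -/
def chi (P : Fin 3 → Fin 3 → E → ℝ) (om : Fin 7 → E → E →L[ℝ] ℝ) (a : Fin 3) (y : E) : E →L[ℝ] ℝ :=
  P a 0 y • om 0 y + P a 1 y • om 1 y + P a 2 y • om 2 y

/-- The thirteen coordinate `1`-forms of the connection. -/
def cbase (k : ℝ) (om : Fin 7 → E → E →L[ℝ] ℝ) (G : Fin 3 → E → E →L[ℝ] ℝ) (rho : E → E →L[ℝ] ℝ)
    (P Q : Fin 3 → Fin 3 → E → ℝ) : Fin 13 → E → E →L[ℝ] ℝ :=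
  ![G 0, G 1, G 2, rho, fun y => k • om 0 y, fun y => k • om 1 y, fun y => k • om 2 y,
    chi P om 0, chi P om 1, chi P om 2, chi Q om 0, chi Q om 1, chi Q om 2]

/-- Entries of the connection matrix, as `1`-forms. -/
def conF (k : ℝ) (om : Fin 7 → E → E →L[ℝ] ℝ) (G : Fin 3 → E → E →L[ℝ] ℝ) (rho : E → E →L[ℝ] ℝ)
    (P Q : Fin 3 → Fin 3 → E → ℝ) (i j : Fin 4) (y : E) : E →L[ℝ] ℝ :=
  ∑ m, gen m i j • cbase k om G rho P Q m y

/-- The data of a coframe that satisfies the real structure equations on an open set. -/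
structure RealFrame (k : ℝ) (s : Set E) (om : Fin 7 → E → E →L[ℝ] ℝ)
    (G : Fin 3 → E → E →L[ℝ] ℝ) (rho : E → E →L[ℝ] ℝ) (P Q : Fin 3 → Fin 3 → E → ℝ) : Prop where
  isOpen : IsOpen s
  om_smooth : ∀ i, ContDiffOn ℝ ∞ (om i) s
  G_smooth : ∀ i, ContDiffOn ℝ ∞ (G i) s
  rho_smooth : ContDiffOn ℝ ∞ rho s
  P_smooth : ∀ i j, ContDiffOn ℝ ∞ (P i j) s
  Q_smooth : ∀ i j, ContDiffOn ℝ ∞ (Q i j) s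
  P_symm : ∀ i j y, P i j y = P j i y
  Q_symm : ∀ i j y, Q i j y = Q j i y
  P_trace : ∀ y, P 0 0 y + P 1 1 y + P 2 2 y = 0
  Q_trace : ∀ y, Q 0 0 y + Q 1 1 y + Q 2 2 y = 0
  frame : ∀ y ∈ s, ∃ e : E ≃L[ℝ] (Fin 7 → ℝ), ∀ v i, e v i = om i y v
  eqs : ∀ y ∈ s, ∀ v w i, dOne (om i) y v w =
    realRHS k (fun a b => P a b y) (fun a b => Q a b y) (fun a => G a y v) (rho y v)
      (fun i => om i y v) (fun a => G a y w) (rho y w) (fun i => om i y w) i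

variable {k : ℝ} {s : Set E} {om : Fin 7 → E → E →L[ℝ] ℝ} {G : Fin 3 → E → E →L[ℝ] ℝ}
  {rho : E → E →L[ℝ] ℝ} {P Q : Fin 3 → Fin 3 → E → ℝ}

theorem conF_apply (y v : E) (i j : Fin 4) :
    conF k om G rho P Q i j y v = conn k (fun a b => P a b y) (fun a b => Q a b y)
      (fun a => G a y v) (rho y v) (fun i => om i y v) i j := by
  have : conn k (fun a b => P a b y) (fun a b => Q a b y)
      (fun a => G a y v) (rho y v) (fun i => om i y v) =
      gamL (fun m => cbase k om G rho P Q m y v) := by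
    simp only [conn, gamL, cbase]
    congr 1
    · funext a; fin_cases a <;> rfl
    · funext a; fin_cases a <;> rfl
    · funext a; fin_cases a <;> rfl
  rw [this, gamL_eq_sum]
  simp [conF]

namespace RealFrame

theorem cda {X : Type*} [NormedAddCommGroup X] [NormedSpace ℝ X] {f : E → X}
    (hs : IsOpen s) (h : ContDiffOn ℝ ∞ f s) {y : E} (hy : y ∈ s) : ContDiffAt ℝ ∞ f y :=
  h.contDiffAt (hs.mem_nhds hy)

theorem chi_smooth {R : Fin 3 → Fin 3 → E → ℝ}
    (hR : ∀ i j, ContDiffOn ℝ ∞ (R i j) s) (hom : ∀ i, ContDiffOn ℝ ∞ (om i) s) (a : Fin 3) :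
    ContDiffOn ℝ ∞ (chi R om a) s :=
  (((hR a 0).smul (hom 0)).add ((hR a 1).smul (hom 1))).add ((hR a 2).smul (hom 2))

theorem cbase_smooth (h : RealFrame k s om G rho P Q) (m : Fin 13) :
    ContDiffOn ℝ ∞ (cbase k om G rho P Q m) s := by
  fin_cases m
  exacts [h.G_smooth 0, h.G_smooth 1, h.G_smooth 2, h.rho_smooth, (h.om_smooth 0).const_smul k,
    (h.om_smooth 1).const_smul k, (h.om_smooth 2).const_smul k,
    chi_smooth h.P_smooth h.om_smooth 0, chi_smooth h.P_smooth h.om_smooth 1,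
    chi_smooth h.P_smooth h.om_smooth 2, chi_smooth h.Q_smooth h.om_smooth 0,
    chi_smooth h.Q_smooth h.om_smooth 1, chi_smooth h.Q_smooth h.om_smooth 2]

theorem conF_smooth (h : RealFrame k s om G rho P Q) (i j : Fin 4) :
    ContDiffOn ℝ ∞ (conF k om G rho P Q i j) s :=
  ContDiffOn.sum fun m _ => (h.cbase_smooth m).const_smul _

theorem diffAt {X : Type*} [NormedAddCommGroup X] [NormedSpace ℝ X] {f : E → X}
    (hs : IsOpen s) (h : ContDiffOn ℝ ∞ f s) {y : E} (hy : y ∈ s) : DifferentiableAt ℝ f y :=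
  (cda hs h hy).differentiableAt (by simp)

theorem dOne_chi (hs : IsOpen s) {R : Fin 3 → Fin 3 → E → ℝ}
    (hR : ∀ i j, ContDiffOn ℝ ∞ (R i j) s) (hom : ∀ i, ContDiffOn ℝ ∞ (om i) s)
    {y : E} (hy : y ∈ s) (a : Fin 3) (v w : E) :
    dOne (chi R om a) y v w =
      (R a 0 y * dOne (om 0) y v w
        + (fderiv ℝ (R a 0) y v * om 0 y w - fderiv ℝ (R a 0) y w * om 0 y v))
      + (R a 1 y * dOne (om 1) y v w
        + (fderiv ℝ (R a 1) y v * om 1 y w - fderiv ℝ (R a 1) y w * om 1 y v))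
      + (R a 2 y * dOne (om 2) y v w
        + (fderiv ℝ (R a 2) y v * om 2 y w - fderiv ℝ (R a 2) y w * om 2 y v)) := by
  have d : ∀ i j, DifferentiableAt ℝ (R i j) y := fun i j => diffAt hs (hR i j) hy
  have e : ∀ i, DifferentiableAt ℝ (om i) y := fun i => diffAt hs (hom i) hy
  rw [show chi R om a = fun y => (R a 0 y • om 0 y + R a 1 y • om 1 y) + R a 2 y • om 2 y from rfl,
    dOne_add (((d a 0).fun_smul (e 0)).fun_add ((d a 1).fun_smul (e 1))) ((d a 2).fun_smul (e 2)),
    dOne_add ((d a 0).fun_smul (e 0)) ((d a 1).fun_smul (e 1)),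
    dOne_smul (d a 0) (e 0), dOne_smul (d a 1) (e 1), dOne_smul (d a 2) (e 2)]
  simp only [smul_eq_mul]

/-- Entries of the curvature matrix. -/
def _root_.G2ERP.curv (k : ℝ) (om : Fin 7 → E → E →L[ℝ] ℝ) (G : Fin 3 → E → E →L[ℝ] ℝ)
    (rho : E → E →L[ℝ] ℝ) (P Q : Fin 3 → Fin 3 → E → ℝ) (i j : Fin 4) (y u v : E) : ℝ :=
  dOne (conF k om G rho P Q i j) y u v +
    ∑ l, (conF k om G rho P Q i l y u * conF k om G rho P Q l j y v
      - conF k om G rho P Q i l y v * conF k om G rho P Q l j y u)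

theorem dOne_fib (h : RealFrame k s om G rho P Q) {y : E} (hy : y ∈ s) (i : Fin 4) (v w : E) :
    dOne (om (fibIdx i)) y v w = ∑ j, (-conF k om G rho P Q i j y v * om (fibIdx j) y w
      - -conF k om G rho P Q i j y w * om (fibIdx j) y v) := by
  rw [h.eqs y hy]
  simp only [conF_apply]
  fin_cases i <;> simp [realRHS, Fin.sum_univ_four, fib, fibIdx] <;> ring

/-- The exterior derivative of dω = -Γ ∧ ω, with dω replaced once more by -Γ ∧ ω, is R ∧ ω = 0. -/
theorem bianchi (h : RealFrame k s om G rho P Q) {x : E} (hx : x ∈ s) (i : Fin 4) (u v w : E) :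
    ∑ j, (curv k om G rho P Q i j x u v * om (fibIdx j) x w
      + curv k om G rho P Q i j x v w * om (fibIdx j) x u
      + curv k om G rho P Q i j x w u * om (fibIdx j) x v) = 0 := by
  have h1 := cyclic_sum_of_dOne_eq (α := om (fibIdx i))
    (β := fun j y => -conF k om G rho P Q i j y) (γ := fun j => om (fibIdx j))
    (cda h.isOpen (h.om_smooth _) hx)
    (fun j => (diffAt h.isOpen (h.conF_smooth i j) hx).neg)
    (fun j => diffAt h.isOpen (h.om_smooth _) hx)
    (Filter.eventually_of_mem (h.isOpen.mem_nhds hx) fun y hy v w => h.dOne_fib hy i v w) u v w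
  have hneg : ∀ j a b, dOne (fun y => -conF k om G rho P Q i j y) x a b =
      -dOne (conF k om G rho P Q i j) x a b := by
    intro j a b
    have := dOne_const_smul (-1) (diffAt h.isOpen (h.conF_smooth i j) hx) a b
    simpa using this
  simp only [hneg, h.dOne_fib hx, Fin.sum_univ_four, neg_apply] at h1
  simp only [curv, Fin.sum_univ_four]
  linear_combination -h1

/-- The curvature of the `so(3)` part of the connection. -/
def _root_.G2ERP.Om (G : Fin 3 → E → E →L[ℝ] ℝ) (a : Fin 3) (y u v : E) : ℝ :=
  dOne (G a) y u v + (G (a + 1) y u * G (a + 2) y v - G (a + 1) y v * G (a + 2) y u)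

theorem dOne_base (h : RealFrame k s om G rho P Q) {y : E} (hy : y ∈ s) (v w : E) :
    dOne (om 0) y v w = (G 2 y v * om 1 y w - G 2 y w * om 1 y v)
        - (G 1 y v * om 2 y w - G 1 y w * om 2 y v) ∧
    dOne (om 1) y v w = (G 0 y v * om 2 y w - G 0 y w * om 2 y v)
        - (G 2 y v * om 0 y w - G 2 y w * om 0 y v) ∧
    dOne (om 2) y v w = (G 1 y v * om 0 y w - G 1 y w * om 0 y v)
        - (G 0 y v * om 1 y w - G 0 y w * om 1 y v) := by
  refine ⟨?_, ?_, ?_⟩ <;> rw [h.eqs y hy] <;> rfl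

/-- The base forms obey the torsion-free equations of the `so(3)`-connection `G`, although `G` may
have fibre components. Differentiation gives the first Bianchi identity for its curvature `Om`. -/
theorem base_bianchi (h : RealFrame k s om G rho P Q) {x : E} (hx : x ∈ s) (u v w : E) :
    (Om G 2 x u v * om 1 x w + Om G 2 x v w * om 1 x u + Om G 2 x w u * om 1 x v)
      - (Om G 1 x u v * om 2 x w + Om G 1 x v w * om 2 x u + Om G 1 x w u * om 2 x v) = 0 ∧
    (Om G 0 x u v * om 2 x w + Om G 0 x v w * om 2 x u + Om G 0 x w u * om 2 x v)
      - (Om G 2 x u v * om 0 x w + Om G 2 x v w * om 0 x u + Om G 2 x w u * om 0 x v) = 0 ∧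
    (Om G 1 x u v * om 0 x w + Om G 1 x v w * om 0 x u + Om G 1 x w u * om 0 x v)
      - (Om G 0 x u v * om 1 x w + Om G 0 x v w * om 1 x u + Om G 0 x w u * om 1 x v) = 0 := by
  have hg : ∀ a, DifferentiableAt ℝ (G a) x := fun a => diffAt h.isOpen (h.G_smooth a) hx
  have ho : ∀ a, DifferentiableAt ℝ (om a) x := fun a => diffAt h.isOpen (h.om_smooth a) hx
  have hneg : ∀ a u v, dOne (fun y => -G a y) x u v = -dOne (G a) x u v := by
    intro a u v
    have := dOne_const_smul (-1) (hg a) u v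
    simpa using this
  have key : ∀ (a : Fin 7) (b c : Fin 3) (b' c' : Fin 7),
      (∀ y ∈ s, ∀ v w, dOne (om a) y v w = (G b y v * om b' y w - G b y w * om b' y v)
        - (G c y v * om c' y w - G c y w * om c' y v)) →
      (dOne (G b) x u v * om b' x w + dOne (G b) x v w * om b' x u + dOne (G b) x w u * om b' x v
        - G b x u * dOne (om b') x v w - G b x v * dOne (om b') x w u
        - G b x w * dOne (om b') x u v)
      - (dOne (G c) x u v * om c' x w + dOne (G c) x v w * om c' x u + dOne (G c) x w u * om c' x v
        - G c x u * dOne (om c') x v w - G c x v * dOne (om c') x w u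
        - G c x w * dOne (om c') x u v) = 0 := by
    intro a b c b' c' hh
    have h1 := cyclic_sum_of_dOne_eq (α := om a) (ι := Fin 2)
      (β := ![G b, fun y => -G c y]) (γ := ![om b', om c'])
      (cda h.isOpen (h.om_smooth _) hx)
      (fun j => by fin_cases j; exacts [hg b, (hg c).neg])
      (fun j => by fin_cases j; exacts [ho b', ho c'])
      (Filter.eventually_of_mem (h.isOpen.mem_nhds hx) fun y hy v w => by
        rw [hh y hy, Fin.sum_univ_two]
        simp
        ring) u v w
    simp only [Fin.sum_univ_two, Matrix.cons_val_zero, Matrix.cons_val_one, hneg, neg_apply] at h1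
    linear_combination h1
  have hb := fun a b => h.dOne_base hx a b
  have k0 := key 0 2 1 1 2 fun y hy v w => (h.dOne_base hy v w).1
  have k1 := key 1 0 2 2 0 fun y hy v w => (h.dOne_base hy v w).2.1
  have k2 := key 2 1 0 0 1 fun y hy v w => (h.dOne_base hy v w).2.2
  simp only [(hb _ _).1, (hb _ _).2.1, (hb _ _).2.2] at k0 k1 k2
  have e0 : (0 : Fin 3) + 1 = 1 := rfl
  have e1 : (0 : Fin 3) + 2 = 2 := rfl
  have e2 : (1 : Fin 3) + 1 = 2 := rfl
  have e3 : (1 : Fin 3) + 2 = 0 := rfl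
  have e4 : (2 : Fin 3) + 1 = 0 := rfl
  have e5 : (2 : Fin 3) + 2 = 1 := rfl
  simp only [Om, e0, e1, e2, e3, e4, e5]
  exact ⟨by linear_combination k0, by linear_combination k1, by linear_combination k2⟩

end RealFrame

end

end G2ERP

/-! ### Algebra of the curvature in mixed directions. -/

namespace G2ERP

noncomputable section

/-- The curvature of `gam` for a pair of vectors the second of which is vertical. -/
theorem gam_curv_vertical (dG dw dp dq Gv Gw wv pv qv : Fin 3 → ℝ) (dρ ρv ρw : ℝ) (i j : Fin 4) :
    gam dG dρ dw dp dq i j + ∑ l, (gam Gv ρv wv pv qv i l * gam Gw ρw 0 0 0 l j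
      - gam Gw ρw 0 0 0 i l * gam Gv ρv wv pv qv l j) =
    gam (fun a => dG a + (Gv (a + 1) * Gw (a + 2) - Gw (a + 1) * Gv (a + 2))) dρ
      (fun a => dw a - Gw (a + 1) * wv (a + 2) + Gw (a + 2) * wv (a + 1))
      (fun a => dp a - Gw (a + 1) * pv (a + 2) + Gw (a + 2) * pv (a + 1) + ρw * qv a)
      (fun a => dq a - Gw (a + 1) * qv (a + 2) + Gw (a + 2) * qv (a + 1) - ρw * pv a) i j := by
  have e0 : (0 : Fin 3) + 1 = 1 := rfl
  have e1 : (0 : Fin 3) + 2 = 2 := rfl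
  have e2 : (1 : Fin 3) + 1 = 2 := rfl
  have e3 : (1 : Fin 3) + 2 = 0 := rfl
  have e4 : (2 : Fin 3) + 1 = 0 := rfl
  have e5 : (2 : Fin 3) + 2 = 1 := rfl
  fin_cases i <;> fin_cases j <;>
    simp [gam, Fin.sum_univ_four, e0, e1, e2, e3, e4, e5] <;> ring

/-- The `so(3)` part of the curvature of `gam`. -/
theorem gam_curv_so3 (dG dw dp dq Gv Gw wv ww pv pw qv qw : Fin 3 → ℝ) (dρ ρv ρw : ℝ)
    (R : Fin 4 → Fin 4 → ℝ)
    (hR : ∀ i j, R i j = gam dG dρ dw dp dq i j + ∑ l, (gam Gv ρv wv pv qv i l * gam Gw ρw ww pw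
        qw l j
      - gam Gw ρw ww pw qw i l * gam Gv ρv wv pv qv l j)) :
    (R 2 3 - R 3 2 - R 1 0 + R 0 1) / 2 = dG 0 + (Gv 1 * Gw 2 - Gw 1 * Gv 2)
      - 4 * ((wv 1 * ww 2 - ww 1 * wv 2) + (pv 1 * pw 2 - pw 1 * pv 2)
        + (qv 1 * qw 2 - qw 1 * qv 2)) ∧
    (R 0 2 - R 1 3 - R 2 0 + R 3 1) / 2 = dG 1 + (Gv 2 * Gw 0 - Gw 2 * Gv 0)
      - 4 * ((wv 2 * ww 0 - ww 2 * wv 0) + (pv 2 * pw 0 - pw 2 * pv 0)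
        + (qv 2 * qw 0 - qw 2 * qv 0)) ∧
    (-R 0 3 - R 1 2 + R 2 1 + R 3 0) / 2 = dG 2 + (Gv 0 * Gw 1 - Gw 0 * Gv 1)
      - 4 * ((wv 0 * ww 1 - ww 0 * wv 1) + (pv 0 * pw 1 - pw 0 * pv 1)
        + (qv 0 * qw 1 - qw 0 * qv 1)) := by
  simp only [hR]
  refine ⟨?_, ?_, ?_⟩ <;> simp [gam, Fin.sum_univ_four] <;> ring

/-- The algebraic consequence of the first Bianchi identity in mixed directions. -/
theorem gam_mixed_bianchi (r : Fin 4 → ℝ) (p q : Fin 4 → Fin 3 → ℝ)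
    (h : ∀ l m i, gam 0 (r l) 0 (p l) (q l) i m = gam 0 (r m) 0 (p m) (q m) i l) :
    (∀ l, r l = 0) ∧ (∀ a, p 1 a = q 0 a) ∧ (∀ a, q 1 a = -p 0 a) ∧ (∀ a, p 3 a = -q 2 a) ∧
      (∀ a, q 3 a = p 2 a) := by
  have h1 := fun i => h 0 1 i
  have h2 := fun i => h 0 2 i
  have h3 := fun i => h 0 3 i
  have h4 := fun i => h 1 2 i
  have h5 := fun i => h 1 3 i
  have h6 := fun i => h 2 3 i
  simp only [Fin.forall_fin_succ, Fin.forall_fin_zero] at h1 h2 h3 h4 h5 h6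
  simp [gam] at h1 h2 h3 h4 h5 h6
  obtain ⟨a1, a2, a3, a4⟩ := h1
  obtain ⟨b1, b2, b3, b4⟩ := h2
  obtain ⟨c1, c2, c3, c4⟩ := h3
  obtain ⟨d1, d2, d3, d4⟩ := h4
  obtain ⟨f1, f2, f3, f4⟩ := h5
  obtain ⟨g1, g2, g3, g4⟩ := h6
  refine ⟨fun l => ?_, fun a => ?_, fun a => ?_, fun a => ?_, fun a => ?_⟩
  · fin_cases l <;> simp <;> linarith
  · fin_cases a <;> simp <;> linarith
  · fin_cases a <;> simp <;> linarith
  · fin_cases a <;> simp <;> linarith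
  · fin_cases a <;> simp <;> linarith

variable {E : Type*} [NormedAddCommGroup E] [NormedSpace ℝ E]

/-- The covariant derivative of a symmetric `so(3)`-tensor `R` that is rotated into `T` by the
`u(1)`-part of the connection. -/
def covD (G : Fin 3 → E → E →L[ℝ] ℝ) (rho : E → E →L[ℝ] ℝ) (R T : Fin 3 → Fin 3 → E → ℝ)
    (a b : Fin 3) (y : E) : E →L[ℝ] ℝ :=
  fderiv ℝ (R a b) y + T a b y • rho y
    + (R (a + 2) b y • G (a + 1) y - R (a + 1) b y • G (a + 2) y)
    + (R a (b + 2) y • G (b + 1) y - R a (b + 1) y • G (b + 2) y)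

variable {k : ℝ} {s : Set E} {om : Fin 7 → E → E →L[ℝ] ℝ} {G : Fin 3 → E → E →L[ℝ] ℝ}
  {rho : E → E →L[ℝ] ℝ} {P Q : Fin 3 → Fin 3 → E → ℝ}

namespace RealFrame

theorem dOne_conF (h : RealFrame k s om G rho P Q) {x : E} (hx : x ∈ s) (i j : Fin 4) (u v : E) :
    dOne (conF k om G rho P Q i j) x u v =
      gam (fun a => dOne (G a) x u v) (dOne rho x u v)
        ![k * dOne (om 0) x u v, k * dOne (om 1) x u v, k * dOne (om 2) x u v]
        (fun a => dOne (chi P om a) x u v) (fun a => dOne (chi Q om a) x u v) i j := by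
  have e : gam (fun a => dOne (G a) x u v) (dOne rho x u v)
        ![k * dOne (om 0) x u v, k * dOne (om 1) x u v, k * dOne (om 2) x u v]
        (fun a => dOne (chi P om a) x u v) (fun a => dOne (chi Q om a) x u v) =
      gamL (fun m => dOne (cbase k om G rho P Q m) x u v) := by
    have hk : ∀ i, dOne (fun y => k • om i y) x u v = k * dOne (om i) x u v := fun i =>
      dOne_const_smul k (diffAt h.isOpen (h.om_smooth i) hx) u v
    simp only [gamL]
    congr 1
    · funext a; fin_cases a <;> rfl
    · funext a; fin_cases a
      exacts [(hk 0).symm, (hk 1).symm, (hk 2).symm]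
    · funext a; fin_cases a <;> rfl
    · funext a; fin_cases a <;> rfl
  rw [e, gamL_eq_sum]
  have hd := fun m => diffAt h.isOpen (h.cbase_smooth m) hx
  change dOne (fun y => ∑ m, gen m i j • cbase k om G rho P Q m y) x u v = _
  rw [dOne_sum _ (fun m _ => (hd m).fun_const_smul _)]
  exact Finset.sum_congr rfl fun m _ => dOne_const_smul _ (hd m) u v

/-- On a vector w that the base forms annihilate, Γ reduces to its `u(2)`-part, so the quadratic
term of the curvature merely rotates the other coordinates. Together with the derivatives of P and Q
along w these rotations form covariant derivatives; the coordinates k ω contribute nothing because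
the base equations are torsion-free. -/
theorem curv_vertical (h : RealFrame k s om G rho P Q) {x : E} (hx : x ∈ s) (i j : Fin 4)
    (v w : E) (w0 : om 0 x w = 0) (w1 : om 1 x w = 0) (w2 : om 2 x w = 0) :
    curv k om G rho P Q i j x v w =
      gam (fun a => Om G a x v w) (dOne rho x v w) 0
        (fun a => -(covD G rho P (fun a b y => -Q a b y) a 0 x w * om 0 x v
          + covD G rho P (fun a b y => -Q a b y) a 1 x w * om 1 x v
          + covD G rho P (fun a b y => -Q a b y) a 2 x w * om 2 x v))
        (fun a => -(covD G rho Q P a 0 x w * om 0 x v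
          + covD G rho Q P a 1 x w * om 1 x v
          + covD G rho Q P a 2 x w * om 2 x v)) i j := by
  obtain ⟨b0, b1, b2⟩ := h.dOne_base hx v w
  have hw : ∀ i j, conF k om G rho P Q i j x w =
      gam (fun a => G a x w) (rho x w) 0 0 0 i j := by
    intro i j
    rw [conF_apply, conn]
    simp only [w0, w1, w2, mul_zero, add_zero]
    congr 1
    funext a; fin_cases a <;> rfl
  have e0 : (0 : Fin 3) + 1 = 1 := rfl
  have e1 : (0 : Fin 3) + 2 = 2 := rfl
  have e2 : (1 : Fin 3) + 1 = 2 := rfl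
  have e3 : (1 : Fin 3) + 2 = 0 := rfl
  have e4 : (2 : Fin 3) + 1 = 0 := rfl
  have e5 : (2 : Fin 3) + 2 = 1 := rfl
  simp only [curv]
  simp only [hw]
  simp only [conF_apply, conn]
  rw [h.dOne_conF hx, gam_curv_vertical]
  simp only [w0, w1, w2, mul_zero] at b0 b1 b2
  congr 1
  · funext a
    fin_cases a <;> simp only [b0, b1, b2] <;> simp [e0, e1, e2, e3, e4, e5] <;> ring
  · funext a
    rw [dOne_chi h.isOpen h.P_smooth h.om_smooth hx, b0, b1, b2, w0, w1, w2]
    simp only [covD, add_apply, sub_apply, smul_apply, smul_eq_mul]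
    fin_cases a <;> simp [e0, e1, e2, e3, e4, e5] <;> ring
  · funext a
    rw [dOne_chi h.isOpen h.Q_smooth h.om_smooth hx, b0, b1, b2, w0, w1, w2]
    simp only [covD, add_apply, sub_apply, smul_apply, smul_eq_mul]
    fin_cases a <;> simp [e0, e1, e2, e3, e4, e5] <;> ring

end RealFrame

end

end G2ERP

/-! ### First Bianchi identities: consequences along the fibres. -/

namespace G2ERP

noncomputable section

variable {E : Type*} [NormedAddCommGroup E] [NormedSpace ℝ E]
variable {k : ℝ} {s : Set E} {om : Fin 7 → E → E →L[ℝ] ℝ} {G : Fin 3 → E → E →L[ℝ] ℝ}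
  {rho : E → E →L[ℝ] ℝ} {P Q : Fin 3 → Fin 3 → E → ℝ}

namespace RealFrame

theorem exists_dual (h : RealFrame k s om G rho P Q) {x : E} (hx : x ∈ s) :
    ∃ X : Fin 7 → E, (∀ i j, om i x (X j) = if i = j then 1 else 0) ∧
      ∀ v, v = ∑ i, om i x v • X i := by
  obtain ⟨e, he⟩ := h.frame x hx
  refine ⟨fun j => e.symm (Pi.single j 1), fun i j => ?_, fun v => ?_⟩
  · rw [← he, e.apply_symm_apply, Pi.single_apply]
  · apply e.injective
    rw [map_sum]
    simp only [map_smul, e.apply_symm_apply]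
    funext i
    rw [he]
    simp [Finset.sum_apply, Pi.single_apply]

theorem Om_swap (a : Fin 3) (x u v : E) : Om G a x v u = -Om G a x u v := by
  rw [Om, Om, dOne_swap]
  ring

/-- The components of `Om` in (v, w), with v a base vector, form an array that is skew in its two
matrix indices and, by the Bianchi identity, symmetric in the last matrix index and the index of v.
Such an array vanishes, as in the uniqueness of the Levi-Civita connection. A general v follows from
one more evaluation. -/
theorem Om_vertical (h : RealFrame k s om G rho P Q) {x : E} (hx : x ∈ s) {w : E}
    (w0 : om 0 x w = 0) (w1 : om 1 x w = 0) (w2 : om 2 x w = 0) (a : Fin 3) (v : E) :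
    Om G a x v w = 0 := by
  obtain ⟨X, hX, -⟩ := h.exists_dual hx
  have key := fun u v => h.base_bianchi hx u v w
  simp only [w0, w1, w2, mul_zero, zero_add, fun a u => Om_swap (G := G) a x u w] at key
  have k01 := key (X 0) (X 1)
  have k02 := key (X 0) (X 2)
  have k12 := key (X 1) (X 2)
  have kv0 := key (X 0) v
  have kv1 := key (X 1) v
  have kv2 := key (X 2) v
  simp [hX] at k01 k02 k12 kv0 kv1 kv2
  obtain ⟨a1, a2, a3⟩ := k01
  obtain ⟨b1, b2, b3⟩ := k02
  obtain ⟨c1, c2, c3⟩ := k12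
  have z00 : Om G 0 x (X 0) w = 0 := by linarith
  have z11 : Om G 1 x (X 1) w = 0 := by linarith
  have z22 : Om G 2 x (X 2) w = 0 := by linarith
  have z01 : Om G 0 x (X 1) w = 0 := by linarith
  have z02 : Om G 0 x (X 2) w = 0 := by linarith
  have z10 : Om G 1 x (X 0) w = 0 := by linarith
  have z12 : Om G 1 x (X 2) w = 0 := by linarith
  have z20 : Om G 2 x (X 0) w = 0 := by linarith
  have z21 : Om G 2 x (X 1) w = 0 := by linarith
  simp only [z00, z11, z22, z01, z02, z10, z12, z20, z21, zero_mul, neg_zero, add_zero]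
    at kv0 kv1 kv2
  fin_cases a
  exacts [kv2.2.1, kv0.2.2, kv1.1]

theorem curv_swap (i j : Fin 4) (x u v : E) :
    curv k om G rho P Q i j x v u = -curv k om G rho P Q i j x u v := by
  rw [curv, curv, dOne_swap, neg_add, ← Finset.sum_neg_distrib]
  congr 1
  refine Finset.sum_congr rfl fun l _ => ?_
  ring

/-- In R ∧ ω = 0, two vectors without fibre components and the dual vector of one fibre form leave a
single term. -/
theorem curv_horizontal (h : RealFrame k s om G rho P Q) {x : E} (hx : x ∈ s) {u v : E}
    (hu : ∀ j, om (fibIdx j) x u = 0) (hv : ∀ j, om (fibIdx j) x v = 0) (i j : Fin 4) :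
    curv k om G rho P Q i j x u v = 0 := by
  obtain ⟨X, hX, -⟩ := h.exists_dual hx
  have hinj : ∀ j j', (fibIdx j' = fibIdx j) ↔ j' = j := by decide
  have := h.bianchi hx i u v (X (fibIdx j))
  simp only [hu, hv, mul_zero, add_zero, hX] at this
  simpa [hinj] using this

/-- The mixed components of the curvature and the first derivatives of the second fundamental
form in vertical directions. -/
theorem vertical_relations (h : RealFrame k s om G rho P Q) {x : E} (hx : x ∈ s) {X : Fin 7 → E}
    (hX : ∀ i j, om i x (X j) = if i = j then 1 else 0) (c : Fin 3) :
    (∀ l, dOne rho x (X (Fin.castLE (by norm_num) c)) (X (fibIdx l)) = 0) ∧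
    ∀ a, covD G rho P (fun a b y => -Q a b y) a c x (X 4) = covD G rho Q P a c x (X 3) ∧
      covD G rho Q P a c x (X 4) = -covD G rho P (fun a b y => -Q a b y) a c x (X 3) ∧
      covD G rho P (fun a b y => -Q a b y) a c x (X 6) = -covD G rho Q P a c x (X 5) ∧
      covD G rho Q P a c x (X 6) = covD G rho P (fun a b y => -Q a b y) a c x (X 5) := by
  set Xc := X (Fin.castLE (by norm_num) c) with hXc
  have hfib : ∀ l, om 0 x (X (fibIdx l)) = 0 ∧ om 1 x (X (fibIdx l)) = 0 ∧
      om 2 x (X (fibIdx l)) = 0 := by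
    intro l
    fin_cases l <;> simp [hX, fibIdx]
  have hbase : ∀ l, om (fibIdx l) x Xc = 0 := by
    intro l
    fin_cases l <;> fin_cases c <;> simp [hXc, hX, fibIdx]
  have hff : ∀ l m, om (fibIdx l) x (X (fibIdx m)) = if l = m then 1 else 0 := by
    intro l m
    fin_cases l <;> fin_cases m <;> simp [hX, fibIdx]
  have hcv : ∀ i j l, curv k om G rho P Q i j x Xc (X (fibIdx l)) =
      gam 0 (dOne rho x Xc (X (fibIdx l))) 0
        (fun a => -covD G rho P (fun a b y => -Q a b y) a c x (X (fibIdx l)))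
        (fun a => -covD G rho Q P a c x (X (fibIdx l))) i j := by
    intro i j l
    obtain ⟨f0, f1, f2⟩ := hfib l
    rw [h.curv_vertical hx i j Xc _ f0 f1 f2]
    congr 1
    · funext a; exact h.Om_vertical hx f0 f1 f2 a _
    · funext a; fin_cases c <;> simp [hXc, hX]
    · funext a; fin_cases c <;> simp [hXc, hX]
  -- The Bianchi identity on one base and two fibre vectors: mixed curvature is symmetric in its
  -- lower matrix index and its fibre direction. Since the matrices are of the form `gam 0 r 0 p q`,
  -- this forces the Cauchy-Riemann relations.
  have hsym : ∀ l m i, curv k om G rho P Q i m x Xc (X (fibIdx l)) =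
      curv k om G rho P Q i l x Xc (X (fibIdx m)) := by
    intro l m i
    have := h.bianchi hx i Xc (X (fibIdx l)) (X (fibIdx m))
    simp only [hbase, hff, mul_zero, add_zero] at this
    simp [Finset.sum_add_distrib] at this
    have sw := curv_swap (k := k) (om := om) (G := G) (rho := rho) (P := P) (Q := Q)
      i l x Xc (X (fibIdx m))
    linarith
  obtain ⟨r1, r2, r3, r4, r5⟩ := gam_mixed_bianchi
    (fun l => dOne rho x Xc (X (fibIdx l)))
    (fun l a => -covD G rho P (fun a b y => -Q a b y) a c x (X (fibIdx l)))
    (fun l a => -covD G rho Q P a c x (X (fibIdx l)))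
    (fun l m i => by
      have := hsym l m i
      rwa [hcv, hcv] at this)
  refine ⟨r1, fun a => ⟨?_, ?_, ?_, ?_⟩⟩
  · have := r2 a; simp only [fibIdx] at this; simpa using this
  · have := r3 a; simp only [fibIdx] at this
    simp at this; linarith
  · have := r4 a; simp only [fibIdx] at this
    simp at this; linarith
  · have := r5 a; simp only [fibIdx] at this; simpa using this

/-- On two fibre vectors only dρ times a fixed invertible matrix survives in the curvature. The
Bianchi identity on three fibre vectors then kills dρ, because there are four fibre directions. -/
theorem rho_vertical (h : RealFrame k s om G rho P Q) {x : E} (hx : x ∈ s) {X : Fin 7 → E}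
    (hX : ∀ i j, om i x (X j) = if i = j then 1 else 0) (l m : Fin 4) :
    dOne rho x (X (fibIdx l)) (X (fibIdx m)) = 0 := by
  have hfib : ∀ l, om 0 x (X (fibIdx l)) = 0 ∧ om 1 x (X (fibIdx l)) = 0 ∧
      om 2 x (X (fibIdx l)) = 0 := by
    intro l
    fin_cases l <;> simp [hX, fibIdx]
  have hff : ∀ l m, om (fibIdx l) x (X (fibIdx m)) = if l = m then 1 else 0 := by
    intro l m
    fin_cases l <;> fin_cases m <;> simp [hX, fibIdx]
  have hcv : ∀ i j l m, curv k om G rho P Q i j x (X (fibIdx l)) (X (fibIdx m)) =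
      gam 0 (dOne rho x (X (fibIdx l)) (X (fibIdx m))) 0 0 0 i j := by
    intro i j l m
    obtain ⟨f0, f1, f2⟩ := hfib m
    obtain ⟨g0, g1, g2⟩ := hfib l
    rw [h.curv_vertical hx i j _ _ f0 f1 f2]
    congr 1
    · funext a; exact h.Om_vertical hx f0 f1 f2 a _
    · funext a; simp [g0, g1, g2]
    · funext a; simp [g0, g1, g2]
  have hsw : ∀ l m, dOne rho x (X (fibIdx l)) (X (fibIdx m)) =
    -dOne rho x (X (fibIdx m)) (X (fibIdx l)) := fun l m => dOne_swap _ _ _ _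
  have hself : ∀ l, dOne rho x (X (fibIdx l)) (X (fibIdx l)) = 0 := fun l => by
    linarith [hsw l l]
  have hb : ∀ i l m n, _ := fun i l m n =>
    h.bianchi hx i (X (fibIdx l)) (X (fibIdx m)) (X (fibIdx n))
  simp only [hcv, hff] at hb
  -- Each row of that matrix has one nonzero entry, so each instance isolates one component of dρ.
  have b012 := hb 3 0 1 2
  have b023 := hb 1 2 3 0
  have b021 := hb 0 0 2 1
  have b031 := hb 0 0 3 1
  have b120 := hb 1 1 2 0
  have b130 := hb 1 1 3 0
  simp [Fin.sum_univ_four, gam] at b012 b023 b021 b031 b120 b130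
  have s01 := hsw 0 1
  have s02 := hsw 0 2
  have s03 := hsw 0 3
  have s12 := hsw 1 2
  have s13 := hsw 1 3
  have s23 := hsw 2 3
  fin_cases l <;> fin_cases m <;> first
    | exact hself _
    | simp only [Fin.zero_eta, Fin.mk_one, Fin.reduceFinMk]
      linarith

end RealFrame

end

end G2ERP

/-! ### The Gauss equation and its derivative along the fibres. -/

namespace G2ERP

noncomputable section

variable {E : Type*} [NormedAddCommGroup E] [NormedSpace ℝ E]
variable {k : ℝ} {s : Set E} {om : Fin 7 → E → E →L[ℝ] ℝ} {G : Fin 3 → E → E →L[ℝ] ℝ}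
  {rho : E → E →L[ℝ] ℝ} {P Q : Fin 3 → Fin 3 → E → ℝ}

theorem chi_apply (R : Fin 3 → Fin 3 → E → ℝ) (a : Fin 3) (y v : E) :
    chi R om a y v = R a 0 y * om 0 y v + R a 1 y * om 1 y v + R a 2 y * om 2 y v := rfl

theorem covD_apply (R T : Fin 3 → Fin 3 → E → ℝ) (a b : Fin 3) (y v : E) :
    covD G rho R T a b y v = fderiv ℝ (R a b) y v + T a b y * rho y v
    + (R (a + 2) b y * G (a + 1) y v - R (a + 1) b y * G (a + 2) y v)
    + (R a (b + 2) y * G (b + 1) y v - R a (b + 1) y * G (b + 2) y v) := rfl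

theorem dOne_add_vectors (α : E → E →L[ℝ] ℝ) (x u u' v v' : E) :
    dOne α x (u + u') (v + v') = dOne α x u v + dOne α x u v' + dOne α x u' v + dOne α x u' v' := by
  simp only [dOne, map_add, add_apply]
  ring

namespace RealFrame

theorem dOne_chi_vertical (h : RealFrame k s om G rho P Q) {R T : Fin 3 → Fin 3 → E → ℝ}
    (hR : ∀ i j, ContDiffOn ℝ ∞ (R i j) s)
    {x : E} (hx : x ∈ s) (a : Fin 3) (v : E)
    {w : E} (w0 : om 0 x w = 0) (w1 : om 1 x w = 0) (w2 : om 2 x w = 0) :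
    dOne (chi R om a) x v w =
      -(covD G rho R T a 0 x w * om 0 x v + covD G rho R T a 1 x w * om 1 x v
          + covD G rho R T a 2 x w * om 2 x v)
      + G (a + 1) x w * chi R om (a + 2) x v - G (a + 2) x w * chi R om (a + 1) x v
      + rho x w * chi T om a x v := by
  obtain ⟨b0, b1, b2⟩ := h.dOne_base hx v w
  have e0 : (0 : Fin 3) + 1 = 1 := rfl
  have e1 : (0 : Fin 3) + 2 = 2 := rfl
  have e2 : (1 : Fin 3) + 1 = 2 := rfl
  have e3 : (1 : Fin 3) + 2 = 0 := rfl
  have e4 : (2 : Fin 3) + 1 = 0 := rfl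
  have e5 : (2 : Fin 3) + 2 = 1 := rfl
  rw [dOne_chi h.isOpen hR h.om_smooth hx, b0, b1, b2, w0, w1, w2]
  simp only [covD_apply, chi_apply]
  fin_cases a <;> simp [e0, e1, e2, e3, e4, e5] <;> ring

/-- The Gauss equation. -/
theorem gauss (h : RealFrame k s om G rho P Q) {x : E} (hx : x ∈ s) (a : Fin 3) (u v : E) :
    Om G a x u v = 4 * (k ^ 2 * (om (Fin.castLE (by norm_num) (a + 1)) x u
          * om (Fin.castLE (by norm_num) (a + 2)) x v
        - om (Fin.castLE (by norm_num) (a + 1)) x v * om (Fin.castLE (by norm_num) (a + 2)) x u)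
      + (chi P om (a + 1) x u * chi P om (a + 2) x v - chi P om (a + 1) x v * chi P om (a + 2) x u)
      + (chi Q om (a + 1) x u * chi Q om (a + 2) x v
        - chi Q om (a + 1) x v * chi Q om (a + 2) x u)) := by
  obtain ⟨X, hX, hsum⟩ := h.exists_dual hx
  have dec : ∀ u, ∃ ub uf, u = ub + uf ∧ (∀ j, om (fibIdx j) x ub = 0) ∧ om 0 x uf = 0 ∧
      om 1 x uf = 0 ∧ om 2 x uf = 0 := by
    intro u
    refine ⟨om 0 x u • X 0 + om 1 x u • X 1 + om 2 x u • X 2,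
      om 3 x u • X 3 + om 4 x u • X 4 + om 5 x u • X 5 + om 6 x u • X 6, ?_, ?_, ?_, ?_, ?_⟩
    · conv_lhs => rw [hsum u, Fin.sum_univ_seven]
      abel
    · intro j
      fin_cases j <;> simp [hX, fibIdx]
    all_goals simp [hX]
  -- On vectors without fibre components the whole curvature vanishes; its `so(3)`-part is `Om`
  -- minus the products of the symmetric coordinates k ω, χ_P and χ_Q. All other components of both
  -- sides vanish by `Om_vertical` and because χ and ω annihilate fibre vectors.
  have hor : ∀ {u v : E}, (∀ j, om (fibIdx j) x u = 0) → (∀ j, om (fibIdx j) x v = 0) →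
      Om G a x u v = 4 * (k ^ 2 * (om (Fin.castLE (by norm_num) (a + 1)) x u
          * om (Fin.castLE (by norm_num) (a + 2)) x v
        - om (Fin.castLE (by norm_num) (a + 1)) x v * om (Fin.castLE (by norm_num) (a + 2)) x u)
      + (chi P om (a + 1) x u * chi P om (a + 2) x v - chi P om (a + 1) x v * chi P om (a + 2) x u)
      + (chi Q om (a + 1) x u * chi Q om (a + 2) x v
        - chi Q om (a + 1) x v * chi Q om (a + 2) x u)) := by
    intro u v hu hv
    obtain ⟨g0, g1, g2⟩ := gam_curv_so3 (fun a => dOne (G a) x u v)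
      ![k * dOne (om 0) x u v, k * dOne (om 1) x u v, k * dOne (om 2) x u v]
      (fun a => dOne (chi P om a) x u v) (fun a => dOne (chi Q om a) x u v)
      (fun a => G a x u) (fun a => G a x v) ![k * om 0 x u, k * om 1 x u, k * om 2 x u]
      ![k * om 0 x v, k * om 1 x v, k * om 2 x v]
      (fun a => chi P om a x u) (fun a => chi P om a x v)
      (fun a => chi Q om a x u) (fun a => chi Q om a x v)
      (dOne rho x u v) (rho x u) (rho x v)
      (fun i j => curv k om G rho P Q i j x u v) (fun i j => by
        rw [curv, h.dOne_conF hx]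
        simp only [conF_apply, conn, chi_apply])
    simp only [h.curv_horizontal hx hu hv] at g0 g1 g2
    have e0 : (0 : Fin 3) + 1 = 1 := rfl
    have e1 : (0 : Fin 3) + 2 = 2 := rfl
    have e2 : (1 : Fin 3) + 1 = 2 := rfl
    have e3 : (1 : Fin 3) + 2 = 0 := rfl
    have e4 : (2 : Fin 3) + 1 = 0 := rfl
    have e5 : (2 : Fin 3) + 2 = 1 := rfl
    simp at g0 g1 g2
    fin_cases a <;> simp [Om, e0, e1, e2, e3, e4, e5]
    · linear_combination -g0
    · linear_combination -g1
    · linear_combination -g2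
  obtain ⟨ub, uf, rfl, hub, u0, u1, u2⟩ := dec u
  obtain ⟨vb, vf, rfl, hvb, v0, v1, v2⟩ := dec v
  have hu0 : ∀ c : Fin 3, om (Fin.castLE (by norm_num) c) x uf = 0 := by
    intro c; fin_cases c; exacts [u0, u1, u2]
  have hv0 : ∀ c : Fin 3, om (Fin.castLE (by norm_num) c) x vf = 0 := by
    intro c; fin_cases c; exacts [v0, v1, v2]
  have cu : ∀ (R : Fin 3 → Fin 3 → E → ℝ) c, chi R om c x uf = 0 := by
    intro R c; simp [chi_apply, u0, u1, u2]
  have cv : ∀ (R : Fin 3 → Fin 3 → E → ℝ) c, chi R om c x vf = 0 := by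
    intro R c; simp [chi_apply, v0, v1, v2]
  have o1 := h.Om_vertical hx v0 v1 v2 a ub
  have o2 := h.Om_vertical hx v0 v1 v2 a uf
  have o3 := h.Om_vertical hx u0 u1 u2 a vb
  rw [Om_swap] at o3
  have o4 := hor hub hvb
  simp only [map_add, hu0, hv0, cu, cv, add_zero]
  rw [← o4]
  simp only [Om, dOne_add_vectors, map_add] at o1 o2 o3 ⊢
  linear_combination o1 + o2 - o3

/-- The vertical derivative of the Gauss equation. -/
theorem gauss_vertical (h : RealFrame k s om G rho P Q) {x : E} (hx : x ∈ s) (a : Fin 3) (u v : E)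
    {w : E} (w0 : om 0 x w = 0) (w1 : om 1 x w = 0) (w2 : om 2 x w = 0)
    (D D' : Fin 3 → E → ℝ)
    (hD : ∀ a v, D a v = covD G rho P (fun a b y => -Q a b y) a 0 x w * om 0 x v
      + covD G rho P (fun a b y => -Q a b y) a 1 x w * om 1 x v
      + covD G rho P (fun a b y => -Q a b y) a 2 x w * om 2 x v)
    (hD' : ∀ a v, D' a v = covD G rho Q P a 0 x w * om 0 x v
      + covD G rho Q P a 1 x w * om 1 x v + covD G rho Q P a 2 x w * om 2 x v) :
    (D (a + 1) u * chi P om (a + 2) x v - D (a + 1) v * chi P om (a + 2) x u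
      + chi P om (a + 1) x u * D (a + 2) v - chi P om (a + 1) x v * D (a + 2) u)
    + (D' (a + 1) u * chi Q om (a + 2) x v - D' (a + 1) v * chi Q om (a + 2) x u
      + chi Q om (a + 1) x u * D' (a + 2) v - chi Q om (a + 1) x v * D' (a + 2) u) = 0 := by
  have hdP := fun a => diffAt h.isOpen (chi_smooth h.P_smooth h.om_smooth a) hx
  have hdQ := fun a => diffAt h.isOpen (chi_smooth h.Q_smooth h.om_smooth a) hx
  have hdG := fun a => diffAt h.isOpen (h.G_smooth a) hx
  have hdo := fun a => diffAt h.isOpen (h.om_smooth a) hx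
  let b : Fin 7 := Fin.castLE (by norm_num) (a + 1)
  let c : Fin 7 := Fin.castLE (by norm_num) (a + 2)
  -- The Gauss equation read as dG = Σ β ∧ γ with four products: the bracket of `G`, the k²-term,
  -- and one term each for P and Q.
  have h1 := cyclic_sum_of_dOne_eq (α := G a) (ι := Fin 4)
      (β := ![fun y => (-1 : ℝ) • G (a + 1) y, fun y => (4 * k ^ 2) • om b y,
        fun y => (4 : ℝ) • chi P om (a + 1) y, fun y => (4 : ℝ) • chi Q om (a + 1) y])
      (γ := ![G (a + 2), om c, chi P om (a + 2), chi Q om (a + 2)])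
      (cda h.isOpen (h.G_smooth _) hx)
      (fun j => by
        fin_cases j
        exacts [(hdG _).fun_const_smul _, (hdo _).fun_const_smul _, (hdP _).fun_const_smul _,
          (hdQ _).fun_const_smul _])
      (fun j => by
        fin_cases j
        exacts [hdG _, hdo _, hdP _, hdQ _])
      (Filter.eventually_of_mem (h.isOpen.mem_nhds hx) fun y hy v w => by
        have := h.gauss hy a v w
        rw [Om] at this
        simp [Fin.sum_univ_four]
        linear_combination this) u v w
  simp only [Fin.sum_univ_four, Matrix.cons_val, dOne_const_smul _ (hdG _),
    dOne_const_smul _ (hdo _), dOne_const_smul _ (hdP _), dOne_const_smul _ (hdQ _),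
    smul_apply, smul_eq_mul] at h1
  have sw : ∀ (α : E → E →L[ℝ] ℝ), dOne α x w u = -dOne α x u w := fun α => dOne_swap α x u w
  have hG : ∀ a v, dOne (G a) x v w = -(G (a + 1) x v * G (a + 2) x w
      - G (a + 1) x w * G (a + 2) x v) := by
    intro a v
    have := h.Om_vertical hx w0 w1 w2 a v
    rw [Om] at this
    linarith
  have hGg : ∀ a, dOne (G a) x u v = _ := fun a => eq_sub_of_add_eq (h.gauss hx a u v)
  have hP := fun a v => h.dOne_chi_vertical (T := fun a b y => -Q a b y) h.P_smooth hx a v w0 w1 w2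
  have hQ := fun a v => h.dOne_chi_vertical (T := P) h.Q_smooth hx a v w0 w1 w2
  simp only [← hD, ← hD'] at hP hQ
  have hT : ∀ a v, chi (fun a b y => -Q a b y) om a x v = -chi Q om a x v := by
    intro a v; simp only [chi_apply]; ring
  have cw : ∀ (R : Fin 3 → Fin 3 → E → ℝ) c, chi R om c x w = 0 := by
    intro R c; simp [chi_apply, w0, w1, w2]
  have hw0 : ∀ c : Fin 3, om (Fin.castLE (by norm_num) c) x w = 0 := by
    intro c; fin_cases c; exacts [w0, w1, w2]
  have hB : ∀ (a : Fin 3) v, dOne (om (Fin.castLE (by norm_num) a)) x v w =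
      G (a + 1) x w * om (Fin.castLE (by norm_num) (a + 2)) x v
      - G (a + 2) x w * om (Fin.castLE (by norm_num) (a + 1)) x v := by
    intro a v
    obtain ⟨b0, b1, b2⟩ := h.dOne_base hx v w
    simp only [w0, w1, w2] at b0 b1 b2
    fin_cases a
    · refine b0.trans ?_
      change _ = G 1 x w * om 2 x v - G 2 x w * om 1 x v
      ring
    · refine b1.trans ?_
      change _ = G 2 x w * om 0 x v - G 0 x w * om 2 x v
      ring
    · refine b2.trans ?_
      change _ = G 0 x w * om 1 x v - G 1 x w * om 0 x v
      ring
  have i1 : a + 1 + 1 = a + 2 := (by decide : ∀ a : Fin 3, a + 1 + 1 = a + 2) a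
  have i2 : a + 1 + 2 = a := (by decide : ∀ a : Fin 3, a + 1 + 2 = a) a
  have i3 : a + 2 + 1 = a := (by decide : ∀ a : Fin 3, a + 2 + 1 = a) a
  have i4 : a + 2 + 2 = a + 1 := (by decide : ∀ a : Fin 3, a + 2 + 2 = a + 1) a
  -- By equivariance the terms in `G` and ρ cancel, and so do the k²-terms; only the covariant
  -- derivatives of P and Q along w survive.
  simp only [sw, b, c, hG, hGg, hP, hQ, hB, hT, cw, hw0, i1, i2, i3, i4] at h1
  linear_combination h1 / 4

end RealFrame

end

end G2ERP

/-! ### The norm of the second fundamental form along the fibres. -/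

namespace G2ERP

noncomputable section

variable {E : Type*} [NormedAddCommGroup E] [NormedSpace ℝ E]
variable {k : ℝ} {s : Set E} {om : Fin 7 → E → E →L[ℝ] ℝ} {G : Fin 3 → E → E →L[ℝ] ℝ}
  {rho : E → E →L[ℝ] ℝ} {P Q : Fin 3 → Fin 3 → E → ℝ}

theorem covD_symm {R T : Fin 3 → Fin 3 → E → ℝ} (hR : ∀ i j y, R i j y = R j i y)
    (hT : ∀ i j y, T i j y = T j i y) (a b : Fin 3) (y : E) :
    covD G rho R T a b y = covD G rho R T b a y := by
  have e : R a b = R b a := funext (hR a b)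
  simp only [covD, e, hT a b y, hR (a + 2) b y, hR (a + 1) b y, hR a (b + 2) y, hR a (b + 1) y]
  abel

theorem covD_trace {R T : Fin 3 → Fin 3 → E → ℝ} (hR : ∀ i j y, R i j y = R j i y)
    (hd : ∀ i j y, y ∈ s → DifferentiableAt ℝ (R i j) y)
    (hR0 : ∀ y, R 0 0 y + R 1 1 y + R 2 2 y = 0) (hT0 : ∀ y, T 0 0 y + T 1 1 y + T 2 2 y = 0)
    {y : E} (hy : y ∈ s) (v : E) :
    covD G rho R T 0 0 y v + covD G rho R T 1 1 y v + covD G rho R T 2 2 y v = 0 := by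
  have h0 : fderiv ℝ (R 0 0) y v + fderiv ℝ (R 1 1) y v + fderiv ℝ (R 2 2) y v = 0 := by
    have : (fun y => R 0 0 y + R 1 1 y + R 2 2 y) = fun _ => (0 : ℝ) := funext hR0
    have h2 := congrArg (fun f => fderiv ℝ f y v) this
    rw [fderiv_fun_add ((hd 0 0 y hy).fun_add (hd 1 1 y hy)) (hd 2 2 y hy),
      fderiv_fun_add (hd 0 0 y hy) (hd 1 1 y hy)] at h2
    simpa using h2
  have e0 : (0 : Fin 3) + 1 = 1 := rfl
  have e1 : (0 : Fin 3) + 2 = 2 := rfl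
  have e2 : (1 : Fin 3) + 1 = 2 := rfl
  have e3 : (1 : Fin 3) + 2 = 0 := rfl
  have e4 : (2 : Fin 3) + 1 = 0 := rfl
  have e5 : (2 : Fin 3) + 2 = 1 := rfl
  simp only [covD_apply, e0, e1, e2, e3, e4, e5, hR 1 0 y, hR 2 0 y, hR 2 1 y]
  linear_combination h0 + hT0 y * rho y v

namespace RealFrame

/-- The norm of the second fundamental form is constant along the fibres. -/
theorem norm_vertical (h : RealFrame k s om G rho P Q) {x : E} (hx : x ∈ s)
    {w : E} (w0 : om 0 x w = 0) (w1 : om 1 x w = 0) (w2 : om 2 x w = 0) :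
    ∑ a, ∑ b, (P a b x * covD G rho P (fun a b y => -Q a b y) a b x w
      + Q a b x * covD G rho Q P a b x w) = 0 := by
  obtain ⟨X, hX, -⟩ := h.exists_dual hx
  have key := fun a u v => h.gauss_vertical hx a u v w0 w1 w2 _ _ (fun _ _ => rfl) (fun _ _ => rfl)
  have k0 := key 0 (X 1) (X 2)
  have k1 := key 1 (X 2) (X 0)
  have k2 := key 2 (X 0) (X 1)
  have e0 : (0 : Fin 3) + 1 = 1 := rfl
  have e1 : (0 : Fin 3) + 2 = 2 := rfl
  have e2 : (1 : Fin 3) + 1 = 2 := rfl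
  have e3 : (1 : Fin 3) + 2 = 0 := rfl
  have e4 : (2 : Fin 3) + 1 = 0 := rfl
  have e5 : (2 : Fin 3) + 2 = 1 := rfl
  have sP := fun a b => covD_symm (G := G) (rho := rho) h.P_symm (T := fun a b y => -Q a b y)
    (fun a b y => by rw [h.Q_symm]) a b x
  have sQ := fun a b => covD_symm (G := G) (rho := rho) h.Q_symm h.P_symm a b x
  have tP := covD_trace (G := G) (rho := rho) h.P_symm (T := fun a b y => -Q a b y)
    (fun i j y hy => diffAt h.isOpen (h.P_smooth i j) hy) h.P_trace
    (fun y => by linarith [h.Q_trace y]) hx w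
  have tQ := covD_trace (G := G) (rho := rho) h.Q_symm
    (fun i j y hy => diffAt h.isOpen (h.Q_smooth i j) hy) h.Q_trace h.P_trace hx w
  simp only [e0, e1, e2, e3, e4, e5, chi_apply, hX] at k0 k1 k2
  simp at k0 k1 k2
  simp only [sP 1 0, sP 2 0, sP 2 1, sQ 1 0, sQ 2 0, sQ 2 1, h.P_symm 1 0 x, h.P_symm 2 0 x,
    h.P_symm 2 1 x, h.Q_symm 1 0 x, h.Q_symm 2 0 x, h.Q_symm 2 1 x] at k0 k1 k2
  simp only [Fin.sum_univ_three]
  simp only [sP 1 0, sP 2 0, sP 2 1, sQ 1 0, sQ 2 0, sQ 2 1, h.P_symm 1 0 x, h.P_symm 2 0 x,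
    h.P_symm 2 1 x, h.Q_symm 1 0 x, h.Q_symm 2 0 x, h.Q_symm 2 1 x]
  -- Summed over the three coordinate planes, the polarised 2 × 2 minors of a symmetric matrix give
  -- tr D · tr P - ⟨D, P⟩, and all traces vanish.
  linear_combination -k0 - k1 - k2 + h.P_trace x * (covD G rho P (fun a b y => -Q a b y) 0 0 x w
    + covD G rho P (fun a b y => -Q a b y) 1 1 x w + covD G rho P (fun a b y => -Q a b y) 2 2 x w)
    + h.Q_trace x * (covD G rho Q P 0 0 x w + covD G rho Q P 1 1 x w + covD G rho Q P 2 2 x w)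

/-- The `1`-form `Im ⟨H, DH⟩` for `H = P + i Q`. -/
def _root_.G2ERP.zeta (G : Fin 3 → E → E →L[ℝ] ℝ) (rho : E → E →L[ℝ] ℝ)
    (P Q : Fin 3 → Fin 3 → E → ℝ) (y : E) : E →L[ℝ] ℝ :=
  ∑ t : Fin 3 × Fin 3, (P t.1 t.2 y • covD G rho Q P t.1 t.2 y
    - Q t.1 t.2 y • covD G rho P (fun a b y => -Q a b y) t.1 t.2 y)

/-- The Cauchy-Riemann relations turn Im⟨H, DH⟩ on one vector of a fibre plane into ± Re⟨H, DH⟩ on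
the other, which is zero because |H|² does not vary along the fibres. -/
theorem zeta_vertical (h : RealFrame k s om G rho P Q) {x : E} (hx : x ∈ s)
    {w : E} (w0 : om 0 x w = 0) (w1 : om 1 x w = 0) (w2 : om 2 x w = 0) :
    zeta G rho P Q x w = 0 := by
  obtain ⟨X, hX, hsum⟩ := h.exists_dual hx
  have hv := fun a c => (h.vertical_relations hx hX c).2 a
  have hn := fun i (h0 : om 0 x (X i) = 0) (h1 : om 1 x (X i) = 0) (h2 : om 2 x (X i) = 0) =>
    h.norm_vertical hx h0 h1 h2
  have n3 := hn 3 (by simp [hX]) (by simp [hX]) (by simp [hX])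
  have n4 := hn 4 (by simp [hX]) (by simp [hX]) (by simp [hX])
  have n5 := hn 5 (by simp [hX]) (by simp [hX]) (by simp [hX])
  have n6 := hn 6 (by simp [hX]) (by simp [hX]) (by simp [hX])
  rw [hsum w, Fin.sum_univ_seven, w0, w1, w2]
  simp only [zero_smul, zero_add, map_add, map_smul]
  have z : ∀ v, zeta G rho P Q x v = ∑ a, ∑ b, (P a b x * covD G rho Q P a b x v
      - Q a b x * covD G rho P (fun a b y => -Q a b y) a b x v) := by
    intro v
    rw [zeta, ← Finset.univ_product_univ, Finset.sum_product, sum_apply]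
    simp only [sum_apply, sub_apply, smul_apply, smul_eq_mul]
  have z3 : zeta G rho P Q x (X 3) = 0 := by
    rw [z, ← n4]
    refine Finset.sum_congr rfl fun a _ => Finset.sum_congr rfl fun b _ => ?_
    obtain ⟨r1, r2, r3, r4⟩ := hv a b
    rw [r1, r2]
    ring
  have z4 : zeta G rho P Q x (X 4) = 0 := by
    rw [z, ← neg_zero, ← n3, ← Finset.sum_neg_distrib]
    refine Finset.sum_congr rfl fun a _ => ?_
    rw [← Finset.sum_neg_distrib]
    refine Finset.sum_congr rfl fun b _ => ?_
    obtain ⟨r1, r2, r3, r4⟩ := hv a b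
    rw [r1, r2]
    ring
  have z5 : zeta G rho P Q x (X 5) = 0 := by
    rw [z, ← neg_zero, ← n6, ← Finset.sum_neg_distrib]
    refine Finset.sum_congr rfl fun a _ => ?_
    rw [← Finset.sum_neg_distrib]
    refine Finset.sum_congr rfl fun b _ => ?_
    obtain ⟨r1, r2, r3, r4⟩ := hv a b
    rw [r3, r4]
    ring
  have z6 : zeta G rho P Q x (X 6) = 0 := by
    rw [z, ← n5]
    refine Finset.sum_congr rfl fun a _ => Finset.sum_congr rfl fun b _ => ?_
    obtain ⟨r1, r2, r3, r4⟩ := hv a b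
    rw [r3, r4]
    ring
  simp [z3, z4, z5, z6]

/-- A vertical vector extends to a vertical vector field. -/
theorem exists_vertical_field [CompleteSpace E] (h : RealFrame k s om G rho P Q) {x : E}
    (hx : x ∈ s) (u : E) : ∃ U : E → E, DifferentiableAt ℝ U x ∧ U x = u ∧
      ∀ᶠ y in nhds x, ∀ i, om i y (U y) = om i x u := by
  obtain ⟨e, he⟩ := h.frame x hx
  let A : E → E →L[ℝ] (Fin 7 → ℝ) := fun y => ContinuousLinearMap.pi fun i => om i y
  have hA : ∀ y v i, A y v i = om i y v := fun _ _ _ => rfl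
  have hAe : ∀ y (e : E ≃L[ℝ] (Fin 7 → ℝ)), (∀ v i, e v i = om i y v) → A y = e := by
    intro y e he
    ext v i
    exact (he v i).symm
  -- The field whose coframe components are constant.
  refine ⟨fun y => ContinuousLinearMap.inverse (A y) (e u), ?_, ?_, ?_⟩
  · have h1 : DifferentiableAt ℝ A x := by
      have : A = fun y => ∑ i, (om i y).smulRight (Pi.single i 1 : Fin 7 → ℝ) := by
        funext y
        ext v j
        simp [hA, Pi.single_apply]
      rw [this]
      exact DifferentiableAt.fun_sum fun i _ => ((ContinuousLinearMap.smulRightL ℝ E (Fin 7 →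
          ℝ)).flip (Pi.single i 1)).differentiableAt.comp x
        (diffAt h.isOpen (h.om_smooth i) hx)
    have h2 : DifferentiableAt ℝ (ContinuousLinearMap.inverse : (E →L[ℝ] (Fin 7 → ℝ)) → _) (A x)
        := by
      rw [hAe x e he]
      exact (contDiffAt_map_inverse (n := 1) e).differentiableAt (by simp)
    exact (h2.comp x h1).clm_apply (differentiableAt_const _)
  · simp only [hAe x e he, ContinuousLinearMap.inverse_equiv]
    simp
  · filter_upwards [h.isOpen.mem_nhds hx] with y hy i
    obtain ⟨e', he'⟩ := h.frame y hy
    rw [← he', hAe y e' he', ContinuousLinearMap.inverse_equiv]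
    simp [he]

/-- Integrability of the fibre distribution: brackets of vertical fields are vertical, since the
derivatives of the base forms vanish on vertical pairs. -/
theorem dOne_of_vertical [CompleteSpace E] (h : RealFrame k s om G rho P Q) {x : E} (hx : x ∈ s)
    {z : E → E →L[ℝ] ℝ} (hz : DifferentiableAt ℝ z x)
    (hz0 : ∀ y ∈ s, ∀ w, om 0 y w = 0 → om 1 y w = 0 → om 2 y w = 0 → z y w = 0)
    {u v : E} (u0 : om 0 x u = 0) (u1 : om 1 x u = 0) (u2 : om 2 x u = 0)
    (v0 : om 0 x v = 0) (v1 : om 1 x v = 0) (v2 : om 2 x v = 0) :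
    dOne z x u v = 0 := by
  obtain ⟨U, dU, Ux, hU⟩ := h.exists_vertical_field hx u
  obtain ⟨V, dV, Vx, hV⟩ := h.exists_vertical_field hx v
  -- Cartan's formula dα(U, V) = -α([U, V]) for fields U, V that α annihilates. Applied to the base
  -- forms it shows that the bracket is vertical, and then it applies to `z`.
  have key : ∀ α : E → E →L[ℝ] ℝ, DifferentiableAt ℝ α x → (∀ᶠ y in nhds x, α y (U y) = 0) →
      (∀ᶠ y in nhds x, α y (V y) = 0) →
      dOne α x u v = -α x (fderiv ℝ V x u - fderiv ℝ U x v) := by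
    intro α hα h1 h2
    have e1 : HasFDerivAt (fun y => α y (U y)) _ x := hα.hasFDerivAt.clm_apply dU.hasFDerivAt
    have e2 : HasFDerivAt (fun y => α y (V y)) _ x := hα.hasFDerivAt.clm_apply dV.hasFDerivAt
    have f1 := e1.unique ((hasFDerivAt_const (0 : ℝ) x).congr_of_eventuallyEq h1)
    have f2 := e2.unique ((hasFDerivAt_const (0 : ℝ) x).congr_of_eventuallyEq h2)
    have g1 := DFunLike.congr_fun f1 v
    have g2 := DFunLike.congr_fun f2 u
    simp [Ux] at g1
    simp [Vx] at g2
    rw [dOne, map_sub]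
    linarith
  have hb : ∀ c : Fin 7, om c x u = 0 → om c x v = 0 → dOne (om c) x u v = 0 →
      om c x (fderiv ℝ V x u - fderiv ℝ U x v) = 0 := by
    intro c cu cv hc
    have := key (om c) (diffAt h.isOpen (h.om_smooth c) hx)
      (hU.mono fun y hy => by rw [hy, cu]) (hV.mono fun y hy => by rw [hy, cv])
    linarith
  obtain ⟨b0, b1, b2⟩ := h.dOne_base hx u v
  simp only [u0, u1, u2, v0, v1, v2, mul_zero, sub_zero] at b0 b1 b2
  rw [key z hz, hz0 x hx _ (hb 0 u0 v0 b0) (hb 1 u1 v1 b1) (hb 2 u2 v2 b2), neg_zero]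
  · filter_upwards [hU, h.isOpen.mem_nhds hx] with y hy hys
    exact hz0 y hys _ (by rw [hy, u0]) (by rw [hy, u1]) (by rw [hy, u2])
  · filter_upwards [hV, h.isOpen.mem_nhds hx] with y hy hys
    exact hz0 y hys _ (by rw [hy, v0]) (by rw [hy, v1]) (by rw [hy, v2])

end RealFrame

end

end G2ERP

/-! ### Flatness of the connection on the fibre forms. -/

namespace G2ERP

noncomputable section

variable {E : Type*} [NormedAddCommGroup E] [NormedSpace ℝ E]
variable {k : ℝ} {s : Set E} {om : Fin 7 → E → E →L[ℝ] ℝ} {G : Fin 3 → E → E →L[ℝ] ℝ}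
  {rho : E → E →L[ℝ] ℝ} {P Q : Fin 3 → Fin 3 → E → ℝ}

namespace RealFrame

theorem covD_smooth (h : RealFrame k s om G rho P Q) {R T : Fin 3 → Fin 3 → E → ℝ}
    (hR : ∀ i j, ContDiffOn ℝ ∞ (R i j) s) (hT : ∀ i j, ContDiffOn ℝ ∞ (T i j) s) (a b : Fin 3) :
    ContDiffOn ℝ ∞ (covD G rho R T a b) s :=
  ((((hR a b).fderiv_of_isOpen h.isOpen (by simp)).add ((hT a b).smul h.rho_smooth)).add
    (((hR _ b).smul (h.G_smooth _)).sub ((hR _ b).smul (h.G_smooth _)))).add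
    (((hR a _).smul (h.G_smooth _)).sub ((hR a _).smul (h.G_smooth _)))

/-- The exterior covariant derivative of a covariant derivative, on vertical vectors. -/
theorem dOne_covD (h : RealFrame k s om G rho P Q) {R T : Fin 3 → Fin 3 → E → ℝ}
    (hR : ∀ i j, ContDiffOn ℝ ∞ (R i j) s) (hT : ∀ i j, ContDiffOn ℝ ∞ (T i j) s)
    {x u v : E} (hx : x ∈ s) (hO : ∀ a, Om G a x u v = 0) (hr : dOne rho x u v = 0) (a b : Fin 3) :
    dOne (covD G rho R T a b) x u v =
      (covD G rho T (fun a b y => -R a b y) a b x u * rho x v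
        - covD G rho T (fun a b y => -R a b y) a b x v * rho x u)
      + ((covD G rho R T (a + 2) b x u * G (a + 1) x v - covD G rho R T (a + 2) b x v * G (a + 1)
          x u)
        - (covD G rho R T (a + 1) b x u * G (a + 2) x v
          - covD G rho R T (a + 1) b x v * G (a + 2) x u))
      + ((covD G rho R T a (b + 2) x u * G (b + 1) x v - covD G rho R T a (b + 2) x v * G (b + 1)
          x u)
        - (covD G rho R T a (b + 1) x u * G (b + 2) x v
          - covD G rho R T a (b + 1) x v * G (b + 2) x u)) := by
  have hdR : ∀ i j, DifferentiableAt ℝ (R i j) x := fun i j => diffAt h.isOpen (hR i j) hx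
  have hdT : ∀ i j, DifferentiableAt ℝ (T i j) x := fun i j => diffAt h.isOpen (hT i j) hx
  have hdG : ∀ a, DifferentiableAt ℝ (G a) x := fun a => diffAt h.isOpen (h.G_smooth a) hx
  have hdr : DifferentiableAt ℝ rho x := diffAt h.isOpen h.rho_smooth hx
  have hdf : DifferentiableAt ℝ (fderiv ℝ (R a b)) x :=
    diffAt h.isOpen ((hR a b).fderiv_of_isOpen h.isOpen (by simp)) hx
  have hG : ∀ a, dOne (G a) x u v = -(G (a + 1) x u * G (a + 2) x v
      - G (a + 1) x v * G (a + 2) x u) := by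
    intro a
    have := hO a
    rw [Om] at this
    linarith
  have i1 : ∀ a : Fin 3, a + 1 + 1 = a + 2 := by decide
  have i2 : ∀ a : Fin 3, a + 1 + 2 = a := by decide
  have i3 : ∀ a : Fin 3, a + 2 + 1 = a := by decide
  have i4 : ∀ a : Fin 3, a + 2 + 2 = a + 1 := by decide
  have e : covD G rho R T a b = fun y => fderiv ℝ (R a b) y + T a b y • rho y
    + (R (a + 2) b y • G (a + 1) y - R (a + 1) b y • G (a + 2) y)
    + (R a (b + 2) y • G (b + 1) y - R a (b + 1) y • G (b + 2) y) := rfl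
  have f1 : ∀ i j c, DifferentiableAt ℝ (fun y => R i j y • G c y) x := fun i j c =>
    (hdR i j).fun_smul (hdG c)
  have f2 := (hdT a b).fun_smul hdr
  rw [e, dOne_add ((hdf.fun_add f2).fun_add ((f1 _ _ _).fun_sub (f1 _ _ _)))
    ((f1 _ _ _).fun_sub (f1 _ _ _)), dOne_add (hdf.fun_add f2) ((f1 _ _ _).fun_sub (f1 _ _ _)),
    dOne_add hdf f2, dOne_sub (f1 _ _ _) (f1 _ _ _), dOne_sub (f1 _ _ _) (f1 _ _ _),
    dOne_smul (hdT a b) hdr, dOne_smul (hdR _ _) (hdG _), dOne_smul (hdR _ _) (hdG _),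
    dOne_smul (hdR _ _) (hdG _), dOne_smul (hdR _ _) (hdG _),
    dOne_fderiv (cda h.isOpen (hR a b) hx), hr, hG, hG, hG, hG]
  simp only [covD_apply, smul_eq_mul, i1, i2, i3, i4]
  ring

theorem zeta_smooth (h : RealFrame k s om G rho P Q) : ContDiffOn ℝ ∞ (zeta G rho P Q) s :=
  ContDiffOn.sum fun t _ => ((h.P_smooth t.1 t.2).smul
    (h.covD_smooth h.Q_smooth h.P_smooth t.1 t.2)).sub ((h.Q_smooth t.1 t.2).smul
    (h.covD_smooth h.P_smooth (fun i j => (h.Q_smooth i j).neg) t.1 t.2))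

/-- The Leibniz rule d Im⟨H, DH⟩ = Im⟨DH ∧ DH⟩ + Im⟨H, D²H⟩. The last term is absent because the
curvatures of `G` and ρ vanish on (u, v), and the connection terms cancel since the pairing is
invariant under rotations. -/
theorem dOne_zeta (h : RealFrame k s om G rho P Q)
    {x u v : E} (hx : x ∈ s) (hO : ∀ a, Om G a x u v = 0) (hr : dOne rho x u v = 0) :
    dOne (zeta G rho P Q) x u v = 2 * ∑ a, ∑ b,
      (covD G rho P (fun a b y => -Q a b y) a b x u * covD G rho Q P a b x v
      - covD G rho P (fun a b y => -Q a b y) a b x v * covD G rho Q P a b x u) := by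
  have hNQ : ∀ i j, ContDiffOn ℝ ∞ (fun y => -Q i j y) s := fun i j => (h.Q_smooth i j).neg
  have hdP : ∀ i j, DifferentiableAt ℝ (P i j) x := fun i j => diffAt h.isOpen (h.P_smooth i j) hx
  have hdQ : ∀ i j, DifferentiableAt ℝ (Q i j) x := fun i j => diffAt h.isOpen (h.Q_smooth i j) hx
  have hcP : ∀ i j, DifferentiableAt ℝ (covD G rho P (fun a b y => -Q a b y) i j) x := fun i j =>
    diffAt h.isOpen (h.covD_smooth h.P_smooth hNQ i j) hx
  have hcQ : ∀ i j, DifferentiableAt ℝ (covD G rho Q P i j) x := fun i j =>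
    diffAt h.isOpen (h.covD_smooth h.Q_smooth h.P_smooth i j) hx
  change dOne (fun y => ∑ t : Fin 3 × Fin 3, (P t.1 t.2 y • covD G rho Q P t.1 t.2 y
    - Q t.1 t.2 y • covD G rho P (fun a b y => -Q a b y) t.1 t.2 y)) x u v = _
  rw [dOne_sum _ (fun t _ => ((hdP _ _).fun_smul (hcQ _ _)).fun_sub ((hdQ _ _).fun_smul (hcP _ _)))]
  have step : ∀ a b, dOne (fun y => P a b y • covD G rho Q P a b y
    - Q a b y • covD G rho P (fun a b y => -Q a b y) a b y) x u v = _ := fun a b => by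
    rw [dOne_sub ((hdP _ _).fun_smul (hcQ _ _)) ((hdQ _ _).fun_smul (hcP _ _)),
      dOne_smul (hdP _ _) (hcQ _ _), dOne_smul (hdQ _ _) (hcP _ _),
      h.dOne_covD h.Q_smooth h.P_smooth hx hO hr, h.dOne_covD h.P_smooth hNQ hx hO hr]
  have hneg : ∀ a b, covD G rho (fun a b y => -Q a b y) (fun a b y => -P a b y) a b x =
      -covD G rho Q P a b x := by
    intro a b
    have : fderiv ℝ (fun y => -Q a b y) x = -fderiv ℝ (Q a b) x := fderiv_fun_neg
    ext v
    simp only [covD_apply, this, neg_apply]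
    ring
  have hfP : ∀ a b v, fderiv ℝ (P a b) x v = covD G rho P (fun a b y => -Q a b y) a b x v
      + Q a b x * rho x v - (P (a + 2) b x * G (a + 1) x v - P (a + 1) b x * G (a + 2) x v)
      - (P a (b + 2) x * G (b + 1) x v - P a (b + 1) x * G (b + 2) x v) := by
    intro a b v; rw [covD_apply]; ring
  have hfQ : ∀ a b v, fderiv ℝ (Q a b) x v = covD G rho Q P a b x v
      - P a b x * rho x v - (Q (a + 2) b x * G (a + 1) x v - Q (a + 1) b x * G (a + 2) x v)
      - (Q a (b + 2) x * G (b + 1) x v - Q a (b + 1) x * G (b + 2) x v) := by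
    intro a b v; rw [covD_apply]; ring
  simp only [step, hneg, hfP, hfQ]
  rw [← Finset.univ_product_univ, Finset.sum_product]
  have e0 : (0 : Fin 3) + 1 = 1 := rfl
  have e1 : (0 : Fin 3) + 2 = 2 := rfl
  have e2 : (1 : Fin 3) + 1 = 2 := rfl
  have e3 : (1 : Fin 3) + 2 = 0 := rfl
  have e4 : (2 : Fin 3) + 1 = 0 := rfl
  have e5 : (2 : Fin 3) + 2 = 1 := rfl
  simp only [Fin.sum_univ_three, e0, e1, e2, e3, e4, e5, smul_eq_mul, neg_apply]
  generalize covD G rho P (fun a b y => -Q a b y) = DP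
  generalize covD G rho Q P = DQ
  ring

/-- The second fundamental form is parallel along the fibres. -/
theorem covD_vertical [CompleteSpace E] (h : RealFrame k s om G rho P Q) {x : E} (hx : x ∈ s)
    {w : E} (w0 : om 0 x w = 0) (w1 : om 1 x w = 0) (w2 : om 2 x w = 0) (a b : Fin 3) :
    covD G rho P (fun a b y => -Q a b y) a b x w = 0 ∧ covD G rho Q P a b x w = 0 := by
  obtain ⟨X, hX, hsum⟩ := h.exists_dual hx
  have hv := fun a c => (h.vertical_relations hx hX c).2 a
  have hz : ∀ l m : Fin 4, dOne (zeta G rho P Q) x (X (fibIdx l)) (X (fibIdx m)) = 0 := by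
    intro l m
    have hfib : ∀ l, om 0 x (X (fibIdx l)) = 0 ∧ om 1 x (X (fibIdx l)) = 0 ∧
        om 2 x (X (fibIdx l)) = 0 := by
      intro l
      fin_cases l <;> simp [hX, fibIdx]
    exact h.dOne_of_vertical hx (diffAt h.isOpen h.zeta_smooth hx)
      (fun y hy w a b c => h.zeta_vertical hy a b c) (hfib l).1 (hfib l).2.1 (hfib l).2.2
      (hfib m).1 (hfib m).2.1 (hfib m).2.2
  have hd := fun l m : Fin 4 => h.dOne_zeta (u := X (fibIdx l)) (v := X (fibIdx m)) hx
    (fun a => h.Om_vertical hx (by fin_cases m <;> simp [hX, fibIdx])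
      (by fin_cases m <;> simp [hX, fibIdx]) (by fin_cases m <;> simp [hX, fibIdx]) a _)
    (h.rho_vertical hx hX l m)
  have d01 := (hz 0 1).symm.trans (hd 0 1)
  have d23 := (hz 2 3).symm.trans (hd 2 3)
  have f0 : fibIdx 0 = 3 := rfl
  have f1 : fibIdx 1 = 4 := rfl
  have f2 : fibIdx 2 = 5 := rfl
  have f3 : fibIdx 3 = 6 := rfl
  simp only [f0, f1, f2, f3] at d01 d23
  -- In the plane of the fourth and fifth dual vectors DH(X 4) = -i DH(X 3), so Im⟨DH ∧ DH⟩ is minus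
  -- a sum of squares; in the other plane the sign is opposite. As dζ = 0 on the fibres, both sums
  -- vanish.
  have s01 : ∑ a, ∑ b, (covD G rho P (fun a b y => -Q a b y) a b x (X 3) ^ 2
      + covD G rho Q P a b x (X 3) ^ 2) = 0 := by
    have : ∑ a, ∑ b, (covD G rho P (fun a b y => -Q a b y) a b x (X 3) * covD G rho Q P a b x (X 4)
      - covD G rho P (fun a b y => -Q a b y) a b x (X 4) * covD G rho Q P a b x (X 3)) =
      -∑ a, ∑ b, (covD G rho P (fun a b y => -Q a b y) a b x (X 3) ^ 2
      + covD G rho Q P a b x (X 3) ^ 2) := by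
      simp only [← Finset.sum_neg_distrib]
      refine Finset.sum_congr rfl fun a _ => Finset.sum_congr rfl fun b _ => ?_
      obtain ⟨r1, r2, r3, r4⟩ := hv a b
      rw [r1, r2]
      ring
    linarith
  have s23 : ∑ a, ∑ b, (covD G rho P (fun a b y => -Q a b y) a b x (X 5) ^ 2
      + covD G rho Q P a b x (X 5) ^ 2) = 0 := by
    have : ∑ a, ∑ b, (covD G rho P (fun a b y => -Q a b y) a b x (X 5) * covD G rho Q P a b x (X 6)
      - covD G rho P (fun a b y => -Q a b y) a b x (X 6) * covD G rho Q P a b x (X 5)) =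
      ∑ a, ∑ b, (covD G rho P (fun a b y => -Q a b y) a b x (X 5) ^ 2
      + covD G rho Q P a b x (X 5) ^ 2) := by
      refine Finset.sum_congr rfl fun a _ => Finset.sum_congr rfl fun b _ => ?_
      obtain ⟨r1, r2, r3, r4⟩ := hv a b
      rw [r3, r4]
      ring
    linarith
  have van : ∀ j, ∑ a, ∑ b, (covD G rho P (fun a b y => -Q a b y) a b x (X j) ^ 2
      + covD G rho Q P a b x (X j) ^ 2) = 0 →
      covD G rho P (fun a b y => -Q a b y) a b x (X j) = 0 ∧ covD G rho Q P a b x (X j) = 0 := by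
    intro j hj
    have nn : ∀ a b, 0 ≤ covD G rho P (fun a b y => -Q a b y) a b x (X j) ^ 2
      + covD G rho Q P a b x (X j) ^ 2 := fun a b => by positivity
    have h1 := (Finset.sum_eq_zero_iff_of_nonneg
      (fun a _ => Finset.sum_nonneg fun b _ => nn a b)).1 hj a (Finset.mem_univ a)
    have h2 := (Finset.sum_eq_zero_iff_of_nonneg (fun b _ => nn a b)).1 h1 b (Finset.mem_univ b)
    constructor <;> nlinarith [sq_nonneg (covD G rho P (fun a b y => -Q a b y) a b x (X j)),
      sq_nonneg (covD G rho Q P a b x (X j))]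
  obtain ⟨p3, q3⟩ := van 3 s01
  obtain ⟨p5, q5⟩ := van 5 s23
  obtain ⟨r1, r2, r3, r4⟩ := hv a b
  rw [q3] at r1
  rw [p3, neg_zero] at r2
  rw [q5, neg_zero] at r3
  rw [p5] at r4
  rw [hsum w, Fin.sum_univ_seven, w0, w1, w2]
  simp [p3, q3, p5, q5, r1, r2, r3, r4]

/-- By bilinearity this combines the base-fibre components from `vertical_relations` with the
fibre-fibre components from `rho_vertical`. -/
theorem rho_closed_vertical (h : RealFrame k s om G rho P Q) {x : E} (hx : x ∈ s)
    {w : E} (w0 : om 0 x w = 0) (w1 : om 1 x w = 0) (w2 : om 2 x w = 0) (v : E) :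
    dOne rho x v w = 0 := by
  obtain ⟨X, hX, hsum⟩ := h.exists_dual hx
  have hb := fun c => (h.vertical_relations hx hX c).1
  have hf := h.rho_vertical hx hX
  have lin : ∀ j : Fin 7, ∀ l : Fin 4, dOne rho x (X j) (X (fibIdx l)) = 0 := by
    intro j l
    fin_cases j
    exacts [hb 0 l, hb 1 l, hb 2 l, hf 0 l, hf 1 l, hf 2 l, hf 3 l]
  have hl : ∀ l v, dOne rho x v (X (fibIdx l)) = 0 := by
    intro l v
    let B := (fderiv ℝ rho x).flip (X (fibIdx l)) - fderiv ℝ rho x (X (fibIdx l))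
    have hB : ∀ j, B (X j) = 0 := fun j => lin j l
    change B v = 0
    rw [hsum v, map_sum]
    simp [hB]
  let C := fderiv ℝ rho x v - (fderiv ℝ rho x).flip v
  have hC : ∀ l, C (X (fibIdx l)) = 0 := fun l => hl l v
  change C w = 0
  rw [hsum w, Fin.sum_univ_seven, w0, w1, w2]
  have c0 : C (X 3) = 0 := hC 0
  have c1 : C (X 4) = 0 := hC 1
  have c2 : C (X 5) = 0 := hC 2
  have c3 : C (X 6) = 0 := hC 3
  simp [c0, c1, c2, c3]

/-- The connection on the fibre bundle is flat. -/
theorem curv_eq_zero [CompleteSpace E] (h : RealFrame k s om G rho P Q) {x : E} (hx : x ∈ s)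
    (i j : Fin 4) (u v : E) : curv k om G rho P Q i j x u v = 0 := by
  obtain ⟨X, hX, hsum⟩ := h.exists_dual hx
  have dec : ∀ u, ∃ ub uf, u = ub + uf ∧ (∀ j, om (fibIdx j) x ub = 0) ∧ om 0 x uf = 0 ∧
      om 1 x uf = 0 ∧ om 2 x uf = 0 := by
    intro u
    refine ⟨om 0 x u • X 0 + om 1 x u • X 1 + om 2 x u • X 2,
      om 3 x u • X 3 + om 4 x u • X 4 + om 5 x u • X 5 + om 6 x u • X 6, ?_, ?_, ?_, ?_, ?_⟩
    · conv_lhs => rw [hsum u, Fin.sum_univ_seven]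
      abel
    · intro j
      fin_cases j <;> simp [hX, fibIdx]
    all_goals simp [hX]
  -- With one vertical argument every entry of the curvature is `Om`, dρ or a vertical derivative of
  -- P or Q, and all of these are now known to vanish.
  have ver : ∀ v w, om 0 x w = 0 → om 1 x w = 0 → om 2 x w = 0 →
      curv k om G rho P Q i j x v w = 0 := by
    intro v w w0 w1 w2
    rw [h.curv_vertical hx i j v w w0 w1 w2]
    simp only [(h.covD_vertical hx w0 w1 w2 _ _).1, (h.covD_vertical hx w0 w1 w2 _ _).2,
      h.Om_vertical hx w0 w1 w2, h.rho_closed_vertical hx w0 w1 w2]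
    fin_cases i <;> fin_cases j <;> simp [gam]
  obtain ⟨ub, uf, rfl, hub, u0, u1, u2⟩ := dec u
  obtain ⟨vb, vf, rfl, hvb, v0, v1, v2⟩ := dec v
  have c1 := h.curv_horizontal hx hub hvb i j
  have c2 := ver ub vf v0 v1 v2
  have c3 := ver uf vf v0 v1 v2
  have c4 := ver vb uf u0 u1 u2
  rw [curv_swap] at c4
  simp only [curv, dOne_add_vectors, map_add, Fin.sum_univ_four] at c1 c2 c3 c4 ⊢
  linear_combination c1 + c2 + c3 - c4

end RealFrame

end

end G2ERP

namespace G2ERP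

noncomputable section

/-! ### Two-forms on `ℝ⁴` -/

theorem comp_pair {V W F : Type*} [NormedAddCommGroup V] [NormedSpace ℝ V]
    [NormedAddCommGroup W] [NormedSpace ℝ W] [NormedAddCommGroup F] [NormedSpace ℝ F]
    (α : W [⋀^Fin 2]→L[ℝ] F) (h : V →L[ℝ] W) (v w : V) :
    α.compContinuousLinearMap h ![v, w] = α ![h v, h w] := by
  change α (h ∘ ![v, w]) = _
  congr 1
  funext i
  fin_cases i <;> rfl

theorem alt_pair_add_left {V F : Type*} [NormedAddCommGroup V] [NormedSpace ℝ V]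
    [NormedAddCommGroup F] [NormedSpace ℝ F] (α : V [⋀^Fin 2]→L[ℝ] F) (v v' w : V) :
    α ![v + v', w] = α ![v, w] + α ![v', w] := by
  have u : ∀ a : V, Function.update ![0, w] 0 a = ![a, w] := fun a => by
    funext i
    fin_cases i <;> simp
  have := α.map_update_add ![0, w] 0 v v'
  rwa [u, u, u] at this

theorem alt_pair_smul_left {V F : Type*} [NormedAddCommGroup V] [NormedSpace ℝ V]
    [NormedAddCommGroup F] [NormedSpace ℝ F] (α : V [⋀^Fin 2]→L[ℝ] F) (c : ℝ) (v w : V) :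
    α ![c • v, w] = c • α ![v, w] := by
  have u : ∀ a : V, Function.update ![0, w] 0 a = ![a, w] := fun a => by
    funext i
    fin_cases i <;> simp
  have := α.map_update_smul ![0, w] 0 c v
  rwa [u, u] at this

theorem alt_pair_swap {V F : Type*} [NormedAddCommGroup V] [NormedSpace ℝ V]
    [NormedAddCommGroup F] [NormedSpace ℝ F] (α : V [⋀^Fin 2]→L[ℝ] F) (v w : V) :
    α ![w, v] = -α ![v, w] := by
  have := α.toAlternatingMap.map_swap ![v, w] (i := 0) (j := 1) (by simp)
  refine Eq.trans ?_ this
  change α _ = α _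
  congr 1
  funext i
  fin_cases i <;> rfl

theorem alt_pair_self {V F : Type*} [NormedAddCommGroup V] [NormedSpace ℝ V]
    [NormedAddCommGroup F] [NormedSpace ℝ F] (α : V [⋀^Fin 2]→L[ℝ] F) (v : V) :
    α ![v, v] = 0 :=
  α.map_eq_zero_of_eq ![v, v] (i := 0) (j := 1) rfl (by simp)

theorem alt_pair_add_right {V F : Type*} [NormedAddCommGroup V] [NormedSpace ℝ V]
    [NormedAddCommGroup F] [NormedSpace ℝ F] (α : V [⋀^Fin 2]→L[ℝ] F) (v w w' : V) :
    α ![v, w + w'] = α ![v, w] + α ![v, w'] := by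
  rw [alt_pair_swap, alt_pair_add_left, alt_pair_swap α v w, alt_pair_swap α v w']
  abel

theorem alt_pair_smul_right {V F : Type*} [NormedAddCommGroup V] [NormedSpace ℝ V]
    [NormedAddCommGroup F] [NormedSpace ℝ F] (α : V [⋀^Fin 2]→L[ℝ] F) (c : ℝ) (v w : V) :
    α ![v, c • w] = c • α ![v, w] := by
  rw [alt_pair_swap, alt_pair_smul_left, alt_pair_swap α v w, smul_neg, neg_neg]

/-- The matrix of a `2`-form. -/
def co (α : Lam2) (i j : Fin 4) : ℝ := α ![stdVec i, stdVec j]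

theorem co_swap (α : Lam2) (i j : Fin 4) : co α j i = -co α i j := alt_pair_swap α _ _

theorem co_self (α : Lam2) (i : Fin 4) : co α i i = 0 := alt_pair_self α _

theorem vec4_eq (v : Fin 4 → ℝ) :
    v = v 0 • stdVec 0 + v 1 • stdVec 1 + v 2 • stdVec 2 + v 3 • stdVec 3 := by
  funext i
  fin_cases i <;> simp [stdVec]

theorem lam2_apply (α : Lam2) (v w : Fin 4 → ℝ) :
    α ![v, w] = co α 0 1 * (v 0 * w 1 - v 1 * w 0) + co α 0 2 * (v 0 * w 2 - v 2 * w 0)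
      + co α 0 3 * (v 0 * w 3 - v 3 * w 0) + co α 1 2 * (v 1 * w 2 - v 2 * w 1)
      + co α 1 3 * (v 1 * w 3 - v 3 * w 1) + co α 2 3 * (v 2 * w 3 - v 3 * w 2) := by
  conv_lhs => rw [vec4_eq v, vec4_eq w]
  simp only [alt_pair_add_left, alt_pair_add_right, alt_pair_smul_left, alt_pair_smul_right]
  have e : ∀ i j, α ![stdVec i, stdVec j] = co α i j := fun _ _ => rfl
  simp only [e, co_self, co_swap α 0 1, co_swap α 0 2, co_swap α 0 3, co_swap α 1 2, co_swap α 1 3,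
    co_swap α 2 3, smul_eq_mul]
  ring

theorem vec2_eta {V : Type*} (v : Fin 2 → V) : v = ![v 0, v 1] := by
  funext i
  fin_cases i <;> rfl

theorem lam2_ext {α β : Lam2} (h01 : co α 0 1 = co β 0 1) (h02 : co α 0 2 = co β 0 2)
    (h03 : co α 0 3 = co β 0 3) (h12 : co α 1 2 = co β 1 2) (h13 : co α 1 3 = co β 1 3)
    (h23 : co α 2 3 = co β 2 3) : α = β := by
  ext v
  rw [vec2_eta v, lam2_apply, lam2_apply, h01, h02, h03, h12, h13, h23]

theorem co_add (α β : Lam2) (i j : Fin 4) : co (α + β) i j = co α i j + co β i j := rfl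
theorem co_sub (α β : Lam2) (i j : Fin 4) : co (α - β) i j = co α i j - co β i j := rfl
theorem co_neg (α : Lam2) (i j : Fin 4) : co (-α) i j = -co α i j := rfl
theorem co_smul (c : ℝ) (α : Lam2) (i j : Fin 4) : co (c • α) i j = c * co α i j := rfl

theorem dx2_apply {n : ℕ} (i j : Fin n) (v w : Fin n → ℝ) :
    dx ![i, j] ![v, w] = v i * w j - v j * w i := by
  change Matrix.det (Matrix.of fun a b => ![v, w] a (![i, j] b)) = _
  rw [Matrix.det_fin_two]
  simp

theorem dx3_apply {n : ℕ} (i j k : Fin n) (u v w : Fin n → ℝ) :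
    dx ![i, j, k] ![u, v, w] = u i * v j * w k - u i * v k * w j - u j * v i * w k
      + u j * v k * w i + u k * v i * w j - u k * v j * w i := by
  change Matrix.det (Matrix.of fun a b => ![u, v, w] a (![i, j, k] b)) = _
  rw [Matrix.det_fin_three]
  simp

theorem co_dx (i j a b : Fin 4) : co (dx ![i, j]) a b =
    (stdVec a : Fin 4 → ℝ) i * (stdVec b : Fin 4 → ℝ) j
      - (stdVec a : Fin 4 → ℝ) j * (stdVec b : Fin 4 → ℝ) i := dx2_apply i j _ _

theorem pair_eq (α β : Lam2) : pair α β = (1 / 2) * (co α 0 1 * co β 2 3 - co α 0 2 * co β 1 3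
    + co α 0 3 * co β 1 2 + co α 1 2 * co β 0 3 - co α 1 3 * co β 0 2 + co α 2 3 * co β 0 1) := by
  have e : ∀ (γ : Lam2) (i j : Fin 4), γ ![stdVec i, stdVec j] = co γ i j := fun _ _ _ => rfl
  have e2 : ∀ f : Fin 2 → Fin 4, β (fun i => stdVec (f i)) = co β (f 0) (f 1) := fun f => by
    rw [vec2_eta fun i => stdVec (f i)]
    rfl
  simp only [pair, wedge2]
  simp only [e2]
  simp only [e]
  change 1 / 2 * (1 / 2 * ∑ x : Fin 4, ∑ y : Fin 3, (-1 : ℝ) ^ ((x : ℕ) + (y : ℕ)) *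
    (co α x (x.succAbove y) *
      co β (x.succAbove (y.succAbove 0)) (x.succAbove (y.succAbove 1)))) = _
  simp only [Fin.sum_univ_four, Fin.sum_univ_three]
  have s00 : (0 : Fin 4).succAbove 0 = 1 := rfl
  have s01 : (0 : Fin 4).succAbove 1 = 2 := rfl
  have s02 : (0 : Fin 4).succAbove 2 = 3 := rfl
  have s10 : (1 : Fin 4).succAbove 0 = 0 := rfl
  have s11 : (1 : Fin 4).succAbove 1 = 2 := rfl
  have s12 : (1 : Fin 4).succAbove 2 = 3 := rfl
  have s20 : (2 : Fin 4).succAbove 0 = 0 := rfl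
  have s21 : (2 : Fin 4).succAbove 1 = 1 := rfl
  have s22 : (2 : Fin 4).succAbove 2 = 3 := rfl
  have s30 : (3 : Fin 4).succAbove 0 = 0 := rfl
  have s31 : (3 : Fin 4).succAbove 1 = 1 := rfl
  have s32 : (3 : Fin 4).succAbove 2 = 2 := rfl
  have t00 : (0 : Fin 3).succAbove 0 = 1 := rfl
  have t01 : (0 : Fin 3).succAbove 1 = 2 := rfl
  have t10 : (1 : Fin 3).succAbove 0 = 0 := rfl
  have t11 : (1 : Fin 3).succAbove 1 = 2 := rfl
  have t20 : (2 : Fin 3).succAbove 0 = 0 := rfl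
  have t21 : (2 : Fin 3).succAbove 1 = 1 := rfl
  simp only [s00, s01, s02, s10, s11, s12, s20, s21, s22, s30, s31, s32, t00, t01, t10, t11, t20,
    t21]
  simp only [co_swap _ 0 1, co_swap _ 0 2, co_swap _ 0 3, co_swap _ 1 2, co_swap _ 1 3,
    co_swap _ 2 3]
  norm_num [Fin.val_zero, Fin.val_one, Fin.val_two]
  ring

theorem pair_add_left (α α' β : Lam2) : pair (α + α') β = pair α β + pair α' β := by
  simp only [pair_eq, co_add]; ring
theorem pair_add_right (α β β' : Lam2) : pair α (β + β') = pair α β + pair α β' := by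
  simp only [pair_eq, co_add]; ring
theorem pair_smul_left (c : ℝ) (α β : Lam2) : pair (c • α) β = c * pair α β := by
  simp only [pair_eq, co_smul]; ring
theorem pair_smul_right (c : ℝ) (α β : Lam2) : pair α (c • β) = c * pair α β := by
  simp only [pair_eq, co_smul]; ring
theorem pair_comm (α β : Lam2) : pair α β = pair β α := by
  simp only [pair_eq]; ring
theorem pair_neg_left (α β : Lam2) : pair (-α) β = -pair α β := by
  simp only [pair_eq, co_neg]; ring
theorem pair_sub_left (α α' β : Lam2) : pair (α - α') β = pair α β - pair α' β := by
  simp only [pair_eq, co_sub]; ring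

/-- The matrix of a `2`-form, as a linear map. -/
def coL : Lam2 →ₗ[ℝ] Fin 4 → Fin 4 → ℝ where
  toFun := co
  map_add' _ _ := rfl
  map_smul' _ _ := rfl

instance : FiniteDimensional ℝ Lam2 :=
  FiniteDimensional.of_injective coL fun α β h => by
    have e : ∀ i j, co α i j = co β i j := fun i j => congrFun (congrFun h i) j
    exact lam2_ext (e _ _) (e _ _) (e _ _) (e _ _) (e _ _) (e _ _)

/-- `pair` as a continuous bilinear map. -/
def pairL : Lam2 →L[ℝ] Lam2 →L[ℝ] ℝ :=
  LinearMap.toContinuousLinearMap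
    { toFun := fun α => LinearMap.toContinuousLinearMap
        { toFun := fun β => pair α β
          map_add' := pair_add_right α
          map_smul' := fun c β => pair_smul_right c α β }
      map_add' := fun α α' => by ext β; exact pair_add_left α α' β
      map_smul' := fun c α => by ext β; exact pair_smul_left c α β }

theorem pairL_apply (α β : Lam2) : pairL α β = pair α β := rfl

theorem co_comp (α : Lam2) (h : (Fin 4 → ℝ) →L[ℝ] (Fin 4 → ℝ)) (i j : Fin 4) :
    co (α.compContinuousLinearMap h) i j = α ![h (stdVec i), h (stdVec j)] := comp_pair α h _ _

/-- The pairing is the coefficient of a top-degree form, on which pullback acts by the determinant.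
Unimodular maps are therefore isometries of ℝ^{3,3}. -/
theorem pair_comp (α β : Lam2) (h : (Fin 4 → ℝ) →L[ℝ] (Fin 4 → ℝ)) :
    pair (α.compContinuousLinearMap h) (β.compContinuousLinearMap h) =
      Matrix.det (Matrix.of fun i j => h (stdVec i) j) * pair α β := by
  rw [pair_eq, pair_eq]
  simp only [co_comp, lam2_apply]
  rw [Matrix.det_succ_row_zero]
  simp only [Fin.sum_univ_four, Matrix.det_fin_three, Matrix.submatrix_apply, Matrix.of_apply]
  have s00 : (0 : Fin 4).succAbove 0 = 1 := rfl
  have s01 : (0 : Fin 4).succAbove 1 = 2 := rfl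
  have s02 : (0 : Fin 4).succAbove 2 = 3 := rfl
  have s10 : (1 : Fin 4).succAbove 0 = 0 := rfl
  have s11 : (1 : Fin 4).succAbove 1 = 2 := rfl
  have s12 : (1 : Fin 4).succAbove 2 = 3 := rfl
  have s20 : (2 : Fin 4).succAbove 0 = 0 := rfl
  have s21 : (2 : Fin 4).succAbove 1 = 1 := rfl
  have s22 : (2 : Fin 4).succAbove 2 = 3 := rfl
  have s30 : (3 : Fin 4).succAbove 0 = 0 := rfl
  have s31 : (3 : Fin 4).succAbove 1 = 1 := rfl
  have s32 : (3 : Fin 4).succAbove 2 = 2 := rfl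
  have r0 : Fin.succ (0 : Fin 3) = 1 := rfl
  have r1 : Fin.succ (1 : Fin 3) = 2 := rfl
  have r2 : Fin.succ (2 : Fin 3) = 3 := rfl
  simp only [s00, s01, s02, s10, s11, s12, s20, s21, s22, s30, s31, s32, r0, r1, r2]
  simp only [Fin.val_zero, Fin.val_one, Fin.val_two, show ((3 : Fin 4) : ℕ) = 3 from rfl]
  generalize h (stdVec 0) = a
  generalize h (stdVec 1) = b
  generalize h (stdVec 2) = c
  generalize h (stdVec 3) = d
  ring

/-- The distinguished vector of square norm `-1`. -/
def negU : Lam2 := dx ![0, 1] - dx ![2, 3]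
/-- The first of two vectors that complete `negU`, `posBasis` to an orthonormal basis. -/
def negN1 : Lam2 := dx ![0, 2] + dx ![1, 3]
/-- The second of two vectors that complete `negU`, `posBasis` to an orthonormal basis. -/
def negN2 : Lam2 := dx ![0, 3] - dx ![1, 2]

theorem posBasis_zero : posBasis 0 = dx ![0, 1] + dx ![2, 3] := rfl
theorem posBasis_one : posBasis 1 = dx ![0, 2] - dx ![1, 3] := rfl
theorem posBasis_two : posBasis 2 = -(dx ![0, 3] + dx ![1, 2]) := rfl

theorem pair_negU : pair negU negU = -1 := by
  simp [pair_eq, negU, co_sub, co_dx, stdVec]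
  norm_num

theorem pair_posBasis (a b : Fin 3) : pair (posBasis a) (posBasis b) = if a = b then 1 else 0 := by
  fin_cases a <;> fin_cases b <;>
    simp [pair_eq, posBasis, co_sub, co_add, co_neg, co_dx, stdVec] <;> norm_num

theorem pair_negU_posBasis (a : Fin 3) : pair negU (posBasis a) = 0 := by
  fin_cases a <;>
    simp [pair_eq, posBasis, negU, co_sub, co_add, co_neg, co_dx, stdVec]

/-- The infinitesimal action of a `4 × 4` matrix on `2`-forms. -/
theorem gam_act_negU (G : Fin 3 → ℝ) (r : ℝ) (w p q : Fin 3 → ℝ) (v v' : Fin 4 → ℝ) :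
    -(negU ![(gam G r w p q).mulVec v, v'] + negU ![v, (gam G r w p q).mulVec v']) =
      2 * ∑ a, w a * posBasis a ![v, v'] := by
  simp only [lam2_apply]
  simp [Fin.sum_univ_three, posBasis, negU, co_sub, co_add, co_neg, co_dx, stdVec,
    Matrix.mulVec, dotProduct, Fin.sum_univ_four, gam]
  ring

/-- The action of `gam` as an infinitesimal isometry of ℝ^{3,3}: w exchanges `negU` with the
positive vectors, G rotates these among themselves, and p, q exchange them with `negN2`, `negN1`.
Applied to a parallel frame this becomes the system of frame equations with P, Q as second
fundamental form. -/
theorem gam_act_posBasis (G : Fin 3 → ℝ) (r : ℝ) (w p q : Fin 3 → ℝ) (v v' : Fin 4 → ℝ)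
    (a : Fin 3) :
    -(posBasis a ![(gam G r w p q).mulVec v, v'] + posBasis a ![v, (gam G r w p q).mulVec v']) =
      2 * w a * negU ![v, v'] + G (a + 2) * posBasis (a + 1) ![v, v']
        - G (a + 1) * posBasis (a + 2) ![v, v'] + 2 * p a * negN2 ![v, v']
        + 2 * q a * negN1 ![v, v'] := by
  have e0 : (0 : Fin 3) + 1 = 1 := rfl
  have e1 : (0 : Fin 3) + 2 = 2 := rfl
  have e2 : (1 : Fin 3) + 1 = 2 := rfl
  have e3 : (1 : Fin 3) + 2 = 0 := rfl
  have e4 : (2 : Fin 3) + 1 = 0 := rfl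
  have e5 : (2 : Fin 3) + 2 = 1 := rfl
  simp only [lam2_apply]
  fin_cases a <;>
  simp [e0, e1, e2, e3, e4, e5, posBasis, negU, negN1, negN2, co_sub, co_add, co_neg, co_dx, stdVec,
    Matrix.mulVec, dotProduct, Fin.sum_univ_four, gam] <;>
  ring

end

end G2ERP

/-! ### The tautological two-form and the three-form of an immersion. -/

namespace G2ERP

noncomputable section

theorem mfderiv_clm_comp {E : Type*} [NormedAddCommGroup E] [NormedSpace ℝ E]
    {H : Type*} [TopologicalSpace H] {I : ModelWithCorners ℝ E H}
    {M : Type*} [TopologicalSpace M] [ChartedSpace H M]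
    {V W : Type*} [NormedAddCommGroup V] [NormedSpace ℝ V] [NormedAddCommGroup W] [NormedSpace ℝ W]
    (L : V →L[ℝ] W) {f : M → V} {x : M} (hf : MDifferentiableAt I 𝓘(ℝ, V) f x)
    (v : TangentSpace I x) :
    mfderiv I 𝓘(ℝ, W) (fun y => L (f y)) x v = L (mfderiv I 𝓘(ℝ, V) f x v) := by
  have h := mfderiv_comp (I := I) (I' := 𝓘(ℝ, V)) (I'' := 𝓘(ℝ, W)) x
    (L.mdifferentiableAt (x := f x)) hf
  have h2 := DFunLike.congr_fun h v
  rw [L.mfderiv_eq] at h2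
  exact h2

/-- The tautological `2`-form on the product of `Lam2` with `ℝ⁴`. -/
def betaTaut (z : Lam2 × (Fin 4 → ℝ)) : (Lam2 × (Fin 4 → ℝ)) [⋀^Fin 2]→L[ℝ] ℝ :=
  z.1.compContinuousLinearMap (ContinuousLinearMap.snd ℝ Lam2 (Fin 4 → ℝ))

theorem betaTaut_apply (z : Lam2 × (Fin 4 → ℝ)) (v : Fin 2 → Lam2 × (Fin 4 → ℝ)) :
    betaTaut z v = z.1 ![(v 0).2, (v 1).2] := by
  change z.1 (fun i => (v i).2) = _
  rw [vec2_eta fun i => (v i).2]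

/-- Evaluation of a `2`-form, as a continuous linear map. -/
def evL (v : Fin 2 → Fin 4 → ℝ) : Lam2 →L[ℝ] ℝ :=
  LinearMap.toContinuousLinearMap
    { toFun := fun α => α v
      map_add' := fun _ _ => rfl
      map_smul' := fun _ _ => rfl }

theorem contDiff_betaTaut : ContDiff ℝ ∞ betaTaut :=
  contDiff_iff_contDiffAt.2 fun z => contDiffAt_alternating_of_apply fun v => by
    simp only [betaTaut_apply]
    exact ((evL ![(v 0).2, (v 1).2]).contDiff.comp contDiff_fst).contDiffAt

/-- The tautological form is linear in the `Lam2`-factor and independent of the point of ℝ⁴. Its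
derivative inserts the `Lam2`-component of each argument in turn. -/
theorem extDeriv_betaTaut (z : Lam2 × (Fin 4 → ℝ)) (v : Fin 3 → Lam2 × (Fin 4 → ℝ)) :
    extDeriv betaTaut z v = (v 0).1 ![(v 1).2, (v 2).2] - (v 1).1 ![(v 0).2, (v 2).2]
      + (v 2).1 ![(v 0).2, (v 1).2] := by
  rw [extDeriv_apply (contDiff_betaTaut.contDiffAt.differentiableAt (by simp)),
    Fin.sum_univ_three]
  have key : ∀ (a b : Lam2 × (Fin 4 → ℝ)) (w : Fin 2 → Lam2 × (Fin 4 → ℝ)) (c), w 0 = a → w 1 = b →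
      fderiv ℝ (fun x => betaTaut x w) z c = c.1 ![a.2, b.2] := by
    rintro a b w c rfl rfl
    have : (fun x => betaTaut x w) = fun x => ((evL ![(w 0).2, (w 1).2]).comp
        (ContinuousLinearMap.fst ℝ Lam2 (Fin 4 → ℝ))) x := funext fun x => betaTaut_apply x w
    rw [this, ContinuousLinearMap.fderiv]
    rfl
  rw [key (v 1) (v 2) _ _ rfl rfl, key (v 0) (v 2) _ _ rfl rfl, key (v 0) (v 1) _ _ rfl rfl]
  simp
  ring

section

variable {B : Type*} [TopologicalSpace B] [ChartedSpace (EuclideanSpace ℝ (Fin 3)) B]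

/-- The map that pulls `betaTaut` back to `tautForm u`. -/
def tautMap (u : B → Lam2) (p : B × (Fin 4 → ℝ)) : Lam2 × (Fin 4 → ℝ) := (u p.1, p.2)

variable {u : B → Lam2}

theorem contMDiff_tautMap (hu : ContMDiff (𝓡 3) 𝓘(ℝ, Lam2) ∞ u) :
    ContMDiff modelBR4 𝓘(ℝ, Lam2 × (Fin 4 → ℝ)) ∞ (tautMap u) :=
  (hu.comp contMDiff_fst).prodMk_space contMDiff_snd

theorem mfderiv_tautMap (hu : ContMDiff (𝓡 3) 𝓘(ℝ, Lam2) ∞ u) (p : B × (Fin 4 → ℝ))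
    (v : TangentSpace modelBR4 p) :
    mfderiv modelBR4 𝓘(ℝ, Lam2 × (Fin 4 → ℝ)) (tautMap u) p v = (du u p.1 v.1, v.2) := by
  have hf := (contMDiff_tautMap hu).mdifferentiableAt (x := p) (by simp)
  have h1 := mfderiv_clm_comp (ContinuousLinearMap.fst ℝ Lam2 (Fin 4 → ℝ)) hf v
  have h2 := mfderiv_clm_comp (ContinuousLinearMap.snd ℝ Lam2 (Fin 4 → ℝ)) hf v
  have h3 := mfderiv_comp (I := modelBR4) (I' := 𝓡 3) (I'' := 𝓘(ℝ, Lam2)) p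
    (hu.mdifferentiableAt (x := p.1) (by simp)) mdifferentiableAt_fst
  have h4 := DFunLike.congr_fun h3 v
  rw [mfderiv_fst] at h4
  have h5 := DFunLike.congr_fun (mfderiv_snd (I := 𝓡 3) (I' := 𝓘(ℝ, Fin 4 → ℝ)) (x := p)) v
  exact Prod.ext (h1.symm.trans h4) (h2.symm.trans h5)

theorem tautForm_eq_pullback (hu : ContMDiff (𝓡 3) 𝓘(ℝ, Lam2) ∞ u) (p : B × (Fin 4 → ℝ)) :
    tautForm u p = (betaTaut (tautMap u p)).compContinuousLinearMap
      (mfderiv modelBR4 𝓘(ℝ, Lam2 × (Fin 4 → ℝ)) (tautMap u) p) := by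
  ext v
  have h5 := fun w => DFunLike.congr_fun
    (mfderiv_snd (I := 𝓡 3) (I' := 𝓘(ℝ, Fin 4 → ℝ)) (x := p)) w
  have e := fun i => congrArg Prod.snd (mfderiv_tautMap hu p (v i))
  refine Eq.trans ?_ ((betaTaut_apply (tautMap u p) fun i =>
    mfderiv modelBR4 𝓘(ℝ, Lam2 × (Fin 4 → ℝ)) (tautMap u) p (v i)).trans
    (congrArg₂ (fun a b => u p.1 ![a, b]) (e 0) (e 1))).symm
  refine congrArg (u p.1) (funext fun i => ?_)
  fin_cases i
  exacts [h5 _, h5 _]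

theorem tautForm_apply (p : B × (Fin 4 → ℝ)) (v w : TangentSpace modelBR4 p) :
    tautForm u p ![v, w] = u p.1 ![v.2, w.2] := by
  have h5 := fun w => DFunLike.congr_fun
    (mfderiv_snd (I := 𝓡 3) (I' := 𝓘(ℝ, Fin 4 → ℝ)) (x := p)) w
  refine congrArg (u p.1) (funext fun i => ?_)
  fin_cases i
  exacts [h5 _, h5 _]

/-- The volume form in terms of an oriented orthonormal coframe. -/
theorem volForm_apply {b : B} {lam : Fin 3 → EuclideanSpace ℝ (Fin 3) →L[ℝ] ℝ} {f : Fin 3 → Lam2}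
    (hf : ∀ a c, pair (f a) (f c) = if a = c then 1 else 0) (ho : 0 < orient f)
    (hd : ∀ v : EuclideanSpace ℝ (Fin 3), du u b v = ∑ a, lam a v • f a)
    (v : Fin 3 → EuclideanSpace ℝ (Fin 3)) :
    volForm u b v = Matrix.det (Matrix.of fun i a => lam a (v i)) := by
  let cv : Fin 3 → EuclideanSpace ℝ (Fin 3) := fun i => EuclideanSpace.single i 1
  let L : Matrix (Fin 3) (Fin 3) ℝ := Matrix.of fun i a => lam a (cv i)
  have hd' : ∀ i, du u b (coordVec b i) = ∑ a, lam a (cv i) • f a := fun i => hd (cv i)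
  have h1 : orient (fun i => du u b (coordVec b i)) = L.det * orient f := by
    rw [orient, orient, ← Matrix.det_mul]
    congr 1
    ext i j
    simp only [Matrix.of_apply, Matrix.mul_apply, hd', L, ← pairL_apply]
    simp
  have h2 : Matrix.of (fun i j => pullMetric u b (coordVec b i) (coordVec b j)) =
      L * L.transpose := by
    ext i j
    simp only [Matrix.of_apply, Matrix.mul_apply, pullMetric, hd', L, Matrix.transpose_apply,
      ← pairL_apply]
    simp only [map_sum, map_smul, sum_apply, smul_apply, pairL_apply, hf, smul_eq_mul]
    simp [mul_comm]
  have h3 : Matrix.of (fun i a => lam a (v i)) =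
      Matrix.of (fun i j => v i j) * L := by
    ext i a
    have : v i = ∑ j, v i j • cv j := by
      have := (EuclideanSpace.basisFun (Fin 3) ℝ).sum_repr (v i)
      simpa [cv] using this.symm
    rw [Matrix.mul_apply, Matrix.of_apply]
    conv_lhs => rw [this]
    simp [L]
  have h4 : (dx ![0, 1, 2]).compContinuousLinearMap
      (EuclideanSpace.equiv (Fin 3) ℝ : EuclideanSpace ℝ (Fin 3) →L[ℝ] (Fin 3 → ℝ)) v =
      Matrix.det (Matrix.of (fun i j => v i j)) := by
    change Matrix.det (Matrix.of fun a b => v a (![0, 1, 2] b)) = _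
    congr 1
    ext i j
    fin_cases j <;> rfl
  change ((SignType.sign (orient fun i => du u b (coordVec b i)) : ℝ) *
    √(Matrix.det (Matrix.of fun i j => pullMetric u b (coordVec b i) (coordVec b j)))) *
    (dx ![0, 1, 2]).compContinuousLinearMap
      (EuclideanSpace.equiv (Fin 3) ℝ : EuclideanSpace ℝ (Fin 3) →L[ℝ] (Fin 3 → ℝ)) v = _
  rw [h1, h2, Matrix.det_mul, Matrix.det_transpose, h3, Matrix.det_mul, h4,
      Real.sqrt_mul_self_eq_abs,
    mul_comm]
  congr 1
  rw [sign_mul, sign_pos ho, mul_one]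
  -- The Gram matrix is L Lᵀ, whose determinant has square root |det L|. The sign of the orientation
  -- number, which is that of det L because `f` is positive, restores det L.
  rcases lt_trichotomy L.det 0 with h | h | h
  · rw [sign_neg h, abs_of_neg h]; simp
  · rw [h]; simp
  · rw [sign_pos h, abs_of_pos h]; simp

variable [IsManifold (𝓡 3) ∞ B]

theorem tautForm_d_eq (hu : ContMDiff (𝓡 3) 𝓘(ℝ, Lam2) ∞ u) (p : B × (Fin 4 → ℝ)) :
    (tautForm u).d modelBR4 p = (extDeriv betaTaut (tautMap u p)).compContinuousLinearMap
      (mfderiv modelBR4 𝓘(ℝ, Lam2 × (Fin 4 → ℝ)) (tautMap u) p) :=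
  d_eq_of_pullback (contMDiff_tautMap hu).contMDiffAt
    (contDiff_betaTaut.contDiffAt.differentiableAt (by simp))
    (Filter.Eventually.of_forall (tautForm_eq_pullback hu))

theorem tautForm_d_apply (hu : ContMDiff (𝓡 3) 𝓘(ℝ, Lam2) ∞ u) (p : B × (Fin 4 → ℝ))
    (v : Fin 3 → TangentSpace modelBR4 p) :
    (tautForm u).d modelBR4 p v = du u p.1 (v 0).1 ![(v 1).2, (v 2).2]
      - du u p.1 (v 1).1 ![(v 0).2, (v 2).2] + du u p.1 (v 2).1 ![(v 0).2, (v 1).2] := by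
  rw [tautForm_d_eq hu]
  have e1 := fun i => congrArg Prod.fst (mfderiv_tautMap hu p (v i))
  have e2 := fun i => congrArg Prod.snd (mfderiv_tautMap hu p (v i))
  refine (extDeriv_betaTaut (tautMap u p)
    (fun i => mfderiv modelBR4 𝓘(ℝ, Lam2 × (Fin 4 → ℝ)) (tautMap u) p (v i))).trans ?_
  have e : ∀ i j l, _ = du u p.1 (v i).1 ![(v j).2, (v l).2] := fun i j l =>
    congr (congrArg DFunLike.coe (e1 i)) (congrArg₂ (fun a b => ![a, b]) (e2 j) (e2 l))
  exact congrArg₂ (· + ·) (congrArg₂ (· - ·) (e 0 1 2) (e 1 0 2)) (e 2 0 1)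

theorem baragliaForm_apply (c : ℝ) (hu : ContMDiff (𝓡 3) 𝓘(ℝ, Lam2) ∞ u) (p : B × (Fin 4 → ℝ))
    (v : Fin 3 → TangentSpace modelBR4 p) :
    baragliaForm c u p v = c * volForm u p.1 (fun i => (v i).1) +
      (du u p.1 (v 0).1 ![(v 1).2, (v 2).2]
      - du u p.1 (v 1).1 ![(v 0).2, (v 2).2] + du u p.1 (v 2).1 ![(v 0).2, (v 1).2]) := by
  rw [← tautForm_d_apply hu]
  have h5 := fun w => DFunLike.congr_fun
    (mfderiv_fst (I := 𝓡 3) (I' := 𝓘(ℝ, Fin 4 → ℝ)) (x := p)) w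
  refine congrArg (fun t => c * t + (tautForm u).d modelBR4 p v)
    (congrArg (volForm u p.1) (funext fun i => h5 (v i)))

end

end

end G2ERP

/-! ### Flat fibre coordinates and the position vector. -/

namespace G2ERP

noncomputable section

open Metric

variable {E : Type*} [NormedAddCommGroup E] [NormedSpace ℝ E]

theorem dOne_smulRight {F : Type*} [NormedAddCommGroup F] [NormedSpace ℝ F] {α : E → E →L[ℝ] ℝ}
    {x : E} (hα : DifferentiableAt ℝ α x) (c : F) (v w : E) :
    dOne (fun y => (α y).smulRight c) x v w = dOne α x v w • c := by
  have h : HasFDerivAt (fun y => (α y).smulRight c)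
      (((ContinuousLinearMap.smulRightL ℝ E F).flip c).comp (fderiv ℝ α x)) x :=
    ((ContinuousLinearMap.smulRightL ℝ E F).flip c).hasFDerivAt.comp x hα.hasFDerivAt
  rw [dOne, dOne, h.fderiv, sub_smul]
  rfl

theorem differentiableAt_smulRight {F : Type*} [NormedAddCommGroup F] [NormedSpace ℝ F]
    {α : E → E →L[ℝ] ℝ} {x : E} (hα : DifferentiableAt ℝ α x) (c : F) :
    DifferentiableAt ℝ (fun y => (α y).smulRight c) x :=
  ((ContinuousLinearMap.smulRightL ℝ E F).flip c).differentiableAt.comp x hα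

theorem contDiffOn_smulRight {F : Type*} [NormedAddCommGroup F] [NormedSpace ℝ F]
    {α : E → E →L[ℝ] ℝ} {s : Set E} (hα : ContDiffOn ℝ ∞ α s) (c : F) :
    ContDiffOn ℝ ∞ (fun y => (α y).smulRight c) s :=
  ((ContinuousLinearMap.smulRightL ℝ E F).flip c).contDiff.comp_contDiffOn hα

/-- Matrix units, as endomorphisms of `ℝ⁴`. -/
def unitL (i j : Fin 4) : (Fin 4 → ℝ) →L[ℝ] (Fin 4 → ℝ) :=
  (ContinuousLinearMap.proj j : (Fin 4 → ℝ) →L[ℝ] ℝ).smulRight (stdVec i)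

/-- The endomorphism-valued `1`-form with given matrix entries. -/
def endForm (A : Fin 4 → Fin 4 → E → E →L[ℝ] ℝ) (y : E) :
    E →L[ℝ] ((Fin 4 → ℝ) →L[ℝ] (Fin 4 → ℝ)) :=
  ∑ i, ∑ j, (A i j y).smulRight (unitL i j)

theorem sum_unitL_apply (c : Fin 4 → Fin 4 → ℝ) (z : Fin 4 → ℝ) :
    (∑ i, ∑ j, c i j • unitL i j) z = (Matrix.of c).mulVec z := by
  funext l
  simp only [sum_apply, smul_apply, unitL, ContinuousLinearMap.smulRight_apply, Matrix.mulVec,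
    dotProduct, Finset.sum_apply, Pi.smul_apply, smul_eq_mul, ContinuousLinearMap.proj_apply,
    Matrix.of_apply, stdVec, Pi.single_apply]
  simp

theorem endForm_apply (A : Fin 4 → Fin 4 → E → E →L[ℝ] ℝ) (y v : E) (z : Fin 4 → ℝ) :
    endForm A y v z = (Matrix.of fun i j => A i j y v).mulVec z := by
  rw [← sum_unitL_apply]
  simp only [endForm, sum_apply, ContinuousLinearMap.smulRight_apply]

theorem dOne_endForm {A : Fin 4 → Fin 4 → E → E →L[ℝ] ℝ} {x : E}
    (hA : ∀ i j, DifferentiableAt ℝ (A i j) x) (v w : E) (z : Fin 4 → ℝ) :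
    dOne (endForm A) x v w z = (Matrix.of fun i j => dOne (A i j) x v w).mulVec z := by
  rw [← sum_unitL_apply]
  change dOne (fun y => ∑ i, ∑ j, (A i j y).smulRight (unitL i j)) x v w z = _
  rw [dOne_sum _ fun i _ => DifferentiableAt.fun_sum fun j _ => differentiableAt_smulRight (hA i
      j) _]
  congr 2
  funext i
  rw [dOne_sum _ fun j _ => differentiableAt_smulRight (hA i j) _]
  exact Finset.sum_congr rfl fun j _ => dOne_smulRight (hA i j) _ v w

theorem fderiv_alt_pair (α : Lam2) {a b : E → Fin 4 → ℝ} {a' b' : E →L[ℝ] (Fin 4 → ℝ)} {x : E}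
    (ha : HasFDerivAt a a' x) (hb : HasFDerivAt b b' x) (v : E) :
    fderiv ℝ (fun y => α ![a y, b y]) x v = α ![a' v, b x] + α ![a x, b' v] := by
  have h2 : HasFDerivAt (fun y => ![a y, b y]) (ContinuousLinearMap.pi ![a', b']) x :=
    hasFDerivAt_pi.2 fun i => by
      fin_cases i
      exacts [ha, hb]
  have h1 := (α.toContinuousMultilinearMap.hasFDerivAt ![a x, b x]).comp x h2
  have h3 : HasFDerivAt (fun y => α ![a y, b y]) _ x := h1
  rw [h3.fderiv, ContinuousLinearMap.comp_apply, ContinuousMultilinearMap.linearDeriv_apply,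
    Fin.sum_univ_two]
  congr 1
  · change α _ = α _
    congr 1
    funext i
    fin_cases i <;> simp
  · change α _ = α _
    congr 1
    funext i
    fin_cases i <;> simp

theorem contDiffAt_comp_lam2 (α : Lam2) {h : E → (Fin 4 → ℝ) →L[ℝ] (Fin 4 → ℝ)} {x : E}
    (hh : ContDiffAt ℝ ∞ h x) : ContDiffAt ℝ ∞ (fun y => α.compContinuousLinearMap (h y)) x :=
  contDiffAt_alternating_of_apply fun v =>
    contDiffAt_alternating_apply (α := fun _ => α) (v := fun y i => h y (v i)) contDiffAt_const
      fun _ => hh.clm_apply contDiffAt_const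

theorem fderiv_comp_lam2 (α : Lam2) {h : E → (Fin 4 → ℝ) →L[ℝ] (Fin 4 → ℝ)} {x : E}
    {h' : E →L[ℝ] ((Fin 4 → ℝ) →L[ℝ] (Fin 4 → ℝ))}
    (hs : ContDiffAt ℝ ∞ h x) (hh : HasFDerivAt h h' x) (v : E) (a b : Fin 4 → ℝ) :
    fderiv ℝ (fun y => α.compContinuousLinearMap (h y)) x v ![a, b] =
      α ![h' v a, h x b] + α ![h x a, h' v b] := by
  have hd := ((contDiffAt_comp_lam2 α hs).differentiableAt (by simp)).hasFDerivAt
  have h1 := ((evL ![a, b]).hasFDerivAt.comp x hd).fderiv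
  have h2 : (evL ![a, b] ∘ fun y => α.compContinuousLinearMap (h y)) =
      fun y => α ![h y a, h y b] := funext fun y => comp_pair α (h y) a b
  rw [h2] at h1
  have h3 := DFunLike.congr_fun h1 v
  rw [fderiv_alt_pair α (hasFDerivAt_clm_apply_const hh a) (hasFDerivAt_clm_apply_const hh b)] at h3
  exact h3.symm

theorem fderiv_pair {a b : E → Lam2} {x : E} (ha : DifferentiableAt ℝ a x)
    (hb : DifferentiableAt ℝ b x) :
    DifferentiableAt ℝ (fun y => pair (a y) (b y)) x ∧ ∀ v, fderiv ℝ (fun y => pair (a y) (b y)) x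
        v =
      pair (fderiv ℝ a x v) (b x) + pair (a x) (fderiv ℝ b x v) := by
  have h : HasFDerivAt (fun y => pairL (a y) (b y)) _ x :=
    pairL.hasFDerivAt_of_bilinear ha.hasFDerivAt hb.hasFDerivAt
  refine ⟨h.differentiableAt, fun v => ?_⟩
  refine (DFunLike.congr_fun h.fderiv v).trans ?_
  rw [add_comm]
  rfl

theorem contDiffAt_pair {a b : E → Lam2} {x : E} (ha : ContDiffAt ℝ ∞ a x)
    (hb : ContDiffAt ℝ ∞ b x) : ContDiffAt ℝ ∞ (fun y => pair (a y) (b y)) x :=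
  pairL.isBoundedBilinearMap.contDiff.contDiffAt.comp₂ ha hb

variable {k : ℝ} {s : Set E} {om : Fin 7 → E → E →L[ℝ] ℝ} {G : Fin 3 → E → E →L[ℝ] ℝ}
  {rho : E → E →L[ℝ] ℝ} {P Q : Fin 3 → Fin 3 → E → ℝ}

/-- The values of the fibre forms on a vector. -/
def fibL (om : Fin 7 → E → E →L[ℝ] ℝ) (y : E) : E →L[ℝ] (Fin 4 → ℝ) :=
  ContinuousLinearMap.pi fun i => om (fibIdx i) y

/-- Flat fibre coordinates `Y` for a coframe that satisfies the structure equations, and the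
position vector `U` with its orthonormal tangent frame `f`. -/
structure FlatChart (k : ℝ) (om : Fin 7 → E → E →L[ℝ] ℝ) (G : Fin 3 → E → E →L[ℝ] ℝ)
    (P Q : Fin 3 → Fin 3 → E → ℝ) (p : E) (r : ℝ) (Y : E → Fin 4 → ℝ) (U : E → Lam2)
    (f : Fin 3 → E → Lam2) (N N' : E → Lam2) : Prop where
  pos : 0 < r
  Y_smooth : ContDiffOn ℝ ∞ Y (ball p r)
  U_smooth : ContDiffOn ℝ ∞ U (ball p r)
  f_smooth : ∀ a, ContDiffOn ℝ ∞ (f a) (ball p r)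
  U_deriv : ∀ x ∈ ball p r, ∀ v, fderiv ℝ U x v = ∑ a : Fin 3,
    (2 * k * om (Fin.castLE (by norm_num) a) x v) • f a x
  f_deriv : ∀ x ∈ ball p r, ∀ a v, fderiv ℝ (f a) x v =
    (2 * k * om (Fin.castLE (by norm_num) a) x v) • U x + G (a + 2) x v • f (a + 1) x
      - G (a + 1) x v • f (a + 2) x + (2 * chi P om a x v) • N x + (2 * chi Q om a x v) • N' x
  U_norm : ∀ x ∈ ball p r, pair (U x) (U x) = -1
  f_norm : ∀ x ∈ ball p r, ∀ a b, pair (f a x) (f b x) = if a = b then 1 else 0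
  f_base : ∀ a, f a p = posBasis a
  Y_inj : ∀ x ∈ ball p r, ∀ v, fderiv ℝ Y x v = 0 → fibL om x v = 0
  U_Y : ∀ x ∈ ball p r, ∀ v w, U x ![fderiv ℝ Y x v, fderiv ℝ Y x w] =
    (2 * k)⁻¹ * negU ![fibL om x v, fibL om x w]
  f_Y : ∀ x ∈ ball p r, ∀ a v w, f a x ![fderiv ℝ Y x v, fderiv ℝ Y x w] =
    (2 * k)⁻¹ * posBasis a ![fibL om x v, fibL om x w]

namespace RealFrame

theorem fibL_smooth (h : RealFrame k s om G rho P Q) : ContDiffOn ℝ ∞ (fibL om) s := by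
  have e : fibL om = fun y => ∑ i, (om (fibIdx i) y).smulRight (stdVec i : Fin 4 → ℝ) := by
    funext y
    ext v j
    simp [fibL, stdVec, Pi.single_apply]
  rw [e]
  exact ContDiffOn.sum fun i _ => contDiffOn_smulRight (h.om_smooth _) _

theorem fderiv_fibL (h : RealFrame k s om G rho P Q) {x : E} (hx : x ∈ s) (u v : E) :
    fderiv ℝ (fibL om) x u v - fderiv ℝ (fibL om) x v u =
      -endForm (conF k om G rho P Q) x u (fibL om x v)
        + endForm (conF k om G rho P Q) x v (fibL om x u) := by
  have hd := (diffAt h.isOpen h.fibL_smooth hx).hasFDerivAt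
  have e : ∀ i u v, fderiv ℝ (fibL om) x u v i = fderiv ℝ (om (fibIdx i)) x u v := by
    intro i u v
    have h1 : HasFDerivAt (fun y => fibL om y v i) _ x :=
      (ContinuousLinearMap.proj i : (Fin 4 → ℝ) →L[ℝ] ℝ).hasFDerivAt.comp x
        (hasFDerivAt_clm_apply_const hd v)
    have h2 := hasFDerivAt_clm_apply_const
      (diffAt h.isOpen (h.om_smooth (fibIdx i)) hx).hasFDerivAt v
    exact DFunLike.congr_fun (h1.unique h2) u
  funext i
  have hf := h.dOne_fib hx i u v
  rw [dOne] at hf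
  simp only [endForm_apply, Pi.sub_apply, Pi.add_apply, Pi.neg_apply, e, hf, Matrix.mulVec,
    dotProduct, Matrix.of_apply, fibL, ContinuousLinearMap.coe_pi']
  rw [← Finset.sum_neg_distrib, ← Finset.sum_add_distrib]
  refine Finset.sum_congr rfl fun j _ => by ring

/-- Vanishing of `curv` is flatness of the endomorphism-valued form. The parallel frame equals 1 at
p and so is invertible nearby. -/
theorem exists_gauge [CompleteSpace E] (h : RealFrame k s om G rho P Q) {p : E} (hp : p ∈ s) :
    ∃ (g : E → (Fin 4 → ℝ) →L[ℝ] (Fin 4 → ℝ)) (r : ℝ), 0 < r ∧ ball p r ⊆ s ∧ g p = 1 ∧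
      (∀ y ∈ ball p r, IsUnit (g y)) ∧ ContDiffOn ℝ ∞ g (ball p r) ∧
      ∀ y ∈ ball p r, ∀ v, fderiv ℝ g y v = g y * endForm (conF k om G rho P Q) y v := by
  have hsm : ContDiffOn ℝ ∞ (endForm (conF k om G rho P Q)) s :=
    ContDiffOn.sum fun i _ => ContDiffOn.sum fun j _ => contDiffOn_smulRight (h.conF_smooth i j) _
  have hflat : ∀ y ∈ s, ∀ v w, dOne (endForm (conF k om G rho P Q)) y v w
      + (endForm (conF k om G rho P Q) y v * endForm (conF k om G rho P Q) y w
        - endForm (conF k om G rho P Q) y w * endForm (conF k om G rho P Q) y v) = 0 := by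
    intro y hy v w
    ext z i
    simp only [add_apply, sub_apply, mul_apply_eq_comp, zero_apply]
    rw [dOne_endForm fun i j => diffAt h.isOpen (h.conF_smooth i j) hy]
    simp only [endForm_apply, Matrix.mulVec_mulVec]
    rw [← Matrix.sub_mulVec, ← Matrix.add_mulVec]
    have : Matrix.of (fun i j => dOne (conF k om G rho P Q i j) y v w)
        + (Matrix.of (fun i j => conF k om G rho P Q i j y v)
            * Matrix.of (fun i j => conF k om G rho P Q i j y w)
          - Matrix.of (fun i j => conF k om G rho P Q i j y w)
            * Matrix.of (fun i j => conF k om G rho P Q i j y v)) = 0 := by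
      ext i j
      have := h.curv_eq_zero hy i j v w
      rw [curv, Finset.sum_sub_distrib] at this
      simpa [Matrix.mul_apply] using this
    rw [this]
    simp
  obtain ⟨g, r, hr, hg1, hg⟩ := exists_gauge_of_flat (cda h.isOpen hsm hp)
    (Filter.eventually_of_mem (h.isOpen.mem_nhds hp) hflat)
  have hu : ∀ᶠ y in nhds p, IsUnit (g y) := by
    have hc : ContinuousAt g p := (hg p (mem_ball_self hr)).continuousAt
    refine hc.eventually (Units.isOpen.mem_nhds ?_)
    rw [hg1]
    exact isUnit_one
  obtain ⟨r', hr', hb⟩ := Metric.eventually_nhds_iff_ball.1 (hu.and (h.isOpen.mem_nhds hp))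
  refine ⟨g, min r r', lt_min hr hr', fun y hy => (hb y (ball_subset_ball (min_le_right _ _) hy)).2,
    hg1, fun y hy => (hb y (ball_subset_ball (min_le_right _ _) hy)).1, ?_, fun y hy v => ?_⟩
  · exact contDiffOn_of_hasFDerivAt_mul isOpen_ball
      (hsm.mono fun y hy => (hb y (ball_subset_ball (min_le_right _ _) hy)).2)
      fun y hy => hg y (ball_subset_ball (min_le_left _ _) hy)
  · rw [(hg y (ball_subset_ball (min_le_left _ _) hy)).fderiv]
    rfl

theorem endForm_conF_apply (x v : E) (z : Fin 4 → ℝ) :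
    endForm (conF k om G rho P Q) x v z = (gam (fun a => G a x v) (rho x v)
      ![k * om 0 x v, k * om 1 x v, k * om 2 x v] (fun a => chi P om a x v)
      (fun a => chi Q om a x v)).mulVec z := by
  rw [endForm_apply]
  congr 1
  ext i j
  simp only [Matrix.of_apply, conF_apply, conn, chi_apply]

/-- From dg = gΓ and dω = -Γ ∧ ω follows d(gω) = 0; a primitive, rescaled, is Y. The inverse
satisfies d(g⁻¹) = -Γ g⁻¹, so constant two-forms pulled back by g⁻¹ obey the equations of
`gam_act_negU` and `gam_act_posBasis`. The form `negU` gives the position vector, `posBasis` its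
tangent frame, and `negN1`, `negN2` the normals. -/
theorem exists_flatChart [CompleteSpace E] (h : RealFrame k s om G rho P Q) (hk : 0 < k) {p : E}
    (hp : p ∈ s) : ∃ r Y U f N N', ball p r ⊆ s ∧ FlatChart k om G P Q p r Y U f N N' := by
  obtain ⟨g, r, hr, hbs, hg1, hgu, hgs, hgd⟩ := h.exists_gauge hp
  let hi : E → (Fin 4 → ℝ) →L[ℝ] (Fin 4 → ℝ) := fun y => Ring.inverse (g y)
  have hgd' : ∀ y ∈ ball p r, DifferentiableAt ℝ g y := fun y hy => diffAt isOpen_ball hgs hy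
  have his : ∀ y ∈ ball p r, ContDiffAt ℝ ∞ hi y := by
    intro y hy
    obtain ⟨w, hw⟩ := hgu y hy
    have := contDiffAt_ringInverse ℝ (n := ∞) w
    rw [hw] at this
    exact this.comp y (cda isOpen_ball hgs hy)
  have hig : ∀ y ∈ ball p r, ∀ z, hi y (g y z) = z := by
    intro y hy z
    have := Ring.inverse_mul_cancel _ (hgu y hy)
    exact DFunLike.congr_fun this z
  have hgi : ∀ y ∈ ball p r, ∀ z, g y (hi y z) = z := by
    intro y hy z
    have := Ring.mul_inverse_cancel _ (hgu y hy)
    exact DFunLike.congr_fun this z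
  have hid : ∀ y ∈ ball p r, ∀ v z, fderiv ℝ hi y v z =
      -endForm (conF k om G rho P Q) y v (hi y z) := by
    intro y hy v z
    obtain ⟨w, hw⟩ := hgu y hy
    have h1 := hasFDerivAt_ringInverse (𝕜 := ℝ) w
    rw [hw] at h1
    have h2 : HasFDerivAt hi _ y := h1.comp y (hgd' y hy).hasFDerivAt
    have hwi : (↑w⁻¹ : (Fin 4 → ℝ) →L[ℝ] (Fin 4 → ℝ)) = hi y := by
      change _ = Ring.inverse (g y)
      rw [← hw, Ring.inverse_unit]
    rw [h2.fderiv]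
    simp only [ContinuousLinearMap.comp_apply, neg_apply, ContinuousLinearMap.mulLeftRight_apply,
      hwi, hgd y hy, mul_apply_eq_comp, hig y hy]
  -- A two-form is quadratic in dY, so this scale yields the factor (2k)⁻¹, which compensates the
  -- factor 2k in dU.
  let c1 : ℝ := (√(2 * k))⁻¹
  have hc1 : c1 * c1 = (2 * k)⁻¹ := by
    rw [← mul_inv, Real.mul_self_sqrt (by positivity)]
  have hc0 : c1 ≠ 0 := by
    intro h0
    rw [h0] at hc1
    have : (2 * k)⁻¹ ≠ 0 := by positivity
    exact this (by linarith)
  have hYs : ContDiffOn ℝ ∞ (fun y => (g y).comp (fibL om y)) (ball p r) :=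
    hgs.clm_comp (h.fibL_smooth.mono hbs)
  -- Poincaré lemma on the convex ball; symmetry of the derivative of gω is its closedness.
  obtain ⟨Y0, hY0⟩ := (convex_ball p r).exists_forall_hasFDerivWithinAt_of_fderivWithin_symmetric
    (𝕜 := ℝ) (hYs.differentiableOn (by simp)) (by
      intro y hy u _ v _
      rw [fderivWithin_of_isOpen isOpen_ball hy]
      have e1 := (hgd' y hy).hasFDerivAt
      have e2 := (diffAt h.isOpen h.fibL_smooth (hbs hy)).hasFDerivAt
      rw [(e1.clm_comp e2).fderiv]
      have e3 := congrArg (g y) (h.fderiv_fibL (hbs hy) u v)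
      simp only [map_sub, map_add, map_neg] at e3
      simp only [add_apply, ContinuousLinearMap.comp_apply, ContinuousLinearMap.compL_apply,
        ContinuousLinearMap.flip_apply, hgd y hy, mul_apply_eq_comp]
      rw [← sub_eq_zero]
      have e4 := sub_eq_zero.2 e3
      rw [← e4]
      abel)
  have hYd : ∀ y ∈ ball p r, HasFDerivAt (fun y => c1 • Y0 y) (c1 • (g y).comp (fibL om y)) y :=
    fun y hy => ((hY0 y hy).hasFDerivAt (isOpen_ball.mem_nhds hy)).const_smul c1
  have hYf : ∀ y ∈ ball p r, ∀ v, hi y (fderiv ℝ (fun y => c1 • Y0 y) y v) = c1 • fibL om y v := by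
    intro y hy v
    rw [(hYd y hy).fderiv, smul_apply, map_smul, ContinuousLinearMap.comp_apply, hig y hy]
  have hcomp : ∀ (α : Lam2), ∀ y ∈ ball p r, ∀ v w, α.compContinuousLinearMap (hi y)
      ![fderiv ℝ (fun y => c1 • Y0 y) y v, fderiv ℝ (fun y => c1 • Y0 y) y w] =
      (2 * k)⁻¹ * α ![fibL om y v, fibL om y w] := by
    intro α y hy v w
    rw [comp_pair, hYf y hy, hYf y hy, alt_pair_smul_left, alt_pair_smul_right, smul_smul, hc1,
      smul_eq_mul]
  have hcd : ∀ (α : Lam2), ∀ y ∈ ball p r, ∀ v a b,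
      fderiv ℝ (fun y => α.compContinuousLinearMap (hi y)) y v ![a, b] =
      -(α ![endForm (conF k om G rho P Q) y v (hi y a), hi y b]
        + α ![hi y a, endForm (conF k om G rho P Q) y v (hi y b)]) := by
    intro α y hy v a b
    rw [fderiv_comp_lam2 α (his y hy) ((his y hy).differentiableAt (by simp)).hasFDerivAt,
      hid y hy, hid y hy, ← neg_one_smul ℝ, alt_pair_smul_left, ← neg_one_smul ℝ (endForm _ _ _ _),
      alt_pair_smul_right]
    simp only [neg_one_smul]
    ring
  have hUd : ∀ x ∈ ball p r, ∀ v, fderiv ℝ (fun y => negU.compContinuousLinearMap (hi y)) x v =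
      ∑ a : Fin 3, (2 * k * om (Fin.castLE (by norm_num) a) x v) •
        (posBasis a).compContinuousLinearMap (hi x) := by
    intro x hx v
    ext z
    rw [vec2_eta z, hcd negU x hx, endForm_conF_apply, endForm_conF_apply, gam_act_negU]
    simp only [Fin.sum_univ_three, ContinuousAlternatingMap.add_apply,
      ContinuousAlternatingMap.smul_apply, comp_pair, smul_eq_mul]
    simp only [Matrix.cons_val]
    have c0 : Fin.castLE (by norm_num : 3 ≤ 7) 0 = 0 := rfl
    have c1 : Fin.castLE (by norm_num : 3 ≤ 7) 1 = 1 := rfl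
    have c2 : Fin.castLE (by norm_num : 3 ≤ 7) 2 = 2 := rfl
    rw [c0, c1, c2]
    ring
  have hUs : ∀ α : Lam2, ContDiffOn ℝ ∞ (fun y => α.compContinuousLinearMap (hi y)) (ball p r) :=
    fun α x hx => (contDiffAt_comp_lam2 α (his x hx)).contDiffWithinAt
  have hhp : hi p = 1 := by
    change Ring.inverse (g p) = 1
    rw [hg1, Ring.inverse_one]
  have hat : ∀ α : Lam2, α.compContinuousLinearMap (hi p) = α := by
    intro α
    rw [hhp]
    ext z
    rfl
  -- One has ⟨U, U⟩ = -det(g⁻¹), and its derivative 2⟨dU, U⟩ is zero because `negU` is orthogonal to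
  -- `posBasis`. Hence the determinant keeps its value 1 at p.
  have hdet : ∀ x ∈ ball p r, Matrix.det (Matrix.of fun i j => hi x (stdVec i) j) = 1 := by
    have hconst : ∀ x ∈ ball p r, pair (negU.compContinuousLinearMap (hi x))
        (negU.compContinuousLinearMap (hi x)) = -1 := by
      intro x hx
      have hD : ∀ y ∈ ball p r, DifferentiableAt ℝ
          (fun y => negU.compContinuousLinearMap (hi y)) y := fun y hy =>
        (cda isOpen_ball (hUs negU) hy).differentiableAt (by simp)
      have := IsOpen.is_const_of_fderiv_eq_zero (𝕜 := ℝ) (f := fun y =>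
        pair (negU.compContinuousLinearMap (hi y)) (negU.compContinuousLinearMap (hi y)))
        isOpen_ball (convex_ball p r).isPreconnected
        (fun y hy => (fderiv_pair (hD y hy) (hD y hy)).1.differentiableWithinAt) (fun y hy => by
          ext v
          rw [(fderiv_pair (hD y hy) (hD y hy)).2, hUd y hy]
          simp only [← pairL_apply, map_sum, map_smul, sum_apply, smul_apply]
          simp [pairL_apply, pair_comp, pair_negU_posBasis, pair_comm (posBasis _) negU]) hx
          (mem_ball_self hr)
      rw [this, hat, pair_negU]
    intro x hx
    have := hconst x hx
    rw [pair_comp, pair_negU] at this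
    linarith
  refine ⟨r, fun y => c1 • Y0 y, fun y => negU.compContinuousLinearMap (hi y),
    fun a y => (posBasis a).compContinuousLinearMap (hi y),
    fun y => negN2.compContinuousLinearMap (hi y), fun y => negN1.compContinuousLinearMap (hi y),
    hbs, hr, ?_, hUs negU, fun a => hUs _, hUd, ?_, ?_, ?_, fun a => hat _, ?_, hcomp negU,
    fun x hx a => hcomp _ x hx⟩
  · refine ((contDiffOn_infty_iff_fderiv_of_isOpen isOpen_ball).2 ⟨fun y hy =>
      (hYd y hy).differentiableAt.differentiableWithinAt, ?_⟩)
    exact (hYs.const_smul c1).congr fun y hy => (hYd y hy).fderiv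
  · intro x hx a v
    ext z
    rw [vec2_eta z, hcd _ x hx, endForm_conF_apply, endForm_conF_apply, gam_act_posBasis]
    simp only [ContinuousAlternatingMap.add_apply, ContinuousAlternatingMap.sub_apply,
      ContinuousAlternatingMap.smul_apply, comp_pair, smul_eq_mul]
    have : ![k * om 0 x v, k * om 1 x v, k * om 2 x v] a =
        k * om (Fin.castLE (by norm_num) a) x v := by fin_cases a <;> rfl
    rw [this]
    ring
  · intro x hx
    rw [pair_comp, hdet x hx, pair_negU, one_mul]
  · intro x hx a b
    rw [pair_comp, hdet x hx, pair_posBasis, one_mul]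
  · intro x hx v hv
    have := hYf x hx v
    rw [hv, map_zero] at this
    exact (smul_eq_zero.1 this.symm).resolve_left hc0

end RealFrame

end

end G2ERP

/-! ### Descent of the position vector to a maximal immersion of the base. -/

namespace G2ERP

noncomputable section

open Metric

/-- Euclidean three-space. -/
abbrev E3 := EuclideanSpace ℝ (Fin 3)

theorem hess_eq (f : E3 → Lam2) (b v w : E3) : hess f b v w = fderiv ℝ (fderiv ℝ f) b v w := by
  simp only [hess, extChartAt_model_space_eq_id]
  rfl

theorem du_eq (f : E3 → Lam2) (b v : E3) : du f b v = fderiv ℝ f b v := by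
  simp only [du, mfderiv_eq_fderiv]
  rfl

variable {E : Type*} [NormedAddCommGroup E] [NormedSpace ℝ E]
variable {k : ℝ} {s : Set E} {om : Fin 7 → E → E →L[ℝ] ℝ} {G : Fin 3 → E → E →L[ℝ] ℝ}
  {rho : E → E →L[ℝ] ℝ} {P Q : Fin 3 → Fin 3 → E → ℝ} {p : E} {r : ℝ} {Y : E → Fin 4 → ℝ}
  {U : E → Lam2} {f : Fin 3 → E → Lam2} {N N' : E → Lam2}

/-- The coordinates of the orthogonal projection to the span of `posBasis`. -/
def posProj : Lam2 →L[ℝ] E3 :=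
  ((EuclideanSpace.equiv (Fin 3) ℝ).symm : (Fin 3 → ℝ) →L[ℝ] E3).comp
    (ContinuousLinearMap.pi fun a => pairL.flip (posBasis a))

/-- The base and fibre coordinates together. -/
def baseFibMap (Y : E → Fin 4 → ℝ) (U : E → Lam2) (x : E) : E3 × (Fin 4 → ℝ) := (posProj (U x), Y x)

theorem orthonormal_comatrix {L : Fin 3 → Fin 3 → ℝ}
    (h : ∀ i j, ∑ a, L i a * L j a = if i = j then 1 else 0) (a c : Fin 3) :
    ∑ i, L i a * L i c = if a = c then 1 else 0 := by
  have h1 : Matrix.of L * (Matrix.of L).transpose = 1 := by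
    ext i j
    simp [Matrix.mul_apply, Matrix.one_apply, h]
  have h2 := congrArg (fun M => M a c) (mul_eq_one_comm.1 h1)
  simpa [Matrix.mul_apply, Matrix.one_apply] using h2

namespace FlatChart

/-- The number `orient f` is the determinant of the projection of the span of f to the span of
`posBasis`. When it is nonzero, dU is determined by its projection, and its coefficients along f are
2k ω_a. -/
theorem om_eq_zero (hF : FlatChart k om G P Q p r Y U f N N') (hk : 0 < k) {x : E}
    (hx : x ∈ ball p r) (ho : orient (fun a => f a x) ≠ 0) {v : E}
    (hv : posProj (fderiv ℝ U x v) = 0) (a : Fin 3) : om (Fin.castLE (by norm_num) a) x v = 0 := by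
  have h1 : Matrix.vecMul (fun a : Fin 3 => 2 * k * om (Fin.castLE (by norm_num) a) x v)
      (Matrix.of fun i j => pair (f i x) (posBasis j)) = 0 := by
    funext j
    have := congrFun (congrArg (EuclideanSpace.equiv (Fin 3) ℝ) hv) j
    have h2 : pair (fderiv ℝ U x v) (posBasis j) = 0 := this
    rw [hF.U_deriv x hx, ← pairL_apply] at h2
    simpa [Matrix.vecMul, dotProduct, pairL_apply] using h2
  have h3 := congrFun (Matrix.eq_zero_of_vecMul_eq_zero ho h1) a
  have h4 : 2 * k * om (Fin.castLE (by norm_num) a) x v = 0 := h3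
  rcases mul_eq_zero.1 h4 with h5 | h5
  · linarith
  · exact h5

theorem differentiableAt_U (hF : FlatChart k om G P Q p r Y U f N N') {x : E}
    (hx : x ∈ ball p r) : DifferentiableAt ℝ U x := RealFrame.diffAt isOpen_ball hF.U_smooth hx

theorem differentiableAt_Y (hF : FlatChart k om G P Q p r Y U f N N') {x : E}
    (hx : x ∈ ball p r) : DifferentiableAt ℝ Y x := RealFrame.diffAt isOpen_ball hF.Y_smooth hx

theorem hasFDerivAt_baseFibMap (hF : FlatChart k om G P Q p r Y U f N N') {x : E}
    (hx : x ∈ ball p r) : HasFDerivAt (baseFibMap Y U)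
      ((posProj.comp (fderiv ℝ U x)).prod (fderiv ℝ Y x)) x :=
  (posProj.hasFDerivAt.comp x (hF.differentiableAt_U hx).hasFDerivAt).prodMk
    (hF.differentiableAt_Y hx).hasFDerivAt

theorem contDiffAt_baseFibMap (hF : FlatChart k om G P Q p r Y U f N N') {x : E}
    (hx : x ∈ ball p r) : ContDiffAt ℝ ∞ (baseFibMap Y U) x :=
  (posProj.contDiff.contDiffAt.comp x (RealFrame.cda isOpen_ball hF.U_smooth hx)).prodMk
    (RealFrame.cda isOpen_ball hF.Y_smooth hx)

theorem exists_equiv (hF : FlatChart k om G P Q p r Y U f N N') (hk : 0 < k)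
    (h : RealFrame k s om G rho P Q) {x : E} (hxs : x ∈ s)
    (hx : x ∈ ball p r) (ho : orient (fun a => f a x) ≠ 0) :
    ∃ e : E ≃L[ℝ] E3 × (Fin 4 → ℝ), HasFDerivAt (baseFibMap Y U) (e : E →L[ℝ] _) x := by
  obtain ⟨e, he⟩ := h.frame x hxs
  have : FiniteDimensional ℝ E := LinearEquiv.finiteDimensional e.toLinearEquiv.symm
  let D := (posProj.comp (fderiv ℝ U x)).prod (fderiv ℝ Y x)
  have hinj : Function.Injective (D : E →ₗ[ℝ] E3 × (Fin 4 → ℝ)) := by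
    rw [injective_iff_map_eq_zero]
    intro v hv
    have h1 : posProj (fderiv ℝ U x v) = 0 := congrArg Prod.fst hv
    have h2 : fderiv ℝ Y x v = 0 := congrArg Prod.snd hv
    have h3 := hF.om_eq_zero hk hx ho h1
    have h4 := hF.Y_inj x hx v h2
    apply e.injective
    rw [map_zero]
    funext i
    rw [he]
    fin_cases i
    exacts [h3 0, h3 1, h3 2, congrFun h4 0, congrFun h4 1, congrFun h4 2, congrFun h4 3]
  have hdim : Module.finrank ℝ E = Module.finrank ℝ (E3 × (Fin 4 → ℝ)) := by
    rw [LinearEquiv.finrank_eq e.toLinearEquiv]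
    simp
  refine ⟨(LinearMap.linearEquivOfInjective _ hinj hdim).toContinuousLinearEquiv, ?_⟩
  convert hF.hasFDerivAt_baseFibMap hx using 1
  rfl

theorem continuousAt_orient (hF : FlatChart k om G P Q p r Y U f N N') {x : E}
    (hx : x ∈ ball p r) : ContinuousAt (fun y => orient fun a => f a y) x := by
  have hc : ∀ i j, ContinuousAt (fun y => pair (f i y) (posBasis j)) x := fun i j =>
    (contDiffAt_pair (RealFrame.cda isOpen_ball (hF.f_smooth i) hx) contDiffAt_const).continuousAt
  simp only [orient, Matrix.det_fin_three, Matrix.of_apply]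
  fun_prop

/-- The projection of U and the coordinates Y have jointly invertible differential at p, where `f`
is `posBasis`. The inverse function theorem gives a chart, and a product of balls as target makes
its fibre slices connected. -/
theorem exists_base (hF : FlatChart k om G P Q p r Y U f N N') (hk : 0 < k) [CompleteSpace E]
    (h : RealFrame k s om G rho P Q) (hbs : ball p r ⊆ s) :
    ∃ (Θ : OpenPartialHomeomorph E (E3 × (Fin 4 → ℝ))) (r1 r2 : ℝ), 0 < r1 ∧ 0 < r2 ∧
      Θ.target = ball (posProj (U p)) r1 ×ˢ ball (Y p) r2 ∧ p ∈ Θ.source ∧ Θ.source ⊆ ball p r ∧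
      (∀ x, Θ x = baseFibMap Y U x) ∧ (∀ x ∈ Θ.source, 0 < orient fun a => f a x) ∧
      ContDiffOn ℝ ∞ Θ.symm Θ.target := by
  have hpb : p ∈ ball p r := mem_ball_self hF.pos
  have hop : orient (fun a => f a p) = 1 := by
    simp only [orient, hF.f_base, pair_posBasis]
    rw [← Matrix.det_one (n := Fin 3) (R := ℝ)]
    congr 1
    ext i j
    simp [Matrix.one_apply]
  have hop' : 0 < orient (fun a => f a p) := by rw [hop]; exact one_pos
  obtain ⟨r', hr', hb'⟩ := Metric.eventually_nhds_iff_ball.1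
    ((hF.continuousAt_orient hpb).eventually (lt_mem_nhds hop'))
  obtain ⟨e, he⟩ := hF.exists_equiv hk h (hbs hpb) hpb (by rw [hop]; exact one_ne_zero)
  let T := (hF.contDiffAt_baseFibMap hpb).toOpenPartialHomeomorph _ he (by simp)
  have hTc : ∀ x, T x = baseFibMap Y U x := fun x => rfl
  let T1 := T.restrOpen (ball p r ∩ ball p r') (isOpen_ball.inter isOpen_ball)
  have hp1 : p ∈ T1.source := ⟨ContDiffAt.mem_toOpenPartialHomeomorph_source _ he _, hpb,
    mem_ball_self hr'⟩
  have hp2 : baseFibMap Y U p ∈ T1.target := T1.map_source hp1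
  obtain ⟨ε, hε, hεb⟩ := Metric.isOpen_iff.1 T1.open_target _ hp2
  have hprod : ball (posProj (U p)) ε ×ˢ ball (Y p) ε = ball (baseFibMap Y U p) ε :=
    ball_prod_same _ _ _
  -- The shrinking takes place on the target: a ball for the maximum norm is a product of balls.
  let T2 := (T1.symm.restrOpen (ball (baseFibMap Y U p) ε) isOpen_ball).symm
  have hT2t : T2.target = ball (baseFibMap Y U p) ε := by
    change T1.target ∩ _ = _
    exact Set.inter_eq_right.2 hεb
  have hT2s : T2.source ⊆ T1.source := by
    intro x hx
    have h1 := T2.map_source hx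
    have h2 := T2.left_inv hx
    rw [← h2]
    rw [hT2t] at h1
    exact T1.map_target (hεb h1)
  have hsrc : ∀ x ∈ T2.source, x ∈ ball p r ∧ x ∈ ball p r' := fun x hx => (hT2s hx).2
  refine ⟨T2, ε, ε, hε, hε, hT2t.trans hprod.symm, ?_, fun x hx => (hsrc x hx).1,
    fun x => rfl, fun x hx => hb' x (hsrc x hx).2, ?_⟩
  · have : T2.symm (baseFibMap Y U p) ∈ T2.source := T2.map_target (by
      rw [hT2t]; exact mem_ball_self hε)
    have h3 : T2.symm (baseFibMap Y U p) = p := T1.left_inv hp1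
    rwa [h3] at this
  · intro z hz
    have hx := T2.map_target hz
    obtain ⟨e', he'⟩ := hF.exists_equiv hk h (hbs (hsrc _ hx).1) (hsrc _ hx).1
      (hb' _ (hsrc _ hx).2).ne'
    exact (T2.contDiffAt_symm hz he' (hF.contDiffAt_baseFibMap (hsrc _ hx).1)).contDiffWithinAt

/-- The composition of the position vector with a map that is transverse to the fibres is
maximal. -/
theorem isMaximal_comp (hF : FlatChart k om G P Q p r Y U f N N') (hk : 0 < k)
    (h : RealFrame k s om G rho P Q) (hbs : ball p r ⊆ s) {σ : E3 → E} (hσ : ContDiff ℝ ∞ σ)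
    (hσb : ∀ b, σ b ∈ ball p r)
    (hinj : ∀ b v, fderiv ℝ U (σ b) (fderiv ℝ σ b v) = 0 → v = 0) :
    IsMaximalInQuadric fun b => U (σ b) := by
  have hs : ContDiff ℝ ∞ fun b => U (σ b) := contDiff_iff_contDiffAt.2 fun b =>
    (RealFrame.cda isOpen_ball hF.U_smooth (hσb b)).comp b hσ.contDiffAt
  have hσd : ∀ b, DifferentiableAt ℝ σ b := fun b => hσ.contDiffAt.differentiableAt (by simp)
  obtain ⟨lam, hlam, hlams⟩ : ∃ lam : Fin 3 → E3 → E3 →L[ℝ] ℝ, (∀ a b v, lam a b v =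
      2 * k * om (Fin.castLE (by norm_num) a) (σ b) (fderiv ℝ σ b v)) ∧
      ∀ a, ContDiff ℝ ∞ (lam a) :=
    ⟨fun a b => (2 * k) • (om (Fin.castLE (by norm_num) a) (σ b)).comp (fderiv ℝ σ b),
      fun _ _ _ => rfl, fun a => contDiff_iff_contDiffAt.2 fun b =>
      (((RealFrame.cda isOpen_ball ((h.om_smooth _).mono hbs) (hσb b)).comp b
        hσ.contDiffAt).clm_comp (hσ.contDiffAt.fderiv_right (by simp))).const_smul _⟩
  have hchain : ∀ b v, fderiv ℝ (fun b => U (σ b)) b v = fderiv ℝ U (σ b) (fderiv ℝ σ b v) := by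
    intro b v
    rw [fderiv_fun_comp b (hF.differentiableAt_U (hσb b)) (hσd b)]
    rfl
  have hdu : ∀ b v, fderiv ℝ (fun b => U (σ b)) b v = ∑ a, lam a b v • f a (σ b) := by
    intro b v
    rw [hchain, hF.U_deriv _ (hσb b)]
    exact Finset.sum_congr rfl fun a _ => by rw [hlam]
  have hmet : ∀ b (v w : E3), pullMetric (fun b => U (σ b)) b v w = ∑ a, lam a b v * lam a b w := by
    intro b v w
    change pair (du _ b v) (du _ b w) = _
    rw [du_eq, du_eq, hdu, hdu]
    simp only [← pairL_apply, map_sum, map_smul, sum_apply, smul_apply]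
    simp only [pairL_apply, hF.f_norm _ (hσb b), smul_eq_mul]
    simp [mul_comm]
  refine ⟨contMDiff_iff_contDiff.2 hs, fun b => hF.U_norm _ (hσb b), fun b v hv => ?_, ?_⟩
  · have key : ∀ v : E3, v ≠ 0 → 0 < ∑ a, lam a b v * lam a b v := by
      intro v hv
      have hnn : 0 ≤ ∑ a, lam a b v * lam a b v := Finset.sum_nonneg fun a _ => mul_self_nonneg _
      refine lt_of_le_of_ne hnn fun h0 => hv (hinj b v ?_)
      have h1 := (Finset.sum_eq_zero_iff_of_nonneg fun a _ => mul_self_nonneg _).1 h0.symm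
      rw [← hchain, hdu]
      refine Finset.sum_eq_zero fun a ha => ?_
      rw [mul_self_eq_zero.1 (h1 a ha), zero_smul]
    exact lt_of_lt_of_eq (key v hv) (hmet b v v).symm
  · intro b e he w hUw hdw
    let e' : Fin 3 → E3 := e
    -- The matrix λ_a(e_i) has orthonormal rows in i, since the frame is orthonormal; being square,
    -- it also has orthonormal columns.
    have hL : ∀ a c, ∑ i, lam a b (e' i) * lam c b (e' i) = if a = c then 1 else 0 :=
      orthonormal_comatrix (L := fun i a => lam a b (e' i)) fun i j => by
        rw [← hmet b (e' i) (e' j)]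
        exact he i j
    have hfw : ∀ a, pair (f a (σ b)) w = 0 := by
      intro a
      have h1 : ∑ i, lam a b (e' i) * pair (du (fun b => U (σ b)) b (e' i)) w = 0 :=
        Finset.sum_eq_zero fun i _ => by rw [hdw, mul_zero]
      have h2 : ∀ i, pair (du (fun b => U (σ b)) b (e' i)) w =
          ∑ c, lam c b (e' i) * pair (f c (σ b)) w := by
        intro i
        rw [du_eq, hdu]
        simp only [← pairL_apply, map_sum, map_smul, sum_apply, smul_apply, smul_eq_mul]
      simp only [h2, Finset.mul_sum, ← mul_assoc] at h1
      rw [Finset.sum_comm] at h1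
      simp only [← Finset.sum_mul, hL] at h1
      simpa using h1
    -- The vector w is orthogonal to U and to the tangent frame. Differentiating Σ λ_a f_a therefore
    -- leaves only the components of df_a along N and N', which are given by χ_P and χ_Q.
    have hhess : ∀ v : E3, pair (hess (fun b => U (σ b)) b v v) w =
        ∑ a, lam a b v * (2 * chi P om a (σ b) (fderiv ℝ σ b v) * pair (N (σ b)) w
          + 2 * chi Q om a (σ b) (fderiv ℝ σ b v) * pair (N' (σ b)) w) := by
      intro v
      rw [hess_eq]
      have hdd : DifferentiableAt ℝ (fderiv ℝ fun b => U (σ b)) b :=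
        (hs.contDiffAt.fderiv_right (m := ∞) (by simp)).differentiableAt (by simp)
      have h1 : fderiv ℝ (fun y => pair (fderiv ℝ (fun b => U (σ b)) y v) w) b v =
          pair (fderiv ℝ (fderiv ℝ fun b => U (σ b)) b v v) w := by
        have e1 := hasFDerivAt_clm_apply_const hdd.hasFDerivAt v
        rw [(fderiv_pair e1.differentiableAt (differentiableAt_const w)).2, e1.fderiv]
        simp [pair_eq, co]
      rw [← h1]
      have h2 : (fun y => pair (fderiv ℝ (fun b => U (σ b)) y v) w) =
          fun y => ∑ a, lam a y v * pair (f a (σ y)) w := by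
        funext y
        rw [hdu]
        simp only [← pairL_apply, map_sum, map_smul, sum_apply, smul_apply, smul_eq_mul]
      have hl : ∀ a, DifferentiableAt ℝ (fun y => lam a y v) b := fun a =>
        (hasFDerivAt_clm_apply_const
          ((hlams a).contDiffAt.differentiableAt (by simp)).hasFDerivAt v).differentiableAt
      have hff : ∀ a, DifferentiableAt ℝ (fun y => f a (σ y)) b := fun a =>
        (RealFrame.diffAt isOpen_ball (hF.f_smooth a) (hσb b)).comp b (hσd b)
      have hfp := fun a => (fderiv_pair (hff a) (differentiableAt_const w)).1
      rw [h2, fderiv_fun_sum fun a _ => (hl a).fun_mul (hfp a), sum_apply]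
      refine Finset.sum_congr rfl fun a _ => ?_
      rw [fderiv_fun_mul (hl a) (hfp a), add_apply, smul_apply, smul_apply, hfw, smul_eq_mul,
        smul_eq_mul, zero_mul, add_zero, (fderiv_pair (hff a) (differentiableAt_const w)).2,
        fderiv_fun_comp b (RealFrame.diffAt isOpen_ball (hF.f_smooth a) (hσb b)) (hσd b),
        ContinuousLinearMap.comp_apply, hF.f_deriv _ (hσb b)]
      simp only [pair_add_left, pair_sub_left, pair_smul_left, hfw, hUw]
      simp [pair_eq, co]
    have hchi : ∀ (R : Fin 3 → Fin 3 → E → ℝ) a v, chi R om a (σ b) (fderiv ℝ σ b v) =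
        (2 * k)⁻¹ * ∑ c, R a c (σ b) * lam c b v := by
      intro R a v
      rw [chi_apply, Fin.sum_univ_three, hlam, hlam, hlam]
      have c0 : Fin.castLE (by norm_num : 3 ≤ 7) 0 = 0 := rfl
      have c1 : Fin.castLE (by norm_num : 3 ≤ 7) 1 = 1 := rfl
      have c2 : Fin.castLE (by norm_num : 3 ≤ 7) 2 = 2 := rfl
      rw [c0, c1, c2]
      field_simp
    -- The frame being orthonormal, this trace is a multiple of the matrix trace of R. This is where
    -- P and Q being trace-free becomes maximality.
    have htr : ∀ R : Fin 3 → Fin 3 → E → ℝ, (∀ y, R 0 0 y + R 1 1 y + R 2 2 y = 0) →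
        ∑ i, ∑ a, lam a b (e' i) * chi R om a (σ b) (fderiv ℝ σ b (e' i)) = 0 := by
      intro R hR
      have h1 : ∀ i a, lam a b (e' i) * chi R om a (σ b) (fderiv ℝ σ b (e' i)) =
          ∑ c, (2 * k)⁻¹ * R a c (σ b) * (lam a b (e' i) * lam c b (e' i)) := by
        intro i a
        rw [hchi, Finset.mul_sum, Finset.mul_sum]
        exact Finset.sum_congr rfl fun c _ => by ring
      simp only [h1]
      rw [Finset.sum_comm]
      have h2 : ∀ a, ∑ i, ∑ c, (2 * k)⁻¹ * R a c (σ b) * (lam a b (e' i) * lam c b (e' i)) =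
          (2 * k)⁻¹ * R a a (σ b) := by
        intro a
        rw [Finset.sum_comm]
        simp only [← Finset.mul_sum, hL]
        simp
      rw [Finset.sum_congr rfl fun a _ => h2 a, Fin.sum_univ_three, ← mul_add, ← mul_add, hR,
          mul_zero]
    have hfin : ∑ i, pair (hess (fun b => U (σ b)) b (e' i) (e' i)) w =
        2 * pair (N (σ b)) w * (∑ i, ∑ a, lam a b (e' i) * chi P om a (σ b) (fderiv ℝ σ b (e' i)))
        + 2 * pair (N' (σ b)) w *
          (∑ i, ∑ a, lam a b (e' i) * chi Q om a (σ b) (fderiv ℝ σ b (e' i))) := by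
      simp only [hhess, Finset.mul_sum, ← Finset.sum_add_distrib]
      exact Finset.sum_congr rfl fun i _ => Finset.sum_congr rfl fun a _ => by ring
    refine hfin.trans ?_
    rw [htr P h.P_trace, htr Q h.Q_trace, mul_zero, mul_zero, add_zero]

/-- U is constant along fibre slices, so any slice Y = const gives a section through which it
factors. The ball of base coordinates is reparametrised diffeomorphically by all of ℝ³, which makes
the immersion globally defined on `E3`. -/
theorem exists_chart (hF : FlatChart k om G P Q p r Y U f N N') (hk : 0 < k) [CompleteSpace E]
    (h : RealFrame k s om G rho P Q) (hbs : ball p r ⊆ s) :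
    ∃ (Ψ : OpenPartialHomeomorph E (E3 × (Fin 4 → ℝ))) (u : E3 → Lam2), IsMaximalInQuadric u ∧
      p ∈ Ψ.source ∧ Ψ.source ⊆ ball p r ∧ ContDiffOn ℝ ∞ Ψ Ψ.source ∧
      ContDiffOn ℝ ∞ Ψ.symm Ψ.target ∧
      ∀ x ∈ Ψ.source, (Ψ x).2 = Y x ∧ u (Ψ x).1 = U x ∧ 0 < orient fun a => f a x := by
  obtain ⟨Θ, r1, r2, hr1, hr2, htar, hp, hsrc, hco, hor, hsm⟩ := hF.exists_base hk h hbs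
  let ι : OpenPartialHomeomorph E3 E3 := OpenPartialHomeomorph.univBall (posProj (U p)) r1
  have hιs : ι.source = Set.univ := OpenPartialHomeomorph.univBall_source _ _
  have hιt : ι.target = ball (posProj (U p)) r1 := OpenPartialHomeomorph.univBall_target _ hr1
  have hιd : ContDiff ℝ ∞ ι := OpenPartialHomeomorph.contDiff_univBall
  have hιsd : ContDiffOn ℝ ∞ ι.symm (ball (posProj (U p)) r1) :=
    OpenPartialHomeomorph.contDiffOn_univBall_symm
  have hmem : ∀ b, ι b ∈ ball (posProj (U p)) r1 := fun b => by
    rw [← hιt]; exact ι.map_source (by rw [hιs]; trivial)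
  have hY2 : Y p ∈ ball (Y p) r2 := mem_ball_self hr2
  let σ : E3 → E := fun b => Θ.symm (ι b, Y p)
  have hσt : ∀ b, (ι b, Y p) ∈ Θ.target := fun b => by
    rw [htar]; exact ⟨hmem b, hY2⟩
  have hσ : ContDiff ℝ ∞ σ := contDiff_iff_contDiffAt.2 fun b =>
    (hsm.contDiffAt (Θ.open_target.mem_nhds (hσt b))).comp b
      (hιd.contDiffAt.prodMk contDiffAt_const)
  have hσb : ∀ b, σ b ∈ ball p r := fun b => hsrc (Θ.map_target (hσt b))
  have hUσ : ∀ b, posProj (U (σ b)) = ι b := fun b => by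
    have := Θ.right_inv (hσt b)
    rw [hco] at this
    exact congrArg Prod.fst this
  -- Along a slice the projection of U is constant, so by `om_eq_zero` the base forms vanish on the
  -- slice, and with them dU.
  have hconst : ∀ b ∈ ball (posProj (U p)) r1, ∀ t ∈ ball (Y p) r2, ∀ t' ∈ ball (Y p) r2,
      U (Θ.symm (b, t)) = U (Θ.symm (b, t')) := by
    intro b hb t ht t' ht'
    have hz : ∀ t ∈ ball (Y p) r2, (b, t) ∈ Θ.target := fun t ht => by
      rw [htar]; exact ⟨hb, ht⟩
    have hd1 : ∀ t ∈ ball (Y p) r2, HasFDerivAt (fun t => Θ.symm (b, t))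
        ((fderiv ℝ Θ.symm (b, t)).comp (ContinuousLinearMap.inr ℝ E3 (Fin 4 → ℝ))) t := by
      intro t ht
      have e1 := ((hsm.contDiffAt (Θ.open_target.mem_nhds (hz t ht))).differentiableAt
        (by simp)).hasFDerivAt
      have e2 : HasFDerivAt (fun t : Fin 4 → ℝ => (b, t)) (ContinuousLinearMap.inr ℝ E3 _) t :=
        hasFDerivAt_prodMk_right b t
      exact e1.comp t e2
    have hd2 : ∀ t ∈ ball (Y p) r2, HasFDerivAt (fun t => U (Θ.symm (b, t))) _ t := fun t ht =>
      (hF.differentiableAt_U (hsrc (Θ.map_target (hz t ht)))).hasFDerivAt.comp t (hd1 t ht)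
    refine IsOpen.is_const_of_fderiv_eq_zero (𝕜 := ℝ) isOpen_ball
      (convex_ball (Y p) r2).isPreconnected
      (fun t ht => (hd2 t ht).differentiableAt.differentiableWithinAt) (fun t ht => ?_) ht ht'
    rw [(hd2 t ht).fderiv]
    ext1 w
    have hx := Θ.map_target (hz t ht)
    have hpp : posProj (fderiv ℝ U (Θ.symm (b, t)) ((fderiv ℝ Θ.symm (b, t))
        (ContinuousLinearMap.inr ℝ E3 (Fin 4 → ℝ) w))) = 0 := by
      have e1 : HasFDerivAt (fun t => posProj (U (Θ.symm (b, t)))) _ t :=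
        posProj.hasFDerivAt.comp t (hd2 t ht)
      have e2 : (fun t => posProj (U (Θ.symm (b, t)))) =ᶠ[nhds t] fun _ => b := by
        filter_upwards [isOpen_ball.mem_nhds ht] with t' ht'
        have := Θ.right_inv (hz t' ht')
        rw [hco] at this
        exact congrArg Prod.fst this
      have e3 := e1.unique ((hasFDerivAt_const b t).congr_of_eventuallyEq e2)
      exact DFunLike.congr_fun e3 w
    have h0 := hF.om_eq_zero hk (hsrc hx) (hor _ hx).ne' hpp
    change fderiv ℝ U (Θ.symm (b, t)) _ = 0
    rw [hF.U_deriv _ (hsrc hx)]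
    refine Finset.sum_eq_zero fun a _ => ?_
    exact (congrArg (fun c => (2 * k * c) • f a (Θ.symm (b, t))) (h0 a)).trans (by simp)
  have hinj : ∀ b v, fderiv ℝ U (σ b) (fderiv ℝ σ b v) = 0 → v = 0 := by
    intro b v hv
    have e0 : HasFDerivAt (fun b => posProj (U (σ b))) _ b := posProj.hasFDerivAt.comp b
      ((hF.differentiableAt_U (hσb b)).hasFDerivAt.comp b
        (hσ.contDiffAt.differentiableAt (by simp)).hasFDerivAt)
    have e1 : (fun b => posProj (U (σ b))) = ι := funext hUσ
    rw [e1] at e0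
    have e2 : fderiv ℝ ι b v = 0 := by
      rw [e0.fderiv]
      change posProj (fderiv ℝ U (σ b) (fderiv ℝ σ b v)) = 0
      rw [hv, map_zero]
    have e3 : HasFDerivAt (fun b => ι.symm (ι b)) _ b :=
      ((hιsd.contDiffAt (isOpen_ball.mem_nhds (hmem b))).differentiableAt (by
          simp)).hasFDerivAt.comp b
        (hιd.contDiffAt.differentiableAt (by simp)).hasFDerivAt
    have e4 : (fun b => ι.symm (ι b)) = id := funext fun b => ι.left_inv (by rw [hιs]; trivial)
    rw [e4] at e3
    have e5 := DFunLike.congr_fun (e3.unique (hasFDerivAt_id b)) v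
    rw [ContinuousLinearMap.comp_apply, e2, map_zero] at e5
    exact e5.symm
  let Ψ := Θ.trans (ι.symm.prod (OpenPartialHomeomorph.refl (Fin 4 → ℝ)))
  have hΨs : ∀ x, x ∈ Ψ.source ↔ x ∈ Θ.source := by
    intro x
    constructor
    · exact fun hx => hx.1
    · intro hx
      refine ⟨hx, ?_⟩
      have := Θ.map_source hx
      rw [htar] at this
      refine ⟨?_, trivial⟩
      change (Θ x).1 ∈ ι.target
      rw [hιt]
      exact this.1
  have hb1 : ∀ x ∈ Θ.source, (Θ x).1 ∈ ball (posProj (U p)) r1 ∧ (Θ x).2 ∈ ball (Y p) r2 := by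
    intro x hx
    have := Θ.map_source hx
    rw [htar] at this
    exact this
  refine ⟨Ψ, fun b => U (σ b), hF.isMaximal_comp hk h hbs hσ hσb hinj, (hΨs p).2 hp,
    fun x hx => hsrc ((hΨs x).1 hx), fun x hx => ?_, fun z hz => ?_, fun x hx => ⟨?_, ?_,
      hor x ((hΨs x).1 hx)⟩⟩
  · have hx' := (hΨs x).1 hx
    have e1 : ContDiffAt ℝ ∞ Θ x := by
      have := hF.contDiffAt_baseFibMap (hsrc hx')
      rwa [← show (Θ : E → _) = baseFibMap Y U from funext hco] at this
    have e2 : ContDiffAt ℝ ∞ (fun x => ι.symm (Θ x).1) x :=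
      (hιsd.contDiffAt (isOpen_ball.mem_nhds (hb1 x hx').1)).comp x (contDiffAt_fst.comp x e1)
    exact (e2.prodMk (contDiffAt_snd.comp x e1)).contDiffWithinAt
  · have e1 : ContDiffAt ℝ ∞ (fun z : E3 × (Fin 4 → ℝ) => (ι z.1, z.2)) z :=
      (hιd.contDiffAt.comp z contDiffAt_fst).prodMk contDiffAt_snd
    have hz2 : (ι z.1, z.2) ∈ Θ.target := hz.2
    exact ((hsm.contDiffAt (Θ.open_target.mem_nhds hz2)).comp z e1).contDiffWithinAt
  · change (Θ x).2 = Y x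
    rw [hco]
    rfl
  · have hx' := (hΨs x).1 hx
    obtain ⟨h1, h2⟩ := hb1 x hx'
    change U (Θ.symm (ι (ι.symm (Θ x).1), Y p)) = U x
    rw [ι.right_inv (by rw [hιt]; exact h1), hconst _ h1 _ hY2 _ h2]
    exact congrArg U (Θ.left_inv hx')

end FlatChart

end

end G2ERP

namespace G2ERP
noncomputable section

set_option linter.unusedSectionVars false

/-! ### The local coframe of a structure of type `S` -/

theorem castLE37 : (Fin.castLE (by norm_num) : Fin 3 → Fin 7) = ![0, 1, 2] := by
  funext a
  fin_cases a <;> rfl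

/-- This expansion explains the choice of `posBasis`: φ₀ is the base volume plus Σ e^a ∧ `posBasis
a`, with the two-forms taken on the fibre. It has the same shape as c vol + du. -/
theorem phi0_apply (z : Fin 3 → Fin 7 → ℝ) :
    phi0 z = Matrix.det (Matrix.of fun i (a : Fin 3) => z i (Fin.castLE (by norm_num) a))
      + (∑ a : Fin 3, z 0 (Fin.castLE (by norm_num) a) * posBasis a ![fib (z 1), fib (z 2)]
        - ∑ a : Fin 3, z 1 (Fin.castLE (by norm_num) a) * posBasis a ![fib (z 0), fib (z 2)]
        + ∑ a : Fin 3, z 2 (Fin.castLE (by norm_num) a) * posBasis a ![fib (z 0), fib (z 1)]) := by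
  have hz : z = ![z 0, z 1, z 2] := by
    funext i
    fin_cases i <;> rfl
  generalize z 0 = a at *
  generalize z 1 = b at *
  generalize z 2 = c at *
  subst hz
  simp only [phi0, ContinuousAlternatingMap.add_apply, ContinuousAlternatingMap.sub_apply,
    ContinuousAlternatingMap.neg_apply, dx3_apply, posBasis,
    Matrix.det_fin_three, Fin.sum_univ_three, Matrix.of_apply, castLE37, Matrix.cons_val_zero,
    Matrix.cons_val_one, Matrix.cons_val, dx2_apply, fib]
  ring

theorem tau0_apply (z w : Fin 7 → ℝ) : tau0 ![z, w] = negU ![fib z, fib w] := by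
  simp only [tau0, negU, ContinuousAlternatingMap.sub_apply, dx2_apply, fib, Matrix.cons_val_zero,
    Matrix.cons_val_one, Matrix.cons_val]

section Pointwise

variable {B : Type*} [TopologicalSpace B] [ChartedSpace (EuclideanSpace ℝ (Fin 3)) B]
  [IsManifold (𝓡 3) ∞ B] {u : B → Lam2}

/-- With λ_a = 2k ω_a the volume term acquires the factor c (2k)³ = 1, while in du the factor 2k is
absorbed by the scale of the fibre forms. -/
theorem baragliaForm_eq_phi0 {k c : ℝ} (hkc : 8 * k ^ 3 * c = 1)
    (hu : ContMDiff (𝓡 3) 𝓘(ℝ, Lam2) ∞ u) {p : B × (Fin 4 → ℝ)}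
    {lam : Fin 3 → EuclideanSpace ℝ (Fin 3) →L[ℝ] ℝ} {f : Fin 3 → Lam2}
    (hf : ∀ a c, pair (f a) (f c) = if a = c then 1 else 0) (ho : 0 < orient f)
    (hd : ∀ v : EuclideanSpace ℝ (Fin 3), du u p.1 v = ∑ a, lam a v • f a)
    {v : Fin 3 → TangentSpace modelBR4 p} {z : Fin 3 → Fin 7 → ℝ}
    (hz : ∀ i a, lam a (v i).1 = 2 * k * z i (Fin.castLE (by norm_num) a))
    (hfib : ∀ a i j, 2 * k * f a ![(v i).2, (v j).2] = posBasis a ![fib (z i), fib (z j)]) :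
    baragliaForm c u p v = phi0 z := by
  have hdu : ∀ i j l, du u p.1 (v i).1 ![(v j).2, (v l).2] =
      ∑ a : Fin 3, z i (Fin.castLE (by norm_num) a) * posBasis a ![fib (z j), fib (z l)] := by
    intro i j l
    rw [hd (v i).1]
    rw [ContinuousAlternatingMap.sum_apply]
    refine Finset.sum_congr rfl fun a _ => ?_
    rw [ContinuousAlternatingMap.smul_apply, hz, ← hfib, smul_eq_mul]
    ring
  rw [baragliaForm_apply c hu, phi0_apply, hdu, hdu, hdu]
  congr 1
  refine (congrArg (c * ·) (volForm_apply hf ho hd fun i => (v i).1)).trans ?_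
  have e : (Matrix.of fun (i a : Fin 3) => lam a (v i).1) =
      (2 * k) • Matrix.of fun i (a : Fin 3) => z i (Fin.castLE (by norm_num) a) := by
    ext i a
    exact hz i a
  change c * Matrix.det (Matrix.of fun (i a : Fin 3) => lam a (v i).1) = _
  rw [e, Matrix.det_smul, Fintype.card_fin]
  linear_combination (Matrix.det (Matrix.of fun i (a : Fin 3) => z i (Fin.castLE (by norm_num) a)))
    * hkc

theorem tautForm_eq_tau0 {k : ℝ} {p : B × (Fin 4 → ℝ)}
    {v w : TangentSpace modelBR4 p} {z z' : Fin 7 → ℝ}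
    (h : 2 * k * u p.1 ![v.2, w.2] = negU ![fib z, fib z']) :
    12 * k ^ 2 * tautForm u p ![v, w] = 6 * k * tau0 ![z, z'] := by
  rw [tautForm_apply, tau0_apply, ← h]
  ring

end Pointwise

theorem contDiffAt_clm_of_apply {D E F : Type*} [NormedAddCommGroup D] [NormedSpace ℝ D]
    [NormedAddCommGroup E] [NormedSpace ℝ E] [NormedAddCommGroup F] [NormedSpace ℝ F]
    [FiniteDimensional ℝ E] {f : D → E →L[ℝ] F} {x : D}
    (h : ∀ v, ContDiffAt ℝ ∞ (fun y => f y v) x) : ContDiffAt ℝ ∞ f x := by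
  let e₁ := ContinuousLinearEquiv.ofFinrankEq
    (Module.finrank_fin_fun ℝ (n := Module.finrank ℝ E)).symm
  let e₂ := (e₁.arrowCongr (1 : F ≃L[ℝ] F)).trans
    (ContinuousLinearEquiv.piRing (Fin (Module.finrank ℝ E)))
  rw [← Function.id_comp f, ← e₂.symm_comp_self]
  exact e₂.symm.contDiff.contDiffAt.comp x (contDiffAt_pi.2 fun i => h _)

section OneForms

variable {E : Type*} [NormedAddCommGroup E] [NormedSpace ℝ E]
  {H : Type*} [TopologicalSpace H] {I : ModelWithCorners ℝ E H} [I.Boundaryless]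
  {M : Type*} [TopologicalSpace M] [ChartedSpace H M] [IsManifold I ∞ M]
  {F : Type*} [NormedAddCommGroup F] [NormedSpace ℝ F]

/-- A `1`-form in the preferred chart at `p`, as a field of linear forms. -/
def oneRep (α : MForm I M 1 F) (p : M) (y : E) : E →L[ℝ] F :=
  (ContinuousAlternatingMap.ofSubsingleton ℝ E F (0 : Fin 1)).symm (α.chartRep I p y)

theorem oneRep_apply (α : MForm I M 1 F) (p : M) (y v : E) :
    oneRep α p y v = α.chartRep I p y (fun _ => v) := rfl

variable [FiniteDimensional ℝ E] [FiniteDimensional ℝ F]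

theorem contDiffAt_oneRep {α : MForm I M 1 F} {p : M} {y : E} (hy : y ∈ (extChartAt I p).target)
    {U : Set M} (hα : α.SmoothOn I U) (hU : (extChartAt I p).symm y ∈ U) :
    ContDiffAt ℝ ∞ (α.chartRep I p) y ∧ ContDiffAt ℝ ∞ (oneRep α p) y := by
  have h1 : ContDiffAt ℝ ∞ (α.chartRep I p) y := by
    have := contDiffAt_chartRep_of_smooth ((extChartAt I p).map_target hy) (hα _ hU)
    rwa [(extChartAt I p).right_inv hy] at this
  refine ⟨h1, contDiffAt_clm_of_apply fun v => ?_⟩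
  exact contDiffAt_alternating_apply (v := fun _ _ => v) h1 fun _ => contDiffAt_const

theorem dOne_oneRep {α : MForm I M 1 F} {p : M} {y : E} (hy : y ∈ (extChartAt I p).target)
    {U : Set M} (hα : α.SmoothOn I U) (hU : (extChartAt I p).symm y ∈ U) (v w : E) :
    dOne (oneRep α p) y v w = α.d I ((extChartAt I p).symm y)
      ![mfderiv 𝓘(ℝ, E) I (extChartAt I p).symm y v,
        mfderiv 𝓘(ℝ, E) I (extChartAt I p).symm y w] := by
  obtain ⟨h1, h2⟩ := contDiffAt_oneRep hy hα hU
  rw [← extDeriv_oneForm_apply (oneRep_apply α p) (h1.differentiableAt (by simp))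
    (h2.differentiableAt (by simp))]
  rw [d_eq_chartRep ((extChartAt I p).map_target hy) (hα _ hU), (extChartAt I p).right_inv hy]
  have e := fun v => DFunLike.congr_fun (mfderiv_comp_mfderiv_symm_extChartAt (I := I) hy) v
  refine congrArg (extDeriv (α.chartRep I p) y) (funext fun i => ?_)
  fin_cases i
  exacts [(e v).symm, (e w).symm]

/-- The real coordinates of a skew-Hermitian matrix of `1`-forms. -/
def realG (κ : Fin 2 → Fin 2 → E →L[ℝ] ℂ) : Fin 3 → E →L[ℝ] ℝ :=
  ![Complex.imCLM.comp (κ 1 1) - Complex.imCLM.comp (κ 0 0),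
    -(2 : ℝ) • Complex.reCLM.comp (κ 0 1), (2 : ℝ) • Complex.imCLM.comp (κ 0 1)]

/-- The trace of a skew-Hermitian matrix of `1`-forms. -/
def realRho (κ : Fin 2 → Fin 2 → E →L[ℝ] ℂ) : E →L[ℝ] ℝ :=
  Complex.imCLM.comp (κ 0 0) + Complex.imCLM.comp (κ 1 1)

theorem kapC_real {κ : Fin 2 → Fin 2 → E →L[ℝ] ℂ} (h : ∀ a b v, κ a b v = -star (κ b a v))
    (a b : Fin 2) (v : E) : kapC (fun i => realG κ i v) (realRho κ v) a b = κ a b v := by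
  have h00 := h 0 0 v
  have h11 := h 1 1 v
  have h10 := h 1 0 v
  simp only [Complex.ext_iff] at h00 h11 h10
  simp at h00 h11 h10
  have e0 : (κ 0 0 v).re = 0 := by linarith
  have e1 : (κ 1 1 v).re = 0 := by linarith
  fin_cases a <;> fin_cases b <;> apply Complex.ext <;>
    simp [kapC, realG, realRho, e0, e1, h10] <;> ring

theorem contDiffOn_quarticMat {σ : ℕ → E → ℂ} {s : Set E} (h : ∀ m, ContDiffOn ℝ ∞ (σ m) s)
    (a b : Fin 3) : ContDiffOn ℝ ∞ (fun y => quarticMat (fun m => σ m y) a b) s := by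
  have h0 := h 0
  have h1 := h 1
  have h2 := h 2
  have h3 := h 3
  have h4 := h 4
  fin_cases a <;> fin_cases b <;>
    simp only [quarticMat, Fin.isValue, Fin.zero_eta, Fin.mk_one, Fin.reduceFinMk,
      Matrix.cons_val_zero, Matrix.cons_val_one, Matrix.cons_val] <;> fun_prop

/-- In a chart the complex equations with A = N = 0 become the real system: the coordinates of κ are
`G` and ρ, and the quartic `S`, read on sorted indices, supplies the real and imaginary parts of H.
-/
theorem IsTypeS.exists_realFrame {k : ℝ} {φ : MForm I M 3 ℝ} {τ : MForm I M 2 ℝ}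
    (h : IsTypeS I k φ τ) (p : M) :
    ∃ (s : Set E) (om : Fin 7 → E → E →L[ℝ] ℝ) (G : Fin 3 → E → E →L[ℝ] ℝ) (rho : E → E →L[ℝ] ℝ)
      (P Q : Fin 3 → Fin 3 → E → ℝ), RealFrame k s om G rho P Q ∧ extChartAt I p p ∈ s ∧
      s ⊆ (extChartAt I p).target ∧
      ∀ x ∈ (extChartAt I p).source, extChartAt I p x ∈ s → ∃ L, IsAdaptedCoframe I k φ τ x L ∧
        ∀ i v, om i (extChartAt I p x) (mfderiv I 𝓘(ℝ, E) (extChartAt I p) x v) = L v i := by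
  obtain ⟨U, hU, hpU, om, κ, A, S, N, ⟨hom, hL⟩, hκ, -, hS, -, hSE, hAN⟩ := h.typeS p
  let s : Set E := (extChartAt I p).target ∩ (extChartAt I p).symm ⁻¹' U
  have hs : IsOpen s := (continuousOn_extChartAt_symm p).isOpen_inter_preimage
    (isOpen_extChartAt_target p) hU
  let κ' : E → Fin 2 → Fin 2 → E →L[ℝ] ℂ := fun y a b => oneRep (κ a b) p y
  let H : Fin 3 → Fin 3 → E → ℂ := fun a b y =>
    quarticMat (fun m => S (quarticIdx m) ((extChartAt I p).symm y)) a b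
  have hκs : ∀ a b, ContDiffOn ℝ ∞ (fun y => κ' y a b) s := fun a b y hy =>
    (contDiffAt_oneRep hy.1 (hκ a b) hy.2).2.contDiffWithinAt
  have hSs : ∀ t, ContDiffOn ℝ ∞ (fun y => S t ((extChartAt I p).symm y)) s := fun t y hy =>
    ((((hS t).contMDiffAt (hU.mem_nhds hy.2)).comp y
      (contMDiffAt_extChartAt_symm hy.1)).contDiffAt).contDiffWithinAt
  have hHs : ∀ a b, ContDiffOn ℝ ∞ (H a b) s := contDiffOn_quarticMat fun m => hSs _
  have hre : ∀ {f : E → E →L[ℝ] ℂ}, ContDiffOn ℝ ∞ f s →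
      ContDiffOn ℝ ∞ (fun y => Complex.reCLM.comp (f y)) s := fun hf =>
    contDiffOn_const.clm_comp hf
  have him : ∀ {f : E → E →L[ℝ] ℂ}, ContDiffOn ℝ ∞ f s →
      ContDiffOn ℝ ∞ (fun y => Complex.imCLM.comp (f y)) s := fun hf =>
    contDiffOn_const.clm_comp hf
  refine ⟨s, fun i => oneRep (om i) p, fun a y => realG (κ' y) a, fun y => realRho (κ' y),
    fun a b y => (H a b y).re, fun a b y => (H a b y).im, ?_,
    ⟨mem_extChartAt_target p, by simpa using hpU⟩, Set.inter_subset_left, ?_⟩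
  · refine
      { isOpen := hs
        om_smooth := fun i y hy => (contDiffAt_oneRep hy.1 (hom i) hy.2).2.contDiffWithinAt
        G_smooth := ?_
        rho_smooth := (him (hκs 0 0)).add (him (hκs 1 1))
        P_smooth := fun a b => Complex.reCLM.contDiff.comp_contDiffOn (hHs a b)
        Q_smooth := fun a b => Complex.imCLM.contDiff.comp_contDiffOn (hHs a b)
        P_symm := ?_
        Q_symm := ?_
        P_trace := ?_
        Q_trace := ?_
        frame := ?_
        eqs := ?_ }
    · intro a
      fin_cases a
      exacts [(him (hκs 1 1)).sub (him (hκs 0 0)), (hre (hκs 0 1)).const_smul (-(2 : ℝ)),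
        (him (hκs 0 1)).const_smul (2 : ℝ)]
    · intro a b y
      fin_cases a <;> fin_cases b <;> rfl
    · intro a b y
      fin_cases a <;> fin_cases b <;> rfl
    · intro y
      simp [H, quarticMat]
      ring
    · intro y
      simp [H, quarticMat]
      ring
    · intro y hy
      obtain ⟨L, -, hL⟩ := hL _ hy.2
      have h1 := mfderiv_comp_mfderiv_symm_extChartAt (I := I) hy.1
      have h2 := mfderiv_symm_comp_mfderiv_extChartAt (I := I) ((extChartAt I p).map_target hy.1)
      rw [(extChartAt I p).right_inv hy.1] at h2
      let e : E ≃L[ℝ] TangentSpace I ((extChartAt I p).symm y) :=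
        ContinuousLinearEquiv.equivOfInverse (mfderiv 𝓘(ℝ, E) I (extChartAt I p).symm y)
          (mfderiv I 𝓘(ℝ, E) (extChartAt I p) ((extChartAt I p).symm y))
          (fun v => DFunLike.congr_fun h1 v) (fun v => DFunLike.congr_fun h2 v)
      exact ⟨e.trans L, fun v i => hL i _⟩
    · intro y hy v w i
      obtain ⟨hsk, -, hsym, he, hn⟩ := hSE _ hy.2
      obtain ⟨hA, hN⟩ := hAN _ hy.2
      have hK := kapC_real (κ := κ' y) fun a b v => hsk a b _
      have hsym' := quartic_eq_of_symmetric (T := fun t => S t ((extChartAt I p).symm y)) hsym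
      have hdz : ∀ i, dOne (oneRep (om i) p) y v w = _ := fun i =>
        dOne_oneRep hy.1 (hom i) hy.2 v w
      -- The components of η and ν together determine all seven real components, so the complex
      -- equations can be verified instead.
      refine congrFun (f := fun i => dOne (oneRep (om i) p) y v w) (eq_of_etaC_nuC ?_ ?_) i
      · intro a
        simp only [H]
        rw [← eta_rhs_eq k _ (fun v i => oneRep (om i) p y v) (fun v a => realG (κ' y) a v)
          (fun v => realRho (κ' y) v)]
        have he' := he a (mfderiv 𝓘(ℝ, E) I (extChartAt I p).symm y v)
          (mfderiv 𝓘(ℝ, E) I (extChartAt I p).symm y w)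
        simp only [hN, mul_zero, zero_mul, Finset.sum_const_zero, add_zero, hsym'] at he'
        simp only [hK, hdz]
        exact he'
      · intro a b
        simp only [H]
        rw [← nu_rhs_eq k _ (fun v i => oneRep (om i) p y v) (fun v a => realG (κ' y) a v)
          (fun v => realRho (κ' y) v)]
        have hn' := hn a b (mfderiv 𝓘(ℝ, E) I (extChartAt I p).symm y v)
          (mfderiv 𝓘(ℝ, E) I (extChartAt I p).symm y w)
        simp only [hA, star_zero, mul_zero, zero_mul, Finset.sum_const_zero, add_zero] at hn'
        simp only [hK, hdz]
        exact hn'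
  · intro x hx hxs
    obtain ⟨L, hL1, hL2⟩ := hL x
      (Set.mem_of_eq_of_mem ((extChartAt I p).left_inv hx).symm hxs.2)
    refine ⟨L, hL1, fun i v => ?_⟩
    rw [hL2, eq_chartRep_pullback (om i) hx]
    rfl

end OneForms

end
end G2ERP

namespace G2ERP
noncomputable section

open Metric

/-! ### Structures of type `S` are locally Baraglia's -/

section

set_option linter.unusedSectionVars false

variable {M : Type*} [TopologicalSpace M] [ChartedSpace (EuclideanSpace ℝ (Fin 7)) M]
  [IsManifold (𝓡 7) ∞ M]

/-- The space ℝ³ × ℝ⁴ carries both the product model and the model of a single vector space; this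
passes between the two. -/
theorem contMDiff_toProd : ContMDiff modelBR4 𝓘(ℝ, E3 × (Fin 4 → ℝ)) ∞
    (fun q : E3 × (Fin 4 → ℝ) => q) :=
  (contMDiff_fst (I := 𝓡 3) (J := 𝓘(ℝ, Fin 4 → ℝ))).prodMk_space contMDiff_snd

theorem contMDiffAt_of_prod {f : M → E3 × (Fin 4 → ℝ)} {x : M}
    (h : ContMDiffAt (𝓡 7) 𝓘(ℝ, E3 × (Fin 4 → ℝ)) ∞ f x) : ContMDiffAt (𝓡 7) modelBR4 ∞ f x :=
  ContMDiffAt.prodMk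
    ((ContinuousLinearMap.fst ℝ E3 (Fin 4 → ℝ)).contDiff.contMDiff.contMDiffAt.comp x h)
    ((ContinuousLinearMap.snd ℝ E3 (Fin 4 → ℝ)).contDiff.contMDiff.contMDiffAt.comp x h)

/-- The chart of M followed by the flat chart identifies (u, t) with (U, Y). Comparing differentials
reduces both equalities to the pointwise normal forms of φ and τ. -/
theorem IsTypeS.exists_baraglia {k c : ℝ} (hk : 0 < k) (hkc : 8 * k ^ 3 * c = 1)
    {φ : MForm (𝓡 7) M 3 ℝ} {τ : MForm (𝓡 7) M 2 ℝ} (h : IsTypeS (𝓡 7) k φ τ) (p : M) :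
    ∃ (u : E3 → Lam2) (Φ : OpenPartialHomeomorph M (E3 × (Fin 4 → ℝ))),
      IsMaximalInQuadric u ∧ p ∈ Φ.source ∧ ContMDiffOn (𝓡 7) modelBR4 ∞ Φ Φ.source ∧
      ContMDiffOn modelBR4 (𝓡 7) ∞ Φ.symm Φ.target ∧
      ∀ x ∈ Φ.source, φ x = (baragliaForm c u).pullback (𝓡 7) modelBR4 Φ x ∧
        τ x = (12 * k ^ 2) • (tautForm u).pullback (𝓡 7) modelBR4 Φ x := by
  obtain ⟨s, om, G, rho, P, Q, hR, hps, hst, hL⟩ := h.exists_realFrame p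
  obtain ⟨r, Y, U, f, N, N', hbs, hF⟩ := hR.exists_flatChart hk hps
  obtain ⟨Ψ, u, hu, hpΨ, hΨb, hΨ, hΨs, hval⟩ := hF.exists_chart hk hR hbs
  let χ := extChartAt (𝓡 7) p
  let Φ : OpenPartialHomeomorph M (E3 × (Fin 4 → ℝ)) := (chartAt _ p).trans Ψ
  have hΦ : ∀ x, Φ x = Ψ (χ x) := fun x => rfl
  have hsrc : ∀ x, x ∈ Φ.source ↔ x ∈ χ.source ∧ χ x ∈ Ψ.source := by
    intro x
    simp [Φ, χ, extChartAt]
  have hΦs : ∀ x ∈ Φ.source, ContMDiffAt (𝓡 7) 𝓘(ℝ, E3 × (Fin 4 → ℝ)) ∞ Φ x := fun x hx =>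
    ((hΨ.contDiffAt (Ψ.open_source.mem_nhds ((hsrc x).1 hx).2)).contMDiffAt).comp x
      (contMDiffAt_extChartAt_of_mem ((hsrc x).1 hx).1)
  have hΦ1 : ContMDiffOn (𝓡 7) modelBR4 ∞ Φ Φ.source := fun x hx =>
    (contMDiffAt_of_prod (hΦs x hx)).contMDiffWithinAt
  have hΦ2 : ContMDiffOn modelBR4 (𝓡 7) ∞ Φ.symm Φ.target := by
    intro q hq
    have hq' : q ∈ Ψ.target ∧ Ψ.symm q ∈ χ.target := by
      simpa [Φ, χ, OpenPartialHomeomorph.trans_target, extChartAt] using hq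
    have h1 : ContMDiffAt 𝓘(ℝ, E3 × (Fin 4 → ℝ)) (𝓡 7) ∞ Φ.symm q :=
      (contMDiffAt_extChartAt_symm hq'.2).comp q
        (hΨs.contDiffAt (Ψ.open_target.mem_nhds hq'.1)).contMDiffAt
    exact (h1.comp q contMDiff_toProd.contMDiffAt).contMDiffWithinAt
  refine ⟨u, Φ, hu, (hsrc p).2 ⟨mem_extChartAt_source p, hpΨ⟩, hΦ1, hΦ2, fun x hx => ?_⟩
  obtain ⟨hx1, hx2⟩ := (hsrc x).1 hx
  have hxb : χ x ∈ ball (χ p) r := hΨb hx2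
  obtain ⟨L, ⟨hL1, hL2⟩, hL3⟩ := hL x hx1 (hbs hxb)
  let D : TangentSpace (𝓡 7) x →L[ℝ] EuclideanSpace ℝ (Fin 7) :=
    mfderiv (𝓡 7) 𝓘(ℝ, EuclideanSpace ℝ (Fin 7)) χ x
  let DΦ : TangentSpace (𝓡 7) x →L[ℝ] TangentSpace modelBR4 (Φ x) := mfderiv (𝓡 7) modelBR4 Φ x
  have hdΦ : ∀ y ∈ Φ.source, MDifferentiableAt (𝓡 7) modelBR4 Φ y := fun y hy =>
    (hΦ1.contMDiffAt (Φ.open_source.mem_nhds hy)).mdifferentiableAt (by simp)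
  have hsurj : Function.Surjective DΦ := by
    refine OpenPartialHomeomorph.MDifferentiable.mfderiv_surjective (e := Φ) ⟨?_, ?_⟩ hx
    · exact hΦ1.mdifferentiableOn (by simp)
    · exact hΦ2.mdifferentiableOn (by simp)
  have hder : ∀ v, ((du u (Φ x).1 (DΦ v).1, (DΦ v).2) : Lam2 × (Fin 4 → ℝ)) =
      (fderiv ℝ U (χ x) (D v), fderiv ℝ Y (χ x) (D v)) := by
    intro v
    have e1 : (tautMap u ∘ Φ) =ᶠ[nhds x] (fun y => (U y, Y y)) ∘ χ := by
      filter_upwards [Φ.open_source.mem_nhds hx] with y hy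
      obtain ⟨h1, h2, -⟩ := hval _ ((hsrc y).1 hy).2
      exact Prod.ext h2 h1
    have e2 := e1.mfderiv_eq (I := 𝓡 7) (I' := 𝓘(ℝ, Lam2 × (Fin 4 → ℝ)))
    rw [mfderiv_comp (I' := modelBR4) x
      ((contMDiff_tautMap hu.smooth).mdifferentiableAt (by simp)) (hdΦ x hx)] at e2
    have hW : HasFDerivAt (fun y => (U y, Y y)) ((fderiv ℝ U (χ x)).prod (fderiv ℝ Y (χ x))) (χ x)
        :=
      (hF.differentiableAt_U hxb).hasFDerivAt.prodMk (hF.differentiableAt_Y hxb).hasFDerivAt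
    rw [mfderiv_comp (I' := 𝓘(ℝ, EuclideanSpace ℝ (Fin 7))) x
      hW.differentiableAt.mdifferentiableAt
      ((contMDiffAt_extChartAt_of_mem hx1).mdifferentiableAt (by simp)), mfderiv_eq_fderiv,
      hW.fderiv] at e2
    exact (mfderiv_tautMap hu.smooth (Φ x) (DΦ v)).symm.trans (DFunLike.congr_fun e2 v)
  have hder1 : ∀ v, du u (Φ x).1 (DΦ v).1 = fderiv ℝ U (χ x) (D v) := fun v =>
    congrArg Prod.fst (hder v)
  have hder2 : ∀ v, (DΦ v).2 = fderiv ℝ Y (χ x) (D v) := fun v => congrArg Prod.snd (hder v)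
  have hfib : ∀ v, fibL om (χ x) (D v) = fib (L v) := by
    intro v
    funext i
    fin_cases i
    exacts [hL3 3 v, hL3 4 v, hL3 5 v, hL3 6 v]
  let lam : Fin 3 → E3 →L[ℝ] ℝ := fun a =>
    (pairL.flip (f a (χ x))).comp (mfderiv (𝓡 3) 𝓘(ℝ, Lam2) u (Φ x).1)
  have hsum : ∀ v, du u (Φ x).1 (DΦ v).1 =
      ∑ a : Fin 3, (2 * k * L v (Fin.castLE (by norm_num) a)) • f a (χ x) := by
    intro v
    rw [hder1, hF.U_deriv _ hxb]
    exact Finset.sum_congr rfl fun a _ => by rw [← hL3]; rfl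
  have hlam : ∀ v a, lam a (DΦ v).1 = 2 * k * L v (Fin.castLE (by norm_num) a) := by
    intro v a
    change pair (du u (Φ x).1 (DΦ v).1) (f a (χ x)) = _
    rw [hsum, ← pairL_apply]
    simp [pairL_apply, hF.f_norm _ hxb]
  -- The differential of the chart is onto, so the expansion of du, known on images of tangent
  -- vectors of M, holds on all base vectors.
  have hd : ∀ w : E3, du u (Φ x).1 w = ∑ a, lam a w • f a (χ x) := by
    intro w
    obtain ⟨v, hv⟩ := hsurj ((w, 0) : E3 × (Fin 4 → ℝ))
    have hv1 : (DΦ v).1 = w := congrArg Prod.fst hv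
    have h1 := hsum v
    simp only [← hlam] at h1
    rw [hv1] at h1
    exact h1
  constructor
  · ext v
    rw [hL1]
    refine Eq.symm (baragliaForm_eq_phi0 (p := Φ x) (v := fun i => DΦ (v i))
      (z := fun i => L (v i)) hkc hu.smooth (hF.f_norm _ hxb) (hval _ hx2).2.2 hd
      (fun i a => hlam _ _) fun a i j => ?_)
    rw [hder2, hder2, hF.f_Y _ hxb, hfib, hfib]
    field_simp
  · ext v
    have h1 := tautForm_eq_tau0 (k := k) (u := u) (p := Φ x) (v := DΦ (v 0)) (w := DΦ (v 1))
      (z := L (v 0)) (z' := L (v 1)) (by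
        rw [hder2, hder2, hΦ, (hval _ hx2).2.1, hF.U_Y _ hxb, hfib, hfib]
        field_simp)
    rw [hL2]
    refine Eq.trans (congrArg (6 * k * ·) (congrArg tau0 (vec2_eta _))) (h1.symm.trans ?_)
    exact congrArg (12 * k ^ 2 * ·) (congrArg (tautForm u (Φ x)) (vec2_eta fun i => DΦ (v i)).symm)

end

end
end G2ERP

namespace G2ERP
noncomputable section

/-! ### Clifford relations in `Λ²(ℝ⁴)*` and adapted frames of `ℝ⁴` -/

/-- The matrix of a `2`-form. -/
def mat (α : Lam2) : Matrix (Fin 4) (Fin 4) ℝ := Matrix.of fun i j => co α i j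

/-- The matrix of the dual bivector of a `2`-form. -/
def hd (α : Lam2) : Matrix (Fin 4) (Fin 4) ℝ :=
  !![0, co α 2 3, -co α 1 3, co α 1 2;
     -co α 2 3, 0, co α 0 3, -co α 0 2;
     co α 1 3, -co α 0 3, 0, co α 0 1;
     -co α 1 2, co α 0 2, -co α 0 1, 0]

theorem mat_eq (α : Lam2) : mat α =
  !![0, co α 0 1, co α 0 2, co α 0 3;
     -co α 0 1, 0, co α 1 2, co α 1 3;
     -co α 0 2, -co α 1 2, 0, co α 2 3;
     -co α 0 3, -co α 1 3, -co α 2 3, 0] := by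
  ext i j
  fin_cases i <;> fin_cases j <;> simp [mat, co_self]
  all_goals exact co_swap _ _ _

theorem mat_transpose (α : Lam2) : (mat α).transpose = -mat α := by
  ext i j
  exact co_swap _ _ _

theorem hd_transpose (α : Lam2) : (hd α).transpose = -hd α := by
  ext i j
  fin_cases i <;> fin_cases j <;> simp [hd]

/-- The polarised Pfaffian identity: a skew 4 × 4 matrix times its dual is minus its Pfaffian, which
is ⟨α, α⟩. These are the Clifford relations of ℝ^{3,3}, with `mat` and `hd` acting between the
half-spin spaces ℝ⁴ and (ℝ⁴)*. -/
theorem hd_mul_mat (α β : Lam2) : hd α * mat β + hd β * mat α = -(2 * pair α β) • 1 := by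
  rw [mat_eq, mat_eq, pair_eq]
  ext i j
  fin_cases i <;> fin_cases j <;> simp [hd] <;> ring

theorem mat_mul_hd (α β : Lam2) : mat α * hd β + mat β * hd α = -(2 * pair α β) • 1 := by
  rw [mat_eq, mat_eq, pair_eq]
  ext i j
  fin_cases i <;> fin_cases j <;> simp [hd] <;> ring

theorem lam2_apply_mat (α : Lam2) (v w : Fin 4 → ℝ) :
    α ![v, w] = v ⬝ᵥ (mat α).mulVec w := by
  rw [lam2_apply, mat_eq]
  simp [dotProduct, Matrix.mulVec, Fin.sum_univ_four]
  ring

section Relations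

variable {α β γ : Lam2}

theorem hd_mul_mat_swap (h : pair α β = 0) : hd α * mat β = -(hd β * mat α) := by
  have := hd_mul_mat α β
  rw [h] at this
  exact eq_neg_of_add_eq_zero_left (by simpa using this)

theorem mat_mul_hd_swap (h : pair α β = 0) : mat α * hd β = -(mat β * hd α) := by
  have := mat_mul_hd α β
  rw [h] at this
  exact eq_neg_of_add_eq_zero_left (by simpa using this)

theorem hd_mul_mat_self (α : Lam2) : hd α * mat α = -(pair α α) • 1 := by
  have := hd_mul_mat α α
  rw [← two_smul ℝ, show -(2 * pair α α) = 2 * -pair α α by ring, mul_smul] at this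
  exact smul_right_injective _ (two_ne_zero' ℝ) this

theorem mat_mul_hd_self (α : Lam2) : mat α * hd α = -(pair α α) • 1 := by
  have := mat_mul_hd α α
  rw [← two_smul ℝ, show -(2 * pair α α) = 2 * -pair α α by ring, mul_smul] at this
  exact smul_right_injective _ (two_ne_zero' ℝ) this

end Relations

/-- An oriented orthonormal triple spans a space-like `3`-plane. -/
def IsOrtho (f : Fin 3 → Lam2) : Prop := ∀ a c, pair (f a) (f c) = if a = c then 1 else 0

/-- The complex structures defined by an orthonormal triple. -/
def cplx (f : Fin 3 → Lam2) (a : Fin 3) : Matrix (Fin 4) (Fin 4) ℝ :=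
  hd (f (a + 2)) * mat (f (a + 1))

/-- The metric on `ℝ⁴` defined by an orthonormal triple. -/
def gmat (f : Fin 3 → Lam2) : Matrix (Fin 4) (Fin 4) ℝ := mat (f 0) * cplx f 0

section Triple

variable {f : Fin 3 → Lam2}

theorem IsOrtho.hm (hf : IsOrtho f) {a b : Fin 3} (h : a ≠ b) :
    hd (f a) * mat (f b) = -(hd (f b) * mat (f a)) := hd_mul_mat_swap (by rw [hf, if_neg h])

theorem IsOrtho.mh (hf : IsOrtho f) {a b : Fin 3} (h : a ≠ b) :
    mat (f a) * hd (f b) = -(mat (f b) * hd (f a)) := mat_mul_hd_swap (by rw [hf, if_neg h])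

theorem IsOrtho.hm_self (hf : IsOrtho f) (a : Fin 3) : hd (f a) * mat (f a) = -1 := by
  rw [hd_mul_mat_self, hf, if_pos rfl]
  simp

theorem IsOrtho.mh_self (hf : IsOrtho f) (a : Fin 3) : mat (f a) * hd (f a) = -1 := by
  rw [mat_mul_hd_self, hf, if_pos rfl]
  simp

theorem IsOrtho.cplx_sq (hf : IsOrtho f) (a : Fin 3) : cplx f a * cplx f a = -1 := by
  have h : a + 1 ≠ a + 2 := by decide +revert
  calc cplx f a * cplx f a
      = hd (f (a + 2)) * (mat (f (a + 1)) * hd (f (a + 2))) * mat (f (a + 1)) := by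
        simp only [cplx, Matrix.mul_assoc]
    _ = -((hd (f (a + 2)) * mat (f (a + 2))) * (hd (f (a + 1)) * mat (f (a + 1)))) := by
        rw [hf.mh h]
        simp only [Matrix.mul_assoc, Matrix.mul_neg, Matrix.neg_mul]
    _ = -1 := by rw [hf.hm_self, hf.hm_self]; simp

/-- The two factors share one vector of the triple, which cancels in the middle. With `cplx_sq` this
gives the quaternion relations. -/
theorem IsOrtho.cplx_succ_mul (hf : IsOrtho f) (a : Fin 3) :
    cplx f (a + 1) * cplx f a = cplx f (a + 2) := by
  have e1 : a + 1 + 2 = a := by decide +revert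
  have e2 : a + 1 + 1 = a + 2 := by decide +revert
  have e3 : a + 2 + 2 = a + 1 := by decide +revert
  have e4 : a + 2 + 1 = a := by decide +revert
  have h : a ≠ a + 1 := by decide +revert
  calc cplx f (a + 1) * cplx f a
      = hd (f a) * (mat (f (a + 2)) * hd (f (a + 2))) * mat (f (a + 1)) := by
        simp only [cplx, Matrix.mul_assoc, e1, e2]
    _ = cplx f (a + 2) := by
        rw [hf.mh_self, cplx, e3, e4, hf.hm h.symm]
        simp

theorem IsOrtho.cplx_mul_succ (hf : IsOrtho f) (a : Fin 3) :
    cplx f a * cplx f (a + 1) = -cplx f (a + 2) := by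
  have e1 : a + 1 + 1 = a + 2 := by decide +revert
  have e2 : a + 1 + 2 = a := by decide +revert
  have h := hf.cplx_succ_mul (a + 1)
  rw [e1, e2] at h
  rw [← h, Matrix.mul_assoc, hf.cplx_sq]
  simp

/-- The product is a triple Clifford product of orthogonal vectors, hence invariant under cyclic
shifts. One metric thus serves all three complex structures. -/
theorem IsOrtho.mat_mul_cplx_succ (hf : IsOrtho f) (a : Fin 3) :
    mat (f (a + 1)) * cplx f (a + 1) = mat (f a) * cplx f a := by
  have e1 : a + 1 + 2 = a := by decide +revert
  have e2 : a + 1 + 1 = a + 2 := by decide +revert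
  have h1 : a + 1 ≠ a := by decide +revert
  have h2 : a + 1 ≠ a + 2 := by decide +revert
  simp only [cplx, e1, e2]
  rw [← Matrix.mul_assoc, hf.mh h1, Matrix.neg_mul, Matrix.mul_assoc, hf.hm h2]
  simp

theorem IsOrtho.mat_mul_cplx (hf : IsOrtho f) (a : Fin 3) : mat (f a) * cplx f a = gmat f := by
  have h0 := hf.mat_mul_cplx_succ 0
  have h1 := hf.mat_mul_cplx_succ 1
  fin_cases a
  · rfl
  · exact h0
  · exact h1.trans h0

theorem IsOrtho.mat_eq_gmat (hf : IsOrtho f) (a : Fin 3) : mat (f a) = -(gmat f * cplx f a) := by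
  rw [← hf.mat_mul_cplx a, Matrix.mul_assoc, hf.cplx_sq]
  simp

theorem IsOrtho.cplx_transpose_mul_mat (hf : IsOrtho f) (a : Fin 3) :
    (cplx f a).transpose * mat (f a) = -gmat f := by
  have h1 : a + 2 ≠ a := by decide +revert
  have h2 : a + 1 ≠ a := by decide +revert
  have h3 : a + 1 ≠ a + 2 := by decide +revert
  have e : (cplx f a).transpose = mat (f (a + 1)) * hd (f (a + 2)) := by
    rw [cplx, Matrix.transpose_mul, mat_transpose, hd_transpose, neg_mul_neg]
  rw [e, Matrix.mul_assoc, hf.hm h1, Matrix.mul_neg, ← Matrix.mul_assoc, hf.mh h2, Matrix.neg_mul,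
    Matrix.mul_assoc, hf.hm h3, ← hf.mat_mul_cplx a, cplx]
  simp

theorem IsOrtho.cplx_transpose_mul (hf : IsOrtho f) (a : Fin 3) :
    (cplx f a).transpose * gmat f = -(gmat f * cplx f a) := by
  rw [← hf.mat_mul_cplx a, ← Matrix.mul_assoc, hf.cplx_transpose_mul_mat, hf.mat_mul_cplx,
    Matrix.neg_mul]

theorem IsOrtho.gmat_transpose (hf : IsOrtho f) : (gmat f).transpose = gmat f := by
  rw [gmat, Matrix.transpose_mul, mat_transpose, Matrix.mul_neg, hf.cplx_transpose_mul_mat, neg_neg,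
    gmat]

/-- The components of a `2`-form in the negative definite complement of `posBasis`. -/
def negBasis : Fin 3 → Lam2 := ![negU, negN1, negN2]

/-- The trace is alternating and trilinear in the triple; split into components along `posBasis` and
`negBasis`, only the two pure determinants contribute. -/
theorem trace_gmat (f : Fin 3 → Lam2) : (gmat f).trace =
    4 * (Matrix.det (Matrix.of fun i j => pair (f i) (posBasis j)) +
      Matrix.det (Matrix.of fun i j => pair (f i) (negBasis j))) := by
  simp only [Matrix.det_fin_three, Matrix.of_apply, pair_eq, posBasis, negBasis, negU, negN1, negN2,
    Matrix.cons_val_zero, Matrix.cons_val_one, Matrix.cons_val, co_add, co_sub, co_neg, co_dx]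
  simp [gmat, cplx, Matrix.trace, mat_eq, hd, Fin.sum_univ_four]
  ring

theorem pair_eq_basis (α β : Lam2) : pair α β =
    ∑ j, pair α (posBasis j) * pair β (posBasis j)
      - ∑ j, pair α (negBasis j) * pair β (negBasis j) := by
  simp only [Fin.sum_univ_three, pair_eq, posBasis, negBasis, negU, negN1, negN2,
    Matrix.cons_val_zero, Matrix.cons_val_one, Matrix.cons_val, co_add, co_sub, co_neg, co_dx]
  simp
  ring

/-- The determinant of 1 + N Nᵀ is one plus the squares of all minors of N (Cauchy-Binet). The
minors of orders one and two are discarded. -/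
theorem det_one_add_mul_transpose (N : Matrix (Fin 3) (Fin 3) ℝ) :
    N.det ^ 2 + 1 ≤ (1 + N * N.transpose).det := by
  have e : (1 + N * N.transpose).det = N.det ^ 2 + 1
      + (N 0 0 ^ 2 + N 0 1 ^ 2 + N 0 2 ^ 2 + N 1 0 ^ 2 + N 1 1 ^ 2 + N 1 2 ^ 2
        + N 2 0 ^ 2 + N 2 1 ^ 2 + N 2 2 ^ 2)
      + ((N 0 0 * N 1 1 - N 0 1 * N 1 0) ^ 2 + (N 0 0 * N 1 2 - N 0 2 * N 1 0) ^ 2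
        + (N 0 1 * N 1 2 - N 0 2 * N 1 1) ^ 2 + (N 0 0 * N 2 1 - N 0 1 * N 2 0) ^ 2
        + (N 0 0 * N 2 2 - N 0 2 * N 2 0) ^ 2 + (N 0 1 * N 2 2 - N 0 2 * N 2 1) ^ 2
        + (N 1 0 * N 2 1 - N 1 1 * N 2 0) ^ 2 + (N 1 0 * N 2 2 - N 1 2 * N 2 0) ^ 2
        + (N 1 1 * N 2 2 - N 1 2 * N 2 1) ^ 2) := by
    simp [Matrix.det_fin_three, Matrix.mul_apply, Fin.sum_univ_three]
    ring
  rw [e]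
  have : 0 ≤ (N 0 0 ^ 2 + N 0 1 ^ 2 + N 0 2 ^ 2 + N 1 0 ^ 2 + N 1 1 ^ 2 + N 1 2 ^ 2
        + N 2 0 ^ 2 + N 2 1 ^ 2 + N 2 2 ^ 2) := by positivity
  have : 0 ≤ ((N 0 0 * N 1 1 - N 0 1 * N 1 0) ^ 2 + (N 0 0 * N 1 2 - N 0 2 * N 1 0) ^ 2
        + (N 0 1 * N 1 2 - N 0 2 * N 1 1) ^ 2 + (N 0 0 * N 2 1 - N 0 1 * N 2 0) ^ 2
        + (N 0 0 * N 2 2 - N 0 2 * N 2 0) ^ 2 + (N 0 1 * N 2 2 - N 0 2 * N 2 1) ^ 2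
        + (N 1 0 * N 2 1 - N 1 1 * N 2 0) ^ 2 + (N 1 0 * N 2 2 - N 1 2 * N 2 0) ^ 2
        + (N 1 1 * N 2 2 - N 1 2 * N 2 1) ^ 2) := by positivity
  linarith

/-- If A and N collect the positive and negative components of an orthonormal triple, then A Aᵀ = 1
+ N Nᵀ. Hence the positive determinant dominates the negative one. -/
theorem IsOrtho.orient_sq (hf : IsOrtho f) :
    Matrix.det (Matrix.of fun i j => pair (f i) (negBasis j)) ^ 2 + 1 ≤ orient f ^ 2 := by
  refine (det_one_add_mul_transpose _).trans (le_of_eq ?_)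
  have e : orient f ^ 2 = Matrix.det ((Matrix.of fun i j => pair (f i) (posBasis j)) *
      (Matrix.of fun i j => pair (f i) (posBasis j)).transpose) := by
    rw [Matrix.det_mul, Matrix.det_transpose, ← sq, orient]
  rw [e]
  congr 1
  ext i j
  have h := pair_eq_basis (f i) (f j)
  rw [hf] at h
  simp only [Matrix.add_apply, Matrix.one_apply, Matrix.mul_apply, Matrix.transpose_apply,
    Matrix.of_apply]
  exact eq_sub_iff_add_eq.1 h

theorem IsOrtho.orient_ne_zero (hf : IsOrtho f) : orient f ≠ 0 := by
  intro h
  have := hf.orient_sq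
  rw [h] at this
  nlinarith [sq_nonneg (Matrix.det (Matrix.of fun i j => pair (f i) (negBasis j)))]

/-- By `orient_sq` positive orientation outweighs the determinant of the negative components, so
`gmat` has positive trace and some positive diagonal entry. The orientation thus decides the sign of
the metric. -/
theorem IsOrtho.exists_pos (hf : IsOrtho f) (ho : 0 < orient f) :
    ∃ x : Fin 4 → ℝ, 0 < x ⬝ᵥ (gmat f).mulVec x := by
  have h1 : 0 < (gmat f).trace := by
    rw [trace_gmat]
    have h2 := hf.orient_sq
    have h3 := abs_lt_of_sq_lt_sq (lt_of_lt_of_le (lt_add_one _) h2) ho.le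
    have h4 := (abs_lt.1 h3).1
    have h5 : Matrix.det (Matrix.of fun i j => pair (f i) (posBasis j)) = orient f := rfl
    rw [h5]
    linarith
  obtain ⟨i, -, hi⟩ := Finset.exists_lt_of_sum_lt (f := fun _ : Fin 4 => (0 : ℝ))
    (g := fun i => gmat f i i) (s := Finset.univ) (by simpa [Matrix.trace] using h1)
  exact ⟨Pi.single i 1, by simpa using hi⟩

/-- The product of the first complex structure of an orthonormal triple with that of a unit
negative vector. -/
def invo (f : Fin 3 → Lam2) (u : Lam2) : Matrix (Fin 4) (Fin 4) ℝ := hd (f 0) * mat u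

variable {u : Lam2}

theorem IsOrtho.mat_neg_eq (hf : IsOrtho f) : mat u = -(mat (f 0) * invo f u) := by
  rw [invo, ← Matrix.mul_assoc, hf.mh_self]
  simp

theorem IsOrtho.invo_transpose_mul (hf : IsOrtho f) :
    (invo f u).transpose * mat (f 0) = mat (f 0) * invo f u := by
  rw [invo, Matrix.transpose_mul, mat_transpose, hd_transpose, neg_mul_neg, Matrix.mul_assoc,
    hf.hm_self, ← Matrix.mul_assoc, hf.mh_self]
  simp

theorem IsOrtho.invo_sq (hf : IsOrtho f) (hu : pair u u = -1) (hfu : ∀ a, pair (f a) u = 0) :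
    invo f u * invo f u = 1 := by
  have h1 : mat u * hd (f 0) = -(mat (f 0) * hd u) := mat_mul_hd_swap (by rw [pair_comm, hfu])
  calc invo f u * invo f u = hd (f 0) * (mat u * hd (f 0)) * mat u := by
        simp only [invo, Matrix.mul_assoc]
    _ = -((hd (f 0) * mat (f 0)) * (hd u * mat u)) := by
        rw [h1]
        simp only [Matrix.mul_assoc, Matrix.mul_neg, Matrix.neg_mul]
    _ = 1 := by rw [hf.hm_self, hd_mul_mat_self, hu]; simp

/-- The involution is the Clifford product of f₀ and u, and the complex structure that of f₂ and f₁.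
Two such products with four distinct orthogonal vectors commute, whereas for `cplx f 1` the shared
vector f₀ makes them anticommute. -/
theorem IsOrtho.invo_cplx_zero (hf : IsOrtho f) (hfu : ∀ a, pair (f a) u = 0) :
    invo f u * cplx f 0 = cplx f 0 * invo f u := by
  have h1 : ∀ a, mat u * hd (f a) = -(mat (f a) * hd u) := fun a =>
    mat_mul_hd_swap (by rw [pair_comm, hfu])
  have h2 : ∀ a, hd u * mat (f a) = -(hd (f a) * mat u) := fun a =>
    hd_mul_mat_swap (by rw [pair_comm, hfu])
  calc invo f u * cplx f 0 = hd (f 0) * (mat u * hd (f 2)) * mat (f 1) := by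
        simp only [invo, cplx, Matrix.mul_assoc]; rfl
    _ = hd (f 0) * mat (f 2) * hd (f 1) * mat u := by
        rw [h1]
        simp only [Matrix.mul_neg, Matrix.neg_mul, Matrix.mul_assoc, h2, neg_neg]
    _ = hd (f 2) * (mat (f 1) * hd (f 0)) * mat u := by
        rw [hf.hm (show (0 : Fin 3) ≠ 2 by decide), hf.mh (show (1 : Fin 3) ≠ 0 by decide)]
        simp only [Matrix.mul_neg, Matrix.neg_mul, Matrix.mul_assoc]
    _ = _ := by simp only [invo, cplx, Matrix.mul_assoc]; rfl

theorem IsOrtho.invo_cplx_one (hf : IsOrtho f) (hfu : ∀ a, pair (f a) u = 0) :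
    invo f u * cplx f 1 = -(cplx f 1 * invo f u) := by
  have h1 : ∀ a, mat u * hd (f a) = -(mat (f a) * hd u) := fun a =>
    mat_mul_hd_swap (by rw [pair_comm, hfu])
  have h2 : ∀ a, hd u * mat (f a) = -(hd (f a) * mat u) := fun a =>
    hd_mul_mat_swap (by rw [pair_comm, hfu])
  calc invo f u * cplx f 1 = hd (f 0) * (mat u * hd (f 0)) * mat (f 2) := by
        simp only [invo, cplx, Matrix.mul_assoc]; rfl
    _ = hd (f 0) * mat (f 0) * hd (f 2) * mat u := by
        rw [h1]
        simp only [Matrix.mul_neg, Matrix.neg_mul, Matrix.mul_assoc, h2, neg_neg]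
    _ = -(hd (f 0) * (mat (f 2) * hd (f 0)) * mat u) := by
        rw [hf.mh (show (2 : Fin 3) ≠ 0 by decide)]
        simp only [Matrix.mul_neg, Matrix.neg_mul, Matrix.mul_assoc, neg_neg]
    _ = _ := by simp only [invo, cplx, Matrix.mul_assoc]; rfl

theorem IsOrtho.invo_cplx_two (hf : IsOrtho f) (hfu : ∀ a, pair (f a) u = 0) :
    invo f u * cplx f 2 = -(cplx f 2 * invo f u) := by
  have h : cplx f 1 * cplx f 0 = cplx f 2 := hf.cplx_succ_mul 0
  rw [← h, ← Matrix.mul_assoc, hf.invo_cplx_one hfu, Matrix.neg_mul, Matrix.mul_assoc,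
    hf.invo_cplx_zero hfu, Matrix.mul_assoc]

theorem dot_mulVec_transpose (A : Matrix (Fin 4) (Fin 4) ℝ) (x y : Fin 4 → ℝ) :
    A.mulVec x ⬝ᵥ y = x ⬝ᵥ A.transpose.mulVec y := by
  rw [Matrix.mulVec_transpose, dotProduct_comm, Matrix.dotProduct_mulVec, dotProduct_comm]

/-- The involution is self-adjoint for the metric, so a vector of positive norm splits orthogonally
into eigenvectors, one of which has positive norm. If only the +1 part does, `cplx f 1`, an isometry
that anticommutes with the involution, carries it to the -1 eigenspace. -/
theorem IsOrtho.exists_adapted (hf : IsOrtho f) (ho : 0 < orient f) (hu : pair u u = -1)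
    (hfu : ∀ a, pair (f a) u = 0) :
    ∃ x : Fin 4 → ℝ, (invo f u).mulVec x = -x ∧ 0 < x ⬝ᵥ (gmat f).mulVec x := by
  obtain ⟨x, hx⟩ := hf.exists_pos ho
  set E := invo f u with hE
  have hsq : E.mulVec (E.mulVec x) = x := by
    rw [Matrix.mulVec_mulVec, hf.invo_sq hu hfu, Matrix.one_mulVec]
  have hsym : E.transpose * gmat f = gmat f * E := by
    rw [gmat, ← Matrix.mul_assoc, hf.invo_transpose_mul, Matrix.mul_assoc, hf.invo_cplx_zero hfu,
      ← Matrix.mul_assoc]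
  set y := x - E.mulVec x with hy
  set z := x + E.mulVec x with hz
  have hEy : E.mulVec y = -y := by rw [hy, Matrix.mulVec_sub, hsq]; abel
  have hEz : E.mulVec z = z := by rw [hz, Matrix.mulVec_add, hsq]; abel
  have hzy : z ⬝ᵥ (gmat f).mulVec y = 0 := by
    have h1 : z ⬝ᵥ (gmat f).mulVec y = -(z ⬝ᵥ (gmat f).mulVec y) := by
      nth_rewrite 1 [← hEz]
      rw [dot_mulVec_transpose, Matrix.mulVec_mulVec, hsym, ← Matrix.mulVec_mulVec, hEy,
        Matrix.mulVec_neg, dotProduct_neg]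
    linarith
  have hyz : y ⬝ᵥ (gmat f).mulVec z = 0 := by
    rw [← hzy, dotProduct_comm, dot_mulVec_transpose, hf.gmat_transpose]
  have hxy : x = (1 / 2 : ℝ) • (y + z) := by
    rw [hy, hz]
    ext i
    simp
    ring
  have hsum : x ⬝ᵥ (gmat f).mulVec x =
      1 / 4 * (y ⬝ᵥ (gmat f).mulVec y + z ⬝ᵥ (gmat f).mulVec z) := by
    rw [hxy]
    simp only [Matrix.mulVec_smul, smul_dotProduct, dotProduct_smul, Matrix.mulVec_add,
      dotProduct_add, add_dotProduct, hzy, hyz, smul_eq_mul]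
    ring
  by_cases hp : 0 < y ⬝ᵥ (gmat f).mulVec y
  · exact ⟨y, hEy, hp⟩
  · refine ⟨(cplx f 1).mulVec z, ?_, ?_⟩
    · rw [Matrix.mulVec_mulVec, hf.invo_cplx_one hfu, Matrix.neg_mulVec, ← Matrix.mulVec_mulVec,
        hEz]
    · rw [dot_mulVec_transpose, Matrix.mulVec_mulVec, Matrix.mulVec_mulVec,
        hf.cplx_transpose_mul, Matrix.neg_mul, Matrix.mul_assoc, hf.cplx_sq]
      simp only [Matrix.mul_neg, Matrix.mul_one, neg_neg]
      linarith

/-- The frame of `ℝ⁴` generated by `x`. -/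
def quatFrame (f : Fin 3 → Lam2) (x : Fin 4 → ℝ) : Fin 4 → Fin 4 → ℝ :=
  ![x, (cplx f 0).mulVec x, (cplx f 1).mulVec x, -(cplx f 2).mulVec x]

/-- Every value is a metric product: f_a(p, q) = -g(p, J_a q) and u(p, q) = g(p, J₀ E q), where E is
the involution. The quaternion relations reduce them all to g(x, x) = 1 and g(x, J_a x) = 0. The
sign of the last frame vector matches that of `posBasis 2`. -/
theorem IsOrtho.quatFrame_apply (hf : IsOrtho f) (hfu : ∀ a, pair (f a) u = 0)
    {x : Fin 4 → ℝ} (hE : (invo f u).mulVec x = -x) (hx : x ⬝ᵥ (gmat f).mulVec x = 1)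
    (i j : Fin 4) :
    (∀ a, f a ![quatFrame f x i, quatFrame f x j] = co (posBasis a) i j) ∧
      u ![quatFrame f x i, quatFrame f x j] = co negU i j := by
  have hval : ∀ a p q, f a ![p, q] = -(p ⬝ᵥ (gmat f).mulVec ((cplx f a).mulVec q)) := by
    intro a p q
    rw [lam2_apply_mat, hf.mat_eq_gmat, Matrix.neg_mulVec, dotProduct_neg, Matrix.mulVec_mulVec]
  have huval : ∀ p q, u ![p, q] =
      p ⬝ᵥ (gmat f).mulVec ((cplx f 0).mulVec ((invo f u).mulVec q)) := by
    intro p q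
    rw [lam2_apply_mat, hf.mat_neg_eq, hf.mat_eq_gmat, Matrix.neg_mul, neg_neg,
      Matrix.mulVec_mulVec, Matrix.mulVec_mulVec]
  have hmove : ∀ b p q, (cplx f b).mulVec p ⬝ᵥ (gmat f).mulVec q =
      -(p ⬝ᵥ (gmat f).mulVec ((cplx f b).mulVec q)) := by
    intro b p q
    rw [dot_mulVec_transpose, Matrix.mulVec_mulVec, hf.cplx_transpose_mul, Matrix.neg_mulVec,
      dotProduct_neg, Matrix.mulVec_mulVec]
  have hzero : ∀ a, x ⬝ᵥ (gmat f).mulVec ((cplx f a).mulVec x) = 0 := by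
    intro a
    have h1 := hval a x x
    rw [alt_pair_self] at h1
    linarith
  have hsq : ∀ a y, (cplx f a).mulVec ((cplx f a).mulVec y) = -y := by
    intro a y
    rw [Matrix.mulVec_mulVec, hf.cplx_sq, Matrix.neg_mulVec, Matrix.one_mulVec]
  have h10 : ∀ y, (cplx f 1).mulVec ((cplx f 0).mulVec y) = (cplx f 2).mulVec y := fun y => by
    rw [Matrix.mulVec_mulVec, show cplx f 1 * cplx f 0 = cplx f 2 from hf.cplx_succ_mul 0]
  have h21 : ∀ y, (cplx f 2).mulVec ((cplx f 1).mulVec y) = (cplx f 0).mulVec y := fun y => by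
    rw [Matrix.mulVec_mulVec, show cplx f 2 * cplx f 1 = cplx f 0 from hf.cplx_succ_mul 1]
  have h02 : ∀ y, (cplx f 0).mulVec ((cplx f 2).mulVec y) = (cplx f 1).mulVec y := fun y => by
    rw [Matrix.mulVec_mulVec, show cplx f 0 * cplx f 2 = cplx f 1 from hf.cplx_succ_mul 2]
  have h01 : ∀ y, (cplx f 0).mulVec ((cplx f 1).mulVec y) = -(cplx f 2).mulVec y := fun y => by
    rw [Matrix.mulVec_mulVec, show cplx f 0 * cplx f 1 = -cplx f 2 from hf.cplx_mul_succ 0,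
      Matrix.neg_mulVec]
  have h12 : ∀ y, (cplx f 1).mulVec ((cplx f 2).mulVec y) = -(cplx f 0).mulVec y := fun y => by
    rw [Matrix.mulVec_mulVec, show cplx f 1 * cplx f 2 = -cplx f 0 from hf.cplx_mul_succ 1,
      Matrix.neg_mulVec]
  have h20 : ∀ y, (cplx f 2).mulVec ((cplx f 0).mulVec y) = -(cplx f 1).mulVec y := fun y => by
    rw [Matrix.mulVec_mulVec, show cplx f 2 * cplx f 0 = -cplx f 1 from hf.cplx_mul_succ 2,
      Matrix.neg_mulVec]
  have e0 : (invo f u).mulVec ((cplx f 0).mulVec x) = -(cplx f 0).mulVec x := by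
    rw [Matrix.mulVec_mulVec, hf.invo_cplx_zero hfu, ← Matrix.mulVec_mulVec, hE, Matrix.mulVec_neg]
  have e1 : (invo f u).mulVec ((cplx f 1).mulVec x) = (cplx f 1).mulVec x := by
    rw [Matrix.mulVec_mulVec, hf.invo_cplx_one hfu, Matrix.neg_mulVec, ← Matrix.mulVec_mulVec, hE,
      Matrix.mulVec_neg, neg_neg]
  have e2 : (invo f u).mulVec ((cplx f 2).mulVec x) = (cplx f 2).mulVec x := by
    rw [Matrix.mulVec_mulVec, hf.invo_cplx_two hfu, Matrix.neg_mulVec, ← Matrix.mulVec_mulVec, hE,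
      Matrix.mulVec_neg, neg_neg]
  constructor
  · intro a
    fin_cases a <;> fin_cases i <;> fin_cases j <;>
      simp [quatFrame, hval, hmove, hzero, hsq, h10, h21, h02, h01, h12, h20, hx, posBasis,
        co_add, co_sub, co_neg, co_dx, Matrix.mulVec_neg, -Matrix.mulVec_mulVec]
  · fin_cases i <;> fin_cases j <;>
      simp [quatFrame, huval, hmove, hzero, hsq, h10, h21, h02, h01, h12, h20, hx, negU, hE, e0,
        e1, e2, co_sub, co_dx, Matrix.mulVec_neg, -Matrix.mulVec_mulVec]

end Triple

end
end G2ERP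

namespace G2ERP
noncomputable section

/-! ### Smooth adapted frames along a space-like immersion -/

section SmoothMatrices

variable {E : Type*} [NormedAddCommGroup E] [NormedSpace ℝ E] {y : E}

/-- Entrywise smoothness of a matrix valued function. -/
def SmoothMatAt (A : E → Matrix (Fin 4) (Fin 4) ℝ) (y : E) : Prop :=
  ∀ i j, ContDiffAt ℝ ∞ (fun z => A z i j) y

theorem contDiffAt_co {f : E → Lam2} (hf : ContDiffAt ℝ ∞ f y) (i j : Fin 4) :
    ContDiffAt ℝ ∞ (fun z => co (f z) i j) y :=
  contDiffAt_alternating_apply hf fun _ => contDiffAt_const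

theorem smoothMatAt_mat {f : E → Lam2} (hf : ContDiffAt ℝ ∞ f y) :
    SmoothMatAt (fun z => mat (f z)) y := fun i j => contDiffAt_co hf i j

theorem smoothMatAt_hd {f : E → Lam2} (hf : ContDiffAt ℝ ∞ f y) :
    SmoothMatAt (fun z => hd (f z)) y := by
  have h := contDiffAt_co hf
  have h' := fun i j => (contDiffAt_co hf i j).neg
  have c : ContDiffAt ℝ ∞ (fun _ : E => (0 : ℝ)) y := contDiffAt_const
  intro i j
  fin_cases i <;> fin_cases j
  exacts [c, h _ _, h' _ _, h _ _, h' _ _, c, h _ _, h' _ _, h _ _, h' _ _, c, h _ _, h' _ _,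
    h _ _, h' _ _, c]

theorem SmoothMatAt.mul {A B : E → Matrix (Fin 4) (Fin 4) ℝ} (hA : SmoothMatAt A y)
    (hB : SmoothMatAt B y) : SmoothMatAt (fun z => A z * B z) y := by
  intro i j
  simp only [Matrix.mul_apply]
  exact ContDiffAt.sum fun l _ => (hA i l).mul (hB l j)

theorem SmoothMatAt.mulVec {A : E → Matrix (Fin 4) (Fin 4) ℝ} {x : E → Fin 4 → ℝ}
    (hA : SmoothMatAt A y) (hx : ContDiffAt ℝ ∞ x y) :
    ContDiffAt ℝ ∞ (fun z => (A z).mulVec (x z)) y := by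
  refine contDiffAt_pi.2 fun i => ?_
  simp only [Matrix.mulVec, dotProduct]
  exact ContDiffAt.sum fun l _ => (hA i l).mul (contDiffAt_pi.1 hx l)

theorem contDiffAt_dot {x x' : E → Fin 4 → ℝ} (hx : ContDiffAt ℝ ∞ x y)
    (hx' : ContDiffAt ℝ ∞ x' y) : ContDiffAt ℝ ∞ (fun z => x z ⬝ᵥ x' z) y :=
  ContDiffAt.sum fun l _ => (contDiffAt_pi.1 hx l).mul (contDiffAt_pi.1 hx' l)

theorem smoothMatAt_cplx {f : Fin 3 → E → Lam2} (hf : ∀ a, ContDiffAt ℝ ∞ (f a) y) (a : Fin 3) :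
    SmoothMatAt (fun z => cplx (fun a => f a z) a) y :=
  (smoothMatAt_hd (hf _)).mul (smoothMatAt_mat (hf _))

theorem smoothMatAt_gmat {f : Fin 3 → E → Lam2} (hf : ∀ a, ContDiffAt ℝ ∞ (f a) y) :
    SmoothMatAt (fun z => gmat fun a => f a z) y :=
  (smoothMatAt_mat (hf _)).mul (smoothMatAt_cplx hf 0)

theorem smoothMatAt_invo {f : Fin 3 → E → Lam2} (hf : ∀ a, ContDiffAt ℝ ∞ (f a) y)
    {U : E → Lam2} (hU : ContDiffAt ℝ ∞ U y) :
    SmoothMatAt (fun z => invo (fun a => f a z) (U z)) y :=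
  (smoothMatAt_hd (hf _)).mul (smoothMatAt_mat hU)

/-- The endomorphism with prescribed values on the standard basis. -/
def frameMap (z : Fin 4 → Fin 4 → ℝ) : (Fin 4 → ℝ) →L[ℝ] (Fin 4 → ℝ) :=
  ∑ i, (ContinuousLinearMap.proj i : (Fin 4 → ℝ) →L[ℝ] ℝ).smulRight (z i)

theorem frameMap_apply (z : Fin 4 → Fin 4 → ℝ) (i : Fin 4) : frameMap z (stdVec i) = z i := by
  simp [frameMap, stdVec, Pi.single_apply, ite_smul]

/-- An orthonormal triple orthogonal to a function with values in the quadric is locally the image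
of the standard one under a smooth frame of `ℝ⁴`. -/
theorem exists_frame {s : Set E} (hs : IsOpen s) {f : Fin 3 → E → Lam2} {U : E → Lam2}
    (hf : ∀ a, ContDiffOn ℝ ∞ (f a) s) (hU : ContDiffOn ℝ ∞ U s)
    (ho : ∀ y ∈ s, IsOrtho fun a => f a y) (hor : ∀ y ∈ s, 0 < orient fun a => f a y)
    (hq : ∀ y ∈ s, pair (U y) (U y) = -1) (hfU : ∀ y ∈ s, ∀ a, pair (f a y) (U y) = 0)
    {p : E} (hp : p ∈ s) :
    ∃ s' ⊆ s, IsOpen s' ∧ p ∈ s' ∧ ∃ Z : E → (Fin 4 → ℝ) →L[ℝ] (Fin 4 → ℝ),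
      ContDiffOn ℝ ∞ Z s' ∧ ∀ y ∈ s',
        (∀ a, (f a y).compContinuousLinearMap (Z y) = posBasis a) ∧
        (U y).compContinuousLinearMap (Z y) = negU := by
  obtain ⟨ξ, hξ1, hξ2⟩ := (ho p hp).exists_adapted (hor p hp) (hq p hp) (hfU p hp)
  have hf' : ∀ y ∈ s, ∀ a, ContDiffAt ℝ ∞ (f a) y := fun y hy a =>
    (hf a).contDiffAt (hs.mem_nhds hy)
  have hU' : ∀ y ∈ s, ContDiffAt ℝ ∞ U y := fun y hy => hU.contDiffAt (hs.mem_nhds hy)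
  -- The map 1 - E projects, up to the factor 2, to the -1 eigenspace of the varying involution. At
  -- p it doubles ξ, so the metric stays positive on x nearby.
  let x : E → Fin 4 → ℝ := fun y => ξ - (invo (fun a => f a y) (U y)).mulVec ξ
  let q : E → ℝ := fun y => x y ⬝ᵥ (gmat fun a => f a y).mulVec (x y)
  have hx : ∀ y ∈ s, ContDiffAt ℝ ∞ x y := fun y hy =>
    contDiffAt_const.sub ((smoothMatAt_invo (hf' y hy) (hU' y hy)).mulVec contDiffAt_const)
  have hqs : ∀ y ∈ s, ContDiffAt ℝ ∞ q y := fun y hy =>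
    contDiffAt_dot (hx y hy) ((smoothMatAt_gmat (hf' y hy)).mulVec (hx y hy))
  have hEx : ∀ y ∈ s, (invo (fun a => f a y) (U y)).mulVec (x y) = -x y := by
    intro y hy
    simp only [x]
    rw [Matrix.mulVec_sub, Matrix.mulVec_mulVec, (ho y hy).invo_sq (hq y hy) (hfU y hy),
      Matrix.one_mulVec]
    abel
  have hxp : x p = (2 : ℝ) • ξ := by
    simp only [x]
    rw [hξ1, two_smul]
    abel
  have hqp : 0 < q p := by
    simp only [q]
    rw [hxp, Matrix.mulVec_smul, smul_dotProduct, dotProduct_smul]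
    simp only [smul_eq_mul]
    linarith
  let s' : Set E := s ∩ q ⁻¹' Set.Ioi 0
  have hs' : IsOpen s' := ContinuousOn.isOpen_inter_preimage
    (fun y hy => (hqs y hy).continuousAt.continuousWithinAt) hs isOpen_Ioi
  let x' : E → Fin 4 → ℝ := fun y => (√(q y))⁻¹ • x y
  have hx' : ∀ y ∈ s', ContDiffAt ℝ ∞ x' y := by
    intro y hy
    have hy2 : 0 < q y := hy.2
    exact (((hqs y hy.1).sqrt hy2.ne').inv (Real.sqrt_pos.2 hy2).ne').smul (hx y hy.1)
  refine ⟨s', Set.inter_subset_left, hs', ⟨hp, hqp⟩,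
    fun y => frameMap (quatFrame (fun a => f a y) (x' y)), ?_, ?_⟩
  · intro y hy
    have hc := fun a => (smoothMatAt_cplx (hf' y hy.1) a).mulVec (hx' y hy)
    have hqf : ∀ i, ContDiffAt ℝ ∞ (fun y => quatFrame (fun a => f a y) (x' y) i) y := by
      intro i
      fin_cases i
      exacts [hx' y hy, hc 0, hc 1, (hc 2).neg]
    refine ContDiffAt.contDiffWithinAt ?_
    simp only [frameMap]
    refine ContDiffAt.sum fun i _ => ?_
    exact (ContinuousLinearMap.smulRightL ℝ (Fin 4 → ℝ) (Fin 4 → ℝ)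
      (ContinuousLinearMap.proj i)).contDiff.contDiffAt.comp y (hqf i)
  · intro y hy
    have hy2 : 0 < q y := hy.2
    have h1 : (invo (fun a => f a y) (U y)).mulVec (x' y) = -x' y := by
      simp only [x']
      rw [Matrix.mulVec_smul, hEx y hy.1, smul_neg]
    have h2 : x' y ⬝ᵥ (gmat fun a => f a y).mulVec (x' y) = 1 := by
      simp only [x']
      rw [Matrix.mulVec_smul, smul_dotProduct, dotProduct_smul]
      simp only [smul_eq_mul]
      change (√(q y))⁻¹ * ((√(q y))⁻¹ * q y) = 1
      rw [← mul_assoc, ← mul_inv, Real.mul_self_sqrt hy2.le, inv_mul_cancel₀ hy2.ne']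
    have h3 := (ho y hy.1).quatFrame_apply (hfU y hy.1) h1 h2
    have e : ∀ (α β : Lam2), (∀ i j, α ![quatFrame (fun a => f a y) (x' y) i,
        quatFrame (fun a => f a y) (x' y) j] = co β i j) →
        α.compContinuousLinearMap (frameMap (quatFrame (fun a => f a y) (x' y))) = β := by
      intro α β h
      have h' : ∀ i j, co (α.compContinuousLinearMap
          (frameMap (quatFrame (fun a => f a y) (x' y)))) i j = co β i j := by
        intro i j
        rw [co_comp, frameMap_apply, frameMap_apply, h]
      exact lam2_ext (h' _ _) (h' _ _) (h' _ _) (h' _ _) (h' _ _) (h' _ _)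
    exact ⟨fun a => e _ _ fun i j => (h3 i j).1 a, e _ _ fun i j => (h3 i j).2⟩

end SmoothMatrices

section GramSchmidt

variable {s : Set E3} {U : E3 → Lam2}

/-- The metric that `U` induces. -/
def indMetric (U : E3 → Lam2) (y v w : E3) : ℝ := pair (fderiv ℝ U y v) (fderiv ℝ U y w)

theorem indMetric_smul_left (y : E3) (c : ℝ) (v w : E3) :
    indMetric U y (c • v) w = c * indMetric U y v w := by
  simp only [indMetric, map_smul, pair_smul_left]

theorem indMetric_comm (y v w : E3) : indMetric U y v w = indMetric U y w v := pair_comm _ _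

theorem indMetric_smul_right (y : E3) (c : ℝ) (v w : E3) :
    indMetric U y v (c • w) = c * indMetric U y v w := by
  rw [indMetric_comm, indMetric_smul_left, indMetric_comm]

theorem indMetric_sub_left (y v v' w : E3) :
    indMetric U y (v - v') w = indMetric U y v w - indMetric U y v' w := by
  simp only [indMetric, map_sub, pair_sub_left]

theorem contDiffAt_indMetric {y : E3} (hU : ContDiffAt ℝ ∞ U y) {v w : E3 → E3}
    (hv : ContDiffAt ℝ ∞ v y) (hw : ContDiffAt ℝ ∞ w y) :
    ContDiffAt ℝ ∞ (fun z => indMetric U z (v z) (w z)) y :=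
  have h := hU.fderiv_right (m := ∞) (by simp)
  contDiffAt_pair (h.clm_apply hv) (h.clm_apply hw)

/-- The normalisation of a vector field. -/
def unitField (U : E3 → Lam2) (v : E3 → E3) (y : E3) : E3 := (√(indMetric U y (v y) (v y)))⁻¹ • v y

theorem contDiffAt_unitField {y : E3} (hU : ContDiffAt ℝ ∞ U y) {v : E3 → E3}
    (hv : ContDiffAt ℝ ∞ v y) (h : 0 < indMetric U y (v y) (v y)) :
    ContDiffAt ℝ ∞ (unitField U v) y :=
  (((contDiffAt_indMetric hU hv hv).sqrt h.ne').inv (Real.sqrt_pos.2 h).ne').smul hv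

theorem indMetric_unitField {y : E3} {v : E3 → E3} (h : 0 < indMetric U y (v y) (v y)) :
    indMetric U y (unitField U v y) (unitField U v y) = 1 := by
  rw [unitField, indMetric_smul_left, indMetric_smul_right, ← mul_assoc, ← mul_inv,
    Real.mul_self_sqrt h.le, inv_mul_cancel₀ h.ne']

theorem indMetric_unitField_left {y : E3} {v : E3 → E3} {w : E3} (h : indMetric U y (v y) w = 0) :
    indMetric U y (unitField U v y) w = 0 := by
  rw [unitField, indMetric_smul_left, h, mul_zero]

theorem exists_orthonormal_frame (hs : IsOpen s) (hU : ContDiffOn ℝ ∞ U s)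
    (hpos : ∀ y ∈ s, ∀ v, v ≠ 0 → 0 < indMetric U y v v) :
    ∃ e : Fin 3 → E3 → E3, (∀ a, ContDiffOn ℝ ∞ (e a) s) ∧
      ∀ y ∈ s, IsOrtho fun a => fderiv ℝ U y (e a y) := by
  let c : Fin 3 → E3 := fun i => EuclideanSpace.single i 1
  let e0 : E3 → E3 := unitField U fun _ => c 0
  let v1 : E3 → E3 := fun y => c 1 - indMetric U y (c 1) (e0 y) • e0 y
  let e1 : E3 → E3 := unitField U v1
  let v2 : E3 → E3 := fun y =>
    c 2 - indMetric U y (c 2) (e0 y) • e0 y - indMetric U y (c 2) (e1 y) • e1 y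
  let e2 : E3 → E3 := unitField U v2
  -- Gram-Schmidt is triangular: these vanishing coordinates show that `v1` and `v2` are nonzero,
  -- whence their norms are positive.
  have h01 : ∀ y, e0 y 1 = 0 := fun y => by simp [e0, unitField, c]
  have h02 : ∀ y, e0 y 2 = 0 := fun y => by simp [e0, unitField, c]
  have h12 : ∀ y, e1 y 2 = 0 := fun y => by simp [e1, unitField, v1, c, h02]
  have hU' : ∀ y ∈ s, ContDiffAt ℝ ∞ U y := fun y hy => hU.contDiffAt (hs.mem_nhds hy)
  have p0 : ∀ y ∈ s, 0 < indMetric U y (c 0) (c 0) := fun y hy => hpos y hy _ fun h => by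
    have := congrArg (fun v : E3 => v 0) h
    simp [c] at this
  have p1 : ∀ y ∈ s, 0 < indMetric U y (v1 y) (v1 y) := fun y hy => hpos y hy _ fun h => by
    have := congrArg (fun v : E3 => v 1) h
    simp [v1, c, h01] at this
  have p2 : ∀ y ∈ s, 0 < indMetric U y (v2 y) (v2 y) := fun y hy => hpos y hy _ fun h => by
    have := congrArg (fun v : E3 => v 2) h
    simp [v2, c, h02, h12] at this
  have s0 : ∀ y ∈ s, ContDiffAt ℝ ∞ e0 y := fun y hy =>
    contDiffAt_unitField (hU' y hy) contDiffAt_const (p0 y hy)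
  have s1 : ∀ y ∈ s, ContDiffAt ℝ ∞ e1 y := fun y hy => contDiffAt_unitField (hU' y hy)
    (contDiffAt_const.sub ((contDiffAt_indMetric (hU' y hy) contDiffAt_const (s0 y hy)).smul
      (s0 y hy))) (p1 y hy)
  have s2 : ∀ y ∈ s, ContDiffAt ℝ ∞ e2 y := fun y hy => contDiffAt_unitField (hU' y hy)
    ((contDiffAt_const.sub ((contDiffAt_indMetric (hU' y hy) contDiffAt_const (s0 y hy)).smul
      (s0 y hy))).sub ((contDiffAt_indMetric (hU' y hy) contDiffAt_const (s1 y hy)).smul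
      (s1 y hy))) (p2 y hy)
  have n0 : ∀ y ∈ s, indMetric U y (e0 y) (e0 y) = 1 := fun y hy =>
    indMetric_unitField (v := fun _ => c 0) (p0 y hy)
  have n1 : ∀ y ∈ s, indMetric U y (e1 y) (e1 y) = 1 := fun y hy => indMetric_unitField (p1 y hy)
  have n2 : ∀ y ∈ s, indMetric U y (e2 y) (e2 y) = 1 := fun y hy => indMetric_unitField (p2 y hy)
  have o10 : ∀ y ∈ s, indMetric U y (e1 y) (e0 y) = 0 := fun y hy =>
    indMetric_unitField_left (by
      simp only [v1]
      rw [indMetric_sub_left, indMetric_smul_left, n0 y hy, mul_one, sub_self])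
  have o20 : ∀ y ∈ s, indMetric U y (e2 y) (e0 y) = 0 := fun y hy =>
    indMetric_unitField_left (by
      simp only [v2]
      rw [indMetric_sub_left, indMetric_sub_left, indMetric_smul_left, indMetric_smul_left,
        n0 y hy, o10 y hy, mul_one, sub_self, mul_zero, sub_zero])
  have o21 : ∀ y ∈ s, indMetric U y (e2 y) (e1 y) = 0 := fun y hy =>
    indMetric_unitField_left (by
      simp only [v2]
      rw [indMetric_sub_left, indMetric_sub_left, indMetric_smul_left, indMetric_smul_left,
        n1 y hy, indMetric_comm y (e0 y), o10 y hy, mul_one, mul_zero, sub_zero, sub_self])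
  refine ⟨![e0, e1, e2], ?_, ?_⟩
  · intro a
    fin_cases a
    exacts [fun y hy => (s0 y hy).contDiffWithinAt, fun y hy => (s1 y hy).contDiffWithinAt,
      fun y hy => (s2 y hy).contDiffWithinAt]
  · intro y hy a b
    change indMetric U y _ _ = _
    fin_cases a <;> fin_cases b
    exacts [n0 y hy, (indMetric_comm _ _ _).trans (o10 y hy),
      (indMetric_comm _ _ _).trans (o20 y hy), o10 y hy, n1 y hy,
      (indMetric_comm _ _ _).trans (o21 y hy), o20 y hy, o21 y hy, n2 y hy]

theorem IsOrtho.flip {f : Fin 3 → Lam2} (hf : IsOrtho f) : IsOrtho ![f 0, f 1, -f 2] := by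
  have h : ∀ α β, pair α (-β) = -pair α β := fun α β => by
    rw [pair_comm, pair_neg_left, pair_comm]
  intro a b
  fin_cases a <;> fin_cases b <;> simp [pair_neg_left, h, hf _ _]

theorem orient_flip (f : Fin 3 → Lam2) : orient ![f 0, f 1, -f 2] = -orient f := by
  simp only [orient, Matrix.det_fin_three, Matrix.of_apply, Matrix.cons_val_zero,
    Matrix.cons_val_one, Matrix.cons_val, pair_neg_left]
  ring

/-- Reversing the third vector corrects the orientation at p, and positivity persists on a
neighbourhood. -/
theorem exists_oriented_frame (hs : IsOpen s) (hU : ContDiffOn ℝ ∞ U s)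
    (hpos : ∀ y ∈ s, ∀ v, v ≠ 0 → 0 < indMetric U y v v) {p : E3} (hp : p ∈ s) :
    ∃ s' ⊆ s, IsOpen s' ∧ p ∈ s' ∧ ∃ e : Fin 3 → E3 → E3, (∀ a, ContDiffOn ℝ ∞ (e a) s') ∧
      ∀ y ∈ s', IsOrtho (fun a => fderiv ℝ U y (e a y)) ∧
        0 < orient (fun a => fderiv ℝ U y (e a y)) := by
  suffices h : ∃ e : Fin 3 → E3 → E3, (∀ a, ContDiffOn ℝ ∞ (e a) s) ∧
      (∀ y ∈ s, IsOrtho fun a => fderiv ℝ U y (e a y)) ∧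
      0 < orient fun a => fderiv ℝ U p (e a p) by
    obtain ⟨e, he, ho, hor⟩ := h
    have hc : ContinuousOn (fun y => orient fun a => fderiv ℝ U y (e a y)) s := by
      have h1 : ∀ i j, ContinuousOn (fun y => pair (fderiv ℝ U y (e i y)) (posBasis j)) s :=
        fun i j y hy => ((contDiffAt_pair (((hU.contDiffAt (hs.mem_nhds hy)).fderiv_right
          (m := ∞) (by simp)).clm_apply ((he i).contDiffAt (hs.mem_nhds hy)))
          contDiffAt_const).continuousAt).continuousWithinAt
      simp only [orient, Matrix.det_fin_three, Matrix.of_apply]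
      fun_prop
    exact ⟨_, Set.inter_subset_left, hc.isOpen_inter_preimage hs isOpen_Ioi, ⟨hp, hor⟩, e,
      fun a => (he a).mono Set.inter_subset_left, fun y hy => ⟨ho y hy.1, hy.2⟩⟩
  obtain ⟨e, he, ho⟩ := exists_orthonormal_frame hs hU hpos
  rcases lt_or_gt_of_ne (ho p hp).orient_ne_zero with h | h
  · have e' : ∀ y, (fun a => fderiv ℝ U y (![e 0, e 1, fun y => -e 2 y] a y)) =
        ![fderiv ℝ U y (e 0 y), fderiv ℝ U y (e 1 y), -fderiv ℝ U y (e 2 y)] := by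
      intro y
      funext a
      fin_cases a <;> simp
    refine ⟨![e 0, e 1, fun y => -e 2 y], ?_, ?_, ?_⟩
    · intro a
      fin_cases a
      exacts [he 0, he 1, (he 2).neg]
    · intro y hy
      rw [e' y]
      exact (ho y hy).flip
    · rw [e' p, orient_flip fun a => fderiv ℝ U p (e a p)]
      linarith
  · exact ⟨e, he, ho, h⟩

end GramSchmidt

end
end G2ERP

namespace G2ERP
noncomputable section

/-! ### Moving frames of maximal immersions -/

/-- An oriented orthonormal frame `e` on an open set, with coframe `θ` and image `f`, along a
maximal space-like immersion `U` into the quadric, and a coframe `Zi` of `ℝ⁴` that carries the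
standard basis of `Λ²` to one that extends `U`, `f`. -/
structure SpaceFrame (s : Set E3) (U : E3 → Lam2) (f : Fin 3 → E3 → Lam2)
    (θ : Fin 3 → E3 → E3 →L[ℝ] ℝ) (e : Fin 3 → E3 → E3)
    (Zi : E3 → (Fin 4 → ℝ) →L[ℝ] (Fin 4 → ℝ)) : Prop where
  isOpen : IsOpen s
  U_smooth : ContDiffOn ℝ ∞ U s
  f_smooth : ∀ a, ContDiffOn ℝ ∞ (f a) s
  θ_smooth : ∀ a, ContDiffOn ℝ ∞ (θ a) s
  e_smooth : ∀ a, ContDiffOn ℝ ∞ (e a) s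
  Zi_smooth : ContDiffOn ℝ ∞ Zi s
  Zi_unit : ∀ y ∈ s, IsUnit (Zi y)
  U_eq : ∀ y ∈ s, U y = negU.compContinuousLinearMap (Zi y)
  f_eq : ∀ y ∈ s, ∀ a, f a y = (posBasis a).compContinuousLinearMap (Zi y)
  U_deriv : ∀ y ∈ s, ∀ v, fderiv ℝ U y v = ∑ a, θ a y v • f a y
  θ_e : ∀ y ∈ s, ∀ a b, θ a y (e b y) = if a = b then 1 else 0
  span : ∀ y ∈ s, ∀ v, v = ∑ a, θ a y v • e a y
  f_norm : ∀ y ∈ s, IsOrtho fun a => f a y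
  oriented : ∀ y ∈ s, 0 < orient fun a => f a y
  maximal : ∀ y ∈ s, ∀ n, pair (U y) n = 0 → (∀ a, pair (f a y) n = 0) →
    ∑ i, pair (fderiv ℝ (fderiv ℝ U) y (e i y) (e i y)) n = 0

/-- The kernel of Z lies in the kernel of the pulled-back form, and `posBasis 0` is nondegenerate.
-/
theorem isUnit_of_comp_eq_posBasis {α : Lam2} {Z : (Fin 4 → ℝ) →L[ℝ] (Fin 4 → ℝ)}
    (h : α.compContinuousLinearMap Z = posBasis 0) : IsUnit Z := by
  have hinj : Function.Injective Z := by
    rw [injective_iff_map_eq_zero]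
    intro v hv
    have h1 : ∀ w, posBasis 0 ![v, w] = 0 := by
      intro w
      rw [← h, comp_pair, hv]
      have := alt_pair_smul_left α 0 0 (Z w)
      simpa using this
    funext i
    have h2 : ∀ w : Fin 4 → ℝ, v 0 * w 1 - v 1 * w 0 + (v 2 * w 3 - v 3 * w 2) = 0 := by
      intro w
      have := h1 w
      rwa [posBasis_zero, ContinuousAlternatingMap.add_apply, dx2_apply, dx2_apply] at this
    have e0 := h2 (stdVec 0)
    have e1 := h2 (stdVec 1)
    have e2 := h2 (stdVec 2)
    have e3 := h2 (stdVec 3)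
    simp [stdVec] at e0 e1 e2 e3
    fin_cases i <;> assumption
  rw [ContinuousLinearMap.isUnit_iff_bijective]
  exact ⟨hinj, (LinearMap.injective_iff_surjective (f := (Z : (Fin 4 → ℝ) →ₗ[ℝ] (Fin 4 → ℝ)))).1
      hinj⟩

theorem exists_spaceFrame {s : Set E3} {U : E3 → Lam2} (hs : IsOpen s) (hU : ContDiffOn ℝ ∞ U s)
    (hq : ∀ y ∈ s, pair (U y) (U y) = -1)
    (hpos : ∀ y ∈ s, ∀ v, v ≠ 0 → 0 < indMetric U y v v)
    (hmax : ∀ y ∈ s, ∀ e : Fin 3 → E3, IsOrtho (fun a => fderiv ℝ U y (e a)) → ∀ n,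
      pair (U y) n = 0 → (∀ v, pair (fderiv ℝ U y v) n = 0) →
      ∑ i, pair (fderiv ℝ (fderiv ℝ U) y (e i) (e i)) n = 0) {p : E3} (hp : p ∈ s) :
    ∃ s' ⊆ s, p ∈ s' ∧ ∃ f θ e Zi, SpaceFrame s' U f θ e Zi := by
  obtain ⟨s1, hs1s, hs1, hp1, e, he, hon⟩ := exists_oriented_frame hs hU hpos hp
  have hU' : ∀ y ∈ s1, ContDiffAt ℝ ∞ U y := fun y hy => hU.contDiffAt (hs.mem_nhds (hs1s hy))
  have hDU : ContDiffOn ℝ ∞ (fderiv ℝ U) s1 := fun y hy =>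
    ((hU' y hy).fderiv_right (m := ∞) (by simp)).contDiffWithinAt
  let f : Fin 3 → E3 → Lam2 := fun a y => fderiv ℝ U y (e a y)
  have hf : ∀ a, ContDiffOn ℝ ∞ (f a) s1 := fun a => hDU.clm_apply (he a)
  -- Differentiating ⟨U, U⟩ = -1 makes the tangent frame orthogonal to U, as the lift to a frame of
  -- ℝ⁴ requires.
  have hUU : ∀ y ∈ s1, ∀ v, pair (fderiv ℝ U y v) (U y) = 0 := by
    intro y hy v
    have hd := (hU' y hy).differentiableAt (by simp)
    have h1 := (fderiv_pair hd hd).2 v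
    have h2 : (fun y => pair (U y) (U y)) =ᶠ[nhds y] fun _ => -1 := by
      filter_upwards [hs1.mem_nhds hy] with z hz using hq z (hs1s hz)
    rw [h2.fderiv_eq, pair_comm (U y)] at h1
    simp at h1
    linarith
  obtain ⟨s2, hs2s, hs2, hp2, Z, hZ, hZe⟩ := exists_frame hs1 hf (hU.mono hs1s)
    (fun y hy => (hon y hy).1) (fun y hy => (hon y hy).2) (fun y hy => hq y (hs1s hy))
    (fun y hy a => hUU y hy _) hp1
  have hunit : ∀ y ∈ s2, IsUnit (Z y) := fun y hy => isUnit_of_comp_eq_posBasis ((hZe y hy).1 0)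
  let Zi : E3 → (Fin 4 → ℝ) →L[ℝ] (Fin 4 → ℝ) := fun y => Ring.inverse (Z y)
  have hZZ : ∀ y ∈ s2, ∀ z, Z y (Zi y z) = z := fun y hy z =>
    DFunLike.congr_fun (Ring.mul_inverse_cancel _ (hunit y hy)) z
  have hcomp : ∀ y ∈ s2, ∀ α β : Lam2, α.compContinuousLinearMap (Z y) = β →
      α = β.compContinuousLinearMap (Zi y) := by
    intro y hy α β h
    ext v
    rw [← h, vec2_eta v, comp_pair, comp_pair, hZZ y hy, hZZ y hy]
  let θ : Fin 3 → E3 → E3 →L[ℝ] ℝ := fun a y => (pairL.flip (f a y)).comp (fderiv ℝ U y)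
  have hθe : ∀ y ∈ s1, ∀ a b, θ a y (e b y) = if a = b then 1 else 0 := by
    intro y hy a b
    refine ((hon y hy).1 b a).trans ?_
    simp only [eq_comm]
  have hspan : ∀ y ∈ s1, ∀ v, v = ∑ a, θ a y v • e a y := by
    intro y hy v
    have hli : LinearIndependent ℝ fun a => e a y := by
      rw [Fintype.linearIndependent_iff]
      intro g hg b
      have := congrArg (θ b y) hg
      simpa [hθe y hy] using this
    let b := basisOfLinearIndependentOfCardEqFinrank hli (by simp)
    have hb : ∀ a, b a = e a y := fun a => by simp [b]
    have h1 := b.sum_repr v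
    simp only [hb] at h1
    have h2 : ∀ a, θ a y v = b.repr v a := by
      intro a
      have h3 := congrArg (θ a y) h1
      simp only [map_sum, map_smul, hθe y hy] at h3
      simpa using h3.symm
    simp only [h2]
    exact h1.symm
  have hUd : ∀ y ∈ s1, ∀ v, fderiv ℝ U y v = ∑ a, θ a y v • f a y := by
    intro y hy v
    conv_lhs => rw [hspan y hy v]
    simp [f]
  refine ⟨s2, hs2s.trans hs1s, hp2, f, θ, e, Zi, ?_⟩
  exact
    { isOpen := hs2
      U_smooth := hU.mono (hs2s.trans hs1s)
      f_smooth := fun a => (hf a).mono hs2s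
      θ_smooth := fun a y hy => (contDiffAt_clm_of_apply fun v => contDiffAt_pair
        ((hDU.contDiffAt (hs1.mem_nhds (hs2s hy))).clm_apply contDiffAt_const)
        ((hf a).contDiffAt (hs1.mem_nhds (hs2s hy)))).contDiffWithinAt
      e_smooth := fun a => (he a).mono hs2s
      Zi_smooth := by
        intro y hy
        obtain ⟨w, hw⟩ := hunit y hy
        have := contDiffAt_ringInverse ℝ (n := ∞) w
        rw [hw] at this
        exact (this.comp y (hZ.contDiffAt (hs2.mem_nhds hy))).contDiffWithinAt
      Zi_unit := fun y hy => (hunit y hy).ringInverse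
      U_eq := fun y hy => hcomp y hy _ _ (hZe y hy).2
      f_eq := fun y hy a => hcomp y hy _ _ ((hZe y hy).1 a)
      U_deriv := fun y hy => hUd y (hs2s hy)
      θ_e := fun y hy => hθe y (hs2s hy)
      span := fun y hy => hspan y (hs2s hy)
      f_norm := fun y hy => (hon y (hs2s hy)).1
      oriented := fun y hy => (hon y (hs2s hy)).2
      maximal := fun y hy n h1 h2 => hmax y (hs1s (hs2s hy)) _ (hon y (hs2s hy)).1 n h1
        fun v => by
          rw [hUd y (hs2s hy), ← pairL_apply]
          simp [pairL_apply, h2] }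

section Extract

variable {X : Type*} [AddCommGroup X] [Module ℝ X]

/-- The `su(2)`-coordinates of a matrix. -/
def matG (g : Fin 4 → Fin 4 → X) : Fin 3 → X :=
  ![(1 / 2 : ℝ) • (g 2 3 - g 3 2 - g 1 0 + g 0 1), (1 / 2 : ℝ) • (g 0 2 - g 2 0 + g 3 1 - g 1 3),
    (1 / 2 : ℝ) • (g 3 0 - g 0 3 + g 2 1 - g 1 2)]

/-- The `u(1)`-coordinate of a matrix. -/
def matR (g : Fin 4 → Fin 4 → X) : X := (1 / 2 : ℝ) • (g 1 0 - g 0 1 + g 2 3 - g 3 2)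

/-- One triple of coordinates of the symmetric part of a matrix. -/
def matP (g : Fin 4 → Fin 4 → X) : Fin 3 → X :=
  ![(-1 / 4 : ℝ) • (g 0 2 + g 2 0 + g 1 3 + g 3 1), (1 / 4 : ℝ) • (g 0 1 + g 1 0 - g 2 3 - g 3 2),
    (1 / 4 : ℝ) • (g 0 0 - g 1 1 + g 3 3 - g 2 2)]

/-- Another triple of coordinates of the symmetric part of a matrix. -/
def matQ (g : Fin 4 → Fin 4 → X) : Fin 3 → X :=
  ![(1 / 4 : ℝ) • (g 0 3 + g 3 0 - g 1 2 - g 2 1), (1 / 4 : ℝ) • (g 3 3 - g 2 2 - g 0 0 + g 1 1),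
    (1 / 4 : ℝ) • (g 0 1 + g 1 0 + g 2 3 + g 3 2)]

end Extract

/-- Of the sixteen parameters of a matrix three are excluded: the image of `negU` has no component
along `negU`, so the trace is zero, and none along `negN1` and `negN2`. The thirteen coordinates of
`gam` remain, and `gam_act_negU` gives w = t / 2. -/
theorem eq_gam_of_act {g : Fin 4 → Fin 4 → ℝ} {t : Fin 3 → ℝ}
    (h : ∀ i j : Fin 4, -(negU ![(Matrix.of g).mulVec (stdVec i), stdVec j]
      + negU ![stdVec i, (Matrix.of g).mulVec (stdVec j)]) =
      ∑ a, t a * posBasis a ![stdVec i, stdVec j]) :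
    Matrix.of g = gam (matG g) (matR g) (fun a => t a / 2) (matP g) (matQ g) := by
  have h01 := h 0 1
  have h02 := h 0 2
  have h03 := h 0 3
  have h12 := h 1 2
  have h13 := h 1 3
  have h23 := h 2 3
  simp [lam2_apply, negU, posBasis, co_sub, co_add, co_neg, co_dx,
    Fin.sum_univ_three, Matrix.of_apply, stdVec] at h01 h02 h03 h12 h13 h23
  ext i j
  fin_cases i <;> fin_cases j <;>
    simp [gam, matG, matR, matP, matQ] <;> linarith

end
end G2ERP

namespace G2ERP
noncomputable section

/-! ### Structure equations of the moving frame -/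

/-- The connection forms of the coframe `Zi` of `ℝ⁴`. -/
def zg (Zi : E3 → (Fin 4 → ℝ) →L[ℝ] (Fin 4 → ℝ)) (y : E3) (i j : Fin 4) : E3 →L[ℝ] ℝ :=
  -((ContinuousLinearMap.proj i : (Fin 4 → ℝ) →L[ℝ] ℝ).comp
    ((ContinuousLinearMap.apply ℝ (Fin 4 → ℝ) (Ring.inverse (Zi y) (stdVec j))).comp
      (fderiv ℝ Zi y)))

theorem zg_apply (Zi : E3 → (Fin 4 → ℝ) →L[ℝ] (Fin 4 → ℝ)) (y : E3) (i j : Fin 4) (v : E3) :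
    zg Zi y i j v = -(fderiv ℝ Zi y v (Ring.inverse (Zi y) (stdVec j)) i) := rfl

theorem mat_coord_apply (v : E3) (g : Fin 4 → Fin 4 → E3 →L[ℝ] ℝ) :
    matG (fun i j => g i j v) = (fun a => matG g a v) ∧ matR (fun i j => g i j v) = matR g v ∧
      matP (fun i j => g i j v) = (fun a => matP g a v) ∧
      matQ (fun i j => g i j v) = fun a => matQ g a v := by
  refine ⟨funext fun a => ?_, rfl, funext fun a => ?_, funext fun a => ?_⟩ <;> fin_cases a <;> rfl

theorem pair_sub_right (α β β' : Lam2) : pair α (β - β') = pair α β - pair α β' := by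
  rw [pair_comm, pair_sub_left, pair_comm β, pair_comm β']

theorem pair_posBasis_negN (a : Fin 3) :
    pair (posBasis a) negN1 = 0 ∧ pair (posBasis a) negN2 = 0 := by
  fin_cases a <;>
    simp [pair_eq, posBasis, negN1, negN2, co_sub, co_add, co_neg, co_dx, stdVec]

theorem pair_negU_negN : pair negU negN1 = 0 ∧ pair negU negN2 = 0 := by
  simp [pair_eq, negU, negN1, negN2, co_sub, co_add, co_dx, stdVec]

theorem pair_negN : pair negN1 negN1 = -1 ∧ pair negN1 negN2 = 0 ∧ pair negN2 negN1 = 0 ∧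
    pair negN2 negN2 = -1 := by
  simp [pair_eq, negN1, negN2, co_sub, co_add, co_dx, stdVec]
  norm_num

namespace SpaceFrame

variable {s : Set E3} {U : E3 → Lam2} {f : Fin 3 → E3 → Lam2} {θ : Fin 3 → E3 → E3 →L[ℝ] ℝ}
  {e : Fin 3 → E3 → E3} {Zi : E3 → (Fin 4 → ℝ) →L[ℝ] (Fin 4 → ℝ)} {y : E3}

theorem at_smooth {X : Type*} [NormedAddCommGroup X] [NormedSpace ℝ X] {g : E3 → X}
    (hF : SpaceFrame s U f θ e Zi) (hg : ContDiffOn ℝ ∞ g s) (hy : y ∈ s) : ContDiffAt ℝ ∞ g y :=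
  hg.contDiffAt (hF.isOpen.mem_nhds hy)

theorem at_diff {X : Type*} [NormedAddCommGroup X] [NormedSpace ℝ X] {g : E3 → X}
    (hF : SpaceFrame s U f θ e Zi) (hg : ContDiffOn ℝ ∞ g s) (hy : y ∈ s) :
    DifferentiableAt ℝ g y := (hF.at_smooth hg hy).differentiableAt (by simp)

theorem inverse_Zi (hF : SpaceFrame s U f θ e Zi) (hy : y ∈ s) (z : Fin 4 → ℝ) :
    Ring.inverse (Zi y) (Zi y z) = z :=
  DFunLike.congr_fun (Ring.inverse_mul_cancel _ (hF.Zi_unit y hy)) z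

theorem Zi_inverse (hF : SpaceFrame s U f θ e Zi) (hy : y ∈ s) (z : Fin 4 → ℝ) :
    Zi y (Ring.inverse (Zi y) z) = z :=
  DFunLike.congr_fun (Ring.mul_inverse_cancel _ (hF.Zi_unit y hy)) z

theorem fderiv_Zi (hF : SpaceFrame s U f θ e Zi) (hy : y ∈ s) (v : E3) (z : Fin 4 → ℝ) :
    fderiv ℝ Zi y v z = -(Matrix.of fun i j => zg Zi y i j v).mulVec (Zi y z) := by
  conv_lhs => rw [← hF.inverse_Zi hy z, vec4_eq (Zi y z)]
  funext i
  simp only [map_add, map_smul, Pi.neg_apply, Matrix.mulVec, dotProduct, Matrix.of_apply, zg_apply,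
    Fin.sum_univ_four, Pi.add_apply, Pi.smul_apply, smul_eq_mul]
  ring

theorem fderiv_comp_Zi (hF : SpaceFrame s U f θ e Zi) (hy : y ∈ s) (α : Lam2) (v : E3)
    (a b : Fin 4 → ℝ) :
    fderiv ℝ (fun z => α.compContinuousLinearMap (Zi z)) y v ![a, b] =
      -(α ![(Matrix.of fun i j => zg Zi y i j v).mulVec (Zi y a), Zi y b]
        + α ![Zi y a, (Matrix.of fun i j => zg Zi y i j v).mulVec (Zi y b)]) := by
  rw [fderiv_comp_lam2 α (hF.at_smooth hF.Zi_smooth hy) (hF.at_diff hF.Zi_smooth hy).hasFDerivAt,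
    hF.fderiv_Zi hy, hF.fderiv_Zi hy, ← neg_one_smul ℝ, alt_pair_smul_left,
    ← neg_one_smul ℝ (Matrix.mulVec _ (Zi y b)), alt_pair_smul_right]
  simp only [neg_one_smul]
  ring

/-- The derivative of U is both Σ θ_a f_a and the action of the connection form on `negU`. Since the
first has no normal component, `eq_gam_of_act` applies. -/
theorem zg_eq (hF : SpaceFrame s U f θ e Zi) (hy : y ∈ s) (v : E3) :
    (Matrix.of fun i j => zg Zi y i j v) = gam (fun a => matG (zg Zi y) a v) (matR (zg Zi y) v)
      (fun a => θ a y v / 2) (fun a => matP (zg Zi y) a v) (fun a => matQ (zg Zi y) a v) := by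
  obtain ⟨h1, h2, h3, h4⟩ := mat_coord_apply v (zg Zi y)
  rw [← h1, ← h2, ← h3, ← h4]
  refine eq_gam_of_act fun i j => ?_
  have e1 : U =ᶠ[nhds y] fun z => negU.compContinuousLinearMap (Zi z) := by
    filter_upwards [hF.isOpen.mem_nhds hy] with z hz using hF.U_eq z hz
  have e2 := hF.fderiv_comp_Zi hy negU v (Ring.inverse (Zi y) (stdVec i))
    (Ring.inverse (Zi y) (stdVec j))
  rw [← e1.fderiv_eq, hF.U_deriv y hy, hF.Zi_inverse hy, hF.Zi_inverse hy] at e2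
  rw [← e2, ContinuousAlternatingMap.sum_apply]
  refine Finset.sum_congr rfl fun a _ => ?_
  rw [ContinuousAlternatingMap.smul_apply, hF.f_eq y hy, comp_pair, hF.Zi_inverse hy,
    hF.Zi_inverse hy, smul_eq_mul]

theorem f_deriv (hF : SpaceFrame s U f θ e Zi) (hy : y ∈ s) (a : Fin 3) (v : E3) :
    fderiv ℝ (f a) y v = θ a y v • U y + matG (zg Zi y) (a + 2) v • f (a + 1) y
      - matG (zg Zi y) (a + 1) v • f (a + 2) y
      + (2 * matP (zg Zi y) a v) • negN2.compContinuousLinearMap (Zi y)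
      + (2 * matQ (zg Zi y) a v) • negN1.compContinuousLinearMap (Zi y) := by
  have e1 : f a =ᶠ[nhds y] fun z => (posBasis a).compContinuousLinearMap (Zi z) := by
    filter_upwards [hF.isOpen.mem_nhds hy] with z hz using hF.f_eq z hz a
  ext z
  rw [vec2_eta z, e1.fderiv_eq, hF.fderiv_comp_Zi hy, hF.zg_eq hy, gam_act_posBasis,
    hF.U_eq y hy, hF.f_eq y hy, hF.f_eq y hy]
  simp only [ContinuousAlternatingMap.add_apply, ContinuousAlternatingMap.sub_apply,
    ContinuousAlternatingMap.smul_apply, comp_pair, smul_eq_mul]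
  ring

theorem det_Zi (hF : SpaceFrame s U f θ e Zi) (hy : y ∈ s) :
    Matrix.det (Matrix.of fun i j => Zi y (stdVec i) j) = 1 := by
  have h := hF.f_norm y hy 0 0
  simp only [hF.f_eq y hy, pair_comp, pair_posBasis] at h
  simpa using h

theorem pair_comp_Zi (hF : SpaceFrame s U f θ e Zi) (hy : y ∈ s) (α β : Lam2) :
    pair (α.compContinuousLinearMap (Zi y)) (β.compContinuousLinearMap (Zi y)) = pair α β := by
  rw [pair_comp, hF.det_Zi hy, one_mul]

theorem pair_U_f (hF : SpaceFrame s U f θ e Zi) (hy : y ∈ s) (a : Fin 3) :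
    pair (U y) (f a y) = 0 := by
  rw [hF.U_eq y hy, hF.f_eq y hy, hF.pair_comp_Zi hy, pair_negU_posBasis]

theorem pair_U_deriv (hF : SpaceFrame s U f θ e Zi) (hy : y ∈ s) (v : E3) :
    pair (U y) (fderiv ℝ U y v) = 0 := by
  rw [hF.U_deriv y hy, ← pairL_apply]
  simp [pairL_apply, hF.pair_U_f hy]

theorem θ_eq (hF : SpaceFrame s U f θ e Zi) (hy : y ∈ s) (a : Fin 3) (w : E3) :
    θ a y w = pair (fderiv ℝ U y w) (f a y) := by
  rw [hF.U_deriv y hy, ← pairL_apply]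
  have h := fun b => hF.f_norm y hy b a
  simp [pairL_apply, h]

theorem fderiv_U_diff (hF : SpaceFrame s U f θ e Zi) (hy : y ∈ s) :
    DifferentiableAt ℝ (fderiv ℝ U) y :=
  ((hF.at_smooth hF.U_smooth hy).fderiv_right (m := ∞) (by simp)).differentiableAt (by simp)

theorem hess_symm (hF : SpaceFrame s U f θ e Zi) (hy : y ∈ s) (v w : E3) :
    fderiv ℝ (fderiv ℝ U) y v w = fderiv ℝ (fderiv ℝ U) y w v :=
  (hF.at_smooth hF.U_smooth hy).isSymmSndFDerivAt (by simp [minSmoothness_of_isRCLikeNormedField,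
    two_le_infty]) v w

/-- Here θ_a = ⟨dU, f_a⟩. In its exterior derivative the Hessian of U drops out by symmetry, and of
df_a only the tangential part pairs with dU. -/
theorem dθ (hF : SpaceFrame s U f θ e Zi) (hy : y ∈ s) (a : Fin 3) (v w : E3) :
    dOne (θ a) y v w =
      (matG (zg Zi y) (a + 2) v * θ (a + 1) y w - matG (zg Zi y) (a + 2) w * θ (a + 1) y v)
      - (matG (zg Zi y) (a + 1) v * θ (a + 2) y w
        - matG (zg Zi y) (a + 1) w * θ (a + 2) y v) := by
  have hd : ∀ v w, fderiv ℝ (θ a) y v w =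
      pair (fderiv ℝ (fderiv ℝ U) y v w) (f a y) + (matG (zg Zi y) (a + 2) v * θ (a + 1) y w
        - matG (zg Zi y) (a + 1) v * θ (a + 2) y w) := by
    intro v w
    have h1 := DFunLike.congr_fun (hasFDerivAt_clm_apply_const
      (hF.at_diff (hF.θ_smooth a) hy).hasFDerivAt w).fderiv v
    have h2 : (fun z => θ a z w) =ᶠ[nhds y] fun z => pair (fderiv ℝ U z w) (f a z) := by
      filter_upwards [hF.isOpen.mem_nhds hy] with z hz using hF.θ_eq hz a w
    have h3 := hasFDerivAt_clm_apply_const (hF.fderiv_U_diff hy).hasFDerivAt w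
    rw [h2.fderiv_eq, (fderiv_pair h3.differentiableAt (hF.at_diff (hF.f_smooth a) hy)).2,
      h3.fderiv] at h1
    refine h1.symm.trans ?_
    have hN2 : pair (fderiv ℝ U y w) (negN2.compContinuousLinearMap (Zi y)) = 0 := by
      rw [hF.U_deriv y hy, ← pairL_apply]
      simp [pairL_apply, hF.f_eq y hy, hF.pair_comp_Zi hy, pair_posBasis_negN]
    have hN1 : pair (fderiv ℝ U y w) (negN1.compContinuousLinearMap (Zi y)) = 0 := by
      rw [hF.U_deriv y hy, ← pairL_apply]
      simp [pairL_apply, hF.f_eq y hy, hF.pair_comp_Zi hy, pair_posBasis_negN]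
    rw [hF.f_deriv hy]
    simp only [pair_add_right, pair_sub_right, pair_smul_right, hN1, hN2, ← hF.θ_eq hy, pair_comm
        _ (U y),
      hF.pair_U_deriv hy]
    simp only [ContinuousLinearMap.flip_apply]
    ring
  rw [dOne, hd, hd, hF.hess_symm hy v w]
  ring

theorem pair_hess (hF : SpaceFrame s U f θ e Zi) (hy : y ∈ s) (v w : E3) {n : Lam2}
    (hn : ∀ a, pair (f a y) n = 0) : pair (fderiv ℝ (fderiv ℝ U) y v w) n =
      ∑ a, θ a y w * pair (fderiv ℝ (f a) y v) n := by
  have h3 := hasFDerivAt_clm_apply_const (hF.fderiv_U_diff hy).hasFDerivAt w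
  have h2 : (fun z => fderiv ℝ U z w) =ᶠ[nhds y] fun z => ∑ a, θ a z w • f a z := by
    filter_upwards [hF.isOpen.mem_nhds hy] with z hz using hF.U_deriv z hz w
  have h4 : HasFDerivAt (fun z => ∑ a, θ a z w • f a z) _ y := HasFDerivAt.fun_sum fun a _ =>
    (hasFDerivAt_clm_apply_const (hF.at_diff (hF.θ_smooth a) hy).hasFDerivAt w).smul
      (hF.at_diff (hF.f_smooth a) hy).hasFDerivAt
  have h5 := (h4.congr_of_eventuallyEq h2).unique h3
  have h6 : fderiv ℝ (fderiv ℝ U) y v w = _ := (DFunLike.congr_fun h5 v).symm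
  rw [h6, ← pairL_apply]
  simp [pairL_apply, hn]

theorem pair_f_deriv (hF : SpaceFrame s U f θ e Zi) (hy : y ∈ s) (a : Fin 3) (v : E3) :
    pair (fderiv ℝ (f a) y v) (negN2.compContinuousLinearMap (Zi y)) = -2 * matP (zg Zi y) a v ∧
    pair (fderiv ℝ (f a) y v) (negN1.compContinuousLinearMap (Zi y)) =
      -2 * matQ (zg Zi y) a v := by
  rw [hF.f_deriv hy, hF.U_eq y hy, hF.f_eq y hy, hF.f_eq y hy]
  simp only [pair_add_left, pair_sub_left, pair_smul_left, hF.pair_comp_Zi hy,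
    (pair_posBasis_negN _).1, (pair_posBasis_negN _).2, pair_negU_negN.1, pair_negU_negN.2,
    pair_negN.1, pair_negN.2.1, pair_negN.2.2.1, pair_negN.2.2.2]
  constructor <;> ring

theorem pair_f_negN (hF : SpaceFrame s U f θ e Zi) (hy : y ∈ s) (a : Fin 3) :
    pair (f a y) (negN1.compContinuousLinearMap (Zi y)) = 0 ∧
      pair (f a y) (negN2.compContinuousLinearMap (Zi y)) = 0 := by
  rw [hF.f_eq y hy, hF.pair_comp_Zi hy, hF.pair_comp_Zi hy]
  exact pair_posBasis_negN a

/-- Up to the factor -2 these are the components of the Hessian of U along the two unit normals. -/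
theorem matP_symm (hF : SpaceFrame s U f θ e Zi) (hy : y ∈ s) (a b : Fin 3) :
    matP (zg Zi y) a (e b y) = matP (zg Zi y) b (e a y) ∧
      matQ (zg Zi y) a (e b y) = matQ (zg Zi y) b (e a y) := by
  constructor
  · have h := congrArg (fun t => pair t (negN2.compContinuousLinearMap (Zi y)))
      (hF.hess_symm hy (e b y) (e a y))
    simp only [hF.pair_hess hy _ _ fun a => (hF.pair_f_negN hy a).2, (hF.pair_f_deriv hy _ _).1,
      hF.θ_e y hy] at h
    simp at h
    linarith
  · have h := congrArg (fun t => pair t (negN1.compContinuousLinearMap (Zi y)))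
      (hF.hess_symm hy (e b y) (e a y))
    simp only [hF.pair_hess hy _ _ fun a => (hF.pair_f_negN hy a).1, (hF.pair_f_deriv hy _ _).2,
      hF.θ_e y hy] at h
    simp at h
    linarith

/-- Maximality, tested on the two normals obtained from `negN2` and `negN1`. -/
theorem matP_trace (hF : SpaceFrame s U f θ e Zi) (hy : y ∈ s) :
    ∑ a, matP (zg Zi y) a (e a y) = 0 ∧ ∑ a, matQ (zg Zi y) a (e a y) = 0 := by
  have hU1 : pair (U y) (negN1.compContinuousLinearMap (Zi y)) = 0 := by
    rw [hF.U_eq y hy, hF.pair_comp_Zi hy, pair_negU_negN.1]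
  have hU2 : pair (U y) (negN2.compContinuousLinearMap (Zi y)) = 0 := by
    rw [hF.U_eq y hy, hF.pair_comp_Zi hy, pair_negU_negN.2]
  constructor
  · have h := hF.maximal y hy _ hU2 fun a => (hF.pair_f_negN hy a).2
    simp only [hF.pair_hess hy _ _ fun a => (hF.pair_f_negN hy a).2, (hF.pair_f_deriv hy _ _).1,
      hF.θ_e y hy] at h
    simp [Fin.sum_univ_three] at h ⊢
    linarith
  · have h := hF.maximal y hy _ hU1 fun a => (hF.pair_f_negN hy a).1
    simp only [hF.pair_hess hy _ _ fun a => (hF.pair_f_negN hy a).1, (hF.pair_f_deriv hy _ _).2,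
      hF.θ_e y hy] at h
    simp [Fin.sum_univ_three] at h ⊢
    linarith

end SpaceFrame

end
end G2ERP

namespace G2ERP
noncomputable section

/-! ### The coframe on the product with `ℝ⁴` -/

/-- The model of `B × ℝ⁴`. -/
abbrev E34 := E3 × (Fin 4 → ℝ)

theorem hasFDerivAt_comp_fst {X : Type*} [NormedAddCommGroup X] [NormedSpace ℝ X]
    {A : E3 → X →L[ℝ] ℝ} {p : E34} (hA : DifferentiableAt ℝ A p.1) (π : E34 →L[ℝ] X) :
    DifferentiableAt ℝ (fun p : E34 => (A p.1).comp π) p ∧ ∀ v w,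
      fderiv ℝ (fun p : E34 => (A p.1).comp π) p v w = fderiv ℝ A p.1 v.1 (π w) := by
  have h : HasFDerivAt (fun p : E34 => (A p.1).comp π)
      (((ContinuousLinearMap.compL ℝ E34 X ℝ).flip π).comp
        ((fderiv ℝ A p.1).comp (ContinuousLinearMap.fst ℝ E3 (Fin 4 → ℝ)))) p :=
    ((ContinuousLinearMap.compL ℝ E34 X ℝ).flip π).hasFDerivAt.comp p
      (hA.hasFDerivAt.comp p hasFDerivAt_fst)
  refine ⟨h.differentiableAt, fun v w => ?_⟩
  rw [h.fderiv]
  rfl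

/-- The coframe on the product with `ℝ⁴`. -/
def prodOm (k : ℝ) (θ : Fin 3 → E3 → E3 →L[ℝ] ℝ) (Zi : E3 → (Fin 4 → ℝ) →L[ℝ] (Fin 4 → ℝ))
    (i : Fin 7) (p : E34) : E34 →L[ℝ] ℝ :=
  Fin.append
    -- The scales invert those of the flat chart: θ = 2k ω on the base, and √(2k) on the fibre,
    -- where two-forms see its square.
    (fun a : Fin 3 => ((2 * k)⁻¹ • θ a p.1).comp (ContinuousLinearMap.fst ℝ E3 (Fin 4 → ℝ)))
    (fun j : Fin 4 => (√(2 * k) • (ContinuousLinearMap.proj j : (Fin 4 → ℝ) →L[ℝ] ℝ).comp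
      (Zi p.1)).comp (ContinuousLinearMap.snd ℝ E3 (Fin 4 → ℝ))) i

theorem prodOm_base (k : ℝ) (θ : Fin 3 → E3 → E3 →L[ℝ] ℝ)
    (Zi : E3 → (Fin 4 → ℝ) →L[ℝ] (Fin 4 → ℝ)) (a : Fin 3) :
    prodOm k θ Zi (Fin.castLE (by norm_num) a) = fun p : E34 =>
      ((2 * k)⁻¹ • θ a p.1).comp (ContinuousLinearMap.fst ℝ E3 (Fin 4 → ℝ)) := by
  fin_cases a <;> rfl

theorem prodOm_fib (k : ℝ) (θ : Fin 3 → E3 → E3 →L[ℝ] ℝ)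
    (Zi : E3 → (Fin 4 → ℝ) →L[ℝ] (Fin 4 → ℝ)) (j : Fin 4) :
    prodOm k θ Zi (fibIdx j) = fun p : E34 =>
      (√(2 * k) • (ContinuousLinearMap.proj j : (Fin 4 → ℝ) →L[ℝ] ℝ).comp
      (Zi p.1)).comp (ContinuousLinearMap.snd ℝ E3 (Fin 4 → ℝ)) := by
  fin_cases j <;> rfl

theorem prodOm_base_apply (k : ℝ) (θ : Fin 3 → E3 → E3 →L[ℝ] ℝ)
    (Zi : E3 → (Fin 4 → ℝ) →L[ℝ] (Fin 4 → ℝ)) (a : Fin 3) (p v : E34) :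
    prodOm k θ Zi (Fin.castLE (by norm_num) a) p v = (2 * k)⁻¹ * θ a p.1 v.1 := by
  rw [prodOm_base]
  rfl

theorem prodOm_fib_apply (k : ℝ) (θ : Fin 3 → E3 → E3 →L[ℝ] ℝ)
    (Zi : E3 → (Fin 4 → ℝ) →L[ℝ] (Fin 4 → ℝ)) (j : Fin 4) (p v : E34) :
    prodOm k θ Zi (fibIdx j) p v = √(2 * k) * Zi p.1 v.2 j := by
  rw [prodOm_fib]
  rfl

theorem fib_prodOm (k : ℝ) (θ : Fin 3 → E3 → E3 →L[ℝ] ℝ)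
    (Zi : E3 → (Fin 4 → ℝ) →L[ℝ] (Fin 4 → ℝ)) (p v : E34) :
    fib (fun i => prodOm k θ Zi i p v) = √(2 * k) • Zi p.1 v.2 := by
  funext j
  have := prodOm_fib_apply k θ Zi j p v
  fin_cases j <;> exact this

/-- The `su(2)`-part of the connection. -/
def prodG (Zi : E3 → (Fin 4 → ℝ) →L[ℝ] (Fin 4 → ℝ)) (a : Fin 3) (p : E34) : E34 →L[ℝ] ℝ :=
  (matG (zg Zi p.1) a).comp (ContinuousLinearMap.fst ℝ E3 (Fin 4 → ℝ))

/-- The `u(1)`-part of the connection. -/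
def prodR (Zi : E3 → (Fin 4 → ℝ) →L[ℝ] (Fin 4 → ℝ)) (p : E34) : E34 →L[ℝ] ℝ :=
  (matR (zg Zi p.1)).comp (ContinuousLinearMap.fst ℝ E3 (Fin 4 → ℝ))

/-- The second fundamental form, as a complex matrix. -/
def sffH (k : ℝ) (e : Fin 3 → E3 → E3) (Zi : E3 → (Fin 4 → ℝ) →L[ℝ] (Fin 4 → ℝ)) (y : E3)
    (a b : Fin 3) : ℂ :=
  (2 * k * matP (zg Zi y) a (e b y) : ℝ) + Complex.I * (2 * k * matQ (zg Zi y) a (e b y) : ℝ)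

/-- The binary quartic with a given complex symmetric trace-free matrix. -/
def quarticOf (H : Fin 3 → Fin 3 → ℂ) (m : ℕ) : ℂ :=
  ![(-Complex.I * (H 1 1 - H 2 2) - 2 * H 1 2) / 2, (-H 0 1 + Complex.I * H 0 2) / 2,
    Complex.I / 2 * H 0 0, (-H 0 1 - Complex.I * H 0 2) / 2,
    (-Complex.I * (H 1 1 - H 2 2) + 2 * H 1 2) / 2] (Fin.ofNat 5 m)

/-- The inverse of the identification of binary quartics with symmetric trace-free 3 × 3 matrices;
it turns the second fundamental form into the tensor `S`. -/
theorem quarticMat_quarticOf {H : Fin 3 → Fin 3 → ℂ} (hs : ∀ a b, H a b = H b a)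
    (ht : ∑ a, H a a = 0) : quarticMat (quarticOf H) = H := by
  have h10 := hs 1 0
  have h20 := hs 2 0
  have h21 := hs 2 1
  have h0 : H 0 0 = -(H 1 1 + H 2 2) := by
    rw [Fin.sum_univ_three] at ht
    linear_combination ht
  have e : ∀ m : ℕ, quarticOf H m = _ := fun m => rfl
  have hI : Complex.I ^ 2 = -1 := Complex.I_sq
  funext a b
  fin_cases a <;> fin_cases b <;>
    simp [quarticMat, quarticOf, Fin.ofNat, h10, h20, h21, h0] <;> ring_nf <;>
    (try rw [hI]) <;> ring

namespace SpaceFrame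

variable {s : Set E3} {U : E3 → Lam2} {f : Fin 3 → E3 → Lam2} {θ : Fin 3 → E3 → E3 →L[ℝ] ℝ}
  {e : Fin 3 → E3 → E3} {Zi : E3 → (Fin 4 → ℝ) →L[ℝ] (Fin 4 → ℝ)} {y : E3} {k : ℝ}

theorem quarticMat_sffH (hF : SpaceFrame s U f θ e Zi) (hy : y ∈ s) :
    quarticMat (quarticOf (sffH k e Zi y)) = sffH k e Zi y := by
  refine quarticMat_quarticOf (fun a b => ?_) ?_
  · rw [sffH, sffH, (hF.matP_symm hy a b).1, (hF.matP_symm hy a b).2]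
  · obtain ⟨h1, h2⟩ := hF.matP_trace hy
    rw [Fin.sum_univ_three] at h1 h2 ⊢
    apply Complex.ext
    · simp [sffH]
      linear_combination 2 * k * h1
    · simp [sffH]
      linear_combination 2 * k * h2

/-- Expanded in the coframe θ = 2k ω, the coordinate θ/2 becomes k ω, and the one-forms P, Q become
matrices times ω. The factor 2k in `sffH` accounts for the scale. -/
theorem conn_eq (hF : SpaceFrame s U f θ e Zi) (hk : 0 < k) {p : E34} (hp : p.1 ∈ s) (v : E34) :
    conn k (fun a b => (quarticMat (quarticOf (sffH k e Zi p.1)) a b).re)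
      (fun a b => (quarticMat (quarticOf (sffH k e Zi p.1)) a b).im) (fun a => prodG Zi a p v)
      (prodR Zi p v) (fun i => prodOm k θ Zi i p v) = Matrix.of fun i j => zg Zi p.1 i j v.1 := by
  rw [hF.zg_eq hp, hF.quarticMat_sffH hp, conn]
  have h0 : prodOm k θ Zi 0 p v = (2 * k)⁻¹ * θ 0 p.1 v.1 := prodOm_base_apply k θ Zi 0 p v
  have h1 : prodOm k θ Zi 1 p v = (2 * k)⁻¹ * θ 1 p.1 v.1 := prodOm_base_apply k θ Zi 1 p v
  have h2 : prodOm k θ Zi 2 p v = (2 * k)⁻¹ * θ 2 p.1 v.1 := prodOm_base_apply k θ Zi 2 p v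
  have hv := hF.span p.1 hp v.1
  rw [Fin.sum_univ_three] at hv
  have hlin : ∀ α : E3 →L[ℝ] ℝ, α v.1 =
      θ 0 p.1 v.1 * α (e 0 p.1) + θ 1 p.1 v.1 * α (e 1 p.1) + θ 2 p.1 v.1 * α (e 2 p.1) := by
    intro α
    conv_lhs => rw [hv]
    simp
  congr 1
  · funext a
    fin_cases a
    · simp [h0]; field_simp
    · simp [h1]; field_simp
    · simp [h2]; field_simp
  · funext a
    rw [hlin, h0, h1, h2]
    simp [sffH]
    field_simp
  · funext a
    rw [hlin, h0, h1, h2]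
    simp [sffH]
    field_simp

/-- The base equations are those of dθ. The fibre equations follow from dZ = -ΓZ for the coframe Z
of ℝ⁴, because the coordinate differentials on ℝ⁴ are closed. -/
theorem prodOm_eqs (hF : SpaceFrame s U f θ e Zi) (hk : 0 < k) {p : E34} (hp : p.1 ∈ s)
    (v w : E34) (i : Fin 7) : dOne (prodOm k θ Zi i) p v w =
      realRHS k (fun a b => (quarticMat (quarticOf (sffH k e Zi p.1)) a b).re)
      (fun a b => (quarticMat (quarticOf (sffH k e Zi p.1)) a b).im) (fun a => prodG Zi a p v)
      (prodR Zi p v) (fun i => prodOm k θ Zi i p v) (fun a => prodG Zi a p w)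
      (prodR Zi p w) (fun i => prodOm k θ Zi i p w) i := by
  have hb : ∀ a : Fin 3, dOne (prodOm k θ Zi (Fin.castLE (by norm_num) a)) p v w =
      (2 * k)⁻¹ * dOne (θ a) p.1 v.1 w.1 := by
    intro a
    have hd := hF.at_diff (hF.θ_smooth a) hp
    have h1 := (hasFDerivAt_comp_fst (p := p) (hd.const_smul (2 * k)⁻¹)
      (ContinuousLinearMap.fst ℝ E3 (Fin 4 → ℝ))).2
    rw [prodOm_base, dOne]
    refine (congrArg₂ (· - ·) (h1 v w) (h1 w v)).trans ?_
    rw [fderiv_const_smul hd, dOne]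
    simp only [smul_apply, ContinuousLinearMap.coe_fst', smul_eq_mul]
    ring
  have hf : ∀ j : Fin 4, dOne (prodOm k θ Zi (fibIdx j)) p v w =
      √(2 * k) * (fderiv ℝ Zi p.1 v.1 w.2 j - fderiv ℝ Zi p.1 w.1 v.2 j) := by
    intro j
    have hd := hF.at_diff hF.Zi_smooth hp
    have hd' : HasFDerivAt (fun y => √(2 * k) • (ContinuousLinearMap.proj j :
        (Fin 4 → ℝ) →L[ℝ] ℝ).comp (Zi y)) (√(2 * k) • ((ContinuousLinearMap.compL ℝ (Fin 4 → ℝ)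
        (Fin 4 → ℝ) ℝ (ContinuousLinearMap.proj j)).comp (fderiv ℝ Zi p.1))) p.1 :=
      ((ContinuousLinearMap.compL ℝ (Fin 4 → ℝ) (Fin 4 → ℝ) ℝ
        (ContinuousLinearMap.proj j)).hasFDerivAt.comp p.1 hd.hasFDerivAt).const_smul (√(2 * k))
    have h1 := (hasFDerivAt_comp_fst (p := p) hd'.differentiableAt
      (ContinuousLinearMap.snd ℝ E3 (Fin 4 → ℝ))).2
    rw [prodOm_fib, dOne]
    refine (congrArg₂ (· - ·) (h1 v w) (h1 w v)).trans ?_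
    rw [hd'.fderiv]
    change √(2 * k) * _ - √(2 * k) * _ = _
    rw [← mul_sub]
    rfl
  have hbase : ∀ a : Fin 3, ∀ v, prodOm k θ Zi (Fin.castLE (by norm_num) a) p v =
      (2 * k)⁻¹ * θ a p.1 v.1 := fun a v => prodOm_base_apply k θ Zi a p v
  have hfib : ∀ j : Fin 4, dOne (prodOm k θ Zi (fibIdx j)) p v w =
      ∑ l, (Matrix.of (fun i j => zg Zi p.1 i j w.1) j l
          * fib (fun i => prodOm k θ Zi i p v) l
        - Matrix.of (fun i j => zg Zi p.1 i j v.1) j l * fib (fun i => prodOm k θ Zi i p w) l) := by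
    intro j
    rw [hf, hF.fderiv_Zi hp, hF.fderiv_Zi hp, fib_prodOm, fib_prodOm]
    simp only [Matrix.mulVec, dotProduct, Fin.sum_univ_four, Pi.neg_apply, Pi.smul_apply,
      smul_eq_mul]
    ring
  have g : ∀ a v, prodG Zi a p v = matG (zg Zi p.1) a v.1 := fun _ _ => rfl
  have a0 := hb 0
  have a1 := hb 1
  have a2 := hb 2
  rw [hF.dθ hp] at a0 a1 a2
  have b0 := fun v => hbase 0 v
  have b1 := fun v => hbase 1 v
  have b2 := fun v => hbase 2 v
  have f0 := hfib 0
  have f1 := hfib 1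
  have f2 := hfib 2
  have f3 := hfib 3
  have c0 : Fin.castLE (by norm_num : 3 ≤ 7) 0 = 0 := rfl
  have c1 : Fin.castLE (by norm_num : 3 ≤ 7) 1 = 1 := rfl
  have c2 : Fin.castLE (by norm_num : 3 ≤ 7) 2 = 2 := rfl
  rw [c0] at a0
  rw [c1] at a1
  rw [c2] at a2
  simp only [c0] at b0
  simp only [c1] at b1
  simp only [c2] at b2
  simp only [realRHS, hF.conn_eq hk hp]
  fin_cases i
  · refine a0.trans ?_
    simp [b1, b2, g]
    ring
  · refine a1.trans ?_
    simp [b0, b2, g]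
    ring
  · refine a2.trans ?_
    simp [b0, b1, g]
    ring
  · exact f0
  · exact f1
  · exact f2
  · exact f3

end SpaceFrame

end
end G2ERP

namespace G2ERP
noncomputable section

set_option linter.unusedSectionVars false

/-! ### Structure equations on a manifold from a coframe on the model -/

section PullOne

variable {E : Type*} [NormedAddCommGroup E] [NormedSpace ℝ E] [FiniteDimensional ℝ E]
  {H : Type*} [TopologicalSpace H] {I : ModelWithCorners ℝ E H} [I.Boundaryless]
  {M : Type*} [TopologicalSpace M] [ChartedSpace H M] [IsManifold I ∞ M]
  {E' : Type*} [NormedAddCommGroup E'] [NormedSpace ℝ E'] [FiniteDimensional ℝ E']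
  {F : Type*} [NormedAddCommGroup F] [NormedSpace ℝ F] [FiniteDimensional ℝ F]

/-- A field of linear forms, as a `1`-form. -/
def toOne (α : E' → E' →L[ℝ] F) (y : E') : E' [⋀^Fin 1]→L[ℝ] F :=
  ContinuousAlternatingMap.ofSubsingleton ℝ E' F (0 : Fin 1) (α y)

theorem contDiffAt_toOne {α : E' → E' →L[ℝ] F} {y : E'} (h : ContDiffAt ℝ ∞ α y) :
    ContDiffAt ℝ ∞ (toOne α) y :=
  contDiffAt_alternating_of_apply fun _ => h.clm_apply contDiffAt_const

variable (I) in
/-- The pullback by `f` of a field of linear forms. -/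
def pullOne (f : M → E') (α : E' → E' →L[ℝ] F) : MForm I M 1 F := fun x =>
  (toOne α (f x)).compContinuousLinearMap (mfderiv I 𝓘(ℝ, E') f x)

variable {f : M → E'} {x : M}

theorem pullOne_apply (α : E' → E' →L[ℝ] F) (v : TangentSpace I x) :
    pullOne I f α x (fun _ => v) = α (f x) (mfderiv I 𝓘(ℝ, E') f x v) := rfl

theorem contDiffAt_pullOne {α : E' → E' →L[ℝ] F} (hf : ContMDiffAt I 𝓘(ℝ, E') ∞ f x)
    (h : ContDiffAt ℝ ∞ α (f x)) :
    ContDiffAt ℝ ∞ ((pullOne I f α).chartRep I x) (extChartAt I x x) :=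
  contDiffAt_chartRep_of_pullback (mem_extChartAt_source x) hf (contDiffAt_toOne h)
    (Filter.Eventually.of_forall fun _ => rfl)

theorem pullOne_d {α : E' → E' →L[ℝ] F} (hf : ContMDiffAt I 𝓘(ℝ, E') ∞ f x)
    (h : ContDiffAt ℝ ∞ α (f x)) (v w : TangentSpace I x) :
    (pullOne I f α).d I x ![v, w] =
      dOne α (f x) (mfderiv I 𝓘(ℝ, E') f x v) (mfderiv I 𝓘(ℝ, E') f x w) := by
  have h1 : (pullOne I f α).d I x = _ := d_eq_of_pullback hf
    ((contDiffAt_toOne h).differentiableAt (by simp)) (Filter.Eventually.of_forall fun _ => rfl)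
  refine (DFunLike.congr_fun h1 ![v, w]).trans (Eq.trans ?_ (extDeriv_oneForm_apply (α := toOne α)
      (α' := α) (fun _ _ => rfl)
    ((contDiffAt_toOne h).differentiableAt (by simp)) (h.differentiableAt (by simp)) _ _))
  refine congrArg (extDeriv (toOne α) (f x)) (funext fun i => ?_)
  fin_cases i <;> rfl

/-- The skew-Hermitian matrix of `1`-forms with coordinates `G`, `R`. -/
def kapL (G : Fin 3 → E' →L[ℝ] ℝ) (R : E' →L[ℝ] ℝ) : Fin 2 → Fin 2 → E' →L[ℝ] ℂ :=
  ![![((1 / 2 : ℝ) • (R - G 0)).smulRight Complex.I,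
      ((-1 / 2 : ℝ) • G 1).smulRight 1 + ((1 / 2 : ℝ) • G 2).smulRight Complex.I],
    ![((1 / 2 : ℝ) • G 1).smulRight 1 + ((1 / 2 : ℝ) • G 2).smulRight Complex.I,
      ((1 / 2 : ℝ) • (R + G 0)).smulRight Complex.I]]

theorem kapL_apply (G : Fin 3 → E' →L[ℝ] ℝ) (R : E' →L[ℝ] ℝ) (a b : Fin 2) (v : E') :
    kapL G R a b v = kapC (fun i => G i v) (R v) a b := by
  fin_cases a <;> fin_cases b <;> apply Complex.ext <;> simp [kapL, kapC] <;> ring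

theorem kapC_skew (G : Fin 3 → ℝ) (ρ : ℝ) (a b : Fin 2) : kapC G ρ a b = -star (kapC G ρ b a) := by
  fin_cases a <;> fin_cases b <;> apply Complex.ext <;> simp [kapC] <;> ring

theorem contDiffAt_kapL {G : Fin 3 → E' → E' →L[ℝ] ℝ} {R : E' → E' →L[ℝ] ℝ} {y : E'}
    (hG : ∀ a, ContDiffAt ℝ ∞ (G a) y) (hR : ContDiffAt ℝ ∞ R y) (a b : Fin 2) :
    ContDiffAt ℝ ∞ (fun z => kapL (fun i => G i z) (R z) a b) y := by
  have h : ∀ {α : E' → E' →L[ℝ] ℝ} (c : ℂ), ContDiffAt ℝ ∞ α y →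
      ContDiffAt ℝ ∞ (fun z => (α z).smulRight c) y := fun c hα =>
    ((ContinuousLinearMap.smulRightL ℝ E' ℂ).flip c).contDiff.contDiffAt.comp y hα
  fin_cases a <;> fin_cases b
  exacts [h _ ((hR.sub (hG 0)).const_smul (1 / 2 : ℝ)),
    (h _ ((hG 1).const_smul (-1 / 2 : ℝ))).add (h _ ((hG 2).const_smul (1 / 2 : ℝ))),
    (h _ ((hG 1).const_smul (1 / 2 : ℝ))).add (h _ ((hG 2).const_smul (1 / 2 : ℝ))),
    h _ ((hR.add (hG 0)).const_smul (1 / 2 : ℝ))]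

/-- Exterior differentiation commutes with pullback, and the real equations regroup into complex
ones. A tensor `S` that depends only on the sum of its indices is automatically symmetric. -/
theorem structureEquations_pullback {k : ℝ} {om : Fin 7 → E' → E' →L[ℝ] ℝ}
    {G : Fin 3 → E' → E' →L[ℝ] ℝ} {R : E' → E' →L[ℝ] ℝ} {σ : ℕ → E' → ℂ}
    (hf : ContMDiffAt I 𝓘(ℝ, E') ∞ f x) (hom : ∀ i, ContDiffAt ℝ ∞ (om i) (f x))
    (heq : ∀ v w i, dOne (om i) (f x) v w =
      realRHS k (fun a b => (quarticMat (fun m => σ m (f x)) a b).re)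
        (fun a b => (quarticMat (fun m => σ m (f x)) a b).im) (fun a => G a (f x) v) (R (f x) v)
        (fun i => om i (f x) v) (fun a => G a (f x) w) (R (f x) w) (fun i => om i (f x) w) i) :
    StructureEquations I k (fun i => pullOne I f (om i))
      (fun a b => pullOne I f fun y => kapL (fun i => G i y) (R y) a b) (fun _ _ => 0)
      (fun t x => σ (∑ i, (t i : ℕ)) (f x)) (fun _ _ => 0) x := by
  have hd : ∀ v w, (fun i => (pullOne I f (om i)).d I x ![v, w]) = _ := fun v w =>
    (funext fun i => pullOne_d hf (hom i) v w).trans (funext fun i => heq _ _ i)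
  have hK : ∀ a b (v : TangentSpace I x),
      pullOne I f (fun y => kapL (fun i => G i y) (R y) a b) x (fun _ => v) =
      kapC (fun i => G i (f x) (mfderiv I 𝓘(ℝ, E') f x v))
        (R (f x) (mfderiv I 𝓘(ℝ, E') f x v)) a b := fun a b v =>
    kapL_apply _ _ a b _
  refine ⟨?_, ?_, ?_, ?_, ?_⟩
  · intro a b v
    simp only [hK]
    exact kapC_skew _ _ _ _
  · intro t τ
    rfl
  · intro t τ
    change σ (∑ i, (t (τ i) : ℕ)) (f x) = _
    rw [Equiv.sum_comp τ fun i => (t i : ℕ)]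
  · intro a v w
    rw [hd v w]
    simp only [hK, pullOne_apply, mul_zero, zero_mul, Finset.sum_const_zero, add_zero]
    refine (eta_rhs_eq k (fun m => σ m (f x))
      (fun v i => om i (f x) (mfderiv I 𝓘(ℝ, E') f x v))
      (fun v a => G a (f x) (mfderiv I 𝓘(ℝ, E') f x v))
      (fun v => R (f x) (mfderiv I 𝓘(ℝ, E') f x v)) v w a).symm.trans ?_
    simp [Fin.sum_univ_four]
  · intro a b v w
    rw [hd v w]
    simp only [hK, pullOne_apply, star_zero, mul_zero, zero_mul, Finset.sum_const_zero, add_zero]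
    exact (nu_rhs_eq k (fun m => σ m (f x))
      (fun v i => om i (f x) (mfderiv I 𝓘(ℝ, E') f x v))
      (fun v a => G a (f x) (mfderiv I 𝓘(ℝ, E') f x v))
      (fun v => R (f x) (mfderiv I 𝓘(ℝ, E') f x v)) v w a b).symm

end PullOne

end
end G2ERP

namespace G2ERP
noncomputable section

set_option linter.unusedSectionVars false

/-! ### Maximal immersions in a chart -/

theorem fderiv_fderiv_comp {T : E3 → E3} {U : E3 → Lam2} {y : E3} (hT : ContDiffAt ℝ ∞ T y)
    (hU : ContDiffAt ℝ ∞ U (T y)) (v w : E3) :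
    fderiv ℝ (fderiv ℝ (U ∘ T)) y v w = fderiv ℝ (fderiv ℝ U) (T y) (fderiv ℝ T y v) (fderiv ℝ T y
        w)
      + fderiv ℝ U (T y) (fderiv ℝ (fderiv ℝ T) y v w) := by
  have e1 : fderiv ℝ (U ∘ T) =ᶠ[nhds y] fun z => (fderiv ℝ U (T z)).comp (fderiv ℝ T z) := by
    have h1 : ∀ᶠ z in nhds y, DifferentiableAt ℝ T z :=
      ((hT.of_le (m := 1) (by simp)).eventually (by simp)).mono
        fun z hz => hz.differentiableAt (by simp)
    have h2 : ∀ᶠ z in nhds (T y), DifferentiableAt ℝ U z :=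
      ((hU.of_le (m := 1) (by simp)).eventually (by simp)).mono
        fun z hz => hz.differentiableAt (by simp)
    filter_upwards [h1, hT.continuousAt.eventually h2] with z hz1 hz2
    exact fderiv_comp z hz2 hz1
  have hT2 := ((hT.fderiv_right (m := ∞) (by simp)).differentiableAt (by simp)).hasFDerivAt
  have hU2 := ((hU.fderiv_right (m := ∞) (by simp)).differentiableAt (by simp)).hasFDerivAt
  have hc := hU2.comp y (hT.differentiableAt (by simp)).hasFDerivAt
  have h := hc.clm_comp hT2
  rw [e1.fderiv_eq]
  refine (congrArg (fun L => L v w) h.fderiv).trans ?_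
  simp
  abel

section

variable {B : Type*} [TopologicalSpace B] [ChartedSpace (EuclideanSpace ℝ (Fin 3)) B]
  [IsManifold (𝓡 3) ∞ B] {u : B → Lam2}

theorem du_eq_fderiv_chart (hu : ContMDiff (𝓡 3) 𝓘(ℝ, Lam2) ∞ u) (b : B) (v : E3) :
    du u b v = fderiv ℝ (u ∘ (extChartAt (𝓡 3) b).symm) (extChartAt (𝓡 3) b b) v := by
  have hd : MDifferentiableAt (𝓡 3) 𝓘(ℝ, Lam2) u b := hu.mdifferentiableAt (by simp)
  refine (congrArg (fun L : E3 →L[ℝ] Lam2 => L v) (if_pos hd)).trans ?_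
  simp only [writtenInExtChartAt, extChartAt_model_space_eq_id, ModelWithCorners.range_eq_univ,
    fderivWithin_univ]
  rfl

theorem fderiv_chart_symm_eq_du (hu : ContMDiff (𝓡 3) 𝓘(ℝ, Lam2) ∞ u) {b₀ b : B}
    (hb : b ∈ (extChartAt (𝓡 3) b₀).source) (v : E3) :
    fderiv ℝ (u ∘ (extChartAt (𝓡 3) b₀).symm) (extChartAt (𝓡 3) b₀ b) v =
      du u b (mfderiv 𝓘(ℝ, E3) (𝓡 3) (extChartAt (𝓡 3) b₀).symm (extChartAt (𝓡 3) b₀ b) v) :=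
  DFunLike.congr_fun (fderiv_comp_chart_symm hb (hu.mdifferentiableAt (by simp))) v

theorem du_eq_fderiv_chart_symm (hu : ContMDiff (𝓡 3) 𝓘(ℝ, Lam2) ∞ u) {b₀ b : B}
    (hb : b ∈ (extChartAt (𝓡 3) b₀).source) (v : TangentSpace (𝓡 3) b) :
    du u b v = fderiv ℝ (u ∘ (extChartAt (𝓡 3) b₀).symm) (extChartAt (𝓡 3) b₀ b)
      (mfderiv (𝓡 3) 𝓘(ℝ, E3) (extChartAt (𝓡 3) b₀) b v) :=
  DFunLike.congr_fun (mfderiv_eq_fderiv_comp_chart hb (hu.mdifferentiableAt (by simp))) v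

namespace IsMaximalInQuadric

theorem indMetric_pos (hu : IsMaximalInQuadric u) (b₀ : B) {y : E3}
    (hy : y ∈ (extChartAt (𝓡 3) b₀).target) {v : E3} (hv : v ≠ 0) :
    0 < indMetric (u ∘ (extChartAt (𝓡 3) b₀).symm) y v v := by
  have hb := (extChartAt (𝓡 3) b₀).map_target hy
  have h1 := fderiv_chart_symm_eq_du hu.smooth hb v
  rw [(extChartAt (𝓡 3) b₀).right_inv hy] at h1
  rw [indMetric, h1]
  refine hu.spacelike _ _ fun h0 => hv ?_
  have h2 := DFunLike.congr_fun (mfderiv_comp_mfderiv_symm_extChartAt (I := 𝓡 3) hy) v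
  have h3 := congrArg (mfderiv (𝓡 3) 𝓘(ℝ, E3) (extChartAt (𝓡 3) b₀)
    ((extChartAt (𝓡 3) b₀).symm y)) h0
  exact h2.symm.trans (h3.trans (map_zero _))

/-- Maximality is formulated at each point in the preferred chart there. Passing to one fixed chart
changes the Hessian by du of a vector, which is tangential and hence invisible to normal vectors. -/
theorem maximal_chart (hu : IsMaximalInQuadric u) (b₀ : B) {y : E3}
    (hy : y ∈ (extChartAt (𝓡 3) b₀).target) {e : Fin 3 → E3}
    (he : IsOrtho fun a => fderiv ℝ (u ∘ (extChartAt (𝓡 3) b₀).symm) y (e a)) {n : Lam2}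
    (hn : pair (u ((extChartAt (𝓡 3) b₀).symm y)) n = 0)
    (hn' : ∀ v, pair (fderiv ℝ (u ∘ (extChartAt (𝓡 3) b₀).symm) y v) n = 0) :
    ∑ i, pair (fderiv ℝ (fderiv ℝ (u ∘ (extChartAt (𝓡 3) b₀).symm)) y (e i) (e i)) n = 0 := by
  set χ := extChartAt (𝓡 3) b₀ with hχ
  set b := χ.symm y with hbdef
  have hb : b ∈ χ.source := χ.map_target hy
  have hby : χ b = y := χ.right_inv hy
  let χ' := extChartAt (𝓡 3) b
  let y' := χ' b
  have hb' : b ∈ χ'.source := mem_extChartAt_source b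
  let T : E3 → E3 := χ ∘ χ'.symm
  let T' : E3 → E3 := χ' ∘ χ.symm
  have hTy : T y' = y := by
    change χ (χ'.symm (χ' b)) = y
    rw [χ'.left_inv hb', hby]
  have hT : ContDiffAt ℝ ∞ T y' :=
    contDiffAt_comp_chart_symm hb' (contMDiffAt_extChartAt_of_mem hb)
  have hT' : ContDiffAt ℝ ∞ T' y := by
    have := contDiffAt_comp_chart_symm (I := 𝓡 3) (E' := E3) hb (contMDiffAt_extChartAt_of_mem hb')
    rwa [← hχ, hby] at this
  have hTT : (T ∘ T') =ᶠ[nhds y] id := by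
    have h1 : ∀ᶠ z in nhds (χ b), χ.symm z ∈ χ'.source :=
      eventually_symm_extChartAt hb (eventually_mem_extChartAt_source hb')
    rw [hby] at h1
    filter_upwards [h1, (isOpen_extChartAt_target b₀).mem_nhds hy] with z hz1 hz2
    change χ (χ'.symm (χ' (χ.symm z))) = z
    rw [χ'.left_inv hz1, χ.right_inv hz2]
  have hT'y : T' y = y' := rfl
  have hA : ∀ v, fderiv ℝ T y' (fderiv ℝ T' y v) = v := by
    intro v
    have h1 := hTT.fderiv_eq (𝕜 := ℝ)
    rw [fderiv_comp y (by rw [hT'y]; exact hT.differentiableAt (by simp))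
      (hT'.differentiableAt (by simp)), fderiv_id] at h1
    exact DFunLike.congr_fun h1 v
  let U : E3 → Lam2 := u ∘ χ.symm
  have hU : ContDiffAt ℝ ∞ U (T y') := by
    have := contDiffAt_comp_chart_symm hb (hu.smooth.contMDiffAt (x := b))
    rw [hTy, ← hby]
    exact this
  have hUT : (u ∘ χ'.symm) =ᶠ[nhds y'] U ∘ T := by
    have h1 : ∀ᶠ z in nhds (χ' b), χ'.symm z ∈ χ.source :=
      eventually_symm_extChartAt hb' (eventually_mem_extChartAt_source hb)
    filter_upwards [h1] with z hz
    change u (χ'.symm z) = u (χ.symm (χ (χ'.symm z)))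
    rw [χ.left_inv hz]
  have hdu : ∀ v : E3, du u b v = fderiv ℝ U y (fderiv ℝ T y' v) := by
    intro v
    refine (du_eq_fderiv_chart hu.smooth b v).trans ?_
    change fderiv ℝ (u ∘ χ'.symm) y' v = _
    rw [hUT.fderiv_eq, fderiv_comp y' (hU.differentiableAt (by simp))
      (hT.differentiableAt (by simp)), hTy]
    rfl
  have hhess : ∀ v w : E3, hess u b v w =
      fderiv ℝ (fderiv ℝ U) y (fderiv ℝ T y' v) (fderiv ℝ T y' w)
        + fderiv ℝ U y (fderiv ℝ (fderiv ℝ T) y' v w) := by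
    intro v w
    change fderiv ℝ (fderiv ℝ (u ∘ χ'.symm)) y' v w = _
    rw [hUT.fderiv.fderiv_eq, fderiv_fderiv_comp hT hU, hTy]
  have key := hu.maximal b (fun i => fderiv ℝ T' y (e i)) (fun i j => by
    change pair (du u b (fderiv ℝ T' y (e i))) (du u b (fderiv ℝ T' y (e j))) = _
    rw [hdu, hdu, hA, hA]
    exact he i j) n hn (fun v => by
      have := hdu v
      rw [this]
      exact hn' _)
  rw [← key]
  refine Finset.sum_congr rfl fun i _ => ?_
  refine Eq.symm ((congrArg (fun t => pair t n) (hhess _ _)).trans ?_)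
  rw [pair_add_left, hA, hn', add_zero]

theorem exists_spaceFrame (hu : IsMaximalInQuadric u) (b₀ : B) :
    ∃ s ⊆ (extChartAt (𝓡 3) b₀).target, extChartAt (𝓡 3) b₀ b₀ ∈ s ∧ ∃ f θ e Zi,
      SpaceFrame s (u ∘ (extChartAt (𝓡 3) b₀).symm) f θ e Zi := by
  refine G2ERP.exists_spaceFrame (isOpen_extChartAt_target b₀) ?_ (fun y _ => hu.quadric _)
    (fun y hy v hv => hu.indMetric_pos b₀ hy hv)
    (fun y hy e he n hn hn' => hu.maximal_chart b₀ hy he hn hn') (mem_extChartAt_target b₀)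
  intro y hy
  have := contDiffAt_comp_chart_symm ((extChartAt (𝓡 3) b₀).map_target hy)
    (hu.smooth.contMDiffAt (x := (extChartAt (𝓡 3) b₀).symm y))
  rw [(extChartAt (𝓡 3) b₀).right_inv hy] at this
  exact this.contDiffWithinAt

end IsMaximalInQuadric

end

end
end G2ERP

namespace G2ERP
noncomputable section

/-! ### The dual `4`-form and the Hodge star in an adapted frame -/

theorem det_fin_four (A : Matrix (Fin 4) (Fin 4) ℝ) : A.det =
    A 0 0 * (A 1 1 * A 2 2 * A 3 3 - A 1 1 * A 2 3 * A 3 2 - A 1 2 * A 2 1 * A 3 3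
      + A 1 2 * A 2 3 * A 3 1 + A 1 3 * A 2 1 * A 3 2 - A 1 3 * A 2 2 * A 3 1)
    - A 0 1 * (A 1 0 * A 2 2 * A 3 3 - A 1 0 * A 2 3 * A 3 2 - A 1 2 * A 2 0 * A 3 3
      + A 1 2 * A 2 3 * A 3 0 + A 1 3 * A 2 0 * A 3 2 - A 1 3 * A 2 2 * A 3 0)
    + A 0 2 * (A 1 0 * A 2 1 * A 3 3 - A 1 0 * A 2 3 * A 3 1 - A 1 1 * A 2 0 * A 3 3
      + A 1 1 * A 2 3 * A 3 0 + A 1 3 * A 2 0 * A 3 1 - A 1 3 * A 2 1 * A 3 0)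
    - A 0 3 * (A 1 0 * A 2 1 * A 3 2 - A 1 0 * A 2 2 * A 3 1 - A 1 1 * A 2 0 * A 3 2
      + A 1 1 * A 2 2 * A 3 0 + A 1 2 * A 2 0 * A 3 1 - A 1 2 * A 2 1 * A 3 0) := by
  rw [Matrix.det_succ_row_zero]
  simp only [Fin.sum_univ_four, Matrix.det_fin_three, Matrix.submatrix_apply, Fin.val_zero,
    Fin.val_one, Fin.val_two, show ((3 : Fin 4) : ℕ) = 3 from rfl]
  have s00 : (0 : Fin 4).succAbove 0 = 1 := rfl
  have s01 : (0 : Fin 4).succAbove 1 = 2 := rfl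
  have s02 : (0 : Fin 4).succAbove 2 = 3 := rfl
  have s10 : (1 : Fin 4).succAbove 0 = 0 := rfl
  have s11 : (1 : Fin 4).succAbove 1 = 2 := rfl
  have s12 : (1 : Fin 4).succAbove 2 = 3 := rfl
  have s20 : (2 : Fin 4).succAbove 0 = 0 := rfl
  have s21 : (2 : Fin 4).succAbove 1 = 1 := rfl
  have s22 : (2 : Fin 4).succAbove 2 = 3 := rfl
  have s30 : (3 : Fin 4).succAbove 0 = 0 := rfl
  have s31 : (3 : Fin 4).succAbove 1 = 1 := rfl
  have s32 : (3 : Fin 4).succAbove 2 = 2 := rfl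
  have r0 : Fin.succ (0 : Fin 3) = 1 := rfl
  have r1 : Fin.succ (1 : Fin 3) = 2 := rfl
  have r2 : Fin.succ (2 : Fin 3) = 3 := rfl
  simp only [s00, s01, s02, s10, s11, s12, s20, s21, s22, s30, s31, s32, r0, r1, r2]
  ring

/-- The signed sum over the `(2,2)`-shuffles. -/
def shuffleSum (S : Fin 4 → Fin 4 → Fin 4 → Fin 4 → ℝ) : ℝ :=
  S 0 1 2 3 - S 0 2 1 3 + S 0 3 1 2 + S 1 2 0 3 - S 1 3 0 2 + S 2 3 0 1

/-- The cross product with values in the span of `f`. -/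
def cross (x y : Fin 3 → ℝ) (f : Fin 3 → Lam2) : Lam2 :=
  ∑ a, (x (a + 1) * y (a + 2) - x (a + 2) * y (a + 1)) • f a

/-- The first three coordinates. -/
def base (z : Fin 7 → ℝ) : Fin 3 → ℝ := ![z 0, z 1, z 2]

theorem cross_apply (x y : Fin 3 → ℝ) (f : Fin 3 → Lam2) (v : Fin 2 → Fin 4 → ℝ) :
    cross x y f v = (x 1 * y 2 - x 2 * y 1) * f 0 v + (x 2 * y 0 - x 0 * y 2) * f 1 v
      + (x 0 * y 1 - x 1 * y 0) * f 2 v := by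
  rw [cross, ContinuousAlternatingMap.sum_apply, Fin.sum_univ_three]
  rfl

/-- The dual form is the fibre volume plus the sum of base two-forms, dual to e^a, wedged with
`posBasis a`; `cross` collects the latter. -/
theorem psi0_apply (z : Fin 4 → Fin 7 → ℝ) : psi0 z =
    Matrix.det (Matrix.of fun i j => fib (z i) j) + shuffleSum fun i j l m =>
      cross (base (z i)) (base (z j)) posBasis ![fib (z l), fib (z m)] := by
  have h : ∀ s : Fin 4 → Fin 7, dx s z = Matrix.det (Matrix.of fun a b => z a (s b)) := fun _ => rfl
  simp only [psi0, ContinuousAlternatingMap.add_apply, ContinuousAlternatingMap.sub_apply, h,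
    shuffleSum, cross_apply, det_fin_four, Matrix.of_apply, posBasis_zero, posBasis_one,
    posBasis_two, ContinuousAlternatingMap.neg_apply, dx2_apply, fib, base, Matrix.cons_val_zero,
    Matrix.cons_val_one, Matrix.cons_val]
  generalize z 0 = a
  generalize z 1 = b
  generalize z 2 = c
  generalize z 3 = d
  ring

theorem wedge2_tau0 (z : Fin 4 → Fin 7 → ℝ) :
    wedge2 tau0 tau0 z = -2 * dx ![3, 4, 5, 6] z := by
  have h : dx ![3, 4, 5, 6] z = Matrix.det (Matrix.of fun a b => z a (![3, 4, 5, 6] b)) := rfl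
  have e : ∀ f : Fin 2 → Fin 4, tau0 (fun i => z (f i)) = tau0 ![z (f 0), z (f 1)] := fun f => by
    rw [vec2_eta fun i => z (f i)]
  change 1 / 2 * ∑ x : Fin 4, ∑ y : Fin 3, (-1 : ℝ) ^ ((x : ℕ) + (y : ℕ)) *
    (tau0 ![z x, z (x.succAbove y)] * tau0 fun i => z (x.succAbove (y.succAbove i))) = _
  simp only [e]
  simp only [Fin.sum_univ_four, Fin.sum_univ_three]
  have s00 : (0 : Fin 4).succAbove 0 = 1 := rfl
  have s01 : (0 : Fin 4).succAbove 1 = 2 := rfl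
  have s02 : (0 : Fin 4).succAbove 2 = 3 := rfl
  have s10 : (1 : Fin 4).succAbove 0 = 0 := rfl
  have s11 : (1 : Fin 4).succAbove 1 = 2 := rfl
  have s12 : (1 : Fin 4).succAbove 2 = 3 := rfl
  have s20 : (2 : Fin 4).succAbove 0 = 0 := rfl
  have s21 : (2 : Fin 4).succAbove 1 = 1 := rfl
  have s22 : (2 : Fin 4).succAbove 2 = 3 := rfl
  have s30 : (3 : Fin 4).succAbove 0 = 0 := rfl
  have s31 : (3 : Fin 4).succAbove 1 = 1 := rfl
  have s32 : (3 : Fin 4).succAbove 2 = 2 := rfl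
  have t00 : (0 : Fin 3).succAbove 0 = 1 := rfl
  have t01 : (0 : Fin 3).succAbove 1 = 2 := rfl
  have t10 : (1 : Fin 3).succAbove 0 = 0 := rfl
  have t11 : (1 : Fin 3).succAbove 1 = 2 := rfl
  have t20 : (2 : Fin 3).succAbove 0 = 0 := rfl
  have t21 : (2 : Fin 3).succAbove 1 = 1 := rfl
  simp only [s00, s01, s02, s10, s11, s12, s20, s21, s22, s30, s31, s32, t00, t01, t10, t11, t20,
    t21]
  simp only [tau0, ContinuousAlternatingMap.sub_apply, dx2_apply, h, det_fin_four,
    Matrix.of_apply, Matrix.cons_val_zero,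
    Matrix.cons_val_one, Matrix.cons_val, Fin.val_zero, Fin.val_one, Fin.val_two,
    show ((3 : Fin 4) : ℕ) = 3 from rfl]
  generalize z 0 = a
  generalize z 1 = b
  generalize z 2 = c
  generalize z 3 = d
  ring

theorem det_append_perm {m n : ℕ} (w : Fin m → Fin (m + n) → ℝ) (v : Fin n → Fin (m + n) → ℝ)
    (π : Equiv.Perm (Fin m)) : Matrix.det (Matrix.of (Fin.append (fun a => w (π a)) v)) =
      (Equiv.Perm.sign π : ℤ) * Matrix.det (Matrix.of (Fin.append w v)) := by
  let ρ : Equiv.Perm (Fin (m + n)) := finSumFinEquiv.permCongr (π.sumCongr 1)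
  have h1 : Matrix.of (Fin.append (fun a => w (π a)) v) =
      (Matrix.of (Fin.append w v)).submatrix ρ id := by
    ext i j
    refine Fin.addCases (fun a => ?_) (fun a => ?_) i <;> simp [ρ, Equiv.permCongr_apply]
  rw [h1, Matrix.det_permute]
  congr 2
  simp [ρ]

/-- In the sum over all index tuples only the rearrangements of s contribute. Their signs cancel
against those of the determinant, and the m! equal terms absorb the normalisation. -/
theorem hodgeStar_dx {m n : ℕ} (s : Fin m → Fin (m + n)) (v : Fin n → Fin (m + n) → ℝ) :
    hodgeStar (fun w => dx s w) v =
      Matrix.det (Matrix.of (Fin.append (fun a => stdVec (s a)) v)) := by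
  have h : ∀ t : Fin m → Fin (m + n), dx s (fun a => stdVec (t a)) =
      ∑ π : Equiv.Perm (Fin m), ((Equiv.Perm.sign π : ℤ) : ℝ) *
        if t = fun a => s (π a) then 1 else 0 := by
    intro t
    change Matrix.det (Matrix.of fun a b => (stdVec (t a) : Fin (m + n) → ℝ) (s b)) = _
    rw [← Matrix.det_transpose, Matrix.det_apply']
    refine Finset.sum_congr rfl fun π _ => ?_
    congr 1
    simp only [Matrix.transpose_apply, Matrix.of_apply, stdVec, Pi.single_apply]
    rw [Finset.prod_ite_zero]
    simp [funext_iff, eq_comm]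
  have hd : ∀ π : Equiv.Perm (Fin m), ((Equiv.Perm.sign π : ℤ) : ℝ) *
      Matrix.det (Matrix.of (Fin.append (fun a => stdVec (s (π a))) v)) =
      Matrix.det (Matrix.of (Fin.append (fun a => stdVec (s a)) v)) := by
    intro π
    rw [det_append_perm (fun a => stdVec (s a)) v π, ← mul_assoc]
    have : ((Equiv.Perm.sign π : ℤ) : ℝ) * ((Equiv.Perm.sign π : ℤ) : ℝ) = 1 := by
      rcases Int.units_eq_one_or (Equiv.Perm.sign π) with h | h <;> rw [h] <;> simp
    rw [this, one_mul]
  rw [hodgeStar]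
  simp only [h, Finset.sum_mul]
  rw [Finset.sum_comm]
  simp only [mul_assoc, ite_mul, one_mul, zero_mul, mul_ite, mul_zero, Finset.sum_ite_eq',
    Finset.mem_univ, if_true, hd]
  simp only [Finset.sum_const, Finset.card_univ, Fintype.card_perm, Fintype.card_fin, nsmul_eq_mul]
  field_simp

theorem det_of_row_zero {n : ℕ} {A : Matrix (Fin (n + 1)) (Fin (n + 1)) ℝ} {j : Fin (n + 1)}
    (h : ∀ i, A 0 i = if i = j then 1 else 0) :
    A.det = (-1) ^ (j : ℕ) * (A.submatrix Fin.succ j.succAbove).det := by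
  rw [Matrix.det_succ_row_zero]
  simp [h]

/-- Expansion along the four unit rows: each gives the sign (-1)³, so the product of the signs is
+1. -/
theorem hodgeStar_dx_fib (v : Fin 3 → Fin 7 → ℝ) :
    hodgeStar (m := 4) (n := 3) (fun w => dx ![3, 4, 5, 6] w) v =
      Matrix.det (Matrix.of fun i (a : Fin 3) => v i (Fin.castLE (by norm_num) a)) := by
  rw [hodgeStar_dx]
  have e : Matrix.of (Fin.append (fun a : Fin 4 => (stdVec (![3, 4, 5, 6] a) : Fin 7 → ℝ)) v) =
      Matrix.of ![stdVec 3, stdVec 4, stdVec 5, stdVec 6, v 0, v 1, v 2] := by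
    ext i j
    fin_cases i <;> rfl
  rw [e]
  rw [det_of_row_zero (j := 3) (fun i => Pi.single_apply _ _ _),
    det_of_row_zero (j := 3) (fun i => (Pi.single_apply _ _ _).trans
      (if_congr ((by decide : ∀ i : Fin 6, (3 : Fin 7).succAbove i = 4 ↔ i = 3) i) rfl rfl)),
    det_of_row_zero (j := 3) (fun i => (Pi.single_apply _ _ _).trans
      (if_congr ((by decide : ∀ i : Fin 5, (3 : Fin 7).succAbove ((3 : Fin 6).succAbove i) = 5
        ↔ i = 3) i) rfl rfl)),
    det_of_row_zero (j := 3) (fun i => (Pi.single_apply _ _ _).trans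
      (if_congr ((by decide : ∀ i : Fin 4, (3 : Fin 7).succAbove ((3 : Fin 6).succAbove
        ((3 : Fin 5).succAbove i)) = 6 ↔ i = 3) i) rfl rfl))]
  have h : ∀ i a : Fin 3, (((((Matrix.of ![stdVec 3, stdVec 4, stdVec 5, stdVec 6, v 0, v 1,
      v 2] : Matrix (Fin 7) (Fin 7) ℝ).submatrix Fin.succ (Fin.succAbove 3)).submatrix Fin.succ
      (Fin.succAbove 3)).submatrix Fin.succ (Fin.succAbove 3)).submatrix Fin.succ
      (Fin.succAbove 3)) i a = v i (Fin.castLE (by norm_num) a) := by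
    intro i a
    fin_cases i <;> fin_cases a <;> rfl
  rw [show ((3 : Fin 7) : ℕ) = 3 from rfl, show ((3 : Fin 6) : ℕ) = 3 from rfl,
    show ((3 : Fin 5) : ℕ) = 3 from rfl, show ((3 : Fin 4) : ℕ) = 3 from rfl]
  rw [show Matrix.submatrix _ _ _ = _ from Matrix.ext h]
  norm_num
  rfl

theorem normSq2_tau0 (c : ℝ) : normSq2 (fun w : Fin 2 → Fin 7 → ℝ => c * tau0 w) = 2 * c ^ 2 := by
  simp only [normSq2, tau0, ContinuousAlternatingMap.sub_apply, dx2_apply, Fin.sum_univ_succ]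
  simp [stdVec, Pi.single_apply]
  ring

end
end G2ERP

namespace G2ERP
noncomputable section

set_option linter.unusedSectionVars false

/-! ### Adapted coframes of `B × ℝ⁴` at a point -/

theorem wedge2_comp {V W : Type*} {n : ℕ} (α : (Fin 2 → W) → ℝ) (β : (Fin n → W) → ℝ) (L : V → W)
    (α' : (Fin 2 → V) → ℝ) (β' : (Fin n → V) → ℝ) (hα : ∀ v w, α' ![v, w] = α ![L v, L w])
    (hβ : ∀ v, β' v = β fun i => L (v i)) (v : Fin (n + 2) → V) :
    wedge2 α' β' v = wedge2 α β fun i => L (v i) := by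
  simp only [wedge2, hα, hβ]

theorem normSq2_symm {k : ℝ} {V : Type*} [NormedAddCommGroup V] [NormedSpace ℝ V]
    {T : V [⋀^Fin 2]→L[ℝ] ℝ} {L : V ≃L[ℝ] (Fin 7 → ℝ)}
    (hT : T = (6 * k) • tau0.compContinuousLinearMap (L : V →L[ℝ] (Fin 7 → ℝ))) :
    normSq2 (fun w => T fun i => L.symm (w i)) = 72 * k ^ 2 := by
  have h : (fun w : Fin 2 → Fin 7 → ℝ => T fun i => L.symm (w i)) = fun w => 6 * k * tau0 w := by
    funext w
    rw [hT]
    change 6 * k * tau0 (fun i => L (L.symm (w i))) = _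
    simp
  rw [h, normSq2_tau0]
  ring

theorem hodgeStar_wedge2_symm {k : ℝ} {V : Type*} [NormedAddCommGroup V] [NormedSpace ℝ V]
    {T : V [⋀^Fin 2]→L[ℝ] ℝ} {L : V ≃L[ℝ] (Fin 7 → ℝ)}
    (hT : T = (6 * k) • tau0.compContinuousLinearMap (L : V →L[ℝ] (Fin 7 → ℝ)))
    (z : Fin 3 → Fin 7 → ℝ) :
    hodgeStar (m := 4) (n := 3) (fun w => wedge2 T T fun i => L.symm (w i)) z =
      (-72 * k ^ 2) * Matrix.det (Matrix.of fun i (a : Fin 3) =>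
        z i (Fin.castLE (by norm_num) a)) := by
  have hw : (fun w : Fin 4 → Fin 7 → ℝ => wedge2 T T fun i => L.symm (w i)) =
      fun w => (-72 * k ^ 2) * dx ![3, 4, 5, 6] w := by
    funext w
    have h1 : wedge2 (fun w : Fin 2 → Fin 7 → ℝ => 6 * k * tau0 w) (fun w => 6 * k * tau0 w) w =
        36 * k ^ 2 * wedge2 tau0 tau0 w := by
      simp only [wedge2, Finset.mul_sum]
      refine Finset.sum_congr rfl fun p _ => Finset.sum_congr rfl fun q _ => ?_
      ring
    have h2 : ∀ w : Fin 2 → Fin 7 → ℝ, 6 * k * tau0 w = T fun i => L.symm (w i) := by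
      intro w
      rw [hT]
      change _ = 6 * k * tau0 (fun i => L (L.symm (w i)))
      simp
    refine ((wedge2_comp _ _ L.symm (fun w => 6 * k * tau0 w)
      (fun w => 6 * k * tau0 w) (fun x y => ?_) h2 w).symm.trans h1).trans ?_
    · refine (h2 _).trans (congrArg T ?_)
      exact vec2_eta _
    · rw [wedge2_tau0]
      ring
  rw [hw, ← hodgeStar_dx_fib, hodgeStar, hodgeStar]
  simp only [Finset.mul_sum]
  refine Finset.sum_congr rfl fun p _ => ?_
  ring

/-- The coframe map of the model. -/
def coframe (k : ℝ) (lam : Fin 3 → E3 →L[ℝ] ℝ) (Z : (Fin 4 → ℝ) →L[ℝ] (Fin 4 → ℝ)) :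
    E34 →L[ℝ] (Fin 7 → ℝ) :=
  ContinuousLinearMap.pi fun i => prodOm k (fun a _ => lam a) (fun _ => Z) i 0

theorem coframe_base (k : ℝ) (lam : Fin 3 → E3 →L[ℝ] ℝ) (Z : (Fin 4 → ℝ) →L[ℝ] (Fin 4 → ℝ))
    (a : Fin 3) (v : E34) :
    coframe k lam Z v (Fin.castLE (by norm_num) a) = (2 * k)⁻¹ * lam a v.1 :=
  prodOm_base_apply k (fun a _ => lam a) (fun _ => Z) a 0 v

theorem base_coframe (k : ℝ) (lam : Fin 3 → E3 →L[ℝ] ℝ) (Z : (Fin 4 → ℝ) →L[ℝ] (Fin 4 → ℝ))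
    (v : E34) : base (coframe k lam Z v) = fun a => (2 * k)⁻¹ * lam a v.1 := by
  funext a
  have := coframe_base k lam Z a v
  fin_cases a <;> exact this

theorem fib_coframe (k : ℝ) (lam : Fin 3 → E3 →L[ℝ] ℝ) (Z : (Fin 4 → ℝ) →L[ℝ] (Fin 4 → ℝ))
    (v : E34) : fib (coframe k lam Z v) = √(2 * k) • Z v.2 :=
  fib_prodOm k (fun a _ => lam a) (fun _ => Z) 0 v

section

variable {B : Type*} [TopologicalSpace B] [ChartedSpace (EuclideanSpace ℝ (Fin 3)) B]

/-- An oriented orthonormal coframe `lam` at `b`, and a coframe `Z` of `ℝ⁴`, adapted to `u`. -/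
structure FrameAt (u : B → Lam2) (b : B) (lam : Fin 3 → E3 →L[ℝ] ℝ) (e : Fin 3 → E3)
    (f : Fin 3 → Lam2) (Z : (Fin 4 → ℝ) →L[ℝ] (Fin 4 → ℝ)) : Prop where
  du_eq : ∀ v : E3, du u b v = ∑ a, lam a v • f a
  lam_e : ∀ a c, lam a (e c) = if a = c then 1 else 0
  span : ∀ v, v = ∑ a, lam a v • e a
  unit : IsUnit Z
  det_Z : Matrix.det (Matrix.of fun i j => Z (stdVec i) j) = 1
  u_eq : u b = negU.compContinuousLinearMap Z
  f_eq : ∀ a, f a = (posBasis a).compContinuousLinearMap Z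
  norm : IsOrtho f
  oriented : 0 < orient f

namespace FrameAt

variable {u : B → Lam2} {b : B} {lam : Fin 3 → E3 →L[ℝ] ℝ} {e : Fin 3 → E3}
    {f : Fin 3 → Lam2} {Z : (Fin 4 → ℝ) →L[ℝ] (Fin 4 → ℝ)} {k c : ℝ} {t : Fin 4 → ℝ}

theorem du_e (h : FrameAt u b lam e f Z) (a : Fin 3) : du u b (e a) = f a := by
  refine (h.du_eq (e a)).trans ?_
  simp [h.lam_e]

/-- Paired with du(x), either side gives the frame-independent vol(x, v, w). Both lie in the tangent
space, where the pairing is nondegenerate. -/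
theorem cross_eq {lam' : Fin 3 → E3 →L[ℝ] ℝ} {e' : Fin 3 → E3}
    {f' : Fin 3 → Lam2} {Z' : (Fin 4 → ℝ) →L[ℝ] (Fin 4 → ℝ)} (h : FrameAt u b lam e f Z)
    (h' : FrameAt u b lam' e' f' Z') (v w : E3) :
    cross (fun a => lam a v) (fun a => lam a w) f =
      cross (fun a => lam' a v) (fun a => lam' a w) f' := by
  have hv : ∀ {lam : Fin 3 → E3 →L[ℝ] ℝ} {e : Fin 3 → E3}
      {f : Fin 3 → Lam2} {Z : (Fin 4 → ℝ) →L[ℝ] (Fin 4 → ℝ)}, FrameAt u b lam e f Z → ∀ x : E3,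
      pair (cross (fun a => lam a v) (fun a => lam a w) f) (du u b x) = volForm u b ![x, v, w] := by
    intro lam e f Z h x
    refine Eq.trans ?_ (volForm_apply h.norm h.oriented h.du_eq ![x, v, w]).symm
    have hd := h.du_eq x
    refine (congrArg (pair _) hd).trans ?_
    have hn : ∀ a c, pair (f a) (f c) = if a = c then 1 else 0 := h.norm
    rw [Matrix.det_fin_three, cross]
    simp only [Fin.sum_univ_three, pair_add_left, pair_add_right, pair_smul_left, pair_smul_right,
      hn]
    simp
    ring
  have hf' : ∀ a, f' a = ∑ c, lam c (e' a) • f c := fun a => (h'.du_e a).symm.trans (h.du_eq _)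
  let D := cross (fun a => lam a v) (fun a => lam a w) f -
      cross (fun a => lam' a v) (fun a => lam' a w) f'
  have hD : ∀ a, pair D (f a) = 0 := by
    intro a
    have h1 := hv h (e a)
    have h2 := hv h' (e a)
    have h3 := h.du_e a
    rw [pair_sub_left, ← h3]
    exact sub_eq_zero.2 (h1.trans h2.symm)
  have hs : ∃ d : Fin 3 → ℝ, D = ∑ a, d a • f a := by
    refine ⟨fun c => (lam (c + 1) v * lam (c + 2) w - lam (c + 2) v * lam (c + 1) w) - ∑ a,
      (lam' (a + 1) v * lam' (a + 2) w - lam' (a + 2) v * lam' (a + 1) w) * lam c (e' a), ?_⟩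
    change cross _ _ f - cross _ _ f' = _
    simp only [cross, hf', Fin.sum_univ_three]
    module
  obtain ⟨d, hd⟩ := hs
  have hd0 : ∀ a, d a = 0 := by
    intro a
    have h1 := hD a
    have hn := h.norm
    rw [hd, ← pairL_apply] at h1
    simpa [pairL_apply, hn _ _] using h1
  have : D = 0 := by rw [hd]; simp [hd0]
  exact sub_eq_zero.1 this

theorem injective_coframe (h : FrameAt u b lam e f Z) (hk : 0 < k) :
    Function.Injective (coframe k lam Z) := by
  rw [injective_iff_map_eq_zero]
  intro v hv
  have h1 : ∀ a, lam a v.1 = 0 := by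
    intro a
    have := coframe_base k lam Z a v
    rw [hv] at this
    have h2 : (2 * k)⁻¹ ≠ 0 := by positivity
    simpa [hk.ne'] using this.symm
  have h2 : Z v.2 = 0 := by
    have h3 := fib_coframe k lam Z v
    rw [hv] at h3
    have h4 : fib (0 : Fin 7 → ℝ) = 0 := by
      funext i
      fin_cases i <;> rfl
    rw [h4] at h3
    have h5 : √(2 * k) ≠ 0 := by positivity
    exact (smul_eq_zero.1 h3.symm).resolve_left h5
  refine Prod.ext ?_ ?_
  · rw [h.span v.1]
    simp [h1]
  · exact (ContinuousLinearMap.isUnit_iff_bijective.1 h.unit).1 (h2.trans (map_zero Z).symm)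

theorem exists_equiv (h : FrameAt u b lam e f Z) (hk : 0 < k) :
    ∃ L : E34 ≃L[ℝ] (Fin 7 → ℝ), (L : E34 →L[ℝ] (Fin 7 → ℝ)) = coframe k lam Z := by
  have hr : Module.finrank ℝ E34 = Module.finrank ℝ (Fin 7 → ℝ) := by simp
  refine ⟨(LinearEquiv.ofInjectiveOfFinrankEq (coframe k lam Z : E34 →ₗ[ℝ] (Fin 7 → ℝ))
    (h.injective_coframe hk) hr).toContinuousLinearEquiv, ?_⟩
  exact ContinuousLinearMap.ext fun v => rfl

/-- The linear isomorphism of an adapted coframe. -/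
def toEquiv (h : FrameAt u b lam e f Z) (hk : 0 < k) (t : Fin 4 → ℝ) :
    TangentSpace modelBR4 ((b, t) : B × (Fin 4 → ℝ)) ≃L[ℝ] (Fin 7 → ℝ) :=
  (h.exists_equiv hk).choose

theorem toEquiv_coe (h : FrameAt u b lam e f Z) (hk : 0 < k) (t : Fin 4 → ℝ) :
    (h.toEquiv hk t : TangentSpace modelBR4 ((b, t) : B × (Fin 4 → ℝ)) →L[ℝ] (Fin 7 → ℝ)) =
      coframe k lam Z :=
  (h.exists_equiv hk).choose_spec

theorem toEquiv_apply (h : FrameAt u b lam e f Z) (hk : 0 < k) (t : Fin 4 → ℝ) (v : E34) :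
    h.toEquiv hk t v = coframe k lam Z v :=
  DFunLike.congr_fun (h.toEquiv_coe hk t) v

theorem comp_scaled (hk : 0 < k) (α : Lam2) (v w : E34) :
    α ![fib (coframe k lam Z v), fib (coframe k lam Z w)] =
      2 * k * α.compContinuousLinearMap Z ![v.2, w.2] := by
  rw [fib_coframe, fib_coframe, alt_pair_smul_left, alt_pair_smul_right, comp_pair]
  have : √(2 * k) * √(2 * k) = 2 * k := Real.mul_self_sqrt (by positivity)
  simp only [smul_eq_mul]
  rw [← mul_assoc, this]

variable [IsManifold (𝓡 3) ∞ B]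

theorem baraglia_eq (h : FrameAt u b lam e f Z) (hk : 0 < k) (hkc : 8 * k ^ 3 * c = 1)
    (hu : ContMDiff (𝓡 3) 𝓘(ℝ, Lam2) ∞ u) (v : Fin 3 → E34) :
    baragliaForm c u (b, t) v = phi0 fun i => coframe k lam Z (v i) :=
  baragliaForm_eq_phi0 (k := k) hkc hu (p := (b, t)) h.norm h.oriented h.du_eq
    (fun i a => by
      rw [coframe_base]
      field_simp)
    (fun a i j => by
      refine Eq.trans ?_ (comp_scaled hk (posBasis a) (v i) (v j)).symm
      rw [h.f_eq a])

theorem taut_eq (h : FrameAt u b lam e f Z) (hk : 0 < k) (v w : E34) :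
    12 * k ^ 2 * tautForm u (b, t) ![v, w] = 6 * k * tau0 ![coframe k lam Z v, coframe k lam Z w] :=
  tautForm_eq_tau0 (p := (b, t)) (by
    refine Eq.trans ?_ (comp_scaled hk negU v w).symm
    change 2 * k * u b ![v.2, w.2] = _
    rw [h.u_eq])

theorem isG2Coframe (h : FrameAt u b lam e f Z) (hk : 0 < k) (hkc : 8 * k ^ 3 * c = 1)
    (hu : ContMDiff (𝓡 3) 𝓘(ℝ, Lam2) ∞ u) (t : Fin 4 → ℝ) :
    IsG2Coframe modelBR4 (baragliaForm c u) (b, t) (h.toEquiv hk t) := by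
  rw [IsG2Coframe, h.toEquiv_coe hk t]
  ext v
  exact h.baraglia_eq hk hkc hu v

theorem isAdapted (h : FrameAt u b lam e f Z) (hk : 0 < k) (hkc : 8 * k ^ 3 * c = 1)
    (hu : ContMDiff (𝓡 3) 𝓘(ℝ, Lam2) ∞ u) (t : Fin 4 → ℝ) :
    IsAdaptedCoframe modelBR4 k (baragliaForm c u) (fun x => (12 * k ^ 2) • tautForm u x) (b, t)
      (h.toEquiv hk t) := by
  refine ⟨h.isG2Coframe hk hkc hu t, ?_⟩
  rw [h.toEquiv_coe hk t]
  ext v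
  rw [vec2_eta v]
  refine (h.taut_eq (t := t) hk (v 0) (v 1)).trans ?_
  exact congrArg (6 * k * ·) (comp_pair tau0 (coframe k lam Z) (v 0) (v 1)).symm

/-- The dual `4`-form in an adapted coframe. -/
theorem psi0_coframe (h : FrameAt u b lam e f Z) (hk : 0 < k) (v : Fin 4 → E34) :
    psi0 (fun i => coframe k lam Z (v i)) =
      4 * k ^ 2 * Matrix.det (Matrix.of fun i j => (v i).2 j) + (2 * k)⁻¹ * shuffleSum
        fun i j l m => cross (fun a => lam a (v i).1) (fun a => lam a (v j).1) f
          ![(v l).2, (v m).2] := by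
  rw [psi0_apply]
  have h1 : Matrix.det (Matrix.of fun i j => fib (coframe k lam Z (v i)) j) =
      4 * k ^ 2 * Matrix.det (Matrix.of fun i j => (v i).2 j) := by
    have h2 : (Matrix.of fun i j => fib (coframe k lam Z (v i)) j) =
        √(2 * k) • ((Matrix.of fun i j => (v i).2 j) * Matrix.of fun i j => Z (stdVec i) j) := by
      ext i j
      simp only [Matrix.of_apply, fib_coframe, Matrix.smul_apply, Matrix.mul_apply, Pi.smul_apply]
      congr 1
      conv_lhs => rw [pi_eq_sum_univ' (v i).2]
      simp
    have h3 : √(2 * k) ^ 4 = 4 * k ^ 2 := by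
      rw [show √(2 * k) ^ 4 = (√(2 * k) ^ 2) ^ 2 by ring, Real.sq_sqrt (by positivity)]
      ring
    rw [h2, Matrix.det_smul, Matrix.det_mul, h.det_Z, mul_one, Fintype.card_fin, h3]
  have h4 : ∀ i j l m, cross (base (coframe k lam Z (v i))) (base (coframe k lam Z (v j))) posBasis
      ![fib (coframe k lam Z (v l)), fib (coframe k lam Z (v m))] =
      (2 * k)⁻¹ * cross (fun a => lam a (v i).1) (fun a => lam a (v j).1) f
          ![(v l).2, (v m).2] := by
    intro i j l m
    rw [cross_apply, cross_apply, comp_scaled hk, comp_scaled hk, comp_scaled hk, ← h.f_eq,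
      ← h.f_eq, ← h.f_eq, base_coframe, base_coframe]
    field_simp
  rw [h1]
  simp only [h4, shuffleSum]
  ring

/-- By `psi0_coframe` the dual form involves the frame only through `cross`, and that is independent
of the frame. -/
theorem psi0_coframe_eq {lam' : Fin 3 → E3 →L[ℝ] ℝ} {e' : Fin 3 → E3}
    {f' : Fin 3 → Lam2} {Z' : (Fin 4 → ℝ) →L[ℝ] (Fin 4 → ℝ)} (h : FrameAt u b lam e f Z)
    (h' : FrameAt u b lam' e' f' Z') (hk : 0 < k) :
    psi0.compContinuousLinearMap (coframe k lam Z) =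
      psi0.compContinuousLinearMap (coframe k lam' Z') := by
  ext v
  refine (h.psi0_coframe hk v).trans (Eq.trans ?_ (h'.psi0_coframe hk v).symm)
  simp only [h.cross_eq h']

theorem smul_tautForm_d (hu : ContMDiff (𝓡 3) 𝓘(ℝ, Lam2) ∞ u) (r : ℝ) (p : B × (Fin 4 → ℝ)) :
    MForm.d modelBR4 (fun x => r • tautForm u x) p = r • (tautForm u).d modelBR4 p := by
  have h1 := d_eq_of_pullback (I := modelBR4) (α := fun x => r • tautForm u x)
    (β := r • betaTaut) (x := p) (contMDiff_tautMap hu).contMDiffAt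
    ((contDiff_betaTaut.contDiffAt.differentiableAt (by simp)).const_smul r)
    (Filter.Eventually.of_forall fun y => by rw [tautForm_eq_pullback hu y]; rfl)
  rw [h1, tautForm_d_eq hu, extDeriv_smul]
  rfl

/-- With |τ|² = 72k² the multiples of φ add up to 72k²/7 · 7/6 = 12k², and the Hodge term gives
-12k² times the base volume ω¹²³. As φ = ω¹²³ + du, the sum is 12k² du = dτ. -/
theorem quadratic (h : FrameAt u b lam e f Z) (hk : 0 < k) (hkc : 8 * k ^ 3 * c = 1)
    (hu : ContMDiff (𝓡 3) 𝓘(ℝ, Lam2) ∞ u) (t : Fin 4 → ℝ)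
    (v : Fin 3 → TangentSpace modelBR4 ((b, t) : B × (Fin 4 → ℝ))) :
    MForm.d modelBR4 (fun x => (12 * k ^ 2) • tautForm u x) (b, t) v =
      (1 / 7) * (72 * k ^ 2) * baragliaForm c u (b, t) v
      + (1 / 6) * ((1 / 7) * (72 * k ^ 2) * baragliaForm c u (b, t) v
        + (-72 * k ^ 2) * Matrix.det (Matrix.of fun i (a : Fin 3) =>
        coframe k lam Z (v i) (Fin.castLE (by norm_num) a))) := by
  have hφ := baragliaForm_apply c hu (b, t) v
  have hd := tautForm_d_apply hu (b, t) v
  have hv : volForm u b (fun i => (v i).1) = _ :=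
    volForm_apply h.norm h.oriented h.du_eq fun i => (v i).1
  have e : (Matrix.of fun (i a : Fin 3) => lam a (v i).1) =
      (2 * k) • Matrix.of fun i (a : Fin 3) =>
        coframe k lam Z (v i) (Fin.castLE (by norm_num) a) := by
    ext i a
    exact (mul_inv_cancel_left₀ (by positivity) _).symm.trans
      (congrArg (2 * k * ·) (coframe_base k lam Z a (v i)).symm)
  rw [e, Matrix.det_smul, Fintype.card_fin] at hv
  have h1 : MForm.d modelBR4 (fun x => (12 * k ^ 2) • tautForm u x) (b, t) v = _ :=
    DFunLike.congr_fun (smul_tautForm_d hu (12 * k ^ 2) (b, t)) v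
  refine h1.trans ?_
  change 12 * k ^ 2 * (tautForm u).d modelBR4 (b, t) v = _
  refine (congrArg (12 * k ^ 2 * ·) hd).trans ?_
  have hφ' : baragliaForm c u (b, t) v = c * volForm u b (fun i => (v i).1) + _ := hφ
  rw [hv] at hφ'
  rw [hφ']
  linear_combination (-12 * k ^ 2 * Matrix.det (Matrix.of fun i (a : Fin 3) =>
        coframe k lam Z (v i) (Fin.castLE (by norm_num) a))) * hkc

end FrameAt

end

end
end G2ERP

namespace G2ERP
noncomputable section

set_option linter.unusedSectionVars false

/-! ### The local section of the `U(2)⁺`-structure -/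

namespace SpaceFrame

variable {s : Set E3} {U : E3 → Lam2} {f : Fin 3 → E3 → Lam2} {θ : Fin 3 → E3 → E3 →L[ℝ] ℝ}
  {e : Fin 3 → E3 → E3} {Zi : E3 → (Fin 4 → ℝ) →L[ℝ] (Fin 4 → ℝ)} {y : E3} {k : ℝ} {p : E34}

theorem contDiffAt_zg (hF : SpaceFrame s U f θ e Zi) (hy : y ∈ s) (i j : Fin 4) :
    ContDiffAt ℝ ∞ (fun y => zg Zi y i j) y := by
  have hZ := hF.at_smooth hF.Zi_smooth hy
  have hI : ContDiffAt ℝ ∞ (fun y => Ring.inverse (Zi y)) y := by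
    obtain ⟨w, hw⟩ := hF.Zi_unit y hy
    have h1 := contDiffAt_ringInverse (n := ∞) ℝ w
    rw [hw] at h1
    exact h1.comp y hZ
  refine contDiffAt_clm_of_apply fun v => ?_
  simp only [zg_apply]
  have h2 : ContDiffAt ℝ ∞ (fun y => fderiv ℝ Zi y v (Ring.inverse (Zi y) (stdVec j))) y :=
    ((hZ.fderiv_right (m := ∞) (by simp)).clm_apply contDiffAt_const).clm_apply
      (hI.clm_apply contDiffAt_const)
  exact (contDiffAt_pi.1 h2 i).neg

theorem contDiffAt_matG (hF : SpaceFrame s U f θ e Zi) (hy : y ∈ s) (a : Fin 3) :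
    ContDiffAt ℝ ∞ (fun y => matG (zg Zi y) a) y := by
  have h := fun i j => hF.contDiffAt_zg hy i j
  fin_cases a
  exacts [((((h 2 3).sub (h 3 2)).sub (h 1 0)).add (h 0 1)).const_smul (1 / 2 : ℝ),
    ((((h 0 2).sub (h 2 0)).add (h 3 1)).sub (h 1 3)).const_smul (1 / 2 : ℝ),
    ((((h 3 0).sub (h 0 3)).add (h 2 1)).sub (h 1 2)).const_smul (1 / 2 : ℝ)]

theorem contDiffAt_matR (hF : SpaceFrame s U f θ e Zi) (hy : y ∈ s) :
    ContDiffAt ℝ ∞ (fun y => matR (zg Zi y)) y := by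
  have h := fun i j => hF.contDiffAt_zg hy i j
  exact ((((h 1 0).sub (h 0 1)).add (h 2 3)).sub (h 3 2)).const_smul (1 / 2 : ℝ)

theorem contDiffAt_matP (hF : SpaceFrame s U f θ e Zi) (hy : y ∈ s) (a : Fin 3) :
    ContDiffAt ℝ ∞ (fun y => matP (zg Zi y) a) y := by
  have h := fun i j => hF.contDiffAt_zg hy i j
  fin_cases a
  exacts [((((h 0 2).add (h 2 0)).add (h 1 3)).add (h 3 1)).const_smul (-1 / 4 : ℝ),
    ((((h 0 1).add (h 1 0)).sub (h 2 3)).sub (h 3 2)).const_smul (1 / 4 : ℝ),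
    ((((h 0 0).sub (h 1 1)).add (h 3 3)).sub (h 2 2)).const_smul (1 / 4 : ℝ)]

theorem contDiffAt_matQ (hF : SpaceFrame s U f θ e Zi) (hy : y ∈ s) (a : Fin 3) :
    ContDiffAt ℝ ∞ (fun y => matQ (zg Zi y) a) y := by
  have h := fun i j => hF.contDiffAt_zg hy i j
  fin_cases a
  exacts [((((h 0 3).add (h 3 0)).sub (h 1 2)).sub (h 2 1)).const_smul (1 / 4 : ℝ),
    ((((h 3 3).sub (h 2 2)).sub (h 0 0)).add (h 1 1)).const_smul (1 / 4 : ℝ),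
    ((((h 0 1).add (h 1 0)).add (h 2 3)).add (h 3 2)).const_smul (1 / 4 : ℝ)]

theorem contDiffAt_sffH (hF : SpaceFrame s U f θ e Zi) (hy : y ∈ s) (a b : Fin 3) :
    ContDiffAt ℝ ∞ (fun y => sffH k e Zi y a b) y := by
  have he := hF.at_smooth (hF.e_smooth b) hy
  have h1 := contDiffAt_const (c := 2 * k).mul ((hF.contDiffAt_matP hy a).clm_apply he)
  have h2 := contDiffAt_const (c := 2 * k).mul ((hF.contDiffAt_matQ hy a).clm_apply he)
  exact (Complex.ofRealCLM.contDiff.contDiffAt.comp y h1).add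
    (contDiffAt_const.mul (Complex.ofRealCLM.contDiff.contDiffAt.comp y h2))

theorem contDiffAt_quarticOf (hF : SpaceFrame s U f θ e Zi) (hy : y ∈ s) (m : ℕ) :
    ContDiffAt ℝ ∞ (fun y => quarticOf (sffH k e Zi y) m) y := by
  have h := fun a b => hF.contDiffAt_sffH (k := k) hy a b
  simp only [quarticOf]
  generalize Fin.ofNat 5 m = i
  have h00 := h 0 0
  have h01 := h 0 1
  have h02 := h 0 2
  have h11 := h 1 1
  have h12 := h 1 2
  have h22 := h 2 2
  fin_cases i <;> simp <;> fun_prop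

theorem contDiffAt_prodOm (hF : SpaceFrame s U f θ e Zi) (hp : p.1 ∈ s) (i : Fin 7) :
    ContDiffAt ℝ ∞ (prodOm k θ Zi i) p := by
  have hb : ∀ a : Fin 3, ContDiffAt ℝ ∞ (prodOm k θ Zi (Fin.castLE (by norm_num) a)) p := by
    intro a
    refine contDiffAt_clm_of_apply fun v => ?_
    simp only [prodOm_base_apply]
    have h1 : ContDiffAt ℝ ∞ (fun p : E34 => θ a p.1) p :=
      (hF.at_smooth (hF.θ_smooth a) hp).comp p contDiffAt_fst
    exact contDiffAt_const.mul (h1.clm_apply contDiffAt_const)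
  have hf : ∀ j : Fin 4, ContDiffAt ℝ ∞ (prodOm k θ Zi (fibIdx j)) p := by
    intro j
    refine contDiffAt_clm_of_apply fun v => ?_
    simp only [prodOm_fib_apply]
    have h1 : ContDiffAt ℝ ∞ (fun p : E34 => Zi p.1) p :=
      (hF.at_smooth hF.Zi_smooth hp).comp p contDiffAt_fst
    have h2 : ContDiffAt ℝ ∞ (fun p : E34 => Zi p.1 v.2) p := h1.clm_apply contDiffAt_const
    exact contDiffAt_const.mul (contDiffAt_pi.1 h2 j)
  fin_cases i
  exacts [hb 0, hb 1, hb 2, hf 0, hf 1, hf 2, hf 3]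

theorem contDiffAt_prodG (hF : SpaceFrame s U f θ e Zi) (hp : p.1 ∈ s) (a : Fin 3) :
    ContDiffAt ℝ ∞ (prodG Zi a) p :=
  ContDiffAt.clm_comp ((hF.contDiffAt_matG hp a).comp p contDiffAt_fst) contDiffAt_const

theorem contDiffAt_prodR (hF : SpaceFrame s U f θ e Zi) (hp : p.1 ∈ s) :
    ContDiffAt ℝ ∞ (prodR Zi) p :=
  ContDiffAt.clm_comp ((hF.contDiffAt_matR hp).comp p contDiffAt_fst) contDiffAt_const

end SpaceFrame

section

variable {B : Type*} [TopologicalSpace B] [ChartedSpace (EuclideanSpace ℝ (Fin 3)) B]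
  [IsManifold (𝓡 3) ∞ B]

/-- The product of a chart of `B` with the identity of `ℝ⁴`. -/
def prodChart (b₀ : B) (q : B × (Fin 4 → ℝ)) : E34 := (extChartAt (𝓡 3) b₀ q.1, q.2)

/-- The points over a subset of the domain of a chart of `B`. -/
def chartDomain (b₀ : B) (s : Set E3) : Set (B × (Fin 4 → ℝ)) :=
  {q | q.1 ∈ (extChartAt (𝓡 3) b₀).source ∧ extChartAt (𝓡 3) b₀ q.1 ∈ s}

theorem isOpen_chartDomain (b₀ : B) {s : Set E3} (hs : IsOpen s) : IsOpen (chartDomain b₀ s) :=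
  ((continuousOn_extChartAt b₀).isOpen_inter_preimage (isOpen_extChartAt_source b₀) hs).preimage
    continuous_fst

variable {b₀ : B} {s : Set E3} {q : B × (Fin 4 → ℝ)} {u : B → Lam2} {k c : ℝ}
  {f : Fin 3 → E3 → Lam2} {θ : Fin 3 → E3 → E3 →L[ℝ] ℝ}
  {e : Fin 3 → E3 → E3} {Zi : E3 → (Fin 4 → ℝ) →L[ℝ] (Fin 4 → ℝ)}

theorem contMDiffAt_prodChart (hq : q.1 ∈ (extChartAt (𝓡 3) b₀).source) :
    ContMDiffAt modelBR4 𝓘(ℝ, E34) ∞ (prodChart b₀) q :=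
  ((contMDiffAt_extChartAt_of_mem hq).comp q contMDiffAt_fst).prodMk_space contMDiffAt_snd

theorem mfderiv_prodChart (hq : q.1 ∈ (extChartAt (𝓡 3) b₀).source)
    (v : TangentSpace modelBR4 q) : mfderiv modelBR4 𝓘(ℝ, E34) (prodChart b₀) q v =
      (mfderiv (𝓡 3) 𝓘(ℝ, E3) (extChartAt (𝓡 3) b₀) q.1 v.1, v.2) := by
  have hf := (contMDiffAt_prodChart hq).mdifferentiableAt (by simp)
  have h1 := mfderiv_clm_comp (ContinuousLinearMap.fst ℝ E3 (Fin 4 → ℝ)) hf v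
  have h2 := mfderiv_clm_comp (ContinuousLinearMap.snd ℝ E3 (Fin 4 → ℝ)) hf v
  have h3 := mfderiv_comp (I := modelBR4) (I' := 𝓡 3) (I'' := 𝓘(ℝ, E3)) q
    ((contMDiffAt_extChartAt_of_mem hq).mdifferentiableAt (by simp)) mdifferentiableAt_fst
  have h4 := DFunLike.congr_fun h3 v
  rw [mfderiv_fst] at h4
  have h5 := DFunLike.congr_fun (mfderiv_snd (I := 𝓡 3) (I' := 𝓘(ℝ, Fin 4 → ℝ)) (x := q)) v
  exact Prod.ext (h1.symm.trans h4) (h2.symm.trans h5)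

namespace SpaceFrame

/-- The frame at a point that belongs to a moving frame in a chart. -/
theorem frameAt (hF : SpaceFrame s (u ∘ (extChartAt (𝓡 3) b₀).symm) f θ e Zi)
    (hu : ContMDiff (𝓡 3) 𝓘(ℝ, Lam2) ∞ u) (hq : q ∈ chartDomain b₀ s) :
    FrameAt u q.1 (fun a => (θ a (extChartAt (𝓡 3) b₀ q.1)).comp
        (mfderiv (𝓡 3) 𝓘(ℝ, E3) (extChartAt (𝓡 3) b₀) q.1))
      (fun a => mfderiv 𝓘(ℝ, E3) (𝓡 3) (extChartAt (𝓡 3) b₀).symm (extChartAt (𝓡 3) b₀ q.1)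
        (e a (extChartAt (𝓡 3) b₀ q.1)))
      (fun a => f a (extChartAt (𝓡 3) b₀ q.1)) (Zi (extChartAt (𝓡 3) b₀ q.1)) := by
  obtain ⟨hb, hy⟩ := hq
  set b := q.1 with hbq
  have hl := (extChartAt (𝓡 3) b₀).left_inv hb
  have hinv : ∀ w : E3, mfderiv (𝓡 3) 𝓘(ℝ, E3) (extChartAt (𝓡 3) b₀) b
      (mfderiv 𝓘(ℝ, E3) (𝓡 3) (extChartAt (𝓡 3) b₀).symm (extChartAt (𝓡 3) b₀ b) w) = w := by
    intro w
    have key : ∀ b', b' = b → ∀ x : E3, (mfderiv (𝓡 3) 𝓘(ℝ, E3) (extChartAt (𝓡 3) b₀) b x : E3) =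
        mfderiv (𝓡 3) 𝓘(ℝ, E3) (extChartAt (𝓡 3) b₀) b' x := by
      rintro _ rfl x
      rfl
    exact (key _ hl _).trans (DFunLike.congr_fun (mfderiv_comp_mfderiv_symm_extChartAt (I := 𝓡 3)
      ((extChartAt (𝓡 3) b₀).map_source hb)) w)
  exact
    { du_eq := fun v => (du_eq_fderiv_chart_symm hu hb v).trans (hF.U_deriv _ hy _)
      lam_e := fun a c => (congrArg (θ a _) (hinv _)).trans (hF.θ_e _ hy a c)
      span := fun v => by
        have h1 := hF.span _ hy (mfderiv (𝓡 3) 𝓘(ℝ, E3) (extChartAt (𝓡 3) b₀) b v)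
        have h2 := congrArg (mfderiv 𝓘(ℝ, E3) (𝓡 3) (extChartAt (𝓡 3) b₀).symm
          (extChartAt (𝓡 3) b₀ b)) h1
        have h3 := DFunLike.congr_fun (mfderiv_symm_comp_mfderiv_extChartAt (I := 𝓡 3) hb) v
        refine h3.symm.trans (h2.trans ?_)
        refine (map_sum _ _ _).trans (Finset.sum_congr rfl fun a _ => ?_)
        exact map_smul _ _ _
      unit := hF.Zi_unit _ hy
      det_Z := hF.det_Zi hy
      u_eq := by
        have := hF.U_eq _ hy
        rw [Function.comp_apply, hl] at this
        exact this
      f_eq := fun a => hF.f_eq _ hy a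
      norm := hF.f_norm _ hy
      oriented := hF.oriented _ hy }

theorem coframe_eq (hq : q.1 ∈ (extChartAt (𝓡 3) b₀).source) (v : TangentSpace modelBR4 q)
    (i : Fin 7) :
    coframe k (fun a => (θ a (extChartAt (𝓡 3) b₀ q.1)).comp
        (mfderiv (𝓡 3) 𝓘(ℝ, E3) (extChartAt (𝓡 3) b₀) q.1)) (Zi (extChartAt (𝓡 3) b₀ q.1)) v i =
      prodOm k θ Zi i (prodChart b₀ q) (mfderiv modelBR4 𝓘(ℝ, E34) (prodChart b₀) q v) := by
  refine Eq.trans ?_ (congrArg (prodOm k θ Zi i (prodChart b₀ q)) (mfderiv_prodChart hq v)).symm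
  fin_cases i <;> rfl

theorem structureEquations (hF : SpaceFrame s (u ∘ (extChartAt (𝓡 3) b₀).symm) f θ e Zi)
    (hk : 0 < k) (hq : q ∈ chartDomain b₀ s) :
    StructureEquations modelBR4 k (fun i => pullOne modelBR4 (prodChart b₀) (prodOm k θ Zi i))
      (fun a b => pullOne modelBR4 (prodChart b₀) fun y =>
        kapL (fun i => prodG Zi i y) (prodR Zi y) a b) (fun _ _ => 0)
      (fun t x => quarticOf (sffH k e Zi (prodChart b₀ x).1) (∑ i, (t i : ℕ))) (fun _ _ => 0) q :=
  structureEquations_pullback (I := modelBR4) (f := prodChart b₀) (om := prodOm k θ Zi)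
    (G := prodG Zi) (R := prodR Zi) (σ := fun m y => quarticOf (sffH k e Zi y.1) m)
    (contMDiffAt_prodChart hq.1) (fun i => hF.contDiffAt_prodOm (p := prodChart b₀ q) hq.2 i)
    (fun v w i => hF.prodOm_eqs (p := prodChart b₀ q) hk hq.2 v w i)

theorem isAdaptedSection (hF : SpaceFrame s (u ∘ (extChartAt (𝓡 3) b₀).symm) f θ e Zi)
    (hk : 0 < k) (hkc : 8 * k ^ 3 * c = 1) (hu : ContMDiff (𝓡 3) 𝓘(ℝ, Lam2) ∞ u) :
    IsAdaptedSection modelBR4 k (baragliaForm c u) (fun x => (12 * k ^ 2) • tautForm u x)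
      (chartDomain b₀ s) fun i => pullOne modelBR4 (prodChart b₀) (prodOm k θ Zi i) := by
  refine ⟨fun i q hq => contDiffAt_pullOne (contMDiffAt_prodChart hq.1)
    (hF.contDiffAt_prodOm (p := prodChart b₀ q) hq.2 i), fun q hq => ?_⟩
  have h := hF.frameAt hu hq
  refine ⟨h.toEquiv hk q.2, h.isAdapted hk hkc hu q.2, fun i v => ?_⟩
  exact (congrFun (h.toEquiv_apply hk q.2 v) i).trans (coframe_eq hq.1 v i)

theorem contMDiffOn_quarticOf (hF : SpaceFrame s (u ∘ (extChartAt (𝓡 3) b₀).symm) f θ e Zi)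
    (m : ℕ) : ContMDiffOn modelBR4 𝓘(ℝ, ℂ) ∞
      (fun x => quarticOf (sffH k e Zi (prodChart b₀ x).1) m) (chartDomain b₀ s) := by
  intro q hq
  have h1 : ContDiffAt ℝ ∞ (fun y : E34 => quarticOf (sffH k e Zi y.1) m) (prodChart b₀ q) :=
    (hF.contDiffAt_quarticOf (y := (prodChart b₀ q).1) hq.2 m).comp _ contDiffAt_fst
  exact (h1.contMDiffAt.comp q (contMDiffAt_prodChart hq.1)).contMDiffWithinAt

end SpaceFrame

end

end
end G2ERP

namespace G2ERP
noncomputable section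

set_option linter.unusedSectionVars false

/-! ### The exterior derivative of the dual `4`-form -/

/-- The `(2,2)`-shuffle product of orthogonal `2`-forms on `ℝ⁴` vanishes. -/
theorem shuffleSum_eq_zero {α β : Lam2} (h : pair α β = 0) (v : Fin 4 → Fin 4 → ℝ) :
    shuffleSum (fun i j l m => α ![v i, v j] * β ![v l, v m]) = 0 := by
  -- A map sending the standard basis to v turns the shuffle sum into twice the pairing of the
  -- pulled-back forms, that is, 2 det(Z)⟨α, β⟩.
  let Z : (Fin 4 → ℝ) →L[ℝ] (Fin 4 → ℝ) :=
    LinearMap.toContinuousLinearMap (Matrix.toLin' (Matrix.of fun j i => v i j))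
  have hZ : ∀ i, Z (stdVec i) = v i := by
    intro i
    funext j
    simp [Z, stdVec]
  have h1 := pair_comp α β Z
  rw [h, mul_zero, pair_eq] at h1
  simp only [co_comp, hZ] at h1
  simp only [shuffleSum]
  linarith

theorem wedge2_eq {V : Type*} {α : (Fin 2 → V) → ℝ} {β : (Fin 3 → V) → ℝ} {v : Fin 5 → V}
    {α' : Fin 5 → Fin 5 → ℝ} {β' : Fin 5 → Fin 5 → Fin 5 → ℝ}
    (hα : ∀ i j, α ![v i, v j] = α' i j) (hs : ∀ i j, α' j i = -α' i j)
    (hβ : ∀ i j l, β ![v i, v j, v l] = β' i j l) :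
    wedge2 α β v = α' 0 1 * β' 2 3 4 - α' 0 2 * β' 1 3 4 + α' 0 3 * β' 1 2 4 - α' 0 4 * β' 1 2 3
      + α' 1 2 * β' 0 3 4 - α' 1 3 * β' 0 2 4 + α' 1 4 * β' 0 2 3 + α' 2 3 * β' 0 1 4
      - α' 2 4 * β' 0 1 3 + α' 3 4 * β' 0 1 2 := by
  have e : ∀ p : Fin 5, ∀ q : Fin 4, ∀ i j l, p.succAbove (q.succAbove 0) = i →
      p.succAbove (q.succAbove 1) = j → p.succAbove (q.succAbove 2) = l →
      β (fun i => v (p.succAbove (q.succAbove i))) = β' i j l := by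
    rintro p q _ _ _ rfl rfl rfl
    rw [← hβ]
    congr 1
    funext i
    fin_cases i <;> rfl
  have e2 : ∀ p : Fin 5, ∀ q : Fin 4, ∀ j, p.succAbove q = j →
      α ![v p, v (p.succAbove q)] = α' p j := by
    rintro p q _ rfl
    exact hα _ _
  change 1 / 2 * ∑ x : Fin 5, ∑ y : Fin 4, (-1 : ℝ) ^ ((x : ℕ) + (y : ℕ)) *
    (α ![v x, v (x.succAbove y)] * β fun i => v (x.succAbove (y.succAbove i))) = _
  simp only [Fin.sum_univ_five, Fin.sum_univ_four]
  rw [e 0 0 2 3 4 rfl rfl rfl, e 0 1 1 3 4 rfl rfl rfl, e 0 2 1 2 4 rfl rfl rfl,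
    e 0 3 1 2 3 rfl rfl rfl, e 1 0 2 3 4 rfl rfl rfl, e 1 1 0 3 4 rfl rfl rfl,
    e 1 2 0 2 4 rfl rfl rfl, e 1 3 0 2 3 rfl rfl rfl, e 2 0 1 3 4 rfl rfl rfl,
    e 2 1 0 3 4 rfl rfl rfl, e 2 2 0 1 4 rfl rfl rfl, e 2 3 0 1 3 rfl rfl rfl,
    e 3 0 1 2 4 rfl rfl rfl, e 3 1 0 2 4 rfl rfl rfl, e 3 2 0 1 4 rfl rfl rfl,
    e 3 3 0 1 2 rfl rfl rfl, e 4 0 1 2 3 rfl rfl rfl, e 4 1 0 2 3 rfl rfl rfl,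
    e 4 2 0 1 3 rfl rfl rfl, e 4 3 0 1 2 rfl rfl rfl,
    e2 0 0 1 rfl, e2 0 1 2 rfl, e2 0 2 3 rfl, e2 0 3 4 rfl, e2 1 0 0 rfl, e2 1 1 2 rfl,
    e2 1 2 3 rfl, e2 1 3 4 rfl, e2 2 0 0 rfl, e2 2 1 1 rfl, e2 2 2 3 rfl, e2 2 3 4 rfl,
    e2 3 0 0 rfl, e2 3 1 1 rfl, e2 3 2 2 rfl, e2 3 3 4 rfl, e2 4 0 0 rfl, e2 4 1 1 rfl,
    e2 4 2 2 rfl, e2 4 3 3 rfl]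
  rw [hs 0 1, hs 0 2, hs 0 3, hs 0 4, hs 1 2, hs 1 3, hs 1 4, hs 2 3, hs 2 4, hs 3 4]
  simp only [Fin.val_zero, Fin.val_one, Fin.val_two, show ((3 : Fin 4) : ℕ) = 3 from rfl,
    show ((3 : Fin 5) : ℕ) = 3 from rfl, show ((4 : Fin 5) : ℕ) = 4 from rfl]
  ring

namespace SpaceFrame

variable {s : Set E3} {U : E3 → Lam2} {f : Fin 3 → E3 → Lam2} {θ : Fin 3 → E3 → E3 →L[ℝ] ℝ}
  {e : Fin 3 → E3 → E3} {Zi : E3 → (Fin 4 → ℝ) →L[ℝ] (Fin 4 → ℝ)} {y : E3} {k c : ℝ} {p : E34}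

/-- The derivative of the dual of `U`. -/
theorem hasFDerivAt_cross (hF : SpaceFrame s U f θ e Zi) (hy : y ∈ s) (b c : E3) :
    ∃ D : E3 →L[ℝ] Lam2,
      HasFDerivAt (fun y => cross (fun a => θ a y b) (fun a => θ a y c) fun a => f a y) D y ∧
      ∀ a, D a = ∑ d : Fin 3,
        ((fderiv ℝ (θ (d + 1)) y a b * θ (d + 2) y c + θ (d + 1) y b * fderiv ℝ (θ (d + 2)) y a c
          - (fderiv ℝ (θ (d + 2)) y a b * θ (d + 1) y c
            + θ (d + 2) y b * fderiv ℝ (θ (d + 1)) y a c)) • f d y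
        + (θ (d + 1) y b * θ (d + 2) y c - θ (d + 2) y b * θ (d + 1) y c) •
          fderiv ℝ (f d) y a) := by
  have hθ : ∀ (d : Fin 3) (x : E3), HasFDerivAt (fun y => θ d y x)
      ((ContinuousLinearMap.apply ℝ ℝ x).comp (fderiv ℝ (θ d) y)) y := fun d x =>
    (ContinuousLinearMap.apply ℝ ℝ x).hasFDerivAt.comp y
      (hF.at_diff (hF.θ_smooth d) hy).hasFDerivAt
  have hf : ∀ d : Fin 3, HasFDerivAt (f d) (fderiv ℝ (f d) y) y := fun d =>
    (hF.at_diff (hF.f_smooth d) hy).hasFDerivAt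
  refine ⟨_, HasFDerivAt.fun_sum fun d _ => (((hθ (d + 1) b).mul (hθ (d + 2) c)).sub
    ((hθ (d + 2) b).mul (hθ (d + 1) c))).smul (hf d), fun a => ?_⟩
  simp only [sum_apply]
  refine Finset.sum_congr rfl fun d _ => ?_
  simp
  module

/-- This is d(*du) = 3 vol ⊗ u, the equation Δu = 3u. The tangential terms cancel because the
connection is torsion-free, the normal terms are the traces that maximality kills, and each of the
three tangent directions contributes one multiple of u. -/
theorem fderiv_cross (hF : SpaceFrame s U f θ e Zi) (hy : y ∈ s) (a b c : E3)
    (w : Fin 2 → Fin 4 → ℝ) :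
    fderiv ℝ (fun y => cross (fun d => θ d y b) (fun d => θ d y c) fun d => f d y) y a w
    - fderiv ℝ (fun y => cross (fun d => θ d y a) (fun d => θ d y c) fun d => f d y) y b w
    + fderiv ℝ (fun y => cross (fun d => θ d y a) (fun d => θ d y b) fun d => f d y) y c w =
    3 * Matrix.det (Matrix.of fun i d => θ d y (![a, b, c] i)) * U y w := by
  obtain ⟨D1, h1, e1⟩ := hF.hasFDerivAt_cross hy b c
  obtain ⟨D2, h2, e2⟩ := hF.hasFDerivAt_cross hy a c
  obtain ⟨D3, h3, e3⟩ := hF.hasFDerivAt_cross hy a b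
  rw [h1.fderiv, h2.fderiv, h3.fderiv, e1, e2, e3]
  have hθ : ∀ d x z, fderiv ℝ (θ d) y z x = fderiv ℝ (θ d) y x z - dOne (θ d) y x z := by
    intro d x z
    rw [dOne]
    ring
  have hlin : ∀ (α : E3 →L[ℝ] ℝ) (v : E3), α v =
      θ 0 y v * α (e 0 y) + θ 1 y v * α (e 1 y) + θ 2 y v * α (e 2 y) := by
    intro α v
    have hv := hF.span y hy v
    rw [Fin.sum_univ_three] at hv
    conv_lhs => rw [hv]
    simp
  obtain ⟨t1, t2⟩ := hF.matP_trace hy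
  have p01 : (0 : Fin 3) + 1 = 1 := rfl
  have p02 : (0 : Fin 3) + 2 = 2 := rfl
  have p11 : (1 : Fin 3) + 1 = 2 := rfl
  have p12 : (1 : Fin 3) + 2 = 0 := rfl
  have p21 : (2 : Fin 3) + 1 = 0 := rfl
  have p22 : (2 : Fin 3) + 2 = 1 := rfl
  rw [Fin.sum_univ_three] at t1 t2
  simp only [Fin.sum_univ_three, hF.f_deriv hy,
    ContinuousAlternatingMap.add_apply, ContinuousAlternatingMap.sub_apply,
    ContinuousAlternatingMap.smul_apply, smul_eq_mul, Matrix.det_fin_three, Matrix.of_apply,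
    p01, p02, p11, p12, p21, p22, Matrix.cons_val_zero, Matrix.cons_val_one, Matrix.cons_val]
  rw [hθ 0 a b, hθ 1 a b, hθ 2 a b, hθ 0 a c, hθ 1 a c, hθ 2 a c, hθ 0 b c, hθ 1 b c, hθ 2 b c]
  simp only [hF.dθ hy, p01, p02, p11, p12, p21, p22]
  rw [hlin (matP (zg Zi y) 0) a, hlin (matP (zg Zi y) 0) b, hlin (matP (zg Zi y) 0) c,
    hlin (matP (zg Zi y) 1) a, hlin (matP (zg Zi y) 1) b, hlin (matP (zg Zi y) 1) c,
    hlin (matP (zg Zi y) 2) a, hlin (matP (zg Zi y) 2) b, hlin (matP (zg Zi y) 2) c,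
    hlin (matQ (zg Zi y) 0) a, hlin (matQ (zg Zi y) 0) b, hlin (matQ (zg Zi y) 0) c,
    hlin (matQ (zg Zi y) 1) a, hlin (matQ (zg Zi y) 1) b, hlin (matQ (zg Zi y) 1) c,
    hlin (matQ (zg Zi y) 2) a, hlin (matQ (zg Zi y) 2) b, hlin (matQ (zg Zi y) 2) c]
  linear_combination (2 * (θ 0 y a * θ 1 y b * θ 2 y c - θ 0 y a * θ 2 y b * θ 1 y c
    - θ 1 y a * θ 0 y b * θ 2 y c + θ 1 y a * θ 2 y b * θ 0 y c + θ 2 y a * θ 0 y b * θ 1 y c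
    - θ 2 y a * θ 1 y b * θ 0 y c)) * (negN2.compContinuousLinearMap (Zi y) w * t1
      + negN1.compContinuousLinearMap (Zi y) w * t2)

/-- The dual `4`-form on the model. -/
def psiForm (k : ℝ) (θ : Fin 3 → E3 → E3 →L[ℝ] ℝ) (Zi : E3 → (Fin 4 → ℝ) →L[ℝ] (Fin 4 → ℝ))
    (p : E34) : E34 [⋀^Fin 4]→L[ℝ] ℝ :=
  psi0.compContinuousLinearMap (coframe k (fun a => θ a p.1) (Zi p.1))

theorem frameAt_model (hF : SpaceFrame s U f θ e Zi) (hy : y ∈ s) :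
    FrameAt U y (fun a => θ a y) (fun a => e a y) (fun a => f a y) (Zi y) where
  du_eq v := (DFunLike.congr_fun (mfderiv_eq_fderiv (f := U) (x := y)) v).trans (hF.U_deriv y hy v)
  lam_e := hF.θ_e y hy
  span := hF.span y hy
  unit := hF.Zi_unit y hy
  det_Z := hF.det_Zi hy
  u_eq := hF.U_eq y hy
  f_eq := hF.f_eq y hy
  norm := hF.f_norm y hy
  oriented := hF.oriented y hy

theorem psiForm_apply (hF : SpaceFrame s U f θ e Zi) (hk : 0 < k) (hp : p.1 ∈ s)
    (v : Fin 4 → E34) : psiForm k θ Zi p v =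
      4 * k ^ 2 * Matrix.det (Matrix.of fun i j => (v i).2 j) + (2 * k)⁻¹ * shuffleSum
        fun i j l m => cross (fun a => θ a p.1 (v i).1) (fun a => θ a p.1 (v j).1)
          (fun a => f a p.1) ![(v l).2, (v m).2] :=
  (hF.frameAt_model hp).psi0_coframe hk v

theorem contDiffAt_psiForm (hF : SpaceFrame s U f θ e Zi) (hp : p.1 ∈ s) :
    ContDiffAt ℝ ∞ (psiForm k θ Zi) p := by
  refine contDiffAt_alternating_of_apply (E := E34) (X := E34) fun v => ?_
  have key := contDiffAt_alternating_apply (X := E34) (α := fun _ => psi0)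
    (v := fun p i => coframe k (fun a => θ a p.1) (Zi p.1) (v i)) (x := p) contDiffAt_const
  refine key fun i => contDiffAt_pi.2 fun j => ?_
  have h1 : ContDiffAt ℝ ∞ (fun p => prodOm k θ Zi j p (v i)) p :=
    (hF.contDiffAt_prodOm (k := k) hp j).clm_apply contDiffAt_const
  have h2 : (fun p : E34 => coframe k (fun a => θ a p.1) (Zi p.1) (v i) j) =
      fun p => prodOm k θ Zi j p (v i) := by
    funext p
    fin_cases j <;> rfl
  rw [h2]
  exact h1

theorem fderiv_psiForm (hF : SpaceFrame s U f θ e Zi) (hk : 0 < k) (hp : p.1 ∈ s)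
    (v : Fin 4 → E34) (w : E34) : fderiv ℝ (fun p => psiForm k θ Zi p v) p w =
      (2 * k)⁻¹ * shuffleSum fun i j l m => fderiv ℝ (fun y => cross (fun a => θ a y (v i).1)
        (fun a => θ a y (v j).1) (fun a => f a y)) p.1 w.1 ![(v l).2, (v m).2] := by
  have h1 : (fun p => psiForm k θ Zi p v) =ᶠ[nhds p] fun p =>
      4 * k ^ 2 * Matrix.det (Matrix.of fun i j => (v i).2 j) + (2 * k)⁻¹ * shuffleSum
        fun i j l m => cross (fun a => θ a p.1 (v i).1) (fun a => θ a p.1 (v j).1)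
          (fun a => f a p.1) ![(v l).2, (v m).2] := by
    filter_upwards [(hF.isOpen.preimage continuous_fst).mem_nhds hp] with q hq
    exact hF.psiForm_apply hk hq v
  have hT : ∀ i j l m, HasFDerivAt (fun p : E34 => cross (fun a => θ a p.1 (v i).1)
      (fun a => θ a p.1 (v j).1) (fun a => f a p.1) ![(v l).2, (v m).2])
      ((evL ![(v l).2, (v m).2]).comp ((fderiv ℝ (fun y => cross (fun a => θ a y (v i).1)
        (fun a => θ a y (v j).1) (fun a => f a y)) p.1).comp
          (ContinuousLinearMap.fst ℝ E3 (Fin 4 → ℝ)))) p := by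
    intro i j l m
    obtain ⟨D, hD, -⟩ := hF.hasFDerivAt_cross hp (v i).1 (v j).1
    rw [hD.fderiv]
    exact (evL ![(v l).2, (v m).2]).hasFDerivAt.comp p
      (HasFDerivAt.comp p hD hasFDerivAt_fst)
  have h2 := (((((((hT 0 1 2 3).sub (hT 0 2 1 3)).add (hT 0 3 1 2)).add (hT 1 2 0 3)).sub
    (hT 1 3 0 2)).add (hT 2 3 0 1)).const_mul (2 * k)⁻¹).const_add
    (4 * k ^ 2 * Matrix.det (Matrix.of fun i j => (v i).2 j))
  rw [h1.fderiv_eq]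
  exact (congrArg (fun L : E34 →L[ℝ] ℝ => L w) h2.fderiv)

/-- The fibre-volume term of ψ is closed, so dψ = (2k)⁻¹ d(*du) = 3(2k)⁻¹ vol ∧ u. On the other side
τ ∧ φ = 12k²(c u ∧ vol + u ∧ du), where 12k²c = 3(2k)⁻¹ and u ∧ du = 0 because ⟨u, du⟩ = 0. -/
theorem extDeriv_psiForm (hF : SpaceFrame s U f θ e Zi) (hk : 0 < k) (hkc : 8 * k ^ 3 * c = 1)
    (hp : p.1 ∈ s) {τ : (Fin 2 → E34) → ℝ} {φ : (Fin 3 → E34) → ℝ}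
    (hτ : ∀ v w, τ ![v, w] = 12 * k ^ 2 * U p.1 ![v.2, w.2])
    (hφ : ∀ a b d, φ ![a, b, d] = c * Matrix.det (Matrix.of fun i l => θ l p.1 (![a.1, b.1, d.1] i))
      + (fderiv ℝ U p.1 a.1 ![b.2, d.2] - fderiv ℝ U p.1 b.1 ![a.2, d.2]
        + fderiv ℝ U p.1 d.1 ![a.2, b.2])) (v : Fin 5 → E34) :
    extDeriv (psiForm k θ Zi) p v = wedge2 τ φ v := by
  let T : Fin 5 → Fin 5 → Fin 5 → Fin 5 → Fin 5 → ℝ := fun i j l m n =>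
    fderiv ℝ (fun y => cross (fun a => θ a y (v j).1) (fun a => θ a y (v l).1) fun a => f a y)
      p.1 (v i).1 ![(v m).2, (v n).2]
  let W : Fin 5 → Fin 5 → Fin 5 → ℝ := fun i j l =>
    Matrix.det (Matrix.of fun a d => θ d p.1 (![(v i).1, (v j).1, (v l).1] a))
  let X : Fin 5 → Fin 5 → ℝ := fun m n => U p.1 ![(v m).2, (v n).2]
  let Y : Fin 5 → Fin 5 → Fin 5 → ℝ := fun i m n => fderiv ℝ U p.1 (v i).1 ![(v m).2, (v n).2]
  have hT : ∀ i j l m n, T i j l m n - T j i l m n + T l i j m n = 3 * W i j l * X m n :=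
    fun i j l m n => hF.fderiv_cross hp (v i).1 (v j).1 (v l).1 ![(v m).2, (v n).2]
  have hD : ∀ (i a b d g : Fin 5), i.removeNth v 0 = v a → i.removeNth v 1 = v b →
      i.removeNth v 2 = v d → i.removeNth v 3 = v g →
      fderiv ℝ (fun p => psiForm k θ Zi p (i.removeNth v)) p (v i) = (2 * k)⁻¹ *
        (T i a b d g - T i a d b g + T i a g b d + T i b d a g - T i b g a d + T i d g a b) := by
    intro i a b d g ha hb hd hg
    rw [hF.fderiv_psiForm hk hp, shuffleSum, ha, hb, hd, hg]
  have hY : ∀ i a b d g : Fin 5, X a b * Y i d g - X a d * Y i b g + X a g * Y i b d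
      + X b d * Y i a g - X b g * Y i a d + X d g * Y i a b = 0 := fun i a b d g =>
    shuffleSum_eq_zero (hF.pair_U_deriv hp (v i).1) ![(v a).2, (v b).2, (v d).2, (v g).2]
  have hXs : ∀ i j, X j i = -X i j := fun i j => alt_pair_swap _ _ _
  rw [extDeriv_apply ((hF.contDiffAt_psiForm hp).differentiableAt (by simp)), Fin.sum_univ_five,
    hD 0 1 2 3 4 rfl rfl rfl rfl, hD 1 0 2 3 4 rfl rfl rfl rfl, hD 2 0 1 3 4 rfl rfl rfl rfl,
    hD 3 0 1 2 4 rfl rfl rfl rfl, hD 4 0 1 2 3 rfl rfl rfl rfl,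
    wedge2_eq (v := v) (α' := fun i j => 12 * k ^ 2 * X i j)
      (β' := fun i j l => c * W i j l + (Y i j l - Y j i l + Y l i j))
      (fun i j => hτ _ _) (fun i j => by rw [hXs]; ring) (fun i j l => hφ _ _ _)]
  have hc : 12 * k ^ 2 * c = 3 * (2 * k)⁻¹ := by
    field_simp
    linear_combination 3 * hkc
  simp only [Fin.val_zero, Fin.val_one, Fin.val_two, show ((3 : Fin 5) : ℕ) = 3 from rfl,
    show ((4 : Fin 5) : ℕ) = 4 from rfl, zsmul_eq_mul]
  push_cast
  -- One instance of d(*du) = 3 vol ⊗ u for each of the ten triples among five vectors, and one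
  -- instance of u ∧ du = 0 for each choice of the vector inserted in du.
  linear_combination (2 * k)⁻¹ * (hT 2 3 4 0 1 - hT 1 3 4 0 2 + hT 1 2 4 0 3 - hT 1 2 3 0 4 +
    hT 0 3 4 1 2 - hT 0 2 4 1 3 + hT 0 2 3 1 4 + hT 0 1 4 2 3 - hT 0 1 3 2 4 + hT 0 1 2 3 4) - (W
    2 3 4 * X 0 1 - W 1 3 4 * X 0 2 + W 1 2 4 * X 0 3 - W 1 2 3 * X 0 4 + W 0 3 4 * X 1 2 - W 0 2
    4 * X 1 3 + W 0 2 3 * X 1 4 + W 0 1 4 * X 2 3 - W 0 1 3 * X 2 4 + W 0 1 2 * X 3 4) * hc - 12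
    * k ^ 2 * (hY 0 1 2 3 4 - hY 1 0 2 3 4 + hY 2 0 1 3 4 - hY 3 0 1 2 4 + hY 4 0 1 2 3)

end SpaceFrame

end
end G2ERP

namespace G2ERP
noncomputable section

set_option linter.unusedSectionVars false

/-! ### Maximal immersions give structures of type `S` -/

/-- A volume form on `ℝ³`. -/
def volE (θ : Fin 3 → E3 → E3 →L[ℝ] ℝ) (y : E3) : E3 [⋀^Fin 3]→L[ℝ] ℝ :=
  (dx ![0, 1, 2]).compContinuousLinearMap (ContinuousLinearMap.pi fun a => θ a y)

theorem volE_apply (θ : Fin 3 → E3 → E3 →L[ℝ] ℝ) (y : E3) (v : Fin 3 → E3) :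
    volE θ y v = Matrix.det (Matrix.of fun i a => θ a y (v i)) := by
  change Matrix.det (Matrix.of fun i a => θ (![0, 1, 2] a) y (v i)) = _
  congr 1
  ext i a
  fin_cases a <;> rfl

theorem fourForm_eq_zero (α : E3 [⋀^Fin 4]→L[ℝ] ℝ) : α = 0 := by
  ext v
  refine α.toAlternatingMap.map_linearDependent v fun h => ?_
  have := h.fintype_card_le_finrank
  simp at this

theorem extDeriv_betaTaut_const (z : Lam2 × (Fin 4 → ℝ)) :
    extDeriv betaTaut z = extDeriv betaTaut 0 := by
  ext v
  rw [extDeriv_betaTaut, extDeriv_betaTaut]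

/-- The `3`-form that pulls back to the `3`-form of a maximal immersion. -/
def closedForm (c : ℝ) (θ : Fin 3 → E3 → E3 →L[ℝ] ℝ) (z : E3 × (Lam2 × (Fin 4 → ℝ))) :
    (E3 × (Lam2 × (Fin 4 → ℝ))) [⋀^Fin 3]→L[ℝ] ℝ :=
  c • (volE θ z.1).compContinuousLinearMap (ContinuousLinearMap.fst ℝ E3 (Lam2 × (Fin 4 → ℝ)))
    + (extDeriv betaTaut 0).compContinuousLinearMap
      (ContinuousLinearMap.snd ℝ E3 (Lam2 × (Fin 4 → ℝ)))

section

variable {B : Type*} [TopologicalSpace B] [ChartedSpace (EuclideanSpace ℝ (Fin 3)) B]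
  [IsManifold (𝓡 3) ∞ B] {b₀ : B} {s : Set E3} {q : B × (Fin 4 → ℝ)} {u : B → Lam2} {k c : ℝ}
  {f : Fin 3 → E3 → Lam2} {θ : Fin 3 → E3 → E3 →L[ℝ] ℝ}
  {e : Fin 3 → E3 → E3} {Zi : E3 → (Fin 4 → ℝ) →L[ℝ] (Fin 4 → ℝ)}

/-- The map that pulls `closedForm` back to `baragliaForm`. -/
def baragliaMap (u : B → Lam2) (b₀ : B) (q : B × (Fin 4 → ℝ)) : E3 × (Lam2 × (Fin 4 → ℝ)) :=
  (extChartAt (𝓡 3) b₀ q.1, tautMap u q)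

theorem contMDiffAt_baragliaMap (hu : ContMDiff (𝓡 3) 𝓘(ℝ, Lam2) ∞ u)
    (hq : q.1 ∈ (extChartAt (𝓡 3) b₀).source) :
    ContMDiffAt modelBR4 𝓘(ℝ, E3 × (Lam2 × (Fin 4 → ℝ))) ∞ (baragliaMap u b₀) q :=
  ((contMDiffAt_extChartAt_of_mem hq).comp q contMDiffAt_fst).prodMk_space
    (contMDiff_tautMap hu).contMDiffAt

theorem mfderiv_baragliaMap (hu : ContMDiff (𝓡 3) 𝓘(ℝ, Lam2) ∞ u)
    (hq : q.1 ∈ (extChartAt (𝓡 3) b₀).source) (v : TangentSpace modelBR4 q) :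
    mfderiv modelBR4 𝓘(ℝ, E3 × (Lam2 × (Fin 4 → ℝ))) (baragliaMap u b₀) q v =
      (mfderiv (𝓡 3) 𝓘(ℝ, E3) (extChartAt (𝓡 3) b₀) q.1 v.1,
        mfderiv modelBR4 𝓘(ℝ, Lam2 × (Fin 4 → ℝ)) (tautMap u) q v) := by
  have hf := (contMDiffAt_baragliaMap hu hq).mdifferentiableAt (by simp)
  have h1 := mfderiv_clm_comp (ContinuousLinearMap.fst ℝ E3 (Lam2 × (Fin 4 → ℝ))) hf v
  have h2 := mfderiv_clm_comp (ContinuousLinearMap.snd ℝ E3 (Lam2 × (Fin 4 → ℝ))) hf v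
  have h3 := mfderiv_comp (I := modelBR4) (I' := 𝓡 3) (I'' := 𝓘(ℝ, E3)) q
    ((contMDiffAt_extChartAt_of_mem hq).mdifferentiableAt (by simp)) mdifferentiableAt_fst
  have h4 := DFunLike.congr_fun h3 v
  rw [mfderiv_fst] at h4
  exact Prod.ext (h1.symm.trans h4) h2.symm

theorem tautForm_smooth (hu : ContMDiff (𝓡 3) 𝓘(ℝ, Lam2) ∞ u) (r : ℝ) :
    MForm.SmoothOn modelBR4 (fun x => r • tautForm u x) Set.univ := fun x _ =>
  contDiffAt_chartRep_of_pullback (β := fun z => r • betaTaut z) (mem_extChartAt_source x)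
    (contMDiff_tautMap hu).contMDiffAt (contDiff_betaTaut.contDiffAt.const_smul r)
    (Filter.Eventually.of_forall fun y => by rw [tautForm_eq_pullback hu y]; rfl)

namespace SpaceFrame

theorem contDiffAt_volE {U : E3 → Lam2} (hF : SpaceFrame s U f θ e Zi) {y : E3} (hy : y ∈ s) :
    ContDiffAt ℝ ∞ (volE θ) y := by
  refine contDiffAt_alternating_of_apply (E := E3) (X := E3) fun v => ?_
  have key := contDiffAt_alternating_apply (X := E3) (α := fun _ => (dx ![0, 1, 2] :
    (Fin 3 → ℝ) [⋀^Fin 3]→L[ℝ] ℝ)) (v := fun y i a => θ a y (v i)) (x := y) contDiffAt_const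
  exact key fun i => contDiffAt_pi.2 fun a =>
    (hF.at_smooth (hF.θ_smooth a) hy).clm_apply contDiffAt_const

theorem contDiffAt_closedForm {U : E3 → Lam2} (hF : SpaceFrame s U f θ e Zi)
    {z : E3 × (Lam2 × (Fin 4 → ℝ))} (hz : z.1 ∈ s) :
    ContDiffAt ℝ ∞ (closedForm c θ) z := by
  refine contDiffAt_alternating_of_apply (E := E3 × (Lam2 × (Fin 4 → ℝ)))
    (X := E3 × (Lam2 × (Fin 4 → ℝ))) fun v => ?_
  have h1 : ContDiffAt ℝ ∞ (fun z : E3 × (Lam2 × (Fin 4 → ℝ)) => volE θ z.1) z :=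
    (hF.contDiffAt_volE hz).comp z contDiffAt_fst
  have h2 : ContDiffAt ℝ ∞ (fun z : E3 × (Lam2 × (Fin 4 → ℝ)) => volE θ z.1
      (fun i => (v i).1)) z :=
    contDiffAt_alternating_apply h1 fun i => contDiffAt_const
  exact (contDiffAt_const.mul h2).add contDiffAt_const

/-- The volume term is pulled back from ℝ³, where there are no nonzero four-forms, and the
derivative of the tautological form has constant coefficients. -/
theorem extDeriv_closedForm {U : E3 → Lam2} (hF : SpaceFrame s U f θ e Zi)
    {z : E3 × (Lam2 × (Fin 4 → ℝ))} (hz : z.1 ∈ s) : extDeriv (closedForm c θ) z = 0 := by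
  let X := E3 × (Lam2 × (Fin 4 → ℝ))
  have e1 : (fun z : X => (volE θ z.1).compContinuousLinearMap
      (ContinuousLinearMap.fst ℝ E3 (Lam2 × (Fin 4 → ℝ)))) = fun z : X =>
      (volE θ (Prod.fst z)).compContinuousLinearMap (fderiv ℝ Prod.fst z) := by
    funext z
    rw [fderiv_fst]
  have h1 : extDeriv (fun z : X => (volE θ z.1).compContinuousLinearMap
      (ContinuousLinearMap.fst ℝ E3 (Lam2 × (Fin 4 → ℝ)))) z = 0 := by
    rw [e1, extDeriv_pullback (r := ∞) ((hF.contDiffAt_volE hz).differentiableAt (by simp))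
      contDiffAt_fst (by simpa using two_le_infty), fourForm_eq_zero (extDeriv (volE θ) z.1)]
    rfl
  have h2 : extDeriv (fun _ : X => (extDeriv betaTaut 0).compContinuousLinearMap
      (ContinuousLinearMap.snd ℝ E3 (Lam2 × (Fin 4 → ℝ)))) z = 0 := by
    rw [extDeriv, fderiv_const_apply]
    exact map_zero (ContinuousAlternatingMap.alternatizeUncurryFinCLM ℝ X ℝ)
  have hd : ContDiffAt ℝ ∞ (fun z : X => (volE θ z.1).compContinuousLinearMap
      (ContinuousLinearMap.fst ℝ E3 (Lam2 × (Fin 4 → ℝ)))) z := by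
    rw [e1]
    exact contDiffAt_pullback_vectorSpace (hF.contDiffAt_volE hz) contDiffAt_fst
  have hd' : DifferentiableAt ℝ (fun z : X => c • (volE θ z.1).compContinuousLinearMap
      (ContinuousLinearMap.fst ℝ E3 (Lam2 × (Fin 4 → ℝ)))) z :=
    (hd.const_smul c).differentiableAt (by simp)
  have hc : DifferentiableAt ℝ (fun _ : X => (extDeriv betaTaut 0).compContinuousLinearMap
      (ContinuousLinearMap.snd ℝ E3 (Lam2 × (Fin 4 → ℝ)))) z := differentiableAt_const _
  have hs : extDeriv (fun z : X => c • (volE θ z.1).compContinuousLinearMap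
      (ContinuousLinearMap.fst ℝ E3 (Lam2 × (Fin 4 → ℝ)))) z = 0 :=
    (extDeriv_smul c _).trans (by rw [h1, smul_zero])
  refine (extDeriv_fun_add hd' hc).trans ?_
  rw [hs, h2, add_zero]

theorem baragliaForm_eq_pullback (hF : SpaceFrame s (u ∘ (extChartAt (𝓡 3) b₀).symm) f θ e Zi)
    (hu : ContMDiff (𝓡 3) 𝓘(ℝ, Lam2) ∞ u) (hq : q ∈ chartDomain b₀ s) :
    baragliaForm c u q = (closedForm c θ (baragliaMap u b₀ q)).compContinuousLinearMap
      (mfderiv modelBR4 𝓘(ℝ, E3 × (Lam2 × (Fin 4 → ℝ))) (baragliaMap u b₀) q) := by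
  ext v
  have hA := hF.frameAt hu hq
  have e0 := fun i => mfderiv_baragliaMap hu hq.1 (v i)
  have h5 := fun w => DFunLike.congr_fun
    (mfderiv_fst (I := 𝓡 3) (I' := 𝓘(ℝ, Fin 4 → ℝ)) (x := q)) w
  refine congrArg₂ (fun a b => c * a + b) ?_ ?_
  · refine (congrArg (volForm u q.1) (funext fun i => h5 (v i))).trans
      ((volForm_apply hA.norm hA.oriented hA.du_eq fun i => (v i).1).trans ?_)
    refine (volE_apply θ _ _).symm.trans (congrArg (volE θ _) (funext fun i => ?_))
    exact (congrArg Prod.fst (e0 i)).symm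
  · refine (DFunLike.congr_fun (tautForm_d_eq hu q) v).trans ?_
    rw [extDeriv_betaTaut_const]
    exact congrArg (extDeriv betaTaut 0) (funext fun i => (congrArg Prod.snd (e0 i)).symm)

theorem psi_eq_pullback (hF : SpaceFrame s (u ∘ (extChartAt (𝓡 3) b₀).symm) f θ e Zi)
    (hu : ContMDiff (𝓡 3) 𝓘(ℝ, Lam2) ∞ u) (hk : 0 < k) (hq : q ∈ chartDomain b₀ s)
    {lam : Fin 3 → E3 →L[ℝ] ℝ} {e' : Fin 3 → E3}
    {f' : Fin 3 → Lam2} {Z : (Fin 4 → ℝ) →L[ℝ] (Fin 4 → ℝ)} (h : FrameAt u q.1 lam e' f' Z) :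
    psi0.compContinuousLinearMap (coframe k lam Z) =
      (psiForm k θ Zi (prodChart b₀ q)).compContinuousLinearMap
        (mfderiv modelBR4 𝓘(ℝ, E34) (prodChart b₀) q : E34 →L[ℝ] E34) := by
  rw [h.psi0_coframe_eq (hF.frameAt hu hq) hk]
  ext v
  refine congrArg psi0 (funext fun i => funext fun j => ?_)
  refine (coframe_eq hq.1 (v i) j).trans ?_
  fin_cases j <;> rfl

theorem extDeriv_psi_eq (hF : SpaceFrame s (u ∘ (extChartAt (𝓡 3) b₀).symm) f θ e Zi)
    (hu : ContMDiff (𝓡 3) 𝓘(ℝ, Lam2) ∞ u) (hk : 0 < k) (hkc : 8 * k ^ 3 * c = 1)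
    (hq : q ∈ chartDomain b₀ s) (v : Fin 5 → TangentSpace modelBR4 q) :
    extDeriv (psiForm k θ Zi) (prodChart b₀ q)
      (fun i => mfderiv modelBR4 𝓘(ℝ, E34) (prodChart b₀) q (v i)) =
      wedge2 ((12 * k ^ 2) • tautForm u q : TangentSpace modelBR4 q [⋀^Fin 2]→L[ℝ] ℝ)
        (baragliaForm c u q) v := by
  have hA := hF.frameAt hu hq
  let χ := extChartAt (𝓡 3) b₀
  let U : E3 → Lam2 := u ∘ χ.symm
  let p := prodChart b₀ q
  have hUp : U p.1 = u q.1 := congrArg u (χ.left_inv hq.1)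
  have e0 : ∀ w : TangentSpace modelBR4 q, _ := fun w => mfderiv_prodChart hq.1 w
  let τ : (Fin 2 → E34) → ℝ := fun w => 12 * k ^ 2 * U p.1 ![(w 0).2, (w 1).2]
  let φ : (Fin 3 → E34) → ℝ := fun w =>
    c * Matrix.det (Matrix.of fun i l => θ l p.1 (![(w 0).1, (w 1).1, (w 2).1] i))
      + (fderiv ℝ U p.1 (w 0).1 ![(w 1).2, (w 2).2] - fderiv ℝ U p.1 (w 1).1 ![(w 0).2, (w 2).2]
        + fderiv ℝ U p.1 (w 2).1 ![(w 0).2, (w 1).2])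
  refine (hF.extDeriv_psiForm (p := p) (τ := τ) (φ := φ) hk hkc hq.2 (fun _ _ => rfl)
    (fun _ _ _ => rfl) _).trans (Eq.symm ?_)
  refine wedge2_comp τ φ (mfderiv modelBR4 𝓘(ℝ, E34) (prodChart b₀) q) _ _ (fun x y => ?_)
    (fun x => ?_) v
  · change 12 * k ^ 2 * tautForm u q ![x, y] = _
    rw [tautForm_apply]
    change _ = 12 * k ^ 2 * U p.1 _
    rw [hUp]
    refine congrArg (fun t => 12 * k ^ 2 * u q.1 t) ?_
    exact congrArg₂ (fun a b => ![a, b]) (congrArg Prod.snd (e0 x)).symm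
      (congrArg Prod.snd (e0 y)).symm
  · refine (baragliaForm_apply c hu q x).trans ?_
    have hv := volForm_apply hA.norm hA.oriented hA.du_eq fun i => (x i).1
    have hdu : ∀ i j l, du u q.1 (x i).1 ![(x j).2, (x l).2] =
        fderiv ℝ U p.1 (mfderiv modelBR4 𝓘(ℝ, E34) (prodChart b₀) q (x i)).1
          ![(mfderiv modelBR4 𝓘(ℝ, E34) (prodChart b₀) q (x j)).2,
            (mfderiv modelBR4 𝓘(ℝ, E34) (prodChart b₀) q (x l)).2] := by
      intro i j l
      have h1 := (du_eq_fderiv_chart_symm hu hq.1 (x i).1).trans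
        (congrArg (fderiv ℝ U p.1) (congrArg Prod.fst (e0 (x i))).symm)
      refine congr (congrArg DFunLike.coe h1) ?_
      exact congrArg₂ (fun a b => ![a, b]) (congrArg Prod.snd (e0 (x j))).symm
        (congrArg Prod.snd (e0 (x l))).symm
    refine congrArg₂ (· + ·) (congrArg (c * ·) (hv.trans ?_))
      (congrArg₂ (· + ·) (congrArg₂ (· - ·) (hdu 0 1 2) (hdu 1 0 2)) (hdu 2 0 1))
    congr 1
    ext i a
    refine congrArg (θ a p.1) ((congrArg Prod.fst (e0 (x i))).symm.trans ?_)
    fin_cases i <;> rfl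

end SpaceFrame

namespace IsMaximalInQuadric

theorem exists_frame (hu : IsMaximalInQuadric u) (b₀ : B) :
    ∃ s f θ e Zi, SpaceFrame s (u ∘ (extChartAt (𝓡 3) b₀).symm) f θ e Zi ∧
      ∀ t, (b₀, t) ∈ chartDomain b₀ s := by
  obtain ⟨s, -, hb, f, θ, e, Zi, hF⟩ := hu.exists_spaceFrame b₀
  exact ⟨s, f, θ, e, Zi, hF, fun t => ⟨mem_extChartAt_source b₀, hb⟩⟩

theorem exists_frameAt (hu : IsMaximalInQuadric u) (b : B) : ∃ lam e f Z,
    FrameAt u b lam e f Z := by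
  obtain ⟨s, f, θ, e, Zi, hF, hs⟩ := hu.exists_frame b
  exact ⟨_, _, _, _, hF.frameAt hu.smooth (hs 0)⟩

theorem baragliaForm_smooth (hu : IsMaximalInQuadric u) (c : ℝ) :
    (baragliaForm c u).SmoothOn modelBR4 Set.univ := by
  intro q _
  obtain ⟨s, f, θ, e, Zi, hF, hs⟩ := hu.exists_frame q.1
  refine contDiffAt_chartRep_of_pullback (mem_extChartAt_source q)
    (contMDiffAt_baragliaMap hu.smooth (hs q.2).1) (hF.contDiffAt_closedForm (hs q.2).2)
    (Filter.mem_of_superset ((isOpen_chartDomain q.1 hF.isOpen).mem_nhds (hs q.2)) fun y hy =>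
      hF.baragliaForm_eq_pullback hu.smooth hy)

theorem baragliaForm_closed (hu : IsMaximalInQuadric u) (c : ℝ) :
    (baragliaForm c u).d modelBR4 = 0 := by
  funext q
  obtain ⟨s, f, θ, e, Zi, hF, hs⟩ := hu.exists_frame q.1
  have h1 : (baragliaForm c u).d modelBR4 q = _ := d_eq_of_pullback
    (contMDiffAt_baragliaMap hu.smooth (hs q.2).1)
    ((hF.contDiffAt_closedForm (hs q.2).2).differentiableAt (by simp))
    (Filter.mem_of_superset ((isOpen_chartDomain q.1 hF.isOpen).mem_nhds (hs q.2)) fun y hy =>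
      hF.baragliaForm_eq_pullback hu.smooth hy)
  rw [h1, hF.extDeriv_closedForm (hs q.2).2]
  rfl

/-- The frames that define ψ are chosen point by point, without continuity. Since ψ does not depend
on them, it agrees near q with the smooth dual form of one moving frame, and only that form is
differentiated. -/
theorem psi_d (hu : IsMaximalInQuadric u) (hk : 0 < k) (hkc : 8 * k ^ 3 * c = 1)
    {ψ : MForm modelBR4 (B × (Fin 4 → ℝ)) 4 ℝ} (hψ : ∀ y, ∃ lam e f Z, FrameAt u y.1 lam e f Z ∧
      ψ y = psi0.compContinuousLinearMap (coframe k lam Z)) (q : B × (Fin 4 → ℝ))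
    (v : Fin 5 → TangentSpace modelBR4 q) :
    ψ.d modelBR4 q v =
      wedge2 ((12 * k ^ 2) • tautForm u q : TangentSpace modelBR4 q [⋀^Fin 2]→L[ℝ] ℝ)
        (baragliaForm c u q) v := by
  obtain ⟨s, f', θ, e', Zi, hF, hs⟩ := hu.exists_frame q.1
  have hev : ∀ᶠ y in nhds q, ψ y =
      (SpaceFrame.psiForm k θ Zi (prodChart q.1 y)).compContinuousLinearMap
        (mfderiv modelBR4 𝓘(ℝ, E34) (prodChart q.1) y) := by
    filter_upwards [(isOpen_chartDomain q.1 hF.isOpen).mem_nhds (hs q.2)] with y hy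
    obtain ⟨lam, e, f, Z, h, he⟩ := hψ y
    exact he.trans (hF.psi_eq_pullback hu.smooth hk hy h)
  have hd := d_eq_of_pullback (contMDiffAt_prodChart (hs q.2).1)
    ((hF.contDiffAt_psiForm (p := prodChart q.1 q) (hs q.2).2).differentiableAt (by simp)) hev
  exact (DFunLike.congr_fun hd v).trans (hF.extDeriv_psi_eq hu.smooth hk hkc (hs q.2) v)

theorem isClosedWithTorsion (hu : IsMaximalInQuadric u) (hk : 0 < k) (hkc : 8 * k ^ 3 * c = 1) :
    IsClosedWithTorsion modelBR4 (baragliaForm c u) (fun x => (12 * k ^ 2) • tautForm u x) := by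
  choose lam e f Z h using hu.exists_frameAt
  let ψ : MForm modelBR4 (B × (Fin 4 → ℝ)) 4 ℝ := fun q =>
    psi0.compContinuousLinearMap (coframe k (lam q.1) (Z q.1))
  refine ⟨⟨hu.baragliaForm_smooth c, fun q => ⟨(h q.1).toEquiv hk q.2,
    (h q.1).isG2Coframe hk hkc hu.smooth q.2⟩⟩, hu.baragliaForm_closed c,
    tautForm_smooth hu.smooth _, ψ, fun q => ⟨(h q.1).toEquiv hk q.2,
      (h q.1).isG2Coframe hk hkc hu.smooth q.2, ?_⟩,
    fun q v => hu.psi_d hk hkc (fun y => ⟨_, _, _, _, h y.1, rfl⟩) q v⟩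
  exact congrArg psi0.compContinuousLinearMap ((h q.1).toEquiv_coe hk q.2).symm

theorem isQuadratic (hu : IsMaximalInQuadric u) (hk : 0 < k) (hkc : 8 * k ^ 3 * c = 1) :
    IsQuadratic modelBR4 (1 / 6) (baragliaForm c u) (fun x => (12 * k ^ 2) • tautForm u x) := by
  intro q
  obtain ⟨lam, e, f, Z, h⟩ := hu.exists_frameAt q.1
  refine ⟨h.toEquiv hk q.2, h.isG2Coframe hk hkc hu.smooth q.2, fun v => ?_⟩
  have hT := (h.isAdapted hk hkc hu.smooth q.2).2
  have h1 := normSq2_symm (V := E34) hT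
  have h2 := hodgeStar_wedge2_symm (V := E34) hT (fun i => h.toEquiv hk q.2 (v i))
  refine (h.quadratic hk hkc hu.smooth q.2 v).trans ?_
  have h3 : (fun i => h.toEquiv hk q.2 (v i)) = fun i => coframe k lam Z (v i) :=
    funext fun i => h.toEquiv_apply hk q.2 (v i)
  refine congrArg₂ (· + ·) (congrArg (fun t => 1 / 7 * t * _) h1.symm)
    (congrArg (1 / 6 * ·) (congrArg₂ (· + ·) (congrArg (fun t => 1 / 7 * t * _) h1.symm) ?_))
  exact (congrArg (fun z : Fin 3 → Fin 7 → ℝ => -72 * k ^ 2 * Matrix.det (Matrix.of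
    fun i (a : Fin 3) => z i (Fin.castLE (by norm_num) a))) h3).symm.trans h2.symm

/-- The `3`-form of a maximal space-like immersion is of type `S`. -/
theorem isTypeS (hu : IsMaximalInQuadric u) (hk : 0 < k) (hkc : 8 * k ^ 3 * c = 1) :
    IsTypeS modelBR4 k (baragliaForm c u) (fun x => (12 * k ^ 2) • tautForm u x) where
  pos := hk
  erp := ⟨hu.isClosedWithTorsion hk hkc, hu.isQuadratic hk hkc⟩
  special q := by
    obtain ⟨lam, e, f, Z, h⟩ := hu.exists_frameAt q.1
    exact ⟨h.toEquiv hk q.2, h.isAdapted hk hkc hu.smooth q.2⟩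
  typeS q := by
    obtain ⟨s, f, θ, e, Zi, hF, hs⟩ := hu.exists_frame q.1
    refine ⟨chartDomain q.1 s, isOpen_chartDomain q.1 hF.isOpen, hs q.2, _, _, _, _, _,
      hF.isAdaptedSection hk hkc hu.smooth, fun a b x hx => ?_, fun _ => contMDiffOn_const,
      fun t => hF.contMDiffOn_quarticOf (k := k) _, fun _ => contMDiffOn_const,
      fun x hx => hF.structureEquations hk hx, fun x hx => ⟨fun _ => rfl, fun _ => rfl⟩⟩
    exact contDiffAt_pullOne (contMDiffAt_prodChart hx.1)
      (contDiffAt_kapL (y := prodChart q.1 x) (fun i => hF.contDiffAt_prodG hx.2 i)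
        (hF.contDiffAt_prodR hx.2) a b)

end IsMaximalInQuadric

end

end
end G2ERP

theorem mainTheorem1 (k c : ℝ) (hk : 0 < k) (hkc : 8 * k ^ 3 * c = 1) :
    (∀ (M : Type*) [TopologicalSpace M] [ChartedSpace (EuclideanSpace ℝ (Fin 7)) M]
        [IsManifold (𝓡 7) ∞ M] (φ : G2ERP.MForm (𝓡 7) M 3 ℝ) (τ : G2ERP.MForm (𝓡 7) M 2 ℝ),
      G2ERP.IsTypeS (𝓡 7) k φ τ →
      ∀ p : M, ∃ (B : Type) (_ : TopologicalSpace B) (_ : T2Space B)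
        (_ : SecondCountableTopology B) (_ : ChartedSpace (EuclideanSpace ℝ (Fin 3)) B)
        (_ : IsManifold (𝓡 3) ∞ B) (u : B → G2ERP.Lam2)
        (Φ : OpenPartialHomeomorph M (B × (Fin 4 → ℝ))),
        G2ERP.IsMaximalInQuadric u ∧
        p ∈ Φ.source ∧
        ContMDiffOn (𝓡 7) G2ERP.modelBR4 ∞ Φ Φ.source ∧
        ContMDiffOn G2ERP.modelBR4 (𝓡 7) ∞ Φ.symm Φ.target ∧
        ∀ x ∈ Φ.source,
          φ x = (G2ERP.baragliaForm c u).pullback (𝓡 7) G2ERP.modelBR4 Φ x ∧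
          τ x = (12 * k ^ 2) • (G2ERP.tautForm u).pullback (𝓡 7) G2ERP.modelBR4 Φ x) ∧
    (∀ (B : Type*) [TopologicalSpace B] [ChartedSpace (EuclideanSpace ℝ (Fin 3)) B]
        [IsManifold (𝓡 3) ∞ B] (u : B → G2ERP.Lam2),
      G2ERP.IsMaximalInQuadric u →
      G2ERP.IsTypeS G2ERP.modelBR4 k (G2ERP.baragliaForm c u)
        (fun x => (12 * k ^ 2) • G2ERP.tautForm u x)) := by
  refine ⟨fun M _ _ _ φ τ h p => ?_, fun B _ _ _ u hu => hu.isTypeS hk hkc⟩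
  obtain ⟨u, Φ, hΦ⟩ := h.exists_baraglia hk hkc p
  -- The local base can always be taken to be all of ℝ³.
  exact ⟨EuclideanSpace ℝ (Fin 3), inferInstance, inferInstance, inferInstance, inferInstance,
    inferInstance, u, Φ, hΦ⟩
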